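/- **Setting.** Let $N\ge 0$ be an integer and let $V:\mathbb R^N\times\mathbb R\to\mathbb R$, $(q,t)\mapsto V(q,t)$, be $C^2$ and $2\pi$-periodic in each of its $N+1$ variables. For $f:\mathbb R\to\mathbb R^N$ put $\|f\|_{L^2_{ul}}=\sup_{y\in\mathbb R}\big(\int_{\mathbb R}e^{-|t+y|}|f(t)|^2dt\big)^{1/2}$; let $L^2_{ul}$ be the space of measurable $f$ with $\|f\|_{L^2_{ul}}<\infty$ and $\lim_{y\to0}\|f(\cdot+y)-f\|_{L^2_{ul}}=0$, let $H^k_{ul}$ be the space of $f$ whose weak derivatives of order $\le k$ are in $L^2_{ul}$, and $\|f\|_{H^k_{ul}}^2=\sum_{j\le k}\|\partial_t^jf\|_{L^2_{ul}}^2$. Let $\mathcal X$ be the set of all $q\in H^2_{loc}(\mathbb R)^N$ with $q_t\in H^1_{ul}$, with the topology of the norm $\big(\int_{\mathbb R}e^{-|t|}(|q|^2+|q_t|^2)\,dt\big)^{1/2}$. Let $\xi^s$, $s\ge0$, be the semiflow on $\mathcal X$ given by $q_s=q_{tt}-\frac{\partial V}{\partial q}(q,t)$: $\xi^s(q^0)=q(s)$,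 where $q(s)\in\mathcal X$ is the unique solution with $q(0)=q^0$ such that $q-q^0\in C^0([0,\infty),H^2_{ul})\cap C^1((0,\infty),L^2_{ul})$. Let $\mathcal E\subset\mathcal X$ be the set of solutions of the Euler–Lagrange equation $q_{tt}=\frac{\partial V}{\partial q}(q,t)$. Let $\hat{\mathcal X}$ be the quotient of $\mathcal X$ by the translations $q\mapsto q+2\pi k$, $k\in\mathbb Z^N$, with the quotient topology and its Borel $\sigma$-algebra; let $\hat{\mathcal E}$ be the image of $\mathcal E$, and let $\hat\xi^s$ and $\hat S$ be the maps of $\hat{\mathcal X}$ induced by $\xi^s$ and by $(Sq)(t)=q(t+2\pi)$. Let $\mu$ be an $\hat S$-invariant Borel probability measure on $\hat{\mathcal X}$, and let $\mu(s)$, $s\ge 0$, be its image under $\hat\xi^s$. Let $\mathcal G$ be a $\sigma$-subalgebra of the Borel $\sigma$-algebra of $\hat{\mathcal X}$. Consider the following conditions on a set $\mathcal M_1\subset\hat{\mathcal X}$, on sets $\mathcal D_q\in\mathcal G$, $q\in\mathcal M_1$, and on $\mathcal G$. * (M1) $\mathcal M_1$ is Borel, $\mu(\mathcal M_1)=1$,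 and the sets $\mathcal D\cap\mathcal M_1$, $\mathcal D\in\mathcal G$, are all the Borel subsets of $\mathcal M_1$. If $q\ne\tilde q$ are in $\mathcal M_1$, then $\mathcal D_q\cap\mathcal D_{\tilde q}=\emptyset$. If $q\in\mathcal M_1$, then $\hat S(q)\in\mathcal M_1$ and $\mathcal D_{\hat S(q)}=\hat S(\mathcal D_q)$. * (M2) If $q\in\mathcal M_1$, $\mathcal D\in\mathcal G$ and $q\in\mathcal D$, then $\hat\xi^s(q)\in\mathcal D$ for all $s\ge0$. * (M3) The set $\mathcal M_2=\bigcup_{q\in\mathcal M_1}\mathcal D_q$ is Borel, and the map $\hat\theta:\mathcal M_2\to\mathcal M_1$ with $\hat\theta(x)=q$ for $x\in\mathcal D_q$ is Borel measurable. * (M4) $\mathcal G$ is generated by a family $(\mathcal D_i)_{i\in\mathcal I}$ of closed sets such that for each $i_1\in\mathcal I$ there is a finite or infinite sequence $i_1,i_2,\dots$ in $\mathcal I$, starting with $i_1$, with the sets $\mathcal D_{i_n}$ pairwise disjoint and $\mu(\bigcup_n\mathcal D_{i_n})=1$. An $\hat S$-invariant Borel probability measure $\nu$ on $\hat{\mathcal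 X}$ *$\mathcal G$-shadows* $\mu$ if $\nu(\mathcal D)=\mu(\mathcal D)$ for all $\mathcal D\in\mathcal G$, and $\mu$ is a factor of $\nu$, that is, there are Borel sets $\mathcal N_1,\mathcal N_2$ with $\mu(\mathcal N_1)=\nu(\mathcal N_2)=1$, $\hat S(\mathcal N_i)\subset\mathcal N_i$, and a Borel map $\theta:\mathcal N_2\to\mathcal N_1$ with $\theta\circ\hat S=\hat S\circ\theta$ on $\mathcal N_2$ that maps $\nu$ to $\mu$. **Theorem 4.4.** Assume that there is $A<\infty$ such that $\|q_t\|_{H^1_{ul}}\le A$ for all $s\ge0$ and all $q$ in the support of $\mu(s)$, and that (M1)–(M4) hold for some $\mathcal M_1$ and $(\mathcal D_q)_{q\in\mathcal M_1}$. Then there is an $\hat S$-invariant Borel probability measure $\nu$ on $\hat{\mathcal X}$ with $\nu(\hat{\mathcal E})=1$ that $\mathcal G$-shadows $\mu$. Furthermore, if $\mu$ is $\hat S$-ergodic, then $\nu$ can be chosen $\hat S$-ergodic. -/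

import Mathlib

open MeasureTheory Filter Topology Set
open scoped ENNReal NNReal

namespace GradientShadowing

noncomputable section

/-! ### Uniformly local spaces -/

/-- The configuration space `ℝ^N` with its Euclidean norm. -/
abbrev Config (N : ℕ) : Type := EuclideanSpace ℝ (Fin N)

/-- The uniformly local norm `‖f‖_{L²_ul} = sup_y (∫ e^{-|t+y|} |f(t)|² dt)^{1/2}`, as an extended
nonnegative number. -/
def l2ulNorm {N : ℕ} (f : ℝ → Config N) : ℝ≥0∞ :=
  ⨆ y : ℝ, (∫⁻ t : ℝ, ENNReal.ofReal (Real.exp (-|t + y|)) * ‖f t‖ₑ ^ 2) ^ (1 / 2 : ℝ)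

/-- Membership in `L²_ul(ℝ)^N`: finite norm, and continuity of the translations. -/
structure MemL2ul {N : ℕ} (f : ℝ → Config N) : Prop where
  aestronglyMeasurable : AEStronglyMeasurable f volume
  norm_lt_top : l2ulNorm f < ∞
  tendsto_translate : Tendsto (fun y : ℝ => l2ulNorm (fun t => f (t + y) - f t)) (𝓝 0) (𝓝 0)

/-- The norm of `H¹_ul(ℝ)^N` (used for locally absolutely continuous `f`). -/
def h1ulNorm {N : ℕ} (f : ℝ → Config N) : ℝ≥0∞ :=
  (l2ulNorm f ^ 2 + l2ulNorm (deriv f) ^ 2) ^ (1 / 2 : ℝ)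

/-- The norm of `H²_ul(ℝ)^N` (used for `C¹` functions `f` with locally absolutely continuous
derivative). -/
def h2ulNorm {N : ℕ} (f : ℝ → Config N) : ℝ≥0∞ :=
  (l2ulNorm f ^ 2 + l2ulNorm (deriv f) ^ 2 + l2ulNorm (deriv (deriv f)) ^ 2) ^ (1 / 2 : ℝ)

/-! ### The phase space -/

/-- `q ∈ H²_loc(ℝ)^N` with `q_t ∈ H¹_ul(ℝ)^N`. We use the continuous representative of `q`, which is
`C¹`; its second derivative, which exists almost everywhere, is in `L²_ul` (hence in `L²_loc`), and
`q_t` is a primitive of it (that is, `q_t` is locally absolutely continuous). -/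
structure MemPhase {N : ℕ} (q : ℝ → Config N) : Prop where
  contDiff : ContDiff ℝ 1 q
  integral_deriv : ∀ a b : ℝ, ∫ t in a..b, deriv (deriv q) t = deriv q b - deriv q a
  deriv_mem : MemL2ul (deriv q)
  deriv_deriv_mem : MemL2ul (deriv (deriv q))

/-- The phase space `𝒳`. -/
def Phase (N : ℕ) : Type := {q : ℝ → Config N // MemPhase q}

instance (N : ℕ) : CoeFun (Phase N) (fun _ => ℝ → Config N) := ⟨Subtype.val⟩

theorem Phase.ext {N : ℕ} {p q : Phase N} (h : ∀ t, p t = q t) : p = q :=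
  Subtype.ext (funext h)

/-- The localized norm `(∫ e^{-|t|} (|f(t)|² + |f_t(t)|²) dt)^{1/2}`. -/
def locNorm {N : ℕ} (f : ℝ → Config N) : ℝ≥0∞ :=
  (∫⁻ t : ℝ, ENNReal.ofReal (Real.exp (-|t|)) * (‖f t‖ₑ ^ 2 + ‖deriv f t‖ₑ ^ 2)) ^ (1 / 2 : ℝ)

theorem locNorm_eq_eLpNorm {N : ℕ} (f : ℝ → Config N) :
    locNorm f = eLpNorm (fun t => WithLp.toLp 2 (f t, deriv f t)) 2
      (volume.withDensity fun t : ℝ => ENNReal.ofReal (Real.exp (-|t|))) := by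
  have hm : Measurable fun t : ℝ => ENNReal.ofReal (Real.exp (-|t|)) := by fun_prop
  rw [eLpNorm_eq_lintegral_rpow_enorm_toReal (by norm_num) (by norm_num),
    lintegral_withDensity_eq_lintegral_mul_non_measurable₀ _ hm.aemeasurable (by simp)]
  unfold locNorm
  simp only [ENNReal.toReal_ofNat, Pi.mul_apply]
  congr 2
  ext t
  congr 1
  have : (‖WithLp.toLp 2 (f t, deriv f t)‖₊ : ℝ≥0) ^ 2 = ‖f t‖₊ ^ 2 + ‖deriv f t‖₊ ^ 2 := by
    apply NNReal.eq
    push_cast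
    simpa using WithLp.prod_norm_sq_eq_of_L2 (WithLp.toLp 2 (f t, deriv f t))
  simp only [enorm_eq_nnnorm]
  rw [show ((2 : ℝ)) = ((2 : ℕ) : ℝ) by norm_num, ENNReal.rpow_natCast]
  exact_mod_cast this.symm

theorem Phase.deriv_sub {N : ℕ} (p q : Phase N) (t : ℝ) :
    deriv (fun t => p t - q t) t = deriv p t - deriv q t :=
  deriv_fun_sub ((p.2.contDiff.differentiable (by norm_num)) t)
    ((q.2.contDiff.differentiable (by norm_num)) t)

/-- The localized topology of `𝒳`: the distance of `p` and `q` is the localized norm of `p - q`. -/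
instance (N : ℕ) : PseudoEMetricSpace (Phase N) where
  edist p q := locNorm fun t => p t - q t
  edist_self p := by
    have h : (fun t : ℝ => p t - p t) = fun _ => (0 : Config N) := by ext1 t; simp
    simp [locNorm]
  edist_comm p q := by
    have h : (fun t => p t - q t) = fun t => -(q t - p t) := by ext1 t; simp
    rw [h]
    have h' : deriv (fun t => -(q t - p t)) = fun t => -deriv (fun t => q t - p t) t := by
      ext1 t; exact deriv.fun_neg
    simp only [locNorm, h', enorm_neg]
  edist_triangle p q r := by
    simp only [locNorm_eq_eLpNorm, Phase.deriv_sub]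
    have hc : ∀ a b : Phase N, AEStronglyMeasurable
        (fun t => WithLp.toLp 2 (a t - b t, deriv a t - deriv b t))
        (volume.withDensity fun t : ℝ => ENNReal.ofReal (Real.exp (-|t|))) := by
      intro a b
      have ha := a.2.contDiff.continuous
      have hb := b.2.contDiff.continuous
      have ha' := a.2.contDiff.continuous_deriv (by norm_num)
      have hb' := b.2.contDiff.continuous_deriv (by norm_num)
      apply Continuous.aestronglyMeasurable
      exact (WithLp.prod_continuous_toLp 2 _ _).comp ((ha.sub hb).prodMk (ha'.sub hb'))
    refine le_trans (le_of_eq ?_) (eLpNorm_add_le (hc p q) (hc q r) (by norm_num))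
    congr 1
    ext1 t
    simp only [Pi.add_apply, ← WithLp.toLp_add, Prod.mk_add_mk, sub_add_sub_cancel]

/-! ### Translations -/

theorem l2ulNorm_translate {N : ℕ} (f : ℝ → Config N) (y : ℝ) :
    l2ulNorm (fun t => f (t + y)) = l2ulNorm f := by
  unfold l2ulNorm
  rw [← (Equiv.addRight y).iSup_comp]
  congr 1
  ext1 z
  rw [← lintegral_add_right_eq_self
    (fun t => ENNReal.ofReal (Real.exp (-|t + z|)) * ‖f t‖ₑ ^ 2) y]
  simp [add_comm, add_left_comm]

theorem MemL2ul.translate {N : ℕ} {f : ℝ → Config N} (hf : MemL2ul f) (y : ℝ) :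
    MemL2ul fun t => f (t + y) where
  aestronglyMeasurable := hf.aestronglyMeasurable.comp_quasiMeasurePreserving
    (measurePreserving_add_right volume y).quasiMeasurePreserving
  norm_lt_top := by rw [l2ulNorm_translate]; exact hf.norm_lt_top
  tendsto_translate := by
    refine hf.tendsto_translate.congr fun z => ?_
    rw [← l2ulNorm_translate _ y]
    simp only [add_right_comm]

theorem MemPhase.translate {N : ℕ} {q : ℝ → Config N} (hq : MemPhase q) (y : ℝ) :
    MemPhase fun t => q (t + y) := by
  have h1 : deriv (fun t => q (t + y)) = fun t => deriv q (t + y) := by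
    ext1 t; exact deriv_comp_add_const _ _ _
  have h2 : deriv (deriv (fun t => q (t + y))) = fun t => deriv (deriv q) (t + y) := by
    rw [h1]; ext1 t; exact deriv_comp_add_const _ _ _
  refine ⟨hq.contDiff.comp (contDiff_id.add contDiff_const), fun a b => ?_, ?_, ?_⟩
  · rw [h2, h1, intervalIntegral.integral_comp_add_right]
    exact hq.integral_deriv _ _
  · rw [h1]; exact hq.deriv_mem.translate y
  · rw [h2]; exact hq.deriv_deriv_mem.translate y

/-- The translation flow `(φ^y q)(t) = q(t + y)`. -/
def translate {N : ℕ} (y : ℝ) (q : Phase N) : Phase N :=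
  ⟨fun t => q (t + y), q.2.translate y⟩

/-! ### The formally gradient semiflow and the Euler--Lagrange solutions -/

/-- The partial gradient `∂V/∂q (x, t)`. -/
def gradV {N : ℕ} (V : Config N → ℝ → ℝ) (x : Config N) (t : ℝ) : Config N :=
  gradient (fun z => V z t) x

/-- `V` is `C²` and `2π`-periodic in all the variables. -/
structure IsPotential {N : ℕ} (V : Config N → ℝ → ℝ) : Prop where
  contDiff : ContDiff ℝ 2 (fun p : Config N × ℝ => V p.1 p.2)
  periodic_space : ∀ x t i, V (x + EuclideanSpace.single i (2 * Real.pi)) t = V x t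
  periodic_time : ∀ x t, V x (t + 2 * Real.pi) = V x t

/-- `Q s`, `s ≥ 0`, is the solution of `q_s = q_tt - ∂V/∂q (q, t)` in `𝒳` with `Q 0 = q`:
`Q s - q` is a continuous curve in `H²_ul` on `[0, ∞)`, and for `s > 0` it is differentiable as a
curve in `L²_ul`, with derivative the right-hand side of the equation (which is then continuous
in `s`, so that the curve is `C¹` into `L²_ul`). -/
structure IsGradientSolution {N : ℕ} (V : Config N → ℝ → ℝ) (q : Phase N)
    (Q : ℝ → Phase N) : Prop where
  init : Q 0 = q
  mem : ∀ s, 0 ≤ s → MemL2ul (fun t => Q s t - q t) ∧ MemL2ul (deriv fun t => Q s t - q t) ∧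
    MemL2ul (deriv (deriv fun t => Q s t - q t))
  continuous : ∀ s, 0 ≤ s →
    Tendsto (fun r => h2ulNorm fun t => Q r t - Q s t) (𝓝[Ici 0] s) (𝓝 0)
  hasDeriv : ∀ s, 0 < s →
    Tendsto (fun h : ℝ => l2ulNorm fun t =>
      h⁻¹ • (Q (s + h) t - Q s t) - (deriv (deriv (Q s)) t - gradV V (Q s t) t)) (𝓝[≠] 0) (𝓝 0)

open Classical in
/-- The semiflow `ξ^s` on `𝒳`, `s ≥ 0`: the value at `s` of the solution of the gradient equation
that starts at `q`. (The solution exists and is unique; the value in the `else` branch is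
never used.) -/
def gradFlow {N : ℕ} (V : Config N → ℝ → ℝ) (s : ℝ) (q : Phase N) : Phase N :=
  if h : ∃ Q : ℝ → Phase N, IsGradientSolution V q Q then h.choose s else q

/-- The set `ℰ` of the `q ∈ 𝒳` that solve the Euler--Lagrange equation `q_tt = ∂V/∂q (q, t)`. -/
def equilibria {N : ℕ} (V : Config N → ℝ → ℝ) : Set (Phase N) :=
  {q | ∀ t : ℝ, HasDerivAt (deriv q) (gradV V (q t) t) t}

/-! ### The quotient phase space -/

/-- `p ∼ q` if `p - q` is a constant in `2π ℤ^N`. -/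
instance phaseSetoid (N : ℕ) : Setoid (Phase N) where
  r p q := ∃ k : Fin N → ℤ, ∀ t i, p t i - q t i = 2 * Real.pi * k i
  iseqv :=
    { refl := fun p => ⟨0, by simp⟩
      symm := by
        rintro p q ⟨k, hk⟩
        exact ⟨-k, fun t i => by have := hk t i; push_cast [Pi.neg_apply]; linarith⟩
      trans := by
        rintro p q r ⟨k, hk⟩ ⟨l, hl⟩
        exact ⟨k + l, fun t i => by
          have := hk t i; have := hl t i; push_cast [Pi.add_apply]; linarith⟩ }

/-- The quotient phase space `𝒳̂`, with the quotient of the localized topology. -/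
def QPhase (N : ℕ) : Type := Quotient (phaseSetoid N)

instance (N : ℕ) : TopologicalSpace (QPhase N) :=
  inferInstanceAs (TopologicalSpace (Quotient (phaseSetoid N)))

/-- `𝒳̂` carries its Borel `σ`-algebra. -/
instance (N : ℕ) : MeasurableSpace (QPhase N) := borel (QPhase N)

instance (N : ℕ) : BorelSpace (QPhase N) := ⟨rfl⟩

/-- The canonical projection `ι : 𝒳 → 𝒳̂`. -/
def proj {N : ℕ} (q : Phase N) : QPhase N := Quotient.mk (phaseSetoid N) q

/-- The map `Ŝ` of `𝒳̂` induced by the translation `S = φ^{2π}`. -/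
def shift {N : ℕ} : QPhase N → QPhase N :=
  Quotient.map (translate (2 * Real.pi)) (by
    rintro p q ⟨k, hk⟩
    exact ⟨k, fun t i => hk (t + 2 * Real.pi) i⟩)

/-- The semiflow `ξ̂^s` of `𝒳̂` induced by `ξ^s`, computed on a representative (by the periodicity
of `V` the result does not depend on which one). -/
def qGradFlow {N : ℕ} (V : Config N → ℝ → ℝ) (s : ℝ) (x : QPhase N) : QPhase N :=
  proj (gradFlow V s (Quotient.out x))

/-- `ℰ̂ = ι(ℰ)`. -/
def qEquilibria {N : ℕ} (V : Config N → ℝ → ℝ) : Set (QPhase N) := proj '' equilibria V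

/-! ### Shadowing of invariant measures -/

/-- A `σ`-subalgebra of the given `σ`-algebra of `Ω`. -/
abbrev SubAlg (Ω : Type*) [m : MeasurableSpace Ω] : Type _ := {G : MeasurableSpace Ω // G ≤ m}

/-- `μ` is an `S`-invariant probability measure. -/
structure IsInvariantProb {Ω : Type*} [MeasurableSpace Ω] (S : Ω → Ω) (μ : Measure Ω) : Prop where
  isProbabilityMeasure : IsProbabilityMeasure μ
  measurePreserving : MeasurePreserving S μ μ

/-- `(S, μ)` is a factor of `(S, ν)`: there are forward invariant measurable sets `M₁`, `M₂` of full
measure for `μ`, `ν` and a measurable map from `M₂` to `M₁` (extended to a measurable map on all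
of `Ω`) that commutes with `S` on `M₂` and maps `ν` to `μ`. -/
def IsFactorOf {Ω : Type*} [MeasurableSpace Ω] (S : Ω → Ω) (μ ν : Measure Ω) : Prop :=
  ∃ (M₁ M₂ : Set Ω) (θ : Ω → Ω),
    MeasurableSet M₁ ∧ MeasurableSet M₂ ∧ μ M₁ = 1 ∧ ν M₂ = 1 ∧
    MapsTo S M₁ M₁ ∧ MapsTo S M₂ M₂ ∧ MapsTo θ M₂ M₁ ∧
    (∀ x ∈ M₂, θ (S x) = S (θ x)) ∧ MeasurePreserving θ ν μ

/-- `ν` `G`-shadows `μ`. -/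
def Shadows {Ω : Type*} [MeasurableSpace Ω] (S : Ω → Ω) (G : SubAlg Ω) (ν μ : Measure Ω) : Prop :=
  IsFactorOf S μ ν ∧ ∀ C : Set Ω, MeasurableSet[G.1] C → μ C = ν C

/-! ### The conditions on the subalgebra

In these, `M₁` is a set of full measure and `D q ∈ G`, `q ∈ M₁`, are the sets that separate its
points (the values of `D` outside `M₁` are irrelevant). -/

/-- The separation property. -/
structure Separation {Ω : Type*} [MeasurableSpace Ω] (S : Ω → Ω) (μ : Measure Ω) (G : SubAlg Ω)
    (M₁ : Set Ω) (D : Ω → Set Ω) : Prop where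
  measurableSet : MeasurableSet M₁
  full : μ M₁ = 1
  trace : ∀ B : Set Ω, MeasurableSet B → B ⊆ M₁ → ∃ C : Set Ω, MeasurableSet[G.1] C ∧ C ∩ M₁ = B
  mem : ∀ q ∈ M₁, MeasurableSet[G.1] (D q)
  disjoint : ∀ p ∈ M₁, ∀ q ∈ M₁, p ≠ q → Disjoint (D p) (D q)
  equivariant : ∀ q ∈ M₁, S q ∈ M₁ ∧ D (S q) = S '' D q

/-- Invariance of the subalgebra under a semiflow `ξ`. -/
def FlowInvariance {Ω : Type*} [MeasurableSpace Ω] (ξ : ℝ → Ω → Ω) (G : SubAlg Ω)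
    (M₁ : Set Ω) : Prop :=
  ∀ q ∈ M₁, ∀ C : Set Ω, MeasurableSet[G.1] C → q ∈ C → ∀ s : ℝ, 0 ≤ s → ξ s q ∈ C

/-- Measurability of `M₂ = ⋃_{q ∈ M₁} D q` and of the map `M₂ → M₁` that sends the points
of `D q` to `q`. -/
def ProjectionMeasurable {Ω : Type*} [MeasurableSpace Ω] (M₁ : Set Ω) (D : Ω → Set Ω) : Prop :=
  MeasurableSet (⋃ q ∈ M₁, D q) ∧
    ∃ θ : (⋃ q ∈ M₁, D q : Set Ω) → M₁, Measurable θ ∧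
      ∀ q : M₁, ∀ x : (⋃ q ∈ M₁, D q : Set Ω), (x : Ω) ∈ D q → θ x = q

/-- The closed-sets property: `G` is generated by a family of closed sets, each of which is a
member of a countable pairwise disjoint subfamily that covers `μ`-almost everything. -/
def ClosedSets {Ω : Type*} [TopologicalSpace Ω] [MeasurableSpace Ω] (μ : Measure Ω)
    (G : SubAlg Ω) : Prop :=
  ∃ F : Set (Set Ω), (∀ C ∈ F, IsClosed C) ∧ G.1 = MeasurableSpace.generateFrom F ∧
    ∀ C ∈ F, ∃ J : Set (Set Ω), J ⊆ F ∧ C ∈ J ∧ J.Countable ∧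
      J.PairwiseDisjoint id ∧ μ (⋃₀ J) = 1

end

end GradientShadowing

open GradientShadowing

namespace GradientShadowing

noncomputable section

variable {N : ℕ}

/-! ### Primitives of locally integrable functions -/

/-- `f` is a primitive of the locally integrable function `g`. -/
structure IsPrim (f g : ℝ → Config N) : Prop where
  locallyIntegrable : LocallyIntegrable g volume
  integral_eq : ∀ a b : ℝ, ∫ t in a..b, g t = f b - f a

theorem _root_.MeasureTheory.LocallyIntegrable.intervalIntegrable' {F : Type*}
    [NormedAddCommGroup F] {g : ℝ → F} (h : LocallyIntegrable g volume) (a b : ℝ) :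
    IntervalIntegrable g volume a b :=
  intervalIntegrable_iff.mpr <|
    (h.integrableOn_isCompact isCompact_uIcc).mono_set uIoc_subset_uIcc

theorem IsPrim.intervalIntegrable {f g : ℝ → Config N} (h : IsPrim f g) (a b : ℝ) :
    IntervalIntegrable g volume a b := h.locallyIntegrable.intervalIntegrable' a b

theorem IsPrim.eq_add {f g : ℝ → Config N} (h : IsPrim f g) (a b : ℝ) :
    f b = f a + ∫ t in a..b, g t := by rw [h.integral_eq]; abel

theorem IsPrim.ae_hasDerivAt {f g : ℝ → Config N} (h : IsPrim f g) :
    ∀ᵐ t, HasDerivAt f (g t) t := by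
  filter_upwards [_root_.LocallyIntegrable.ae_hasDerivAt_integral h.locallyIntegrable] with t ht
  have : f = fun x => f 0 + ∫ u in (0 : ℝ)..x, g u := funext fun x => h.eq_add 0 x
  rw [this]
  exact (ht 0).const_add _

theorem IsPrim.deriv_ae_eq {f g : ℝ → Config N} (h : IsPrim f g) : deriv f =ᵐ[volume] g := by
  filter_upwards [h.ae_hasDerivAt] with t ht using ht.deriv

theorem IsPrim.congr_right {f g g' : ℝ → Config N} (h : IsPrim f g) (hg : g =ᵐ[volume] g') :
    IsPrim f g' where
  locallyIntegrable := h.locallyIntegrable.congr hg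
  integral_eq a b := by
    rw [← h.integral_eq]
    exact intervalIntegral.integral_congr_ae (hg.symm.mono fun t ht _ => ht)

theorem IsPrim.deriv_right {f g : ℝ → Config N} (h : IsPrim f g) : IsPrim f (deriv f) :=
  h.congr_right h.deriv_ae_eq.symm

theorem IsPrim.continuous {f g : ℝ → Config N} (h : IsPrim f g) : Continuous f := by
  have : f = fun x => f 0 + ∫ u in (0 : ℝ)..x, g u := funext fun x => h.eq_add 0 x
  rw [this]
  exact continuous_const.add
    (intervalIntegral.continuous_primitive (fun a b => h.intervalIntegrable a b) 0)

theorem IsPrim.sub {f g f' g' : ℝ → Config N} (h : IsPrim f g) (h' : IsPrim f' g') :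
    IsPrim (fun t => f t - f' t) (fun t => g t - g' t) where
  locallyIntegrable := h.locallyIntegrable.sub h'.locallyIntegrable
  integral_eq a b := by
    rw [intervalIntegral.integral_sub (h.intervalIntegrable a b) (h'.intervalIntegrable a b),
      h.integral_eq, h'.integral_eq]
    abel

theorem isPrim_of_hasDerivAt {f g : ℝ → Config N} (h : ∀ t, HasDerivAt f (g t) t)
    (hg : Continuous g) : IsPrim f g where
  locallyIntegrable := hg.locallyIntegrable
  integral_eq a b := intervalIntegral.integral_eq_sub_of_hasDerivAt (fun t _ => h t)
    (hg.intervalIntegrable a b)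

theorem MemPhase.differentiable {q : ℝ → Config N} (hq : MemPhase q) : Differentiable ℝ q :=
  hq.contDiff.differentiable (by norm_num)

theorem MemPhase.continuous_deriv {q : ℝ → Config N} (hq : MemPhase q) : Continuous (deriv q) :=
  hq.contDiff.continuous_deriv (by norm_num)

theorem MemPhase.isPrim {q : ℝ → Config N} (hq : MemPhase q) : IsPrim q (deriv q) :=
  isPrim_of_hasDerivAt (fun t => (hq.differentiable t).hasDerivAt) hq.continuous_deriv

theorem IsPrim.absolutelyContinuous_apply {f g : ℝ → Config N} (h : IsPrim f g) (i : Fin N)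
    (a b : ℝ) : AbsolutelyContinuousOnInterval (fun t => f t i) a b := by
  have hi : IntervalIntegrable (fun t => g t i) volume a b := by
    rw [intervalIntegrable_iff]
    exact ((EuclideanSpace.proj (𝕜 := ℝ) i).integrable_comp
      (intervalIntegrable_iff.1 (h.intervalIntegrable a b)))
  have h1 := hi.absolutelyContinuousOnInterval_intervalIntegral (c := a) left_mem_uIcc
  have h2 : AbsolutelyContinuousOnInterval (fun _ : ℝ => f a i) a b :=
    ((LipschitzWith.const (f a i)).lipschitzOnWith (s := uIcc a b)).absolutelyContinuousOnInterval
  have h3 : (fun t => f t i) = fun t => f a i + ∫ v in a..t, g v i := by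
    ext1 t
    have := congrArg (EuclideanSpace.proj (𝕜 := ℝ) i) (h.eq_add a t)
    rw [map_add, ← ContinuousLinearMap.intervalIntegral_comp_comm _ (h.intervalIntegrable a t)]
      at this
    exact this
  rw [h3]
  exact h2.fun_add h1

theorem absolutelyContinuousOnInterval_finset_sum {ι : Type*} (s : Finset ι) (f : ι → ℝ → ℝ)
    (a b : ℝ) (h : ∀ i ∈ s, AbsolutelyContinuousOnInterval (f i) a b) :
    AbsolutelyContinuousOnInterval (fun t => ∑ i ∈ s, f i t) a b := by
  classical
  induction s using Finset.induction_on with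
  | empty =>
    simpa using
      ((LipschitzWith.const (0 : ℝ)).lipschitzOnWith (s := uIcc a b)).absolutelyContinuousOnInterval
  | insert i s hi ih =>
    simp only [Finset.sum_insert hi]
    exact (h i (by simp)).fun_add (ih fun j hj => h j (by simp [hj]))

/-- Integration by parts for the inner product of absolutely continuous functions. -/
theorem IsPrim.integral_inner {f f' g g' : ℝ → Config N} (hf : IsPrim f f') (hg : IsPrim g g')
    (a b : ℝ) : ∫ t in a..b, (inner ℝ (f' t) (g t) + inner ℝ (f t) (g' t)) =
      inner ℝ (f b) (g b) - inner ℝ (f a) (g a) := by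
  have hac : AbsolutelyContinuousOnInterval (fun t => inner ℝ (f t) (g t)) a b := by
    simp only [PiLp.inner_apply, RCLike.inner_apply, conj_trivial]
    exact absolutelyContinuousOnInterval_finset_sum _ _ _ _ fun i _ =>
      (hg.absolutelyContinuous_apply i a b).fun_mul (hf.absolutelyContinuous_apply i a b)
  rw [← hac.integral_deriv_eq_sub]
  apply intervalIntegral.integral_congr_ae
  filter_upwards [hf.ae_hasDerivAt, hg.ae_hasDerivAt] with t h1 h2 _
  rw [(h1.inner ℝ h2).deriv, add_comm]

/-! ### The uniformly local norm -/

/-- The measure `e^{-|t + y|} dt`. -/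
def expMeasure (y : ℝ) : Measure ℝ :=
  volume.withDensity fun t => ENNReal.ofReal (Real.exp (-|t + y|))

theorem expMeasure_ac (y : ℝ) : expMeasure y ≪ volume := withDensity_absolutelyContinuous _ _

theorem measurable_expWeight (y : ℝ) :
    Measurable fun t : ℝ => ENNReal.ofReal (Real.exp (-|t + y|)) := by fun_prop

theorem lintegral_expMeasure (y : ℝ) (f : ℝ → ℝ≥0∞) :
    ∫⁻ t, f t ∂(expMeasure y) = ∫⁻ t, ENNReal.ofReal (Real.exp (-|t + y|)) * f t := by
  rw [expMeasure, lintegral_withDensity_eq_lintegral_mul_non_measurable₀ _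
    (measurable_expWeight y).aemeasurable (by simp)]
  rfl

theorem lintegral_exp_neg_abs : ∫⁻ t : ℝ, ENNReal.ofReal (Real.exp (-|t|)) = 2 := by
  have h1 : ∫⁻ t in Ioi (0 : ℝ), ENNReal.ofReal (Real.exp (-|t|)) = 1 := by
    rw [setLIntegral_congr_fun (g := fun t => ENNReal.ofReal (Real.exp (-t))) measurableSet_Ioi
      (fun t ht => by simp only [abs_of_pos (mem_Ioi.1 ht)])]
    rw [← ofReal_integral_eq_lintegral_ofReal]
    · rw [integral_exp_neg_Ioi]; simp
    · exact integrableOn_exp_neg_Ioi 0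
    · exact Eventually.of_forall fun t => (Real.exp_pos _).le
  have h2 : ∫⁻ t in Iic (0 : ℝ), ENNReal.ofReal (Real.exp (-|t|)) = 1 := by
    rw [setLIntegral_congr_fun (g := fun t => ENNReal.ofReal (Real.exp t)) measurableSet_Iic
      (fun t ht => by simp only [abs_of_nonpos (mem_Iic.1 ht), neg_neg])]
    rw [← ofReal_integral_eq_lintegral_ofReal]
    · rw [integral_exp_Iic]; simp
    · exact integrableOn_exp_Iic 0
    · exact Eventually.of_forall fun t => (Real.exp_pos _).le
  rw [← lintegral_add_compl _ (measurableSet_Iic (a := (0 : ℝ))), compl_Iic, h1, h2]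
  norm_num

theorem expMeasure_univ (y : ℝ) : expMeasure y univ = 2 := by
  rw [← lintegral_one, lintegral_expMeasure]
  simp only [mul_one]
  rw [lintegral_add_right_eq_self (fun t => ENNReal.ofReal (Real.exp (-|t|))) y,
    lintegral_exp_neg_abs]

theorem eLpNorm_two_expMeasure (f : ℝ → Config N) (y : ℝ) :
    eLpNorm f 2 (expMeasure y) =
      (∫⁻ t : ℝ, ENNReal.ofReal (Real.exp (-|t + y|)) * ‖f t‖ₑ ^ 2) ^ (1 / 2 : ℝ) := by
  rw [eLpNorm_eq_lintegral_rpow_enorm_toReal (by norm_num) (by norm_num), lintegral_expMeasure]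
  simp

theorem l2ulNorm_eq_iSup (f : ℝ → Config N) : l2ulNorm f = ⨆ y, eLpNorm f 2 (expMeasure y) := by
  simp only [l2ulNorm, eLpNorm_two_expMeasure]

theorem eLpNorm_le_l2ulNorm (f : ℝ → Config N) (y : ℝ) :
    eLpNorm f 2 (expMeasure y) ≤ l2ulNorm f := by
  rw [l2ulNorm_eq_iSup]; exact le_iSup (fun y => eLpNorm f 2 (expMeasure y)) y

theorem l2ulNorm_sq (f : ℝ → Config N) : l2ulNorm f ^ 2 =
    ⨆ y : ℝ, ∫⁻ t : ℝ, ENNReal.ofReal (Real.exp (-|t + y|)) * ‖f t‖ₑ ^ 2 := by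
  have : ∀ x : ℝ≥0∞, x ^ 2 = x ^ (2 : ℝ) := fun x => (ENNReal.rpow_two x).symm
  rw [l2ulNorm, this,
    ← Monotone.map_iSup_of_continuousAt (f := fun x : ℝ≥0∞ => x ^ (1 / 2 : ℝ))
      (ENNReal.continuous_rpow_const.continuousAt) (ENNReal.monotone_rpow_of_nonneg (by norm_num))
      (by simp)]
  rw [← ENNReal.rpow_mul]; norm_num

theorem lintegral_le_l2ulNorm_sq (f : ℝ → Config N) (y : ℝ) :
    ∫⁻ t : ℝ, ENNReal.ofReal (Real.exp (-|t + y|)) * ‖f t‖ₑ ^ 2 ≤ l2ulNorm f ^ 2 := by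
  rw [l2ulNorm_sq]
  exact le_iSup (fun y : ℝ => ∫⁻ t : ℝ, ENNReal.ofReal (Real.exp (-|t + y|)) * ‖f t‖ₑ ^ 2) y

theorem l2ulNorm_congr {f g : ℝ → Config N} (h : f =ᵐ[volume] g) : l2ulNorm f = l2ulNorm g := by
  simp only [l2ulNorm_eq_iSup]
  congr 1; ext1 y
  exact eLpNorm_congr_ae ((expMeasure_ac y).ae_le h)

theorem l2ulNorm_add_le {f g : ℝ → Config N} (hf : AEStronglyMeasurable f volume)
    (hg : AEStronglyMeasurable g volume) :
    l2ulNorm (fun t => f t + g t) ≤ l2ulNorm f + l2ulNorm g := by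
  rw [l2ulNorm_eq_iSup]
  exact iSup_le fun y => (eLpNorm_add_le (hf.mono_ac (expMeasure_ac y))
    (hg.mono_ac (expMeasure_ac y)) (by norm_num)).trans
      (add_le_add (eLpNorm_le_l2ulNorm f y) (eLpNorm_le_l2ulNorm g y))

theorem l2ulNorm_neg (f : ℝ → Config N) : l2ulNorm (fun t => -f t) = l2ulNorm f := by
  simp [l2ulNorm]

theorem l2ulNorm_sub_le {f g : ℝ → Config N} (hf : AEStronglyMeasurable f volume)
    (hg : AEStronglyMeasurable g volume) :
    l2ulNorm (fun t => f t - g t) ≤ l2ulNorm f + l2ulNorm g := by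
  have := l2ulNorm_add_le hf hg.neg
  simp only [Pi.neg_apply, ← sub_eq_add_neg] at this
  refine this.trans_eq ?_
  congr 1
  exact l2ulNorm_neg g

theorem l2ulNorm_le_of_bound {f : ℝ → Config N} {C : ℝ} (h : ∀ᵐ t, ‖f t‖ ≤ C) :
    l2ulNorm f ≤ 2 * ENNReal.ofReal C := by
  rw [l2ulNorm_eq_iSup]
  refine iSup_le fun y => ?_
  refine (eLpNorm_le_of_ae_bound ((expMeasure_ac y).ae_le h)).trans ?_
  rw [expMeasure_univ]
  gcongr
  calc (2 : ℝ≥0∞) ^ ((2 : ℝ≥0∞).toReal⁻¹) ≤ 2 ^ (1 : ℝ) :=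
        ENNReal.rpow_le_rpow_of_exponent_le (by norm_num) (by norm_num)
    _ = 2 := by simp

theorem memLp_expMeasure {f : ℝ → Config N} (hf : AEStronglyMeasurable f volume)
    (h : l2ulNorm f < ∞) (y : ℝ) : MemLp f 2 (expMeasure y) :=
  ⟨hf.mono_ac (expMeasure_ac y), (eLpNorm_le_l2ulNorm f y).trans_lt h⟩

theorem volume_restrict_le_expMeasure (y R : ℝ) :
    volume.restrict (Icc (-R) R) ≤ ENNReal.ofReal (Real.exp (R + |y|)) • expMeasure y := by
  refine Measure.le_iff.2 fun s hs => ?_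
  rw [Measure.restrict_apply hs, Measure.smul_apply, expMeasure, withDensity_apply _ hs,
    smul_eq_mul, ← lintegral_const_mul _ (measurable_expWeight y), ← setLIntegral_one]
  refine le_trans ?_ (lintegral_mono_set (inter_subset_left (t := Icc (-R) R)))
  refine setLIntegral_mono' (hs.inter measurableSet_Icc) fun t ht => ?_
  rw [← ENNReal.ofReal_mul (Real.exp_pos _).le, ← Real.exp_add, ← ENNReal.ofReal_one]
  apply ENNReal.ofReal_le_ofReal
  rw [← Real.exp_zero]
  apply Real.exp_le_exp.2
  have := abs_add_le t y
  have := abs_le.2 ht.2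
  linarith

theorem memLp_restrict_Icc {f : ℝ → Config N} (hf : AEStronglyMeasurable f volume)
    (h : l2ulNorm f < ∞) (R : ℝ) : MemLp f 2 (volume.restrict (Icc (-R) R)) :=
  ((memLp_expMeasure hf h 0).smul_measure (by simp)).mono_measure
    (volume_restrict_le_expMeasure 0 R)

theorem exists_subset_Icc_neg {K : Set ℝ} (hK : IsCompact K) : ∃ R : ℝ, K ⊆ Icc (-R) R := by
  obtain ⟨R, hR⟩ := hK.isBounded.subset_closedBall 0
  exact ⟨R, by simpa [Real.closedBall_eq_Icc] using hR⟩

theorem locallyIntegrable_of_l2ulNorm {f : ℝ → Config N} (hf : AEStronglyMeasurable f volume)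
    (h : l2ulNorm f < ∞) : LocallyIntegrable f volume := by
  rw [locallyIntegrable_iff]
  intro K hK
  obtain ⟨R, hR⟩ := exists_subset_Icc_neg hK
  exact IntegrableOn.mono_set ((memLp_restrict_Icc hf h R).integrable (by norm_num)) hR

/-- Local square integrals are controlled by the uniformly local norm. -/
theorem setLIntegral_Icc_le_l2ulNorm (f : ℝ → Config N) (a : ℝ) {R : ℝ} :
    ∫⁻ t in Icc (a - R) (a + R), ‖f t‖ₑ ^ 2 ≤ ENNReal.ofReal (Real.exp R) * l2ulNorm f ^ 2 := by
  refine le_trans ?_ (mul_le_mul_right (lintegral_le_l2ulNorm_sq f (-a)) _)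
  rw [← lintegral_const_mul' _ _ (by simp)]
  refine (setLIntegral_mono' measurableSet_Icc fun t ht => ?_).trans (setLIntegral_le_lintegral _ _)
  rw [← mul_assoc, ← ENNReal.ofReal_mul (Real.exp_pos _).le, ← Real.exp_add]
  refine le_mul_of_one_le_left (by simp) ?_
  rw [← ENNReal.ofReal_one]
  apply ENNReal.ofReal_le_ofReal
  rw [← Real.exp_zero]
  apply Real.exp_le_exp.2
  have : |t + -a| ≤ R := abs_le.2 ⟨by linarith [ht.1], by linarith [ht.2]⟩
  linarith

/-! ### The space of functions with continuous translations -/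

theorem MemL2ul.congr {f g : ℝ → Config N} (hf : MemL2ul f) (h : f =ᵐ[volume] g) :
    MemL2ul g where
  aestronglyMeasurable := hf.aestronglyMeasurable.congr h
  norm_lt_top := by rw [← l2ulNorm_congr h]; exact hf.norm_lt_top
  tendsto_translate := by
    refine hf.tendsto_translate.congr fun y => l2ulNorm_congr ?_
    have := (measurePreserving_add_right volume y).quasiMeasurePreserving.ae_eq_comp h
    filter_upwards [h, this] with t h1 h2
    simp only [Function.comp_apply] at h2
    rw [h1, h2]

theorem aestronglyMeasurable_translate {f : ℝ → Config N} (hf : AEStronglyMeasurable f volume)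
    (y : ℝ) : AEStronglyMeasurable (fun t => f (t + y)) volume :=
  hf.comp_quasiMeasurePreserving (measurePreserving_add_right volume y).quasiMeasurePreserving

theorem MemL2ul.add {f g : ℝ → Config N} (hf : MemL2ul f) (hg : MemL2ul g) :
    MemL2ul fun t => f t + g t where
  aestronglyMeasurable := hf.aestronglyMeasurable.add hg.aestronglyMeasurable
  norm_lt_top := (l2ulNorm_add_le hf.aestronglyMeasurable hg.aestronglyMeasurable).trans_lt
    (ENNReal.add_lt_top.2 ⟨hf.norm_lt_top, hg.norm_lt_top⟩)
  tendsto_translate := by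
    have h := hf.tendsto_translate.add hg.tendsto_translate
    rw [add_zero] at h
    refine tendsto_of_tendsto_of_tendsto_of_le_of_le tendsto_const_nhds h (fun _ => zero_le)
      fun y => ?_
    refine le_trans (le_of_eq ?_) (l2ulNorm_add_le
      ((aestronglyMeasurable_translate hf.aestronglyMeasurable y).sub hf.aestronglyMeasurable)
      ((aestronglyMeasurable_translate hg.aestronglyMeasurable y).sub hg.aestronglyMeasurable))
    congr 1; ext1 t
    abel

theorem MemL2ul.neg {f : ℝ → Config N} (hf : MemL2ul f) : MemL2ul fun t => -f t where
  aestronglyMeasurable := hf.aestronglyMeasurable.neg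
  norm_lt_top := by rw [l2ulNorm_neg]; exact hf.norm_lt_top
  tendsto_translate := by
    refine hf.tendsto_translate.congr fun y => ?_
    rw [← l2ulNorm_neg]
    congr 1; ext1 t; abel

theorem MemL2ul.sub {f g : ℝ → Config N} (hf : MemL2ul f) (hg : MemL2ul g) :
    MemL2ul fun t => f t - g t := by
  simpa only [sub_eq_add_neg] using hf.add hg.neg

/-- Bounded, uniformly continuous functions are in `L²_ul`. -/
theorem MemL2ul.of_uniformContinuous {f : ℝ → Config N} (hf : UniformContinuous f) {C : ℝ}
    (hC : ∀ t, ‖f t‖ ≤ C) : MemL2ul f where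
  aestronglyMeasurable := hf.continuous.aestronglyMeasurable
  norm_lt_top := (l2ulNorm_le_of_bound (Eventually.of_forall hC)).trans_lt (by finiteness)
  tendsto_translate := by
    rw [ENNReal.tendsto_nhds_zero]
    intro ε hε
    obtain ⟨e, he, hε'⟩ : ∃ e : ℝ, 0 < e ∧ 2 * ENNReal.ofReal e ≤ ε := by
      rcases eq_or_ne ε ∞ with rfl | h
      · exact ⟨1, one_pos, le_top⟩
      · refine ⟨ε.toReal / 2, by have := ENNReal.toReal_pos hε.ne' h; linarith, ?_⟩
        rw [ENNReal.ofReal_div_of_pos two_pos, ENNReal.ofReal_toReal h]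
        simp [ENNReal.mul_div_cancel]
    obtain ⟨δ, hδ, h⟩ := Metric.uniformContinuous_iff.1 hf e he
    filter_upwards [Metric.ball_mem_nhds (0 : ℝ) hδ] with y hy
    refine (l2ulNorm_le_of_bound (C := e) (Eventually.of_forall fun t => ?_)).trans hε'
    have := h (a := t + y) (b := t) (by simpa [dist_eq_norm] using hy)
    rw [dist_eq_norm] at this
    exact this.le

theorem MemPhase.isPrim_deriv {q : ℝ → Config N} (hq : MemPhase q) :
    IsPrim (deriv q) (deriv (deriv q)) where
  locallyIntegrable := locallyIntegrable_of_l2ulNorm hq.deriv_deriv_mem.aestronglyMeasurable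
    hq.deriv_deriv_mem.norm_lt_top
  integral_eq := hq.integral_deriv

end

end GradientShadowing

namespace GradientShadowing

noncomputable section

variable {N : ℕ}

/-! ### Periodic functions -/

/-- The vector `2πk`. -/
def latticeVec (k : Fin N → ℤ) : Config N := WithLp.toLp 2 fun i => 2 * Real.pi * k i

@[simp] theorem latticeVec_apply (k : Fin N → ℤ) (i : Fin N) :
    latticeVec k i = 2 * Real.pi * k i := rfl

theorem eq_of_forall_periodic_single {F : Type*} {f : Config N → F}
    (hf : ∀ x i, f (x + EuclideanSpace.single i (2 * Real.pi)) = f x)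
    (k : Fin N → ℤ) (x : Config N) : f (x + latticeVec k) = f x := by
  have h1 : ∀ (m : ℤ) (i : Fin N) (x : Config N),
      f (x + EuclideanSpace.single i (2 * Real.pi * m)) = f x := by
    intro m i x
    have hp : Function.Periodic (fun c : ℝ => f (x + EuclideanSpace.single i c))
        (2 * Real.pi) := by
      intro c
      have := hf (x + EuclideanSpace.single i c) i
      have h2 : EuclideanSpace.single i (c + 2 * Real.pi) =
          EuclideanSpace.single i c + EuclideanSpace.single (𝕜 := ℝ) i (2 * Real.pi) := by
        ext j
        by_cases h : j = i <;> simp [h]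
      rw [add_assoc, ← h2] at this
      exact this
    have h3 : f (x + EuclideanSpace.single i ((m : ℝ) * (2 * Real.pi))) =
        f (x + EuclideanSpace.single i 0) := hp.int_mul_eq m
    have h4 : EuclideanSpace.single (𝕜 := ℝ) i (0 : ℝ) = (0 : Config N) := by
      ext j
      by_cases h : j = i <;> simp [h]
    rw [mul_comm, h3, h4, add_zero]
  have h2 : ∀ s : Finset (Fin N), ∀ x : Config N,
      f (x + ∑ i ∈ s, EuclideanSpace.single i (2 * Real.pi * k i)) = f x := by
    intro s
    induction s using Finset.induction_on with
    | empty => simp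
    | insert i s hi ih =>
      intro x
      rw [Finset.sum_insert hi, ← add_assoc, ih, h1]
  have h3 : latticeVec k = ∑ i, EuclideanSpace.single i (2 * Real.pi * (k i : ℝ)) := by
    ext j
    simp [Finset.sum_apply, Pi.single_apply]
  rw [h3, h2]

/-- Functions of position and time that are `2π`-periodic in each variable. -/
def IsBiperiodic {F : Type*} (f : Config N × ℝ → F) : Prop :=
  ∀ x t (k : Fin N → ℤ) (m : ℤ), f (x + latticeVec k, t + 2 * Real.pi * m) = f (x, t)

theorem exists_lattice_mem_compact : ∃ B : Set (Config N × ℝ), IsCompact B ∧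
    ∀ p : Config N × ℝ, ∃ (k : Fin N → ℤ) (m : ℤ),
      (p.1 + latticeVec k, p.2 + 2 * Real.pi * m) ∈ B := by
  have key : ∀ c : ℝ, c + 2 * Real.pi * ((-⌊c / (2 * Real.pi)⌋ : ℤ) : ℝ) ∈
      Icc 0 (2 * Real.pi) := by
    intro c
    have h1 := Int.floor_le (c / (2 * Real.pi))
    have h2 := (Int.lt_floor_add_one (c / (2 * Real.pi))).le
    rw [le_div_iff₀ Real.two_pi_pos] at h1
    rw [div_le_iff₀ Real.two_pi_pos] at h2
    push_cast
    constructor <;> nlinarith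
  refine ⟨((WithLp.toLp 2) '' (univ.pi fun _ : Fin N => Icc 0 (2 * Real.pi))) ×ˢ
    Icc 0 (2 * Real.pi), ?_, ?_⟩
  · exact ((isCompact_univ_pi fun _ => isCompact_Icc).image
      (PiLp.continuous_toLp 2 _)).prod isCompact_Icc
  · intro p
    refine ⟨fun i => -⌊p.1 i / (2 * Real.pi)⌋, -⌊p.2 / (2 * Real.pi)⌋, ?_, key _⟩
    exact ⟨_, fun i _ => key (p.1 i), rfl⟩

theorem IsBiperiodic.exists_bound {F : Type*} [NormedAddCommGroup F] {f : Config N × ℝ → F}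
    (hp : IsBiperiodic f) (hf : Continuous f) : ∃ C : ℝ, 0 ≤ C ∧ ∀ p, ‖f p‖ ≤ C := by
  obtain ⟨B, hB, h⟩ := exists_lattice_mem_compact (N := N)
  obtain ⟨C, hC⟩ := hB.exists_bound_of_continuousOn hf.continuousOn
  have h' : ∀ p, ‖f p‖ ≤ C := by
    intro p
    obtain ⟨k, m, hkm⟩ := h p
    rw [← hp p.1 p.2 k m]
    exact hC _ hkm
  exact ⟨C, (norm_nonneg _).trans (h' 0), h'⟩

theorem IsBiperiodic.uniformContinuous {F : Type*} [PseudoMetricSpace F] {f : Config N × ℝ → F}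
    (hp : IsBiperiodic f) (hf : Continuous f) : UniformContinuous f := by
  obtain ⟨B, hB, h⟩ := exists_lattice_mem_compact (N := N)
  have hB' : IsCompact (Metric.cthickening 1 B) := hB.cthickening
  have hu := hB'.uniformContinuousOn_of_continuous hf.continuousOn
  rw [Metric.uniformContinuousOn_iff] at hu
  rw [Metric.uniformContinuous_iff]
  intro ε hε
  obtain ⟨δ, hδ, hu⟩ := hu ε hε
  refine ⟨min δ 1, by positivity, fun {p p'} hpp => ?_⟩
  obtain ⟨k, m, hkm⟩ := h p
  have hd : dist (p.1 + latticeVec k, p.2 + 2 * Real.pi * m)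
      (p'.1 + latticeVec k, p'.2 + 2 * Real.pi * m) = dist p p' := by
    simp [Prod.dist_eq]
  rw [← hp p.1 p.2 k m, ← hp p'.1 p'.2 k m]
  refine hu _ (Metric.self_subset_cthickening B hkm) _ ?_ ?_
  · refine Metric.mem_cthickening_of_dist_le _ _ _ _ hkm ?_
    rw [dist_comm, hd]
    exact (hpp.trans_le (min_le_right _ _)).le
  · rw [hd]
    exact hpp.trans_le (min_le_left _ _)

/-! ### The gradient of the potential -/

variable {V : Config N → ℝ → ℝ}

theorem IsPotential.differentiableAt_space (hV : IsPotential V) (x : Config N) (t : ℝ) :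
    DifferentiableAt ℝ (fun z => V z t) x :=
  ((hV.contDiff.differentiable (by norm_num)) (x, t)).comp x
    (f := fun z : Config N => ((z, t) : Config N × ℝ)) (by fun_prop)

theorem IsPotential.gradV_eq (hV : IsPotential V) (x : Config N) (t : ℝ) :
    gradV V x t = (InnerProductSpace.toDual ℝ (Config N)).symm
      ((fderiv ℝ (fun p : Config N × ℝ => V p.1 p.2) (x, t)).comp
        (ContinuousLinearMap.inl ℝ (Config N) ℝ)) := by
  rw [gradV, gradient]
  congr 1
  have h1 : HasFDerivAt (fun p : Config N × ℝ => V p.1 p.2)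
      (fderiv ℝ (fun p : Config N × ℝ => V p.1 p.2) (x, t)) (x, t) :=
    ((hV.contDiff.differentiable (by norm_num)) (x, t)).hasFDerivAt
  exact (h1.comp (f := fun z : Config N => ((z, t) : Config N × ℝ)) x
    (hasFDerivAt_prodMk_left x t)).fderiv

theorem IsPotential.contDiff_gradV (hV : IsPotential V) :
    ContDiff ℝ 1 fun p : Config N × ℝ => gradV V p.1 p.2 := by
  simp only [hV.gradV_eq]
  have h1 : ContDiff ℝ 1 fun p : Config N × ℝ =>
      fderiv ℝ (fun p : Config N × ℝ => V p.1 p.2) (p.1, p.2) :=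
    (hV.contDiff.fderiv_right (m := 1) (by norm_num)).comp (contDiff_fst.prodMk contDiff_snd)
  exact (InnerProductSpace.toDual ℝ (Config N)).symm.contDiff.comp
    (h1.clm_comp contDiff_const)

theorem IsPotential.biperiodic (hV : IsPotential V) :
    IsBiperiodic fun p : Config N × ℝ => V p.1 p.2 := by
  intro x t k m
  have h1 := eq_of_forall_periodic_single (f := fun x => V x (t + 2 * Real.pi * m))
    (fun x i => hV.periodic_space x _ i) k x
  have h2 : Function.Periodic (fun t => V x t) (2 * Real.pi) := hV.periodic_time x
  simp only at h1 ⊢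
  rw [h1, mul_comm]
  exact h2.int_mul m t

theorem IsPotential.gradV_biperiodic (hV : IsPotential V) :
    IsBiperiodic fun p : Config N × ℝ => gradV V p.1 p.2 := by
  intro x t k m
  simp only [gradV, gradient]
  congr 1
  rw [← fderiv_comp_add_right]
  congr 1
  ext1 z
  exact hV.biperiodic z t k m

theorem IsPotential.gradV_add_latticeVec (hV : IsPotential V) (x : Config N) (t : ℝ)
    (k : Fin N → ℤ) : gradV V (x + latticeVec k) t = gradV V x t := by
  simpa using hV.gradV_biperiodic x t k 0

theorem IsPotential.gradV_add_two_pi (hV : IsPotential V) (x : Config N) (t : ℝ) :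
    gradV V x (t + 2 * Real.pi) = gradV V x t := by
  have h0 : latticeVec (0 : Fin N → ℤ) = 0 := by ext i; simp
  simpa [h0] using hV.gradV_biperiodic x t 0 1

theorem IsPotential.fderiv_gradV_biperiodic (hV : IsPotential V) :
    IsBiperiodic fun p : Config N × ℝ =>
      fderiv ℝ (fun p : Config N × ℝ => gradV V p.1 p.2) p := by
  intro x t k m
  have h : ((x + latticeVec k, t + 2 * Real.pi * m) : Config N × ℝ) =
    (x, t) + (latticeVec k, 2 * Real.pi * m) := rfl
  simp only
  rw [h, ← fderiv_comp_add_right]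
  congr 1
  ext1 p
  exact hV.gradV_biperiodic p.1 p.2 k m

theorem IsPotential.continuous_fderiv_gradV (hV : IsPotential V) :
    Continuous fun p : Config N × ℝ =>
      fderiv ℝ (fun p : Config N × ℝ => gradV V p.1 p.2) p :=
  hV.contDiff_gradV.continuous_fderiv (by norm_num)

theorem IsPotential.continuous_gradV (hV : IsPotential V) :
    Continuous fun p : Config N × ℝ => gradV V p.1 p.2 := hV.contDiff_gradV.continuous

theorem IsPotential.exists_bound_gradV (hV : IsPotential V) :
    ∃ M : ℝ, 0 ≤ M ∧ ∀ x t, ‖gradV V x t‖ ≤ M := by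
  obtain ⟨M, h0, h⟩ := hV.gradV_biperiodic.exists_bound hV.continuous_gradV
  exact ⟨M, h0, fun x t => h (x, t)⟩

theorem IsPotential.exists_lipschitz_gradV (hV : IsPotential V) :
    ∃ L : ℝ, 0 ≤ L ∧
      (∀ p, ‖fderiv ℝ (fun p : Config N × ℝ => gradV V p.1 p.2) p‖ ≤ L) ∧
      ∀ p p' : Config N × ℝ, ‖gradV V p.1 p.2 - gradV V p'.1 p'.2‖ ≤ L * ‖p - p'‖ := by
  obtain ⟨L, h0, h⟩ := hV.fderiv_gradV_biperiodic.exists_bound hV.continuous_fderiv_gradV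
  refine ⟨L, h0, h, fun p p' => ?_⟩
  exact convex_univ.norm_image_sub_le_of_norm_fderiv_le
    (f := fun p : Config N × ℝ => gradV V p.1 p.2)
    (fun p _ => (hV.contDiff_gradV.differentiable (by norm_num)) p) (fun p _ => h p)
    (mem_univ _) (mem_univ _)

theorem IsPotential.lipschitz_space {L : ℝ}
    (hL : ∀ p p' : Config N × ℝ, ‖gradV V p.1 p.2 - gradV V p'.1 p'.2‖ ≤ L * ‖p - p'‖)
    (x y : Config N) (t : ℝ) : ‖gradV V x t - gradV V y t‖ ≤ L * ‖x - y‖ := by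
  have := hL (x, t) (y, t)
  simpa [Prod.norm_def] using this

/-- Second-order Taylor estimate for the potential. -/
theorem IsPotential.taylor (hV : IsPotential V) {L : ℝ}
    (hL : ∀ p p' : Config N × ℝ, ‖gradV V p.1 p.2 - gradV V p'.1 p'.2‖ ≤ L * ‖p - p'‖)
    (x y : Config N) (t : ℝ) :
    |V y t - V x t - inner ℝ (gradV V x t) (y - x)| ≤ L * ‖y - x‖ ^ 2 := by
  have hg : ∀ z, HasGradientAt (fun z => V z t) (gradV V z t) z := fun z =>
    (hV.differentiableAt_space z t).hasGradientAt
  set ψ : Config N → ℝ := fun z => V z t - inner ℝ (gradV V x t) z with hψ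
  have hd : ∀ z ∈ segment ℝ x y, HasFDerivWithinAt ψ
      (InnerProductSpace.toDual ℝ (Config N) (gradV V z t - gradV V x t)) (segment ℝ x y) z := by
    intro z _
    have h1 := (hg z).hasFDerivAt
    have h2 : HasFDerivAt (fun z : Config N => (inner ℝ (gradV V x t) z : ℝ))
        (InnerProductSpace.toDual ℝ (Config N) (gradV V x t)) z :=
      (InnerProductSpace.toDual ℝ (Config N) (gradV V x t)).hasFDerivAt
    rw [map_sub]
    exact (h1.sub h2).hasFDerivWithinAt
  have hb : ∀ z ∈ segment ℝ x y,
      ‖InnerProductSpace.toDual ℝ (Config N) (gradV V z t - gradV V x t)‖ ≤ L * ‖y - x‖ := by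
    intro z hz
    rw [LinearIsometryEquiv.norm_map]
    refine (IsPotential.lipschitz_space hL z x t).trans ?_
    have hL0 : 0 ≤ L ∨ z = x := by
      by_cases h : z = x
      · exact Or.inr h
      · left
        have h1 := IsPotential.lipschitz_space hL z x t
        by_contra hlt
        have : 0 < ‖z - x‖ := norm_pos_iff.2 (sub_ne_zero.2 h)
        nlinarith [norm_nonneg (gradV V z t - gradV V x t)]
    rcases hL0 with hL0 | rfl
    · gcongr
      obtain ⟨θ, hθ, rfl⟩ := (segment_eq_image' ℝ x y ▸ hz)
      simp only [add_sub_cancel_left, norm_smul, Real.norm_eq_abs, abs_of_nonneg hθ.1]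
      exact mul_le_of_le_one_left (norm_nonneg _) hθ.2
    · simp only [sub_self, norm_zero, mul_zero]
      by_cases h : y = z
      · simp [h]
      · have h1 := IsPotential.lipschitz_space hL y z t
        exact (norm_nonneg _).trans h1
  have := (convex_segment x y).norm_image_sub_le_of_norm_hasFDerivWithin_le hd hb
    (left_mem_segment ℝ x y) (right_mem_segment ℝ x y)
  rw [hψ, Real.norm_eq_abs] at this
  simp only at this
  rw [inner_sub_right, sq, ← mul_assoc]
  convert this using 2
  ring

end

end GradientShadowing

namespace GradientShadowing

noncomputable section

variable {N : ℕ}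

/-! ### Gaussian averages -/

/-- The standard Gaussian measure on `ℝ`. -/
abbrev stdGauss : Measure ℝ := ProbabilityTheory.gaussianReal 0 1

theorem integrable_stdGauss_iff {F : Type*} [NormedAddCommGroup F] [NormedSpace ℝ F] (f : ℝ → F) :
    Integrable f stdGauss ↔
      Integrable (fun z => ProbabilityTheory.gaussianPDFReal 0 1 z • f z) volume := by
  rw [stdGauss, ProbabilityTheory.gaussianReal_of_var_ne_zero _ one_ne_zero,
    integrable_withDensity_iff_integrable_smul' (ProbabilityTheory.measurable_gaussianPDF _ _)
      (ae_of_all _ fun _ => ProbabilityTheory.gaussianPDF_lt_top)]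
  simp only [ProbabilityTheory.toReal_gaussianPDF]

theorem integrable_sq_stdGauss : Integrable (fun z : ℝ => z ^ 2) stdGauss := by
  have := (ProbabilityTheory.memLp_id_gaussianReal (μ := 0) (v := 1) 2).integrable_norm_pow
    (by norm_num)
  simpa using this

theorem integrable_id_stdGauss : Integrable (fun z : ℝ => z) stdGauss := by
  have := (ProbabilityTheory.memLp_id_gaussianReal (μ := 0) (v := 1) 1)
  exact this.integrable (by norm_num)

theorem integrable_abs_stdGauss : Integrable (fun z : ℝ => |z|) stdGauss :=
  integrable_id_stdGauss.abs

theorem integral_sq_stdGauss : ∫ z, z ^ 2 ∂stdGauss = 1 := by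
  have h1 := ProbabilityTheory.variance_fun_id_gaussianReal (μ := 0) (v := 1)
  rw [ProbabilityTheory.variance_eq_integral aemeasurable_id',
    ProbabilityTheory.integral_id_gaussianReal] at h1
  simpa using h1

theorem integral_abs_stdGauss_le : ∫ z, |z| ∂stdGauss ≤ 1 := by
  have h : ∫ z, |z| ∂stdGauss ≤ ∫ z, (1 + z ^ 2) / 2 ∂stdGauss := by
    refine integral_mono integrable_abs_stdGauss
      (((integrable_const _).add integrable_sq_stdGauss).div_const 2) fun z => ?_
    have := sq_abs z
    nlinarith [sq_nonneg (|z| - 1)]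
  rw [integral_div, integral_add (integrable_const _) integrable_sq_stdGauss,
    integral_sq_stdGauss] at h
  simpa using h

theorem integrable_of_le_abs {F : Type*} [NormedAddCommGroup F] {f : ℝ → F}
    (hf : AEStronglyMeasurable f stdGauss)
    {A B : ℝ} (h : ∀ z, ‖f z‖ ≤ A + B * |z|) : Integrable f stdGauss :=
  ((integrable_const A).add (integrable_abs_stdGauss.const_mul B)).mono' hf
    (Eventually.of_forall h)

theorem integrable_of_le_sq {F : Type*} [NormedAddCommGroup F] {f : ℝ → F}
    (hf : AEStronglyMeasurable f stdGauss)
    {A B : ℝ} (h : ∀ z, ‖f z‖ ≤ A + B * z ^ 2) : Integrable f stdGauss :=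
  ((integrable_const A).add (integrable_sq_stdGauss.const_mul B)).mono' hf
    (Eventually.of_forall h)

theorem hasDerivAt_gaussianPDFReal (z : ℝ) :
    HasDerivAt (ProbabilityTheory.gaussianPDFReal 0 1)
      (-(z * ProbabilityTheory.gaussianPDFReal 0 1 z)) z := by
  have h : ProbabilityTheory.gaussianPDFReal 0 1 = fun x =>
      (√(2 * Real.pi * (1 : ℝ≥0)))⁻¹ * Real.exp (-(x - 0) ^ 2 / (2 * (1 : ℝ≥0))) :=
    ProbabilityTheory.gaussianPDFReal_def 0 1
  rw [h]
  have h1 : HasDerivAt (fun x : ℝ => -(x - 0) ^ 2 / (2 * ((1 : ℝ≥0) : ℝ))) (-z) z := by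
    have := ((((hasDerivAt_id z).sub_const 0).pow 2).neg).div_const (2 * ((1 : ℝ≥0) : ℝ))
    refine this.congr_deriv ?_
    simp only [NNReal.coe_one, id]
    ring
  refine (h1.exp.const_mul ((√(2 * Real.pi * (1 : ℝ≥0)))⁻¹)).congr_deriv ?_
  ring

/-- Stein's identity. -/
theorem integral_smul_stdGauss {ψ ψ' : ℝ → Config N} (h : ∀ z, HasDerivAt ψ (ψ' z) z)
    (hc : Continuous ψ') {C : ℝ} (hC : ∀ z, ‖ψ' z‖ ≤ C) :
    ∫ z, z • ψ z ∂stdGauss = ∫ z, ψ' z ∂stdGauss := by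
  have hcont : Continuous ψ := continuous_iff_continuousAt.2 fun z => (h z).continuousAt
  have hlip : ∀ z, ‖ψ z‖ ≤ ‖ψ 0‖ + C * |z| := by
    intro z
    have := convex_univ.norm_image_sub_le_of_norm_hasDerivWithin_le
      (fun x _ => (h x).hasDerivWithinAt) (fun x _ => hC x) (mem_univ 0) (mem_univ z)
    rw [sub_zero, Real.norm_eq_abs] at this
    have h2 := norm_le_norm_add_norm_sub' (ψ z) (ψ 0)
    linarith
  have hC0 : 0 ≤ C := (norm_nonneg _).trans (hC 0)
  have i1 : Integrable ψ stdGauss := integrable_of_le_abs hcont.aestronglyMeasurable hlip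
  have i2 : Integrable ψ' stdGauss :=
    integrable_of_le_abs (A := C) (B := 0) hc.aestronglyMeasurable (by simpa using hC)
  have i3 : Integrable (fun z => z • ψ z) stdGauss := by
    refine integrable_of_le_sq (A := ‖ψ 0‖) (B := ‖ψ 0‖ + C)
      (continuous_id.smul hcont).aestronglyMeasurable fun z => ?_
    rw [norm_smul, Real.norm_eq_abs]
    have h1 : |z| ≤ 1 + z ^ 2 := by
      have := sq_abs z
      nlinarith [sq_nonneg (|z| - 1)]
    calc |z| * ‖ψ z‖ ≤ |z| * (‖ψ 0‖ + C * |z|) := by gcongr; exact hlip z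
      _ = ‖ψ 0‖ * |z| + C * z ^ 2 := by rw [← sq_abs z]; ring
      _ ≤ ‖ψ 0‖ * (1 + z ^ 2) + C * z ^ 2 := by gcongr
      _ = _ := by ring
  have key := integral_bilinear_hasDerivAt_right_eq_neg_left_of_integrable
    (L := ContinuousLinearMap.lsmul ℝ ℝ) (u := ProbabilityTheory.gaussianPDFReal 0 1)
    (v := ψ) (v' := ψ') (fun z _ => hasDerivAt_gaussianPDFReal z) (fun z _ => h z)
    ((integrable_stdGauss_iff _).1 i2)
    (by
      refine ((integrable_stdGauss_iff _).1 i3).neg.congr (Eventually.of_forall fun z => ?_)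
      simp only [Pi.neg_apply, ContinuousLinearMap.lsmul_apply, smul_smul, neg_smul]
      rw [mul_comm])
    ((integrable_stdGauss_iff _).1 i1)
  simp only [ContinuousLinearMap.lsmul_apply] at key
  rw [stdGauss, ProbabilityTheory.integral_gaussianReal_eq_integral_smul one_ne_zero,
    ProbabilityTheory.integral_gaussianReal_eq_integral_smul one_ne_zero, key, ← integral_neg]
  congr 1
  ext1 z
  rw [smul_smul, neg_smul, neg_neg, mul_comm]

/-- Stein's identity along a line. -/
theorem integral_smul_stdGauss_line {φ φ' : ℝ → Config N} (h : ∀ t, HasDerivAt φ (φ' t) t)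
    (hc : Continuous φ') {C : ℝ} (hC : ∀ t, ‖φ' t‖ ≤ C) (t ρ : ℝ) :
    ∫ z, z • φ (t + ρ * z) ∂stdGauss = ∫ z, ρ • φ' (t + ρ * z) ∂stdGauss := by
  refine integral_smul_stdGauss (C := |ρ| * C) (fun z => ?_) (by fun_prop) fun z => ?_
  · have h1 : HasDerivAt (fun z : ℝ => t + ρ * z) ρ z := by
      simpa using ((hasDerivAt_id z).const_mul ρ).const_add t
    exact (h (t + ρ * z)).scomp z h1
  · rw [norm_smul, Real.norm_eq_abs]
    gcongr
    exact hC _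

theorem isFiniteMeasure_restrict_uIoc (a b : ℝ) :
    IsFiniteMeasure (volume.restrict (uIoc a b)) := ⟨by simp [uIoc]⟩

theorem integrable_prod_of_bound {α β F : Type*} [MeasurableSpace α] [MeasurableSpace β]
    [NormedAddCommGroup F] {μ : Measure α} {ν : Measure β} [IsFiniteMeasure μ] [SFinite ν]
    {f : α × β → F} {b : β → ℝ} (hf : AEStronglyMeasurable f (μ.prod ν)) (hb : Integrable b ν)
    (h : ∀ p, ‖f p‖ ≤ b p.2) : Integrable f (μ.prod ν) :=
  (hb.comp_snd μ).mono' hf (Eventually.of_forall h)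

/-- Integrated form of Stein's identity, for functions that are merely continuous. -/
theorem intervalIntegral_integral_smul_stdGauss {φ : ℝ → Config N} (hφ : Continuous φ) {B : ℝ}
    (hB : ∀ t, ‖φ t‖ ≤ B) (a b ρ : ℝ) :
    ∫ t in a..b, ∫ z, z • φ (t + ρ * z) ∂stdGauss =
      (∫ z, ρ • φ (b + ρ * z) ∂stdGauss) - ∫ z, ρ • φ (a + ρ * z) ∂stdGauss := by
  have hB0 : 0 ≤ B := (norm_nonneg _).trans (hB 0)
  set Φ : ℝ → Config N := fun t => ∫ u in (0 : ℝ)..t, φ u with hΦ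
  have hd : ∀ t, HasDerivAt Φ (φ t) t := fun t =>
    intervalIntegral.integral_hasDerivAt_right (hφ.intervalIntegrable _ _)
      (hφ.stronglyMeasurableAtFilter _ _) hφ.continuousAt
  have hdiff : ∀ z, ∫ t in a..b, φ (t + ρ * z) = Φ (b + ρ * z) - Φ (a + ρ * z) := by
    intro z
    rw [intervalIntegral.integral_comp_add_right, hΦ]
    rw [intervalIntegral.integral_interval_sub_left] <;> exact hφ.intervalIntegrable _ _
  have hint : ∀ t, Integrable (fun z => ρ • φ (t + ρ * z)) stdGauss := fun t =>
    integrable_of_le_abs (A := |ρ| * B) (B := 0) (by fun_prop) fun z => by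
      rw [norm_smul, Real.norm_eq_abs, zero_mul, add_zero]
      gcongr
      exact hB _
  rw [intervalIntegral_integral_swap]
  · simp_rw [intervalIntegral.integral_smul, hdiff]
    rw [← integral_sub (hint b) (hint a)]
    refine integral_smul_stdGauss (C := |ρ| * B + |ρ| * B) (fun z => ?_) (by fun_prop) fun z => ?_
    · have h1 : ∀ t, HasDerivAt (fun z : ℝ => t + ρ * z) ρ z := fun t => by
        simpa using ((hasDerivAt_id z).const_mul ρ).const_add t
      exact ((hd _).scomp z (h1 b)).sub ((hd _).scomp z (h1 a))
    · refine (norm_sub_le _ _).trans ?_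
      rw [norm_smul, norm_smul, Real.norm_eq_abs]
      gcongr <;> exact hB _
  · have : IsFiniteMeasure (volume.restrict (uIoc a b)) :=
      isFiniteMeasure_restrict_uIoc a b
    refine integrable_prod_of_bound (b := fun z => B * |z|) ?_
      (integrable_abs_stdGauss.const_mul B) fun p => ?_
    · have : Continuous (Function.uncurry fun t z : ℝ => z • φ (t + ρ * z)) := by
        unfold Function.uncurry; fun_prop
      exact this.aestronglyMeasurable
    · simp only [Function.uncurry]
      rw [norm_smul, Real.norm_eq_abs, mul_comm]
      gcongr
      exact hB _

/-! ### Duhamel integrals -/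

/-- The kernels `κ(ρ, z)` of the Duhamel integrals. -/
structure IsDuhamelKernel (κ : ℝ → ℝ → ℝ) : Prop where
  continuous : Continuous fun p : ℝ × ℝ => κ p.1 p.2
  bound : ∀ ρ z, |κ ρ z| ≤ |ρ| + |z|

theorem isDuhamelKernel_fst : IsDuhamelKernel fun ρ _ => ρ :=
  ⟨by fun_prop, fun ρ z => by simp⟩

theorem isDuhamelKernel_snd : IsDuhamelKernel fun _ z => z :=
  ⟨by fun_prop, fun ρ z => by simp⟩

/-- The Gaussian average inside of a Duhamel integral. -/
def duhamelInner (κ : ℝ → ℝ → ℝ) (Φ : ℝ → ℝ → Config N) (s t ρ : ℝ) : Config N :=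
  ∫ z, κ ρ z • Φ (s - ρ ^ 2 / 2) (t + ρ * z) ∂stdGauss

/-- `∫_0^{√(2s)} E[κ(ρ, Z) Φ(s - ρ²/2, t + ρ Z)] dρ`; for `κ = ρ` it is the Duhamel integral
`∫_0^s e^{(s-r)Δ} Φ(r) dr`, and for `κ = z` its derivative in `t`. -/
def duhamel (κ : ℝ → ℝ → ℝ) (Φ : ℝ → ℝ → Config N) (s t : ℝ) : Config N :=
  ∫ ρ in (0 : ℝ)..√(2 * s), duhamelInner κ Φ s t ρ

section

variable {κ : ℝ → ℝ → ℝ} (hκ : IsDuhamelKernel κ) {Φ : ℝ → ℝ → Config N}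
  (hΦ : Continuous fun p : ℝ × ℝ => Φ p.1 p.2) {B : ℝ} (hB : ∀ s t, ‖Φ s t‖ ≤ B)

include hκ in
theorem IsDuhamelKernel.integrable (ρ : ℝ) : Integrable (fun z => |κ ρ z|) stdGauss := by
  refine integrable_of_le_abs (A := |ρ|) (B := 1) ?_ fun z => ?_
  · have := hκ.continuous
    exact (Continuous.abs (this.comp (Continuous.prodMk_right ρ))).aestronglyMeasurable
  · simpa using hκ.bound ρ z

include hκ in
theorem IsDuhamelKernel.integral_le (ρ : ℝ) : ∫ z, |κ ρ z| ∂stdGauss ≤ |ρ| + 1 := by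
  have : ∫ z, |κ ρ z| ∂stdGauss ≤ ∫ z, (|ρ| + |z|) ∂stdGauss :=
    integral_mono (hκ.integrable ρ) ((integrable_const _).add integrable_abs_stdGauss)
      fun z => hκ.bound ρ z
  rw [integral_add (integrable_const _) integrable_abs_stdGauss] at this
  have h1 := integral_abs_stdGauss_le
  simp only [integral_const, probReal_univ, smul_eq_mul, one_mul] at this
  linarith

include hκ hΦ hB in
theorem continuous_duhamelInner :
    Continuous fun p : (ℝ × ℝ) × ℝ => duhamelInner κ Φ p.1.1 p.1.2 p.2 := by
  have hκc := hκ.continuous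
  have hB0 : 0 ≤ B := (norm_nonneg _).trans (hB 0 0)
  rw [continuous_iff_continuousAt]
  intro p₀
  have hcont : Continuous fun x : ((ℝ × ℝ) × ℝ) × ℝ =>
      κ x.1.2 x.2 • Φ (x.1.1.1 - x.1.2 ^ 2 / 2) (x.1.1.2 + x.1.2 * x.2) := by
    have h1 : Continuous fun x : ((ℝ × ℝ) × ℝ) × ℝ => κ x.1.2 x.2 :=
      hκc.comp (f := fun x : ((ℝ × ℝ) × ℝ) × ℝ => (x.1.2, x.2)) (by fun_prop)
    have h2 : Continuous fun x : ((ℝ × ℝ) × ℝ) × ℝ =>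
        Φ (x.1.1.1 - x.1.2 ^ 2 / 2) (x.1.1.2 + x.1.2 * x.2) :=
      hΦ.comp (f := fun x : ((ℝ × ℝ) × ℝ) × ℝ =>
        (x.1.1.1 - x.1.2 ^ 2 / 2, x.1.1.2 + x.1.2 * x.2)) (by fun_prop)
    exact h1.smul h2
  refine continuousAt_of_dominated (bound := fun z => ((|p₀.2| + 1) + |z|) * B) ?_ ?_ ?_ ?_
  · exact Eventually.of_forall fun p =>
      (hcont.comp (Continuous.prodMk_right p)).aestronglyMeasurable
  · have : ∀ᶠ p : (ℝ × ℝ) × ℝ in 𝓝 p₀, |p.2| < |p₀.2| + 1 :=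
      (continuous_snd.abs.tendsto p₀).eventually (gt_mem_nhds (by simp))
    filter_upwards [this] with p hp
    refine Eventually.of_forall fun z => ?_
    rw [norm_smul, Real.norm_eq_abs]
    have := hκ.bound p.2 z
    gcongr
    · linarith
    · exact hB _ _
  · exact ((integrable_const _).add integrable_abs_stdGauss).mul_const B
  · exact Eventually.of_forall fun z => (hcont.comp (Continuous.prodMk_left z)).continuousAt

include hκ hΦ hB in
theorem integrable_duhamelAux (s t ρ : ℝ) :
    Integrable (fun z => κ ρ z • Φ (s - ρ ^ 2 / 2) (t + ρ * z)) stdGauss := by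
  refine ((hκ.integrable ρ).mul_const B).mono' ?_ (Eventually.of_forall fun z => ?_)
  · have h1 : Continuous (κ ρ) := hκ.continuous.comp (Continuous.prodMk_right ρ)
    have h2 : Continuous fun z => Φ (s - ρ ^ 2 / 2) (t + ρ * z) :=
      hΦ.comp (f := fun z : ℝ => (s - ρ ^ 2 / 2, t + ρ * z)) (by fun_prop)
    exact (h1.smul h2).aestronglyMeasurable
  · rw [norm_smul, Real.norm_eq_abs]
    gcongr
    exact hB _ _

include hκ in
theorem norm_duhamelInner_le {C : ℝ} {s t ρ : ℝ} (hC : ∀ x, ‖Φ (s - ρ ^ 2 / 2) x‖ ≤ C) :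
    ‖duhamelInner κ Φ s t ρ‖ ≤ (|ρ| + 1) * C := by
  have hC0 : 0 ≤ C := (norm_nonneg _).trans (hC 0)
  refine (norm_integral_le_of_norm_le ((hκ.integrable ρ).mul_const C)
    (Eventually.of_forall fun z => ?_)).trans ?_
  · rw [norm_smul, Real.norm_eq_abs]
    gcongr
    exact hC _
  · rw [integral_mul_const]
    gcongr
    exact hκ.integral_le ρ

include hκ hΦ hB in
theorem continuous_duhamelInner_right (s t : ℝ) : Continuous (duhamelInner κ Φ s t) :=
  (continuous_duhamelInner hκ hΦ hB).comp (Continuous.prodMk_right (s, t))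

include hκ hΦ hB in
theorem continuous_duhamel : Continuous fun p : ℝ × ℝ => duhamel κ Φ p.1 p.2 :=
  intervalIntegral.continuous_parametric_intervalIntegral_of_continuous
    (f := fun (p : ℝ × ℝ) ρ => duhamelInner κ Φ p.1 p.2 ρ)
    (continuous_duhamelInner hκ hΦ hB) (by fun_prop)

theorem sq_div_two_le_of_mem {s ρ : ℝ} (h : ρ ∈ Ioc 0 (√(2 * s))) : ρ ^ 2 / 2 ≤ s := by
  have hs : 0 < √(2 * s) := h.1.trans_le h.2
  have hs' := Real.sqrt_pos.1 hs
  have := Real.sq_sqrt hs'.le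
  have : ρ ^ 2 ≤ √(2 * s) ^ 2 := by gcongr; exacts [h.1.le, h.2]
  linarith

include hκ in
theorem norm_duhamel_le {C s : ℝ} (t : ℝ) (hC : ∀ r ≤ s, ∀ x, ‖Φ r x‖ ≤ C) :
    ‖duhamel κ Φ s t‖ ≤ (√(2 * s) + 1) * C * √(2 * s) := by
  have hC0 : 0 ≤ C := (norm_nonneg _).trans (hC s le_rfl 0)
  refine (intervalIntegral.norm_integral_le_of_norm_le_const
    (C := (√(2 * s) + 1) * C) fun ρ hρ => ?_).trans ?_
  · rw [uIoc_of_le (Real.sqrt_nonneg _)] at hρ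
    refine (norm_duhamelInner_le hκ (C := C) fun x => hC _ ?_ x).trans ?_
    · nlinarith
    · rw [abs_of_pos hρ.1]
      gcongr
      exact hρ.2
  · rw [sub_zero, abs_of_nonneg (Real.sqrt_nonneg _)]

theorem duhamel_congr {Φ Ψ : ℝ → ℝ → Config N} {s t : ℝ} (h : ∀ r, r ≤ s → ∀ x, Φ r x = Ψ r x) :
    duhamel κ Φ s t = duhamel κ Ψ s t := by
  unfold duhamel duhamelInner
  congr 1
  ext1 ρ
  congr 1
  ext1 z
  rw [h _ (by nlinarith)]

end

/-- Bounded and uniformly continuous on the half-plane of the times up to `T`. -/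
def UCUpTo (T : ℝ) (Φ : ℝ → ℝ → Config N) : Prop :=
  ∀ ε > 0, ∃ δ > 0, ∀ s s' t t', s ≤ T → s' ≤ T → |s - s'| < δ → |t - t'| < δ →
    ‖Φ s t - Φ s' t'‖ < ε

theorem abs_sqrt_sub_sqrt_le {a b : ℝ} (hab : a ≤ b) : √b - √a ≤ √(b - a) := by
  rcases le_or_gt 0 a with ha | ha
  · have h1 := Real.sq_sqrt ha
    have h2 := Real.sq_sqrt (ha.trans hab)
    have h3 := Real.sq_sqrt (sub_nonneg.2 hab)
    have h4 := Real.sqrt_nonneg a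
    have h5 := Real.sqrt_nonneg (b - a)
    have h6 := Real.sqrt_nonneg b
    nlinarith [mul_nonneg h4 h5]
  · rw [Real.sqrt_eq_zero_of_nonpos ha.le, sub_zero]
    exact Real.sqrt_le_sqrt (by linarith)

theorem UCUpTo.duhamel {κ : ℝ → ℝ → ℝ} (hκ : IsDuhamelKernel κ) {Φ : ℝ → ℝ → Config N}
    (hΦ : Continuous fun p : ℝ × ℝ => Φ p.1 p.2) {B : ℝ} (hB : ∀ s t, ‖Φ s t‖ ≤ B) {T : ℝ}
    (hu : UCUpTo T Φ) : UCUpTo T (duhamel κ Φ) := by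
  have hB0 : 0 ≤ B := (norm_nonneg _).trans (hB 0 0)
  set R := √(2 * T) with hR
  have hR0 : 0 ≤ R := Real.sqrt_nonneg _
  -- the estimate for ordered times
  have key : ∀ e > 0, ∃ δ > 0, ∀ s s' t t', s' ≤ s → s ≤ T → |s - s'| < δ → |t - t'| < δ →
      ‖GradientShadowing.duhamel κ Φ s t - GradientShadowing.duhamel κ Φ s' t'‖ ≤
        (R + 1) * e * R + (R + 1) * B * √(2 * |s - s'|) := by
    intro e he
    obtain ⟨δ, hδ, h⟩ := hu e he
    refine ⟨δ, hδ, fun s s' t t' hss hsT hs ht => ?_⟩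
    have hle : √(2 * s') ≤ √(2 * s) := Real.sqrt_le_sqrt (by linarith)
    have hsR : √(2 * s) ≤ R := Real.sqrt_le_sqrt (by linarith)
    have hi : ∀ s t a b, IntervalIntegrable (duhamelInner κ Φ s t) volume a b := fun s t a b =>
      (continuous_duhamelInner_right hκ hΦ hB s t).intervalIntegrable a b
    have hsplit : GradientShadowing.duhamel κ Φ s t - GradientShadowing.duhamel κ Φ s' t' =
        (∫ ρ in (0 : ℝ)..√(2 * s'), (duhamelInner κ Φ s t ρ - duhamelInner κ Φ s' t' ρ)) +
          ∫ ρ in √(2 * s')..√(2 * s), duhamelInner κ Φ s t ρ := by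
      rw [intervalIntegral.integral_sub (hi _ _ _ _) (hi _ _ _ _), GradientShadowing.duhamel,
        GradientShadowing.duhamel,
        ← intervalIntegral.integral_add_adjacent_intervals (hi s t 0 (√(2 * s')))
          (hi s t (√(2 * s')) (√(2 * s)))]
      abel
    rw [hsplit]
    refine (norm_add_le _ _).trans (add_le_add ?_ ?_)
    · refine (intervalIntegral.norm_integral_le_of_norm_le_const (C := (R + 1) * e)
        fun ρ hρ => ?_).trans ?_
      · rw [uIoc_of_le (Real.sqrt_nonneg _)] at hρ
        have hsub : duhamelInner κ Φ s t ρ - duhamelInner κ Φ s' t' ρ =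
            duhamelInner κ (fun r x => Φ (r + (s - s')) (x + (t - t')) - Φ r x) s' t' ρ := by
          unfold duhamelInner
          rw [← integral_sub]
          · congr 1
            ext1 z
            rw [← smul_sub]
            congr 3 <;> ring
          · exact integrable_duhamelAux hκ hΦ hB s t ρ
          · exact integrable_duhamelAux hκ hΦ hB s' t' ρ
        rw [hsub]
        refine (norm_duhamelInner_le hκ (C := e) fun x => ?_).trans ?_
        · have h0 := sq_nonneg ρ
          refine (h _ _ _ _ (by linarith) (by linarith) ?_ ?_).le
          · simpa using hs
          · simpa using ht
        · rw [abs_of_pos hρ.1]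
          gcongr
          exact hρ.2.trans (hle.trans hsR)
      · rw [sub_zero, abs_of_nonneg (Real.sqrt_nonneg _)]
        gcongr
        exact hle.trans hsR
    · refine (intervalIntegral.norm_integral_le_of_norm_le_const (C := (R + 1) * B)
        fun ρ hρ => ?_).trans ?_
      · rw [uIoc_of_le hle] at hρ
        refine (norm_duhamelInner_le hκ (C := B) fun x => hB _ _).trans ?_
        rw [abs_of_nonneg ((Real.sqrt_nonneg _).trans hρ.1.le)]
        gcongr
        exact hρ.2.trans hsR
      · rw [abs_of_nonneg (sub_nonneg.2 hle)]
        gcongr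
        refine (abs_sqrt_sub_sqrt_le (by linarith)).trans_eq ?_
        rw [abs_of_nonneg (sub_nonneg.2 hss)]
        congr 1; ring
  intro ε hε
  obtain ⟨δ, hδ, h⟩ := key (ε / (2 * ((R + 1) * R + 1))) (by positivity)
  have hlim : Tendsto (fun x : ℝ => (R + 1) * B * √(2 * |x|)) (𝓝 0) (𝓝 0) := by
    have : Continuous fun x : ℝ => (R + 1) * B * √(2 * |x|) := by fun_prop
    simpa using this.tendsto 0
  obtain ⟨η, hη, hη'⟩ := Metric.eventually_nhds_iff.1 (hlim.eventually (gt_mem_nhds (half_pos hε)))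
  have hfin : ∀ s s' t t', s' ≤ s → s ≤ T → |s - s'| < min δ η → |t - t'| < min δ η →
      ‖GradientShadowing.duhamel κ Φ s t - GradientShadowing.duhamel κ Φ s' t'‖ < ε := by
    intro s s' t t' hss hsT hs ht
    have h1 := h s s' t t' hss hsT (hs.trans_le (min_le_left _ _)) (ht.trans_le (min_le_left _ _))
    have h2 := hη' (y := s - s') (by simpa using hs.trans_le (min_le_right _ _))
    have h3 : (R + 1) * (ε / (2 * ((R + 1) * R + 1))) * R ≤ ε / 2 := by
      have h4 : (R + 1) * (ε / (2 * ((R + 1) * R + 1))) * R =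
          ε / 2 * (((R + 1) * R) / ((R + 1) * R + 1)) := by field_simp
      rw [h4]
      refine mul_le_of_le_one_right (by positivity) ?_
      rw [div_le_one (by positivity)]
      linarith
    linarith
  refine ⟨min δ η, by positivity, fun s s' t t' hs hs' h1 h2 => ?_⟩
  rcases le_total s' s with hss | hss
  · exact hfin s s' t t' hss hs h1 h2
  · rw [norm_sub_rev]
    exact hfin s' s t' t hss hs' (by rwa [abs_sub_comm]) (by rwa [abs_sub_comm])

end

end GradientShadowing

namespace GradientShadowing

noncomputable section

variable {N : ℕ}

theorem integrable_prod_restrict_uIoc {F : Type*} [NormedAddCommGroup F] {f : ℝ × ℝ → F}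
    (hf : Continuous f) (a b c d : ℝ) :
    IntegrableOn f (uIoc a b ×ˢ uIoc c d) := by
  have h : IsCompact (uIcc a b ×ˢ uIcc c d) := isCompact_uIcc.prod isCompact_uIcc
  exact (hf.continuousOn.integrableOn_compact h).mono_set
    (prod_mono uIoc_subset_uIcc uIoc_subset_uIcc)

theorem hasDerivAt_of_forall_integral_eq {f g : ℝ → Config N} (hg : Continuous g)
    (h : ∀ a b, f b - f a = ∫ t in a..b, g t) (t : ℝ) : HasDerivAt f (g t) t := by
  have h1 : f = fun x => f 0 + ∫ u in (0 : ℝ)..x, g u := by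
    ext1 x
    rw [← h]; abel
  rw [h1]
  exact (intervalIntegral.integral_hasDerivAt_right (hg.intervalIntegrable _ _)
      (hg.stronglyMeasurableAtFilter _ _) hg.continuousAt).const_add _

section

variable {Φ : ℝ → ℝ → Config N} (hΦ : Continuous fun p : ℝ × ℝ => Φ p.1 p.2) {B : ℝ}
  (hB : ∀ s t, ‖Φ s t‖ ≤ B)

include hΦ hB in
theorem hasDerivAt_duhamel (s t : ℝ) :
    HasDerivAt (duhamel (fun ρ _ => ρ) Φ s) (duhamel (fun _ z => z) Φ s t) t := by
  have hc := continuous_duhamel isDuhamelKernel_snd hΦ hB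
  refine hasDerivAt_of_forall_integral_eq (hc.comp (Continuous.prodMk_right s)) ?_ t
  intro a b
  have hi := fun t => (continuous_duhamelInner_right isDuhamelKernel_fst hΦ hB s t)
  simp only [Function.comp_def, duhamel]
  rw [← intervalIntegral.integral_sub ((hi b).intervalIntegrable _ _)
    ((hi a).intervalIntegrable _ _)]
  rw [intervalIntegral_intervalIntegral_swap]
  · congr 1
    ext1 ρ
    simp only [duhamelInner]
    exact (intervalIntegral_integral_smul_stdGauss (φ := Φ (s - ρ ^ 2 / 2))
      (hΦ.comp (Continuous.prodMk_right _)) (hB _) a b ρ).symm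
  · have h2 := continuous_duhamelInner isDuhamelKernel_snd hΦ hB
    exact integrable_prod_restrict_uIoc (h2.comp
      (f := fun p : ℝ × ℝ => ((s, p.1), p.2)) (by fun_prop)) _ _ _ _

theorem norm_duhamel_fst_le {C s : ℝ} (t : ℝ) {b : ℝ → ℝ} (hb : Continuous b)
    (hC : ∀ r ≤ s, ∀ x, ‖Φ r x‖ ≤ b r)
    (hint : ∫ ρ in (0 : ℝ)..√(2 * s), ρ * b (s - ρ ^ 2 / 2) ≤ C) :
    ‖duhamel (fun ρ _ => ρ) Φ s t‖ ≤ C := by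
  refine le_trans ?_ hint
  refine intervalIntegral.norm_integral_le_of_norm_le (Real.sqrt_nonneg _) ?_
    (by apply Continuous.intervalIntegrable; fun_prop)
  refine Eventually.of_forall fun ρ hρ => ?_
  refine (norm_integral_le_of_norm_le (integrable_const (ρ * b (s - ρ ^ 2 / 2)))
    (Eventually.of_forall fun z => ?_)).trans_eq (by simp)
  rw [norm_smul, Real.norm_eq_abs, abs_of_pos hρ.1]
  have := hρ.1
  gcongr
  exact hC _ (by nlinarith [sq_nonneg ρ]) _

theorem norm_duhamel_fst_le_exp {C l s : ℝ} (hl : 0 < l) (hs : 0 ≤ s) (t : ℝ) (hC0 : 0 ≤ C)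
    (hC : ∀ r ≤ s, ∀ x, ‖Φ r x‖ ≤ C * Real.exp (l * r)) :
    ‖duhamel (fun ρ _ => ρ) Φ s t‖ ≤ C / l * Real.exp (l * s) := by
  refine norm_duhamel_fst_le t (b := fun r => C * Real.exp (l * r)) (by fun_prop) hC ?_
  have hd : ∀ ρ ∈ uIcc 0 (√(2 * s)), HasDerivAt
      (fun ρ : ℝ => -(C / l * Real.exp (l * (s - ρ ^ 2 / 2))))
      (ρ * (C * Real.exp (l * (s - ρ ^ 2 / 2)))) ρ := by
    intro ρ _
    have h1 : HasDerivAt (fun ρ : ℝ => l * (s - ρ ^ 2 / 2)) (-(l * ρ)) ρ := by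
      have := ((((hasDerivAt_id ρ).pow 2).div_const 2).const_sub s).const_mul l
      refine this.congr_deriv ?_
      simp
    refine (h1.exp.const_mul (C / l)).neg.congr_deriv ?_
    field_simp
  rw [intervalIntegral.integral_eq_sub_of_hasDerivAt hd
    (by apply Continuous.intervalIntegrable; fun_prop)]
  rw [Real.sq_sqrt (by positivity)]
  have : 0 ≤ C / l := by positivity
  simp only [ne_eq, OfNat.ofNat_ne_zero, not_false_eq_true, zero_pow, zero_div, sub_zero]
  rw [show s - 2 * s / 2 = 0 by ring, mul_zero, Real.exp_zero]
  linarith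

theorem norm_duhamel_fst_le_mul {C s : ℝ} (hs : 0 ≤ s) (t : ℝ)
    (hC : ∀ r ≤ s, ∀ x, ‖Φ r x‖ ≤ C) :
    ‖duhamel (fun ρ _ => ρ) Φ s t‖ ≤ C * s := by
  refine norm_duhamel_fst_le t (b := fun _ => C) (by fun_prop) hC ?_
  rw [intervalIntegral.integral_mul_const, integral_id, Real.sq_sqrt (by positivity)]
  apply le_of_eq; ring

theorem duhamel_of_nonpos (κ : ℝ → ℝ → ℝ) {s : ℝ} (hs : s ≤ 0) (t : ℝ) :
    duhamel κ Φ s t = 0 := by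
  rw [duhamel, Real.sqrt_eq_zero_of_nonpos (by linarith), intervalIntegral.integral_same]

variable {Φ' : ℝ → ℝ → Config N} (hΦ' : Continuous fun p : ℝ × ℝ => Φ' p.1 p.2) {B' : ℝ}
  (hB' : ∀ s t, ‖Φ' s t‖ ≤ B') (hd : ∀ s t, HasDerivAt (Φ s) (Φ' s t) t)

include hΦ' hB' hd in
theorem duhamel_snd_eq (s t : ℝ) :
    duhamel (fun _ z => z) Φ s t = duhamel (fun ρ _ => ρ) Φ' s t := by
  unfold duhamel duhamelInner
  congr 1
  ext1 ρ
  exact integral_smul_stdGauss_line (hd _) (hΦ'.comp (Continuous.prodMk_right _)) (hB' _) t ρ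

end

/-- The increment of Gaussian averages in the standard deviation. -/
theorem integral_stdGauss_sub {φ φ' : ℝ → Config N} (h : ∀ t, HasDerivAt φ (φ' t) t)
    (hc : Continuous φ') {C : ℝ} (hC : ∀ t, ‖φ' t‖ ≤ C) (t a b : ℝ) :
    (∫ z, φ (t + b * z) ∂stdGauss) - ∫ z, φ (t + a * z) ∂stdGauss =
      ∫ ρ in a..b, ∫ z, z • φ' (t + ρ * z) ∂stdGauss := by
  have hcont : Continuous φ := continuous_iff_continuousAt.2 fun z => (h z).continuousAt
  have hC0 : 0 ≤ C := (norm_nonneg _).trans (hC 0)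
  have hlip : ∀ x, ‖φ x‖ ≤ ‖φ t‖ + C * |x - t| := by
    intro z
    have := convex_univ.norm_image_sub_le_of_norm_hasDerivWithin_le
      (fun x _ => (h x).hasDerivWithinAt) (fun x _ => hC x) (mem_univ t) (mem_univ z)
    rw [Real.norm_eq_abs] at this
    have h2 := norm_le_norm_add_norm_sub' (φ z) (φ t)
    linarith
  have hint : ∀ ρ, Integrable (fun z => φ (t + ρ * z)) stdGauss := fun ρ =>
    integrable_of_le_abs (A := ‖φ t‖) (B := C * |ρ|) (by fun_prop) fun z => by
      refine (hlip _).trans_eq ?_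
      rw [add_sub_cancel_left, abs_mul, mul_assoc]
  rw [intervalIntegral_integral_swap, ← integral_sub (hint b) (hint a)]
  · congr 1
    ext1 z
    have hd : ∀ ρ ∈ uIcc a b, HasDerivAt (fun ρ : ℝ => φ (t + ρ * z)) (z • φ' (t + ρ * z)) ρ := by
      intro ρ _
      have h1 : HasDerivAt (fun ρ : ℝ => t + ρ * z) z ρ := by
        simpa using ((hasDerivAt_id ρ).mul_const z).const_add t
      exact (h _).scomp ρ h1
    rw [intervalIntegral.integral_eq_sub_of_hasDerivAt hd
      (by apply Continuous.intervalIntegrable; fun_prop)]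
  · have : IsFiniteMeasure (volume.restrict (uIoc a b)) := isFiniteMeasure_restrict_uIoc a b
    refine integrable_prod_of_bound (b := fun z => C * |z|) ?_
      (integrable_abs_stdGauss.const_mul C) fun p => ?_
    · have : Continuous (Function.uncurry fun ρ z : ℝ => z • φ' (t + ρ * z)) := by
        unfold Function.uncurry; fun_prop
      exact this.aestronglyMeasurable
    · simp only [Function.uncurry]
      rw [norm_smul, Real.norm_eq_abs, mul_comm]
      gcongr
      exact hC _

/-- Interchange of the order of integration over `{(r, σ) | 0 < σ²/2 ≤ r ≤ s}`. -/
theorem integral_parabola_swap {k : ℝ → ℝ → Config N} (hk : Continuous fun p : ℝ × ℝ => k p.1 p.2)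
    {s : ℝ} (hs : 0 ≤ s) :
    ∫ r in (0 : ℝ)..s, ∫ σ in (0 : ℝ)..√(2 * r), k r σ =
      ∫ σ in (0 : ℝ)..√(2 * s), ∫ r in σ ^ 2 / 2..s, k r σ := by
  set A : Set (ℝ × ℝ) := {p | p.2 ^ 2 / 2 ≤ p.1} with hA
  have hAm : MeasurableSet A := measurableSet_le (by fun_prop) (by fun_prop)
  set k' : ℝ → ℝ → Config N := fun r σ => A.indicator (fun p => k p.1 p.2) (r, σ) with hk'
  have h1 : ∀ r ∈ Ioc 0 s, ∫ σ in (0 : ℝ)..√(2 * r), k r σ =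
      ∫ σ in (0 : ℝ)..√(2 * s), k' r σ := by
    intro r hr
    rw [intervalIntegral.integral_of_le (Real.sqrt_nonneg _),
      intervalIntegral.integral_of_le (Real.sqrt_nonneg _)]
    have hset : Ioc 0 (√(2 * r)) = Ioc 0 (√(2 * s)) ∩ {σ | σ ^ 2 / 2 ≤ r} := by
      ext σ
      simp only [mem_Ioc, mem_inter_iff, mem_ofPred_eq]
      have h0 : 0 ≤ 2 * r := by linarith [hr.1]
      have hle : √(2 * r) ≤ √(2 * s) := Real.sqrt_le_sqrt (by linarith [hr.2])
      constructor
      · rintro ⟨h1, h2⟩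
        have := (Real.le_sqrt h1.le h0).1 h2
        exact ⟨⟨h1, h2.trans hle⟩, by linarith⟩
      · rintro ⟨⟨h1, _⟩, h2⟩
        exact ⟨h1, (Real.le_sqrt h1.le h0).2 (by linarith)⟩
    rw [hset, ← setIntegral_indicator (measurableSet_le (by fun_prop) (by fun_prop))]
    rfl
  have h2 : ∀ σ ∈ Ioc 0 (√(2 * s)), ∫ r in σ ^ 2 / 2..s, k r σ = ∫ r in (0 : ℝ)..s, k' r σ := by
    intro σ hσ
    have hσs := sq_div_two_le_of_mem hσ
    rw [intervalIntegral.integral_of_le hσs, intervalIntegral.integral_of_le hs,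
      ← integral_Icc_eq_integral_Ioc]
    have hset : Icc (σ ^ 2 / 2) s = Ioc 0 s ∩ {r | σ ^ 2 / 2 ≤ r} := by
      ext r
      simp only [mem_Ioc, mem_Icc, mem_inter_iff, mem_ofPred_eq]
      have h0 := hσ.1
      have : 0 < σ ^ 2 / 2 := by positivity
      constructor
      · rintro ⟨h1, h2⟩
        exact ⟨⟨by linarith, h2⟩, h1⟩
      · rintro ⟨⟨_, h1⟩, h2⟩
        exact ⟨h2, h1⟩
    rw [hset, ← setIntegral_indicator (measurableSet_le (by fun_prop) (by fun_prop))]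
    rfl
  rw [intervalIntegral.integral_congr_Ioo_of_le hs fun r hr => h1 r (Ioo_subset_Ioc_self hr),
    intervalIntegral.integral_congr_Ioo_of_le (Real.sqrt_nonneg _)
      fun r hr => h2 r (Ioo_subset_Ioc_self hr)]
  apply intervalIntegral_intervalIntegral_swap
  exact (integrable_prod_restrict_uIoc hk 0 s 0 (√(2 * s))).indicator hAm

/-- The Duhamel integral solves the inhomogeneous heat equation, in integrated form. -/
theorem duhamel_eq_integral {Φ Φ' : ℝ → ℝ → Config N}
    (hΦ : Continuous fun p : ℝ × ℝ => Φ p.1 p.2) {B : ℝ} (hB : ∀ s t, ‖Φ s t‖ ≤ B)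
    (hΦ' : Continuous fun p : ℝ × ℝ => Φ' p.1 p.2) {B' : ℝ}
    (hB' : ∀ s t, ‖Φ' s t‖ ≤ B') (hd : ∀ s t, HasDerivAt (Φ s) (Φ' s t) t) {s : ℝ} (hs : 0 ≤ s)
    (t : ℝ) : duhamel (fun ρ _ => ρ) Φ s t =
      ∫ r in (0 : ℝ)..s, (Φ r t + duhamel (fun _ z => z) Φ' r t) := by
  set h : ℝ → ℝ → Config N := fun r ρ => ∫ z, z • Φ' r (t + ρ * z) ∂stdGauss with hh
  have hhc : Continuous fun p : ℝ × ℝ => h p.1 p.2 := by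
    have := (continuous_duhamelInner isDuhamelKernel_snd hΦ' hB').comp
      (f := fun p : ℝ × ℝ => ((p.1 + p.2 ^ 2 / 2, t), p.2)) (by fun_prop)
    refine this.congr fun p => ?_
    simp [duhamelInner, hh]
  set e : ℝ → ℝ → Config N := fun r ρ => ∫ z, Φ r (t + ρ * z) ∂stdGauss with he
  have hec : Continuous fun p : ℝ × ℝ => e p.1 p.2 := by
    refine continuous_of_dominated (bound := fun _ => B) (fun p => ?_)
      (fun p => Eventually.of_forall fun z => hB _ _) (integrable_const _)
      (Eventually.of_forall fun z => ?_)
    · exact (hΦ.comp (f := fun z => (p.1, t + p.2 * z)) (by fun_prop)).aestronglyMeasurable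
    · exact hΦ.comp (f := fun p : ℝ × ℝ => (p.1, t + p.2 * z)) (by fun_prop)
  have heq : ∀ r a, e r a = Φ r t + ∫ ρ in (0 : ℝ)..a, h r ρ := by
    intro r a
    have := integral_stdGauss_sub (hd r) (hΦ'.comp (Continuous.prodMk_right r)) (hB' r) t 0 a
    simp only [zero_mul, add_zero, integral_const, probReal_univ, one_smul] at this
    rw [he, hh]
    rw [← this]
    abel
  have hU : duhamel (fun ρ _ => ρ) Φ s t = ∫ r in (0 : ℝ)..s, e (s - r) (√(2 * r)) := by
    have h1 := intervalIntegral.integral_deriv_smul_comp (a := 0) (b := √(2 * s))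
      (f := fun ρ : ℝ => ρ ^ 2 / 2) (f' := fun ρ => ρ) (g := fun r => e (s - r) (√(2 * r)))
      (fun ρ _ => by
        have := ((hasDerivAt_id ρ).pow 2).div_const 2
        refine this.congr_deriv ?_
        simp) (by fun_prop)
      (hec.comp (f := fun r : ℝ => (s - r, √(2 * r))) (by fun_prop))
    rw [Real.sq_sqrt (by positivity)] at h1
    simp only [ne_eq, OfNat.ofNat_ne_zero, not_false_eq_true, zero_pow, zero_div] at h1
    rw [show 2 * s / 2 = s by ring] at h1
    rw [← h1, duhamel]
    refine intervalIntegral.integral_congr_Ioo_of_le (Real.sqrt_nonneg _) fun ρ hρ => ?_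
    simp only [duhamelInner, Function.comp_def, he]
    rw [integral_smul, show 2 * (ρ ^ 2 / 2) = ρ ^ 2 by ring, Real.sqrt_sq hρ.1.le]
  have hΦt : Continuous fun r => Φ r t := hΦ.comp (Continuous.prodMk_left t)
  have hS : ∀ k : ℝ → ℝ → Config N, Continuous (fun p : ℝ × ℝ => k p.1 p.2) →
      Continuous fun r => ∫ σ in (0 : ℝ)..√(2 * r), k r σ := fun k hk =>
    intervalIntegral.continuous_parametric_intervalIntegral_of_continuous
      (f := k) hk (by fun_prop)
  have hc1 : Continuous fun p : ℝ × ℝ => h (s - p.1) p.2 :=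
    hhc.comp (f := fun p : ℝ × ℝ => (s - p.1, p.2)) (by fun_prop)
  have hc2 : Continuous fun p : ℝ × ℝ => h (p.1 - p.2 ^ 2 / 2) p.2 :=
    hhc.comp (f := fun p : ℝ × ℝ => (p.1 - p.2 ^ 2 / 2, p.2)) (by fun_prop)
  have hD : ∀ r, duhamel (fun _ z => z) Φ' r t =
      ∫ σ in (0 : ℝ)..√(2 * r), h (r - σ ^ 2 / 2) σ := fun r => rfl
  rw [hU]
  simp only [heq, hD]
  rw [intervalIntegral.integral_add, intervalIntegral.integral_add,
    integral_parabola_swap (k := fun r σ => h (s - r) σ) hc1 hs,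
    integral_parabola_swap (k := fun r σ => h (r - σ ^ 2 / 2) σ) hc2 hs]
  · congr 1
    · rw [intervalIntegral.integral_comp_sub_left (fun r => Φ r t) s]
      simp
    · congr 1
      ext1 σ
      rw [intervalIntegral.integral_comp_sub_left (fun r => h r σ) s,
        intervalIntegral.integral_comp_sub_right (fun r => h r σ) (σ ^ 2 / 2)]
      simp
  · exact hΦt.intervalIntegrable _ _
  · exact (hS _ hc2).intervalIntegrable _ _
  · exact (hΦt.comp (by fun_prop : Continuous fun r => s - r)).intervalIntegrable _ _
  · exact (hS _ hc1).intervalIntegrable _ _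

end

end GradientShadowing

namespace GradientShadowing

noncomputable section

variable {N : ℕ}

/-! ### Averages in uniformly local spaces -/

theorem enorm_integral_sq_le {α : Type*} [MeasurableSpace α] (P : Measure α)
    [IsProbabilityMeasure P] {f : α → Config N} (hf : AEStronglyMeasurable f P) :
    ‖∫ z, f z ∂P‖ₑ ^ 2 ≤ ∫⁻ z, ‖f z‖ₑ ^ 2 ∂P := by
  have h1 : ‖∫ z, f z ∂P‖ₑ ≤ eLpNorm f 2 P := by
    refine (enorm_integral_le_lintegral_enorm f).trans ?_
    rw [← eLpNorm_one_eq_lintegral_enorm]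
    exact eLpNorm_le_eLpNorm_of_exponent_le (by norm_num) hf
  calc ‖∫ z, f z ∂P‖ₑ ^ 2 ≤ eLpNorm f 2 P ^ 2 := by gcongr
    _ = ∫⁻ z, ‖f z‖ₑ ^ 2 ∂P := by
      rw [eLpNorm_eq_lintegral_rpow_enorm_toReal (by norm_num) (by norm_num), ← ENNReal.rpow_two,
        ← ENNReal.rpow_mul]
      simp

theorem lintegral_lintegral_le_of_l2ulNorm {α : Type*} [MeasurableSpace α] (P : Measure α)
    [IsProbabilityMeasure P] {G : α → ℝ → Config N}
    (hG : Measurable fun p : ℝ × α => G p.2 p.1) {c : α → ℝ≥0∞}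
    (hc : ∀ z, l2ulNorm (G z) ^ 2 ≤ c z) (y : ℝ) :
    ∫⁻ t : ℝ, ENNReal.ofReal (Real.exp (-|t + y|)) * ∫⁻ z, ‖G z t‖ₑ ^ 2 ∂P ≤ ∫⁻ z, c z ∂P := by
  have hm : Measurable fun p : ℝ × α =>
      ENNReal.ofReal (Real.exp (-|p.1 + y|)) * ‖G p.2 p.1‖ₑ ^ 2 :=
    ((measurable_expWeight y).comp measurable_fst).mul (hG.enorm.pow_const 2)
  calc ∫⁻ t : ℝ, ENNReal.ofReal (Real.exp (-|t + y|)) * ∫⁻ z, ‖G z t‖ₑ ^ 2 ∂P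
      = ∫⁻ t : ℝ, ∫⁻ z, ENNReal.ofReal (Real.exp (-|t + y|)) * ‖G z t‖ₑ ^ 2 ∂P := by
        congr 1; ext1 t
        rw [lintegral_const_mul]
        exact (hG.comp measurable_prodMk_left).enorm.pow_const 2
    _ = ∫⁻ z, (∫⁻ t : ℝ, ENNReal.ofReal (Real.exp (-|t + y|)) * ‖G z t‖ₑ ^ 2) ∂P :=
        lintegral_lintegral_swap hm.aemeasurable
    _ ≤ ∫⁻ z, c z ∂P := lintegral_mono fun z => (lintegral_le_l2ulNorm_sq (G z) y).trans (hc z)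

theorem l2ulNorm_average_le {α : Type*} [MeasurableSpace α] (P : Measure α)
    [IsProbabilityMeasure P] {G : α → ℝ → Config N}
    (hG : Measurable fun p : ℝ × α => G p.2 p.1) {c : α → ℝ≥0∞}
    (hc : ∀ z, l2ulNorm (G z) ^ 2 ≤ c z) :
    l2ulNorm (fun t => ∫ z, G z t ∂P) ^ 2 ≤ ∫⁻ z, c z ∂P := by
  rw [l2ulNorm_sq]
  refine iSup_le fun y => ?_
  refine le_trans (lintegral_mono fun t => ?_) (lintegral_lintegral_le_of_l2ulNorm P hG hc y)
  gcongr
  exact enorm_integral_sq_le P (hG.comp measurable_prodMk_left).aestronglyMeasurable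

theorem ae_integrable_of_l2ulNorm {α : Type*} [MeasurableSpace α] (P : Measure α)
    [IsProbabilityMeasure P] {G : α → ℝ → Config N}
    (hG : Measurable fun p : ℝ × α => G p.2 p.1) {C : ℝ≥0∞} (hC : C < ∞)
    (hc : ∀ z, l2ulNorm (G z) ≤ C) : ∀ᵐ t, Integrable (fun z => G z t) P := by
  have h1 := lintegral_lintegral_le_of_l2ulNorm P hG (c := fun _ => C ^ 2)
    (fun z => by gcongr; exact hc z) 0
  have hm : Measurable fun t : ℝ => ENNReal.ofReal (Real.exp (-|t + 0|)) *
      ∫⁻ z, ‖G z t‖ₑ ^ 2 ∂P :=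
    (measurable_expWeight 0).mul (Measurable.lintegral_prod_right' (hG.enorm.pow_const 2))
  have h2 : ∀ᵐ t : ℝ, ENNReal.ofReal (Real.exp (-|t + 0|)) *
      ∫⁻ z, ‖G z t‖ₑ ^ 2 ∂P < ∞ := by
    refine ae_lt_top hm (h1.trans_lt ?_).ne
    rw [lintegral_const, measure_univ, mul_one]
    exact ENNReal.pow_lt_top hC
  filter_upwards [h2] with t ht
  have h3 : ∫⁻ z, ‖G z t‖ₑ ^ 2 ∂P < ∞ := by
    by_contra h
    rw [not_lt_top_iff.1 h, ENNReal.mul_top (by simp [Real.exp_pos])] at ht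
    exact lt_irrefl _ ht
  have hmt : AEStronglyMeasurable (fun z => G z t) P :=
    (hG.comp measurable_prodMk_left).aestronglyMeasurable
  have h4 : MemLp (fun z => G z t) 2 P := by
    refine ⟨hmt, ?_⟩
    rw [eLpNorm_lt_top_iff_lintegral_rpow_enorm_lt_top (by norm_num) (by norm_num)]
    simpa using h3
  exact h4.integrable (by norm_num)

/-- The Gaussian average with standard deviation `a`. -/
def heat (a : ℝ) (φ : ℝ → Config N) (t : ℝ) : Config N := ∫ z, φ (t + a * z) ∂stdGauss

@[simp] theorem heat_zero (φ : ℝ → Config N) : heat 0 φ = φ := by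
  ext1 t; simp [heat]

theorem measurable_heat_integrand {k : ℝ → Config N} (hk : Measurable k) (a : ℝ) :
    Measurable fun p : ℝ × ℝ => k (p.1 + a * p.2) := hk.comp (by fun_prop)

theorem stronglyMeasurable_heat {k : ℝ → Config N} (hk : Measurable k) (a : ℝ) :
    StronglyMeasurable (heat a k) :=
  StronglyMeasurable.integral_prod_right' (f := fun p : ℝ × ℝ => k (p.1 + a * p.2))
    (measurable_heat_integrand hk a).stronglyMeasurable

theorem l2ulNorm_heat_le {k : ℝ → Config N} (hk : Measurable k) (a : ℝ) :
    l2ulNorm (heat a k) ≤ l2ulNorm k := by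
  have := l2ulNorm_average_le stdGauss (G := fun z t => k (t + a * z))
    (measurable_heat_integrand hk a) (c := fun _ => l2ulNorm k ^ 2)
    (fun z => by rw [l2ulNorm_translate])
  rw [lintegral_const, measure_univ, mul_one] at this
  exact (ENNReal.pow_le_pow_left_iff (by norm_num)).1 this

theorem ae_integrable_heat {k : ℝ → Config N} (hk : Measurable k) (h : l2ulNorm k < ∞) (a : ℝ) :
    ∀ᵐ t, Integrable (fun z => k (t + a * z)) stdGauss :=
  ae_integrable_of_l2ulNorm stdGauss (G := fun z t => k (t + a * z))
    (measurable_heat_integrand hk a) h (fun z => by rw [l2ulNorm_translate])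

theorem heat_sub_ae {k l : ℝ → Config N} (hk : Measurable k) (h : l2ulNorm k < ∞)
    (hl : Measurable l) (h' : l2ulNorm l < ∞) (a : ℝ) :
    heat a (fun t => k t - l t) =ᵐ[volume] fun t => heat a k t - heat a l t := by
  filter_upwards [ae_integrable_heat hk h a, ae_integrable_heat hl h' a] with t h1 h2
  exact integral_sub h1 h2

theorem MemL2ul.heat {k : ℝ → Config N} (hk : MemL2ul k) (hm : Measurable k) (a : ℝ) :
    MemL2ul (heat a k) where
  aestronglyMeasurable := (stronglyMeasurable_heat hm a).aestronglyMeasurable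
  norm_lt_top := (l2ulNorm_heat_le hm a).trans_lt hk.norm_lt_top
  tendsto_translate := by
    refine tendsto_of_tendsto_of_tendsto_of_le_of_le tendsto_const_nhds hk.tendsto_translate
      (fun _ => zero_le) fun y => ?_
    have hmy : Measurable fun t => k (t + y) := hm.comp (by fun_prop)
    refine le_trans (le_of_eq ?_) (l2ulNorm_heat_le (hmy.sub hm) a)
    have h2 := heat_sub_ae hmy (by rw [l2ulNorm_translate]; exact hk.norm_lt_top) hm
      hk.norm_lt_top a
    refine (l2ulNorm_congr (h2.trans (Eventually.of_forall fun t => ?_))).symm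
    simp only [GradientShadowing.heat, add_right_comm]

/-- The modulus of continuity of the translations, made quantitative. -/
theorem MemL2ul.exists_modulus {k : ℝ → Config N} (hk : MemL2ul k) {ε : ℝ≥0∞} (hε : 0 < ε) :
    ∃ C : ℝ≥0, ∀ y : ℝ, l2ulNorm (fun t => k (t + y) - k t) ^ 2 ≤
      ε + C * ENNReal.ofReal (y ^ 2) := by
  have h1 : Tendsto (fun y : ℝ => l2ulNorm (fun t => k (t + y) - k t) ^ 2) (𝓝 0) (𝓝 0) := by
    have := ENNReal.Tendsto.pow (n := 2) hk.tendsto_translate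
    simpa using this
  obtain ⟨δ, hδ, h⟩ := Metric.eventually_nhds_iff.1 (ENNReal.tendsto_nhds_zero.1 h1 ε hε)
  set A : ℝ≥0∞ := (2 * l2ulNorm k) ^ 2 with hA
  have hAtop : A < ∞ := ENNReal.pow_lt_top (ENNReal.mul_lt_top (by simp) hk.norm_lt_top)
  refine ⟨A.toNNReal * (1 / δ ^ 2).toNNReal, fun y => ?_⟩
  rcases lt_or_ge |y| δ with hy | hy
  · exact (h (by simpa using hy)).trans le_self_add
  · refine le_add_left ?_
    have h2 : l2ulNorm (fun t => k (t + y) - k t) ^ 2 ≤ A := by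
      rw [hA]
      gcongr
      refine (l2ulNorm_sub_le (aestronglyMeasurable_translate hk.aestronglyMeasurable y)
        hk.aestronglyMeasurable).trans_eq ?_
      rw [l2ulNorm_translate, two_mul]
    refine h2.trans ?_
    rw [ENNReal.coe_mul, ENNReal.coe_toNNReal hAtop.ne, mul_assoc]
    refine le_mul_of_one_le_right zero_le ?_
    rw [← ENNReal.ofReal, ← ENNReal.ofReal_mul (by positivity), ← ENNReal.ofReal_one]
    apply ENNReal.ofReal_le_ofReal
    rw [one_div, inv_mul_eq_div, le_div_iff₀ (by positivity), one_mul, ← sq_abs y]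
    gcongr

theorem lintegral_sq_stdGauss : ∫⁻ z, ENNReal.ofReal (z ^ 2) ∂stdGauss = 1 := by
  rw [← ofReal_integral_eq_lintegral_ofReal integrable_sq_stdGauss
    (Eventually.of_forall fun z => sq_nonneg z), integral_sq_stdGauss, ENNReal.ofReal_one]

/-- The heat flow is strongly continuous in `L²_ul`. -/
theorem MemL2ul.tendsto_heat {k : ℝ → Config N} (hk : MemL2ul k) (hm : Measurable k) (a : ℝ) :
    Tendsto (fun b => l2ulNorm fun t => GradientShadowing.heat b k t -
      GradientShadowing.heat a k t) (𝓝 a) (𝓝 0) := by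
  suffices h : Tendsto (fun b => l2ulNorm (fun t => GradientShadowing.heat b k t -
      GradientShadowing.heat a k t) ^ 2) (𝓝 a) (𝓝 0) by
    have := (ENNReal.continuous_rpow_const (y := 1 / 2)).tendsto 0 |>.comp h
    simp only [Function.comp_def] at this
    rw [ENNReal.zero_rpow_of_pos (by norm_num)] at this
    refine this.congr fun b => ?_
    rw [← ENNReal.rpow_two, ← ENNReal.rpow_mul]
    norm_num
  rw [ENNReal.tendsto_nhds_zero]
  intro ε hε
  obtain ⟨C, hC⟩ := hk.exists_modulus (ENNReal.half_pos hε.ne')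
  have hlim : Tendsto (fun b : ℝ => C * ENNReal.ofReal ((b - a) ^ 2)) (𝓝 a) (𝓝 0) := by
    have h1 : Continuous fun b : ℝ => C * ENNReal.ofReal ((b - a) ^ 2) := by
      have : Continuous fun b : ℝ => ENNReal.ofReal ((b - a) ^ 2) :=
        ENNReal.continuous_ofReal.comp (by fun_prop)
      exact ENNReal.continuous_const_mul (by simp) |>.comp this
    simpa using h1.tendsto a
  filter_upwards [ENNReal.tendsto_nhds_zero.1 hlim _ (ENNReal.half_pos hε.ne')] with b hb
  have h1 : (fun t => GradientShadowing.heat b k t - GradientShadowing.heat a k t)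
      =ᵐ[volume] fun t => ∫ z, (k (t + b * z) - k (t + a * z)) ∂stdGauss := by
    filter_upwards [ae_integrable_heat hm hk.norm_lt_top a,
      ae_integrable_heat hm hk.norm_lt_top b] with t h1 h2
    exact (integral_sub h2 h1).symm
  rw [l2ulNorm_congr h1]
  refine (l2ulNorm_average_le stdGauss (G := fun z t => k (t + b * z) - k (t + a * z))
    ((measurable_heat_integrand hm b).sub (measurable_heat_integrand hm a))
    (c := fun z => ε / 2 + C * (ENNReal.ofReal ((b - a) ^ 2) * ENNReal.ofReal (z ^ 2)))
    (fun z => ?_)).trans ?_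
  · have h2 := hC ((b - a) * z)
    rw [← l2ulNorm_translate _ (a * z), mul_pow, ENNReal.ofReal_mul (sq_nonneg _)] at h2
    refine le_trans (le_of_eq ?_) h2
    congr 2
    ext1 t
    congr 2
    ring
  · rw [lintegral_add_left measurable_const, lintegral_const, measure_univ, mul_one,
      lintegral_const_mul' _ _ (by simp), lintegral_const_mul' _ _ (by simp),
      lintegral_sq_stdGauss, mul_one]
    exact (add_le_add_right hb _).trans_eq (ENNReal.add_halves ε)

/-- Gaussian averages of primitives are primitives. -/
theorem IsPrim.heat {f k : ℝ → Config N} (hf : IsPrim f k) (hm : Measurable k)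
    (hk : l2ulNorm k < ∞) {A B : ℝ} (hB : 0 ≤ B) (hAB : ∀ x, ‖f x‖ ≤ A + B * |x|) (a : ℝ) :
    IsPrim (heat a f) (heat a k) where
  locallyIntegrable := locallyIntegrable_of_l2ulNorm
    (stronglyMeasurable_heat hm a).aestronglyMeasurable ((l2ulNorm_heat_le hm a).trans_lt hk)
  integral_eq b c := by
    have hint : ∀ t, Integrable (fun z => f (t + a * z)) stdGauss := fun t => by
      have := hf.continuous
      refine integrable_of_le_abs (A := A + B * |t|) (B := B * |a|) (by fun_prop) fun z => ?_
      refine (hAB _).trans ?_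
      have h1 := abs_add_le t (a * z)
      rw [abs_mul] at h1
      nlinarith
    simp only [GradientShadowing.heat]
    rw [intervalIntegral_integral_swap, ← integral_sub (hint c) (hint b)]
    · congr 1; ext1 z
      rw [intervalIntegral.integral_comp_add_right, hf.integral_eq]
    · have : IsFiniteMeasure (volume.restrict (uIoc b c)) := isFiniteMeasure_restrict_uIoc b c
      obtain ⟨R, hR⟩ := exists_subset_Icc_neg (isCompact_uIcc (a := b) (b := c))
      have hM : MemLp (Function.uncurry fun t z => k (t + a * z)) 2
          ((volume.restrict (uIoc b c)).prod stdGauss) := by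
        refine ⟨(measurable_heat_integrand hm a).aestronglyMeasurable, ?_⟩
        rw [eLpNorm_lt_top_iff_lintegral_rpow_enorm_lt_top (by norm_num) (by norm_num)]
        simp only [ENNReal.toReal_ofNat, ENNReal.rpow_two, Function.uncurry_def]
        rw [lintegral_prod_symm' _ ((measurable_heat_integrand hm a).enorm.pow_const 2)]
        refine (lintegral_mono (g := fun _ => ENNReal.ofReal (Real.exp R) * l2ulNorm k ^ 2)
          fun z => ?_).trans_lt ?_
        · rw [← l2ulNorm_translate k (a * z)]
          refine le_trans (lintegral_mono_set ?_)
            (setLIntegral_Icc_le_l2ulNorm (fun t => k (t + a * z)) 0)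
          simpa using uIoc_subset_uIcc.trans hR
        · rw [lintegral_const, measure_univ, mul_one]
          exact ENNReal.mul_lt_top (by simp) (ENNReal.pow_lt_top hk)
      exact hM.integrable (by norm_num)

/-! ### Pointwise bounds -/

theorem norm_sub_le_sqrt_of_isPrim {p k : ℝ → Config N} (hp : IsPrim p k)
    (hkm : AEStronglyMeasurable k volume) {A : ℝ}
    (hA : l2ulNorm k ≤ ENNReal.ofReal A) (hA0 : 0 ≤ A) {t u : ℝ} (htu : |t - u| ≤ 1) :
    ‖p t - p u‖ ≤ 2 * A * √|t - u| := by
  rw [← hp.integral_eq]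
  have hsub : uIoc u t ⊆ Icc (u - 1) (u + 1) := by
    intro x hx
    have h1 := abs_le.1 htu
    rcases le_total u t with h | h
    · rw [uIoc_of_le h] at hx
      exact ⟨by linarith [hx.1], by linarith [hx.2]⟩
    · rw [uIoc_of_ge h] at hx
      exact ⟨by linarith [hx.1], by linarith [hx.2]⟩
  have h1 : ‖∫ x in u..t, k x‖ₑ ≤ ENNReal.ofReal (2 * A * √|t - u|) := by
    rw [enorm_eq_nnnorm, ← norm_toNNReal, intervalIntegral.norm_intervalIntegral_eq, norm_toNNReal,
      ← enorm_eq_nnnorm]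
    refine (enorm_integral_le_lintegral_enorm _).trans ?_
    have h2 : ∫⁻ x in uIoc u t, ‖k x‖ₑ ≤
        eLpNorm k 2 (volume.restrict (uIoc u t)) * volume (uIoc u t) ^ (1 / 2 : ℝ) := by
      rw [← eLpNorm_one_eq_lintegral_enorm]
      refine (eLpNorm_le_eLpNorm_mul_rpow_measure_univ (p := 1) (q := 2) (by norm_num)
        hkm.restrict).trans_eq ?_
      rw [Measure.restrict_apply_univ]
      norm_num
    refine h2.trans ?_
    have h3 : eLpNorm k 2 (volume.restrict (uIoc u t)) ≤ ENNReal.ofReal (2 * A) := by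
      rw [eLpNorm_eq_lintegral_rpow_enorm_toReal (by norm_num) (by norm_num)]
      simp only [ENNReal.toReal_ofNat, ENNReal.rpow_two]
      rw [one_div, ENNReal.rpow_inv_le_iff (by norm_num), ENNReal.rpow_two]
      refine (lintegral_mono_set hsub).trans ((setLIntegral_Icc_le_l2ulNorm k u).trans ?_)
      calc ENNReal.ofReal (Real.exp 1) * l2ulNorm k ^ 2
          ≤ ENNReal.ofReal 4 * ENNReal.ofReal A ^ 2 := by
            gcongr
            have := Real.exp_one_lt_d9
            linarith
        _ = ENNReal.ofReal (2 * A) ^ 2 := by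
            rw [← ENNReal.ofReal_pow hA0, ← ENNReal.ofReal_mul (by norm_num),
              ← ENNReal.ofReal_pow (by positivity)]
            congr 1; ring
    rw [ENNReal.ofReal_mul (by positivity)]
    gcongr
    rw [Real.volume_uIoc, ENNReal.ofReal_rpow_of_nonneg (abs_nonneg _) (by norm_num),
      ← Real.sqrt_eq_rpow]
  rw [← ofReal_norm, ENNReal.ofReal_le_ofReal_iff (by positivity)] at h1
  exact h1

theorem norm_le_of_isPrim {p k : ℝ → Config N} (hp : IsPrim p k)
    (hkm : AEStronglyMeasurable k volume) {A : ℝ}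
    (hpA : l2ulNorm p ≤ ENNReal.ofReal A) (hA : l2ulNorm k ≤ ENNReal.ofReal A) (hA0 : 0 ≤ A)
    (t : ℝ) : ‖p t‖ ≤ 4 * A := by
  by_contra hlt
  push Not at hlt
  have h1 : ∀ u ∈ Icc (t - 1) (t + 1), 2 * A < ‖p u‖ := by
    intro u hu
    have h2 : |t - u| ≤ 1 := abs_le.2 ⟨by linarith [hu.2], by linarith [hu.1]⟩
    have h3 := norm_sub_le_sqrt_of_isPrim hp hkm hA hA0 h2
    have h4 : √|t - u| ≤ 1 := Real.sqrt_le_one.2 h2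
    have h5 := norm_sub_norm_le (p t) (p u)
    nlinarith
  have h2 : 0 < 4 * A ∨ A = 0 := by
    rcases hA0.eq_or_lt with h | h
    · exact Or.inr h.symm
    · exact Or.inl (by linarith)
  have h3 := setLIntegral_Icc_le_l2ulNorm p t (R := 1)
  have h4 : ENNReal.ofReal (Real.exp 1) * l2ulNorm p ^ 2 ≤ ENNReal.ofReal (4 * A ^ 2) := by
    calc ENNReal.ofReal (Real.exp 1) * l2ulNorm p ^ 2
          ≤ ENNReal.ofReal 4 * ENNReal.ofReal A ^ 2 := by
            gcongr
            have := Real.exp_one_lt_d9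
            linarith
        _ = _ := by
            rw [← ENNReal.ofReal_pow hA0, ← ENNReal.ofReal_mul (by norm_num)]
  obtain ⟨c, hc, hc'⟩ : ∃ c, 2 * A < c ∧ ∀ u ∈ Icc (t - 1) (t + 1), c ≤ ‖p u‖ := by
    obtain ⟨x, hx, hx'⟩ := isCompact_Icc.exists_isMinOn
      (nonempty_Icc.2 (by linarith : t - 1 ≤ t + 1)) hp.continuous.norm.continuousOn
    exact ⟨‖p x‖, h1 x hx, fun u hu => hx' hu⟩
  have h5 : ENNReal.ofReal (2 * c ^ 2) ≤ ∫⁻ u in Icc (t - 1) (t + 1), ‖p u‖ₑ ^ 2 := by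
    have h6 : ∫⁻ u in Icc (t - 1) (t + 1), ENNReal.ofReal (c ^ 2) ≤
        ∫⁻ u in Icc (t - 1) (t + 1), ‖p u‖ₑ ^ 2 := by
      refine setLIntegral_mono' measurableSet_Icc fun u hu => ?_
      rw [← ofReal_norm, ← ENNReal.ofReal_pow (norm_nonneg _)]
      apply ENNReal.ofReal_le_ofReal
      have := hc' u hu
      have : 0 ≤ c := by linarith
      gcongr
    refine le_trans (le_of_eq ?_) h6
    rw [setLIntegral_const, Real.volume_Icc, ← ENNReal.ofReal_mul (sq_nonneg c)]
    congr 1; ring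
  have h6 := h5.trans (h3.trans h4)
  rw [ENNReal.ofReal_le_ofReal_iff (by positivity)] at h6
  nlinarith

theorem norm_sub_le_of_isPrim {p k : ℝ → Config N} (hp : IsPrim p k)
    (hkm : AEStronglyMeasurable k volume) {A : ℝ}
    (hpA : l2ulNorm p ≤ ENNReal.ofReal A) (hA : l2ulNorm k ≤ ENNReal.ofReal A) (hA0 : 0 ≤ A)
    (t u : ℝ) : ‖p t - p u‖ ≤ 8 * A * √|t - u| := by
  rcases le_total |t - u| 1 with h | h
  · have := norm_sub_le_sqrt_of_isPrim hp hkm hA hA0 h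
    have h2 := Real.sqrt_nonneg |t - u|
    nlinarith [mul_nonneg hA0 h2]
  · have h1 := norm_le_of_isPrim hp hkm hpA hA hA0 t
    have h2 := norm_le_of_isPrim hp hkm hpA hA hA0 u
    have h3 : 1 ≤ √|t - u| := Real.one_le_sqrt.2 h
    have h4 := norm_sub_le (p t) (p u)
    nlinarith

theorem measurable_deriv_config (f : ℝ → Config N) : Measurable (deriv f) := measurable_deriv f

/-- The velocities of elements of the phase space are bounded and Hölder continuous. -/
theorem MemPhase.exists_bound {q : ℝ → Config N} (hq : MemPhase q) :
    ∃ C : ℝ, 0 ≤ C ∧ (∀ t, ‖deriv q t‖ ≤ C) ∧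
      ∀ t u, ‖deriv q t - deriv q u‖ ≤ C * √|t - u| := by
  set A := max (l2ulNorm (deriv q)) (l2ulNorm (deriv (deriv q))) with hA
  have hAt : A ≠ ∞ := (max_lt hq.deriv_mem.norm_lt_top hq.deriv_deriv_mem.norm_lt_top).ne
  have h1 : l2ulNorm (deriv q) ≤ ENNReal.ofReal A.toReal := by
    rw [ENNReal.ofReal_toReal hAt]; exact le_max_left _ _
  have h2 : l2ulNorm (deriv (deriv q)) ≤ ENNReal.ofReal A.toReal := by
    rw [ENNReal.ofReal_toReal hAt]; exact le_max_right _ _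
  have h0 : 0 ≤ A.toReal := ENNReal.toReal_nonneg
  have hm := hq.deriv_deriv_mem.aestronglyMeasurable
  refine ⟨8 * A.toReal, by positivity, fun t => ?_, norm_sub_le_of_isPrim hq.isPrim_deriv hm h1 h2 h0⟩
  have := norm_le_of_isPrim hq.isPrim_deriv hm h1 h2 h0 t
  linarith

theorem norm_le_add_mul_abs {q : ℝ → Config N} (hq : Differentiable ℝ q) {C : ℝ}
    (hC : ∀ t, ‖deriv q t‖ ≤ C) (x : ℝ) : ‖q x‖ ≤ ‖q 0‖ + C * |x| := by
  have := convex_univ.norm_image_sub_le_of_norm_hasDerivWithin_le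
    (fun x _ => (hq x).hasDerivAt.hasDerivWithinAt) (fun x _ => hC x) (mem_univ 0) (mem_univ x)
  rw [sub_zero, Real.norm_eq_abs] at this
  have h2 := norm_le_norm_add_norm_sub' (q x) (q 0)
  linarith

end

end GradientShadowing

namespace GradientShadowing

noncomputable section

variable {N : ℕ}

/-! ### Existence of mild solutions -/

theorem duhamel_sub {κ : ℝ → ℝ → ℝ} (hκ : IsDuhamelKernel κ) {Φ Ψ : ℝ → ℝ → Config N}
    (hΦ : Continuous fun p : ℝ × ℝ => Φ p.1 p.2) {B : ℝ} (hB : ∀ s t, ‖Φ s t‖ ≤ B)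
    (hΨ : Continuous fun p : ℝ × ℝ => Ψ p.1 p.2) {B' : ℝ} (hB' : ∀ s t, ‖Ψ s t‖ ≤ B') (s t : ℝ) :
    duhamel κ (fun r x => Φ r x - Ψ r x) s t = duhamel κ Φ s t - duhamel κ Ψ s t := by
  simp only [duhamel]
  rw [← intervalIntegral.integral_sub
    ((continuous_duhamelInner_right hκ hΦ hB s t).intervalIntegrable _ _)
    ((continuous_duhamelInner_right hκ hΨ hB' s t).intervalIntegrable _ _)]
  congr 1; ext1 ρ
  simp only [duhamelInner, smul_sub]
  exact integral_sub (integrable_duhamelAux hκ hΦ hB s t ρ) (integrable_duhamelAux hκ hΨ hB' s t ρ)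

theorem norm_heat_sub_le {φ : ℝ → Config N} (hφ : Continuous φ) {A B : ℝ} (hB : 0 ≤ B)
    (hAB : ∀ x, ‖φ x‖ ≤ A + B * |x|) {ε K : ℝ} (hK : 0 ≤ K)
    (h : ∀ x y, ‖φ x - φ y‖ ≤ ε + K * |x - y|)
    (a b t u : ℝ) : ‖heat a φ t - heat b φ u‖ ≤ ε + K * (|t - u| + |a - b|) := by
  have hint : ∀ a t, Integrable (fun z => φ (t + a * z)) stdGauss := fun a t => by
    refine integrable_of_le_abs (A := A + B * |t|) (B := B * |a|) (by fun_prop) fun z => ?_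
    refine (hAB _).trans ?_
    have h1 := abs_add_le t (a * z)
    rw [abs_mul] at h1
    nlinarith
  simp only [heat]
  rw [← integral_sub (hint a t) (hint b u)]
  have hi : Integrable (fun z : ℝ => ε + K * (|t - u| + |a - b| * |z|)) stdGauss :=
    (integrable_const _).add (((integrable_const _).add
      (integrable_abs_stdGauss.const_mul _)).const_mul K)
  refine (norm_integral_le_of_norm_le hi (Eventually.of_forall fun z => ?_)).trans ?_
  · refine (h _ _).trans ?_
    gcongr
    have : t + a * z - (u + b * z) = (t - u) + (a - b) * z := by ring
    rw [this, ← abs_mul]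
    exact abs_add_le _ _
  · have h1 : Integrable (fun z : ℝ => |a - b| * |z|) stdGauss :=
      integrable_abs_stdGauss.const_mul _
    have h2 : Integrable (fun z : ℝ => |t - u| + |a - b| * |z|) stdGauss :=
      (integrable_const _).add h1
    have h3 : ∫ z, (ε + K * (|t - u| + |a - b| * |z|)) ∂stdGauss =
        ε + K * (|t - u| + |a - b| * ∫ z, |z| ∂stdGauss) := by
      rw [integral_add (integrable_const _) (h2.const_mul K), integral_const_mul,
        integral_add (integrable_const _) h1, integral_const_mul]
      simp only [integral_const, probReal_univ, one_smul]
    rw [h3]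
    have := integral_abs_stdGauss_le
    have h2 := abs_nonneg (a - b)
    have : |a - b| * ∫ z, |z| ∂stdGauss ≤ |a - b| * 1 := by gcongr
    nlinarith

/-- Uniform continuity in quantitative form. -/
def QuasiLipschitz (φ : ℝ → Config N) : Prop :=
  ∀ ε > 0, ∃ K : ℝ, 0 ≤ K ∧ ∀ x y, ‖φ x - φ y‖ ≤ ε + K * |x - y|

theorem quasiLipschitz_of_holder {φ : ℝ → Config N} {C : ℝ}
    (h : ∀ x y, ‖φ x - φ y‖ ≤ C * √|x - y|) : QuasiLipschitz φ := by
  intro ε hε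
  refine ⟨C ^ 2 / (4 * ε), by positivity, fun x y => (h x y).trans ?_⟩
  have h1 := Real.sq_sqrt (abs_nonneg (x - y))
  rw [← sub_nonneg]
  have : ε + C ^ 2 / (4 * ε) * |x - y| - C * √|x - y| =
      (2 * ε - C * √|x - y|) ^ 2 / (4 * ε) := by
    nth_rewrite 1 [← h1]
    field_simp
    ring
  rw [this]
  positivity

/-- `Q` solves the gradient equation in the mild sense, with the initial value `q`. -/
structure IsMild (V : Config N → ℝ → ℝ) (q : ℝ → Config N) (Q : ℝ → ℝ → Config N) : Prop where
  continuous : Continuous fun p : ℝ × ℝ => Q p.1 p.2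
  eq : ∀ s t, Q s t = heat (√(2 * s)) q t -
    duhamel (fun ρ _ => ρ) (fun r x => gradV V (Q r x) x) s t

theorem continuous_heat_sqrt {q : ℝ → Config N} (hq : Continuous q) {A B : ℝ} (hB : 0 ≤ B)
    (hAB : ∀ x, ‖q x‖ ≤ A + B * |x|) (h : QuasiLipschitz q) :
    Continuous fun p : ℝ × ℝ => heat (√(2 * p.1)) q p.2 := by
  have hc : Continuous fun p : ℝ × ℝ => heat p.1 q p.2 := by
    rw [Metric.continuous_iff]
    intro p ε hε
    obtain ⟨K, hK0, hK⟩ := h (ε / 2) (by positivity)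
    refine ⟨ε / (4 * (K + 1)), by positivity, fun p' hp => ?_⟩
    rw [dist_eq_norm]
    refine (norm_heat_sub_le hq hB hAB hK0 hK _ _ _ _).trans_lt ?_
    rw [Prod.dist_eq, max_lt_iff, Real.dist_eq, Real.dist_eq] at hp
    have h1 : K * (|p'.2 - p.2| + |p'.1 - p.1|) ≤ K * (2 * (ε / (4 * (K + 1)))) := by
      gcongr; linarith
    have h2 : K * (2 * (ε / (4 * (K + 1)))) = ε / 2 * (K / (K + 1)) := by field_simp; norm_num
    have h3 : K / (K + 1) < 1 := by rw [div_lt_one (by positivity)]; linarith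
    nlinarith
  exact hc.comp (f := fun p : ℝ × ℝ => (√(2 * p.1), p.2)) (by fun_prop)

theorem MemPhase.exists_lipschitz {q : ℝ → Config N} (hq : MemPhase q) :
    ∃ C : ℝ, 0 ≤ C ∧ (∀ x, ‖q x‖ ≤ ‖q 0‖ + C * |x|) ∧ ∀ x y, ‖q x - q y‖ ≤ 0 + C * |x - y| := by
  obtain ⟨C, hC0, hC, -⟩ := hq.exists_bound
  refine ⟨C, hC0, norm_le_add_mul_abs hq.differentiable hC, fun x y => ?_⟩
  have := convex_univ.norm_image_sub_le_of_norm_hasDerivWithin_le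
    (fun x _ => (hq.differentiable x).hasDerivAt.hasDerivWithinAt) (fun x _ => hC x)
    (mem_univ y) (mem_univ x)
  rwa [zero_add, ← Real.norm_eq_abs]

theorem exists_isMild {V : Config N → ℝ → ℝ} (hV : IsPotential V) {q : ℝ → Config N}
    (hq : MemPhase q) : ∃ Q, IsMild V q Q := by
  obtain ⟨M, hM0, hM⟩ := hV.exists_bound_gradV
  obtain ⟨L, hL0, -, hL⟩ := hV.exists_lipschitz_gradV
  obtain ⟨C, hC0, hC, hC'⟩ := hq.exists_lipschitz
  set W : ℝ → ℝ → Config N := fun s t => heat (√(2 * s)) q t with hW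
  have hWc : Continuous fun p : ℝ × ℝ => W p.1 p.2 :=
    continuous_heat_sqrt hq.contDiff.continuous hC0 hC
      (fun ε hε => ⟨C, hC0, fun x y => (hC' x y).trans (by linarith)⟩)
  set l : ℝ := L + 1 with hl
  have hl0 : 0 < l := by positivity
  let X := BoundedContinuousFunction (ℝ × ℝ) (Config N)
  let F : X → ℝ → ℝ → Config N := fun u s t => gradV V (W s t + Real.exp (l * s) • u (s, t)) t
  have hFc : ∀ u, Continuous fun p : ℝ × ℝ => F u p.1 p.2 := fun u => by
    have : Continuous fun p : ℝ × ℝ => (W p.1 p.2 + Real.exp (l * p.1) • u (p.1, p.2), p.2) := by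
      have := u.continuous
      fun_prop
    exact hV.continuous_gradV.comp this
  have hFb : ∀ u s t, ‖F u s t‖ ≤ M := fun u s t => hM _ _
  have hUc := fun u => continuous_duhamel isDuhamelKernel_fst (hFc u) (hFb u)
  have hbound : ∀ u (p : ℝ × ℝ),
      ‖-(Real.exp (-(l * p.1)) • duhamel (fun ρ _ => ρ) (F u) p.1 p.2)‖ ≤ M / l := by
    intro u p
    rw [norm_neg, norm_smul, Real.norm_eq_abs, abs_of_pos (Real.exp_pos _)]
    rcases le_total p.1 0 with h | h
    · rw [duhamel_of_nonpos _ h, norm_zero, mul_zero]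
      positivity
    · have h1 := norm_duhamel_fst_le_mul h p.2 (fun r _ x => hFb u r x)
      have h2 : p.1 ≤ Real.exp (l * p.1) / l := by
        rw [le_div_iff₀ hl0]
        have := Real.add_one_le_exp (l * p.1)
        linarith
      calc Real.exp (-(l * p.1)) * ‖duhamel (fun ρ _ => ρ) (F u) p.1 p.2‖
          ≤ Real.exp (-(l * p.1)) * (M * (Real.exp (l * p.1) / l)) := by
            gcongr
            exact h1.trans (by gcongr)
        _ = M / l * (Real.exp (-(l * p.1)) * Real.exp (l * p.1)) := by ring
        _ = M / l := by rw [← Real.exp_add]; simp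
  let Ψ : X → X := fun u => BoundedContinuousFunction.ofNormedAddCommGroup
    (fun p : ℝ × ℝ => -(Real.exp (-(l * p.1)) • duhamel (fun ρ _ => ρ) (F u) p.1 p.2))
    (by have := hUc u; fun_prop) (M / l) (hbound u)
  have hcontr : ContractingWith (L / l).toNNReal Ψ := by
    refine ⟨?_, LipschitzWith.of_dist_le_mul fun u v => ?_⟩
    · rw [← NNReal.coe_lt_coe, Real.coe_toNNReal _ (by positivity), NNReal.coe_one,
        div_lt_one hl0]
      linarith
    · rw [Real.coe_toNNReal _ (by positivity)]
      refine (BoundedContinuousFunction.dist_le (by positivity)).2 fun p => ?_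
      have h0 : 0 ≤ L / l * dist u v := by positivity
      show dist (-(Real.exp (-(l * p.1)) • duhamel (fun ρ _ => ρ) (F u) p.1 p.2))
        (-(Real.exp (-(l * p.1)) • duhamel (fun ρ _ => ρ) (F v) p.1 p.2)) ≤ _
      rw [dist_neg_neg, dist_eq_norm, ← smul_sub, norm_smul, Real.norm_eq_abs,
        abs_of_pos (Real.exp_pos _),
        ← duhamel_sub isDuhamelKernel_fst (hFc u) (hFb u) (hFc v) (hFb v)]
      rcases le_total p.1 0 with h | h
      · rw [duhamel_of_nonpos _ h, norm_zero, mul_zero]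
        exact h0
      · have h1 := norm_duhamel_fst_le_exp (Φ := fun r x => F u r x - F v r x)
          (C := L * dist u v) (l := l) hl0 h p.2 (by positivity) (fun r _ x => by
            refine (IsPotential.lipschitz_space hL _ _ x).trans ?_
            rw [add_sub_add_left_eq_sub, ← smul_sub, norm_smul, Real.norm_eq_abs,
              abs_of_pos (Real.exp_pos _), mul_assoc, mul_comm (Real.exp _)]
            gcongr
            rw [← dist_eq_norm]
            exact BoundedContinuousFunction.dist_coe_le_dist _)
        calc _ ≤ Real.exp (-(l * p.1)) * (L * dist u v / l * Real.exp (l * p.1)) := by gcongr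
          _ = L / l * dist u v * (Real.exp (-(l * p.1)) * Real.exp (l * p.1)) := by ring
          _ = _ := by rw [← Real.exp_add]; simp
  set u := ContractingWith.fixedPoint Ψ hcontr with hu
  have hfix : Ψ u = u := hcontr.fixedPoint_isFixedPt
  refine ⟨fun s t => W s t + Real.exp (l * s) • u (s, t), ?_, fun s t => ?_⟩
  · have := u.continuous
    fun_prop
  · have h1 : u (s, t) = -(Real.exp (-(l * s)) • duhamel (fun ρ _ => ρ) (F u) s t) := by
      conv_lhs => rw [← hfix]
      rfl
    have h2 : Real.exp (l * s) • u (s, t) = -duhamel (fun ρ _ => ρ) (F u) s t := by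
      rw [h1, smul_neg, smul_smul, ← Real.exp_add]
      simp
    simp only [h2]
    rw [← sub_eq_add_neg]

/-! ### Regularity of mild solutions -/

/-- The force along `Q`. -/
def forceOf (V : Config N → ℝ → ℝ) (Q : ℝ → ℝ → Config N) (s t : ℝ) : Config N :=
  gradV V (Q s t) t

/-- The velocity of the mild solution. -/
def velOf (V : Config N → ℝ → ℝ) (q : ℝ → Config N) (Q : ℝ → ℝ → Config N) (s t : ℝ) :
    Config N :=
  heat (√(2 * s)) (deriv q) t - duhamel (fun _ z => z) (forceOf V Q) s t

/-- The total `t`-derivative of the force along the mild solution. -/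
def forceDerivOf (V : Config N → ℝ → ℝ) (q : ℝ → Config N) (Q : ℝ → ℝ → Config N) (s t : ℝ) :
    Config N :=
  fderiv ℝ (fun p : Config N × ℝ => gradV V p.1 p.2) (Q s t, t) (velOf V q Q s t, 1)

/-- The acceleration of the mild solution. -/
def accOf (V : Config N → ℝ → ℝ) (q : ℝ → Config N) (Q : ℝ → ℝ → Config N) (s t : ℝ) :
    Config N :=
  heat (√(2 * s)) (deriv (deriv q)) t - duhamel (fun _ z => z) (forceDerivOf V q Q) s t

/-- `Φ`, stopped at time `T`. -/
def stopAt (T : ℝ) (Φ : ℝ → ℝ → Config N) (s t : ℝ) : Config N := Φ (min s T) t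

theorem stopAt_eq {T s : ℝ} (hs : s ≤ T) (Φ : ℝ → ℝ → Config N) (t : ℝ) :
    stopAt T Φ s t = Φ s t := by rw [stopAt, min_eq_left hs]

theorem duhamel_stopAt {T s : ℝ} (hs : s ≤ T) (κ : ℝ → ℝ → ℝ) (Φ : ℝ → ℝ → Config N) (t : ℝ) :
    duhamel κ (stopAt T Φ) s t = duhamel κ Φ s t :=
  duhamel_congr fun _ hr _ => stopAt_eq (hr.trans hs) _ _

theorem continuous_stopAt {T : ℝ} {Φ : ℝ → ℝ → Config N}
    (hΦ : Continuous fun p : ℝ × ℝ => Φ p.1 p.2) :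
    Continuous fun p : ℝ × ℝ => stopAt T Φ p.1 p.2 :=
  hΦ.comp (f := fun p : ℝ × ℝ => (min p.1 T, p.2)) (by fun_prop)

theorem UCUpTo.congr {T : ℝ} {Φ Ψ : ℝ → ℝ → Config N} (h : UCUpTo T Φ)
    (he : ∀ s ≤ T, ∀ t, Φ s t = Ψ s t) : UCUpTo T Ψ := by
  intro ε hε
  obtain ⟨δ, hδ, h⟩ := h ε hε
  refine ⟨δ, hδ, fun s s' t t' hs hs' h1 h2 => ?_⟩
  rw [← he s hs, ← he s' hs']
  exact h s s' t t' hs hs' h1 h2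

theorem UCUpTo.sub {T : ℝ} {Φ Ψ : ℝ → ℝ → Config N} (h : UCUpTo T Φ) (h' : UCUpTo T Ψ) :
    UCUpTo T fun s t => Φ s t - Ψ s t := by
  intro ε hε
  obtain ⟨δ, hδ, h⟩ := h (ε / 2) (by positivity)
  obtain ⟨δ', hδ', h'⟩ := h' (ε / 2) (by positivity)
  refine ⟨min δ δ', by positivity, fun s s' t t' hs hs' h1 h2 => ?_⟩
  have e1 := h s s' t t' hs hs' (h1.trans_le (min_le_left _ _)) (h2.trans_le (min_le_left _ _))
  have e2 := h' s s' t t' hs hs' (h1.trans_le (min_le_right _ _)) (h2.trans_le (min_le_right _ _))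
  rw [sub_sub_sub_comm]
  exact (norm_sub_le _ _).trans_lt (by linarith)

theorem UCUpTo.add {T : ℝ} {Φ Ψ : ℝ → ℝ → Config N} (h : UCUpTo T Φ) (h' : UCUpTo T Ψ) :
    UCUpTo T fun s t => Φ s t + Ψ s t := by
  have h2 : UCUpTo T fun s t => -Ψ s t := by
    intro ε hε
    obtain ⟨δ, hδ, h'⟩ := h' ε hε
    refine ⟨δ, hδ, fun s s' t t' hs hs' h1 h2 => ?_⟩
    rw [← neg_sub', norm_neg]
    exact h' s s' t t' hs hs' h1 h2
  simpa using h.sub h2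

theorem UCUpTo.stopAt {T : ℝ} {Φ : ℝ → ℝ → Config N} (h : UCUpTo T Φ) :
    UCUpTo T (stopAt T Φ) := h.congr fun _ hs t => (stopAt_eq hs Φ t).symm

theorem UCUpTo.uniformContinuous {T s : ℝ} {Φ : ℝ → ℝ → Config N} (h : UCUpTo T Φ)
    (hs : s ≤ T) : UniformContinuous (Φ s) := by
  rw [Metric.uniformContinuous_iff]
  intro ε hε
  obtain ⟨δ, hδ, h⟩ := h ε hε
  refine ⟨δ, hδ, fun {a b} hab => ?_⟩
  rw [dist_eq_norm]
  exact h s s a b hs hs (by simpa using hδ) (by simpa [Real.dist_eq] using hab)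

theorem UCUpTo.eventually_norm_sub_le {T s : ℝ} {Φ : ℝ → ℝ → Config N} (h : UCUpTo T Φ)
    (hs : s < T) {ε : ℝ} (hε : 0 < ε) : ∀ᶠ r in 𝓝 s, ∀ t, ‖Φ r t - Φ s t‖ ≤ ε := by
  obtain ⟨δ, hδ, h⟩ := h ε hε
  filter_upwards [gt_mem_nhds hs, Metric.ball_mem_nhds s hδ] with r hr hr' t
  exact (h r s t t hr.le hs.le (by simpa [Real.dist_eq] using hr') (by simpa using hδ)).le

theorem ucUpTo_heat {φ : ℝ → Config N} (hφ : Continuous φ) {A B : ℝ} (hB : 0 ≤ B)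
    (hAB : ∀ x, ‖φ x‖ ≤ A + B * |x|) (h : QuasiLipschitz φ) (T : ℝ) :
    UCUpTo T fun s t => heat (√(2 * s)) φ t := by
  intro ε hε
  obtain ⟨K, hK0, hK⟩ := h (ε / 2) (by positivity)
  have hlim : Tendsto (fun x : ℝ => K * (x + √(2 * x))) (𝓝 0) (𝓝 0) := by
    have : Continuous fun x : ℝ => K * (x + √(2 * x)) := by fun_prop
    simpa using this.tendsto 0
  obtain ⟨δ, hδ, hδ'⟩ := Metric.eventually_nhds_iff.1 (hlim.eventually (gt_mem_nhds (half_pos hε)))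
  have hd := hδ' (y := δ / 2) (by rw [Real.dist_eq, sub_zero, abs_of_pos (by positivity)]; linarith)
  refine ⟨δ / 2, by positivity, fun s s' t t' _ _ hs ht => ?_⟩
  refine (norm_heat_sub_le hφ hB hAB hK0 hK _ _ _ _).trans_lt ?_
  have hsq : |√(2 * s) - √(2 * s')| ≤ √(2 * (δ / 2)) := by
    have aux : ∀ a b : ℝ, b ≤ a → |a - b| < δ / 2 → |√(2 * a) - √(2 * b)| ≤ √(2 * (δ / 2)) := by
      intro a b hab h1
      have hle : √(2 * b) ≤ √(2 * a) := Real.sqrt_le_sqrt (by linarith)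
      rw [abs_of_nonneg (sub_nonneg.2 hle)]
      refine (abs_sqrt_sub_sqrt_le (by linarith)).trans (Real.sqrt_le_sqrt ?_)
      have := (le_abs_self _).trans h1.le
      linarith
    rcases le_total s' s with h | h
    · exact aux _ _ h hs
    · rw [abs_sub_comm]
      exact aux _ _ h (by rwa [abs_sub_comm])
  have : K * (|t - t'| + |√(2 * s) - √(2 * s')|) ≤ K * (δ / 2 + √(2 * (δ / 2))) := by gcongr
  linarith

theorem norm_heat_le {φ : ℝ → Config N} {C : ℝ} (hC : ∀ t, ‖φ t‖ ≤ C) (a t : ℝ) :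
    ‖heat a φ t‖ ≤ C := by
  refine (norm_integral_le_of_norm_le (integrable_const C)
    (Eventually.of_forall fun z => hC _)).trans_eq ?_
  simp

section

variable {V : Config N → ℝ → ℝ} (hV : IsPotential V) {q : ℝ → Config N} (hq : MemPhase q)
  {Q : ℝ → ℝ → Config N} (hQ : IsMild V q Q)

include hV hQ in
theorem IsMild.continuous_force : Continuous fun p : ℝ × ℝ => forceOf V Q p.1 p.2 :=
  hV.continuous_gradV.comp (f := fun p : ℝ × ℝ => (Q p.1 p.2, p.2))
    (hQ.continuous.prodMk continuous_snd)

theorem MemPhase.quasiLipschitz_deriv {q : ℝ → Config N} (hq : MemPhase q) :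
    QuasiLipschitz (deriv q) := by
  obtain ⟨C, -, -, hC⟩ := hq.exists_bound
  exact quasiLipschitz_of_holder hC

theorem MemPhase.exists_bound_deriv {q : ℝ → Config N} (hq : MemPhase q) :
    ∃ C : ℝ, 0 ≤ C ∧ (∀ x, ‖deriv q x‖ ≤ C) ∧ ∀ x, ‖deriv q x‖ ≤ C + 0 * |x| := by
  obtain ⟨C, h0, hC, -⟩ := hq.exists_bound
  exact ⟨C, h0, hC, by simpa using hC⟩

include hV hq hQ in
theorem IsMild.continuous_vel : Continuous fun p : ℝ × ℝ => velOf V q Q p.1 p.2 := by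
  obtain ⟨C, h0, -, hC⟩ := hq.exists_bound_deriv
  obtain ⟨M, -, hM⟩ := hV.exists_bound_gradV
  exact (continuous_heat_sqrt hq.continuous_deriv le_rfl hC hq.quasiLipschitz_deriv).sub
    (continuous_duhamel isDuhamelKernel_snd (hQ.continuous_force hV) fun s t => hM _ _)

include hV hq hQ in
theorem IsMild.hasDerivAt (s t : ℝ) : HasDerivAt (Q s) (velOf V q Q s t) t := by
  obtain ⟨C, hC0, hC, hC'⟩ := hq.exists_lipschitz
  obtain ⟨D, -, -, hD⟩ := hq.exists_bound_deriv
  obtain ⟨M, -, hM⟩ := hV.exists_bound_gradV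
  have h1 : HasDerivAt (heat (√(2 * s)) q) (heat (√(2 * s)) (deriv q) t) t := by
    refine hasDerivAt_of_forall_integral_eq ?_ (fun a b => ?_) t
    · exact (continuous_heat_sqrt hq.continuous_deriv le_rfl hD hq.quasiLipschitz_deriv).comp
        (Continuous.prodMk_right s)
    · exact ((hq.isPrim.heat (measurable_deriv_config q) hq.deriv_mem.norm_lt_top hC0 hC
        (√(2 * s))).integral_eq a b).symm
  have h2 := hasDerivAt_duhamel (hQ.continuous_force hV) (fun s t => hM _ _) s t
  have h3 : Q s = fun t => heat (√(2 * s)) q t - duhamel (fun ρ _ => ρ) (forceOf V Q) s t :=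
    funext fun t => hQ.eq s t
  rw [h3]
  exact h1.sub h2

include hV hq in
theorem exists_bound_vel (Q : ℝ → ℝ → Config N) (T : ℝ) :
    ∃ C : ℝ, 0 ≤ C ∧ ∀ s ≤ T, ∀ t, ‖velOf V q Q s t‖ ≤ C := by
  obtain ⟨D, hD0, hD, -⟩ := hq.exists_bound_deriv
  obtain ⟨M, hM0, hM⟩ := hV.exists_bound_gradV
  refine ⟨D + (√(2 * T) + 1) * M * √(2 * T), by positivity, fun s hs t => ?_⟩
  refine (norm_sub_le _ _).trans (add_le_add (norm_heat_le hD _ _) ?_)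
  refine (norm_duhamel_le isDuhamelKernel_snd t fun r _ x => hM _ _).trans ?_
  have : √(2 * s) ≤ √(2 * T) := Real.sqrt_le_sqrt (by linarith)
  gcongr

include hV hq hQ in
theorem IsMild.continuous_forceDeriv :
    Continuous fun p : ℝ × ℝ => forceDerivOf V q Q p.1 p.2 := by
  have h1 : Continuous fun p : ℝ × ℝ =>
      fderiv ℝ (fun p : Config N × ℝ => gradV V p.1 p.2) (Q p.1 p.2, p.2) :=
    hV.continuous_fderiv_gradV.comp (f := fun p : ℝ × ℝ => (Q p.1 p.2, p.2))
    (hQ.continuous.prodMk continuous_snd)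
  exact h1.clm_apply ((hQ.continuous_vel hV hq).prodMk continuous_const)

include hV hq hQ in
theorem IsMild.hasDerivAt_force (s t : ℝ) :
    HasDerivAt (forceOf V Q s) (forceDerivOf V q Q s t) t := by
  have h1 : HasFDerivAt (fun p : Config N × ℝ => gradV V p.1 p.2)
      (fderiv ℝ (fun p : Config N × ℝ => gradV V p.1 p.2) (Q s t, t)) (Q s t, t) :=
    ((hV.contDiff_gradV.differentiable (by norm_num)) _).hasFDerivAt
  exact h1.comp_hasDerivAt (f := fun t => (Q s t, t)) t
    ((hQ.hasDerivAt hV hq s t).prodMk (hasDerivAt_id t))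

include hV hq in
theorem exists_bound_forceDeriv (Q : ℝ → ℝ → Config N) (T : ℝ) :
    ∃ C : ℝ, 0 ≤ C ∧ ∀ s ≤ T, ∀ t, ‖forceDerivOf V q Q s t‖ ≤ C := by
  obtain ⟨C, hC0, hC⟩ := exists_bound_vel hV hq Q T
  obtain ⟨L, hL0, hL, -⟩ := hV.exists_lipschitz_gradV
  refine ⟨L * max C 1, by positivity, fun s hs t => ?_⟩
  refine (ContinuousLinearMap.le_opNorm _ _).trans ?_
  gcongr
  · exact hL _
  · rw [Prod.norm_def, norm_one]
    exact max_le_max (hC s hs t) le_rfl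

theorem exists_bound_stopAt {T : ℝ} {Φ : ℝ → ℝ → Config N}
    (h : ∃ C : ℝ, 0 ≤ C ∧ ∀ s ≤ T, ∀ t, ‖Φ s t‖ ≤ C) :
    ∃ C : ℝ, 0 ≤ C ∧ ∀ s t, ‖stopAt T Φ s t‖ ≤ C := by
  obtain ⟨C, h0, h⟩ := h
  exact ⟨C, h0, fun s t => h _ (min_le_right _ _) _⟩

include hV hq hQ in
theorem IsMild.duhamel_force_eq_integral {s : ℝ} (hs : 0 ≤ s) (t : ℝ) :
    duhamel (fun ρ _ => ρ) (forceOf V Q) s t =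
      ∫ r in (0 : ℝ)..s, (forceOf V Q r t + duhamel (fun _ z => z) (forceDerivOf V q Q) r t) := by
  obtain ⟨M, hM0, hM⟩ := hV.exists_bound_gradV
  obtain ⟨B, hB0, hB⟩ := exists_bound_stopAt (exists_bound_forceDeriv hV hq Q s)
  have h1 := duhamel_eq_integral (continuous_stopAt (T := s) (hQ.continuous_force hV))
    (fun s t => hM _ _) (continuous_stopAt (T := s) (hQ.continuous_forceDeriv hV hq)) hB
    (fun r t => hQ.hasDerivAt_force hV hq (min r s) t) hs t
  rw [duhamel_stopAt le_rfl] at h1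
  rw [h1]
  refine intervalIntegral.integral_congr_Ioo_of_le hs fun r hr => ?_
  rw [stopAt_eq hr.2.le, duhamel_stopAt hr.2.le]

include hV hq hQ in
theorem IsMild.continuous_duhamel_forceDeriv (T t : ℝ) :
    ContinuousOn (fun r => duhamel (fun _ z => z) (forceDerivOf V q Q) r t) (Iic T) := by
  obtain ⟨B, hB0, hB⟩ := exists_bound_stopAt (exists_bound_forceDeriv hV hq Q T)
  have := continuous_duhamel isDuhamelKernel_snd
    (continuous_stopAt (T := T) (hQ.continuous_forceDeriv hV hq)) hB
  refine (this.comp (Continuous.prodMk_left t)).continuousOn.congr fun r hr => ?_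
  exact (duhamel_stopAt hr _ _ _).symm

include hV hq hQ in
theorem IsMild.duhamel_force_sub {r s : ℝ} (hr : 0 ≤ r) (hs : 0 ≤ s) (t : ℝ) :
    duhamel (fun ρ _ => ρ) (forceOf V Q) s t - duhamel (fun ρ _ => ρ) (forceOf V Q) r t =
      ∫ x in r..s, (forceOf V Q x t + duhamel (fun _ z => z) (forceDerivOf V q Q) x t) := by
  rw [hQ.duhamel_force_eq_integral hV hq hr, hQ.duhamel_force_eq_integral hV hq hs]
  have hc : ∀ b, 0 ≤ b → IntervalIntegrable (fun x => forceOf V Q x t +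
      duhamel (fun _ z => z) (forceDerivOf V q Q) x t) volume 0 b := by
    intro b hb
    refine ContinuousOn.intervalIntegrable ?_
    refine (((hQ.continuous_force hV).comp (Continuous.prodMk_left t)).continuousOn.add
      (hQ.continuous_duhamel_forceDeriv hV hq b t)).mono fun x hx => ?_
    rw [uIcc_of_le hb] at hx
    exact hx.2
  exact intervalIntegral.integral_interval_sub_left (hc s hs) (hc r hr)

include hV hq hQ in
theorem IsMild.ucUpTo (T : ℝ) : UCUpTo T Q := by
  obtain ⟨C, hC0, hC, hC'⟩ := hq.exists_lipschitz
  have h1 : UCUpTo T fun s t => heat (√(2 * s)) q t :=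
    ucUpTo_heat hq.contDiff.continuous hC0 hC
      (fun ε hε => ⟨C, hC0, fun x y => (hC' x y).trans (by linarith)⟩) T
  obtain ⟨M, hM0, hM⟩ := hV.exists_bound_gradV
  obtain ⟨B, hB0, hB⟩ := exists_bound_forceDeriv hV hq Q T
  set K : ℝ := M + (√(2 * T) + 1) * B * √(2 * T) with hK
  have hK0 : 0 ≤ K := by positivity
  have htime : ∀ s s' t, 0 ≤ s → 0 ≤ s' → s ≤ T → s' ≤ T →
      ‖duhamel (fun ρ _ => ρ) (forceOf V Q) s t - duhamel (fun ρ _ => ρ) (forceOf V Q) s' t‖ ≤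
        K * |s - s'| := by
    intro s s' t h0 h0' hs hs'
    rw [hQ.duhamel_force_sub hV hq h0' h0]
    refine intervalIntegral.norm_integral_le_of_norm_le_const fun x hx => ?_
    have hxT : x ≤ T := by
      have := uIoc_subset_uIcc hx
      rcases le_total s' s with h | h
      · rw [uIcc_of_le h] at this; exact this.2.trans hs
      · rw [uIcc_of_ge h] at this; exact this.2.trans hs'
    refine (norm_add_le _ _).trans (add_le_add (hM _ _) ?_)
    refine (norm_duhamel_le isDuhamelKernel_snd t fun r hr y => hB r (hr.trans hxT) y).trans ?_
    have : √(2 * x) ≤ √(2 * T) := Real.sqrt_le_sqrt (by linarith)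
    gcongr
  have htime' : ∀ s s' t, s ≤ T → s' ≤ T →
      ‖duhamel (fun ρ _ => ρ) (forceOf V Q) s t - duhamel (fun ρ _ => ρ) (forceOf V Q) s' t‖ ≤
        K * |s - s'| := by
    have aux : ∀ s s' t, 0 ≤ s → s' ≤ 0 → s ≤ T →
      ‖duhamel (fun ρ _ => ρ) (forceOf V Q) s t - duhamel (fun ρ _ => ρ) (forceOf V Q) s' t‖ ≤
        K * |s - s'| := by
      intro s s' t h h' hs
      have := htime s 0 t h le_rfl hs (h.trans hs)
      rw [duhamel_of_nonpos _ le_rfl] at this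
      rw [duhamel_of_nonpos _ h']
      refine this.trans ?_
      gcongr
    intro s s' t hs hs'
    rcases le_total 0 s with h | h <;> rcases le_total 0 s' with h' | h'
    · exact htime s s' t h h' hs hs'
    · exact aux s s' t h h' hs
    · rw [norm_sub_rev, abs_sub_comm]
      exact aux s' s t h' h hs'
    · rw [duhamel_of_nonpos _ h, duhamel_of_nonpos _ h', sub_self, norm_zero]
      positivity
  have hspace : ∀ s t t', ‖duhamel (fun ρ _ => ρ) (forceOf V Q) s t -
      duhamel (fun ρ _ => ρ) (forceOf V Q) s t'‖ ≤
        (√(2 * s) + 1) * M * √(2 * s) * |t - t'| := by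
    intro s t t'
    have := convex_univ.norm_image_sub_le_of_norm_hasDerivWithin_le
      (fun x _ => (hasDerivAt_duhamel (hQ.continuous_force hV) (fun s t => hM _ _) s x).hasDerivWithinAt)
      (fun x _ => norm_duhamel_le isDuhamelKernel_snd x fun r _ y => hM _ _)
      (mem_univ t') (mem_univ t)
    exact this
  have h2 : UCUpTo T (duhamel (fun ρ _ => ρ) (forceOf V Q)) := by
    intro ε hε
    set K' : ℝ := (√(2 * T) + 1) * M * √(2 * T) with hK'
    have hK'0 : 0 ≤ K' := by positivity
    refine ⟨ε / (K + K' + 1), by positivity, fun s s' t t' hs hs' h1 h2 => ?_⟩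
    have e1 := htime' s s' t hs hs'
    have e2 : ‖duhamel (fun ρ _ => ρ) (forceOf V Q) s' t -
      duhamel (fun ρ _ => ρ) (forceOf V Q) s' t'‖ ≤ K' * |t - t'| := by
      refine (hspace s' t t').trans ?_
      have : √(2 * s') ≤ √(2 * T) := Real.sqrt_le_sqrt (by linarith)
      rw [hK']
      gcongr
    have e3 := norm_sub_le_norm_sub_add_norm_sub (duhamel (fun ρ _ => ρ) (forceOf V Q) s t)
      (duhamel (fun ρ _ => ρ) (forceOf V Q) s' t) (duhamel (fun ρ _ => ρ) (forceOf V Q) s' t')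
    have e4 : K * |s - s'| ≤ K * (ε / (K + K' + 1)) := by gcongr
    have e5 : K' * |t - t'| ≤ K' * (ε / (K + K' + 1)) := by gcongr
    have e6 : (K + K' + 1) * (ε / (K + K' + 1)) = ε := by field_simp
    have e7 : 0 < ε / (K + K' + 1) := by positivity
    nlinarith
  exact (h1.sub h2).congr fun s _ t => (hQ.eq s t).symm

include hV hq hQ in
theorem IsMild.ucUpTo_force (T : ℝ) : UCUpTo T (forceOf V Q) := by
  have hu := hV.gradV_biperiodic.uniformContinuous hV.continuous_gradV
  rw [Metric.uniformContinuous_iff] at hu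
  intro ε hε
  obtain ⟨δ, hδ, h⟩ := hu ε hε
  obtain ⟨η, hη, h'⟩ := hQ.ucUpTo hV hq T δ hδ
  refine ⟨min δ η, by positivity, fun s s' t t' hs hs' h1 h2 => ?_⟩
  rw [← dist_eq_norm]
  refine h (a := (Q s t, t)) (b := (Q s' t', t')) ?_
  rw [Prod.dist_eq, max_lt_iff, dist_eq_norm, Real.dist_eq]
  exact ⟨h' s s' t t' hs hs' (h1.trans_le (min_le_right _ _)) (h2.trans_le (min_le_right _ _)),
    h2.trans_le (min_le_left _ _)⟩

include hV hq hQ in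
theorem IsMild.ucUpTo_vel (T : ℝ) : UCUpTo T (velOf V q Q) := by
  obtain ⟨D, -, -, hD⟩ := hq.exists_bound_deriv
  obtain ⟨M, hM0, hM⟩ := hV.exists_bound_gradV
  exact (ucUpTo_heat hq.continuous_deriv le_rfl hD hq.quasiLipschitz_deriv T).sub
    ((hQ.ucUpTo_force hV hq T).duhamel isDuhamelKernel_snd (hQ.continuous_force hV)
      fun s t => hM _ _)

include hV hq hQ in
theorem IsMild.ucUpTo_forceDeriv (T : ℝ) : UCUpTo T (forceDerivOf V q Q) := by
  have hu := hV.fderiv_gradV_biperiodic.uniformContinuous hV.continuous_fderiv_gradV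
  rw [Metric.uniformContinuous_iff] at hu
  obtain ⟨C, hC0, hC⟩ := exists_bound_vel hV hq Q T
  obtain ⟨L, hL0, hL, -⟩ := hV.exists_lipschitz_gradV
  intro ε hε
  obtain ⟨δ, hδ, h⟩ := hu (ε / (2 * (max C 1))) (by positivity)
  obtain ⟨η, hη, h'⟩ := hQ.ucUpTo hV hq T δ hδ
  obtain ⟨θ, hθ, h''⟩ := hQ.ucUpTo_vel hV hq T (ε / (2 * (L + 1))) (by positivity)
  refine ⟨min δ (min η θ), by positivity, fun s s' t t' hs hs' h1 h2 => ?_⟩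
  simp only [lt_min_iff] at h1 h2
  have e1 := h (a := (Q s t, t)) (b := (Q s' t', t')) (by
    rw [Prod.dist_eq, max_lt_iff, dist_eq_norm, Real.dist_eq]
    exact ⟨h' s s' t t' hs hs' h1.2.1 h2.2.1, h2.1⟩)
  have e2 := h'' s s' t t' hs hs' h1.2.2 h2.2.2
  rw [dist_eq_norm] at e1
  have e3 : forceDerivOf V q Q s t - forceDerivOf V q Q s' t' =
      (fderiv ℝ (fun p : Config N × ℝ => gradV V p.1 p.2) (Q s t, t) -
        fderiv ℝ (fun p : Config N × ℝ => gradV V p.1 p.2) (Q s' t', t')) (velOf V q Q s t, 1) +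
      fderiv ℝ (fun p : Config N × ℝ => gradV V p.1 p.2) (Q s' t', t')
        (velOf V q Q s t - velOf V q Q s' t', 0) := by
    have : ((velOf V q Q s t - velOf V q Q s' t', 0) : Config N × ℝ) =
      (velOf V q Q s t, 1) - (velOf V q Q s' t', 1) := by simp
    rw [this, map_sub, _root_.sub_apply, forceDerivOf, forceDerivOf]
    abel
  rw [e3]
  refine (norm_add_le _ _).trans_lt ?_
  have e4 := (ContinuousLinearMap.le_opNorm
    (fderiv ℝ (fun p : Config N × ℝ => gradV V p.1 p.2) (Q s t, t) -
        fderiv ℝ (fun p : Config N × ℝ => gradV V p.1 p.2) (Q s' t', t')) (velOf V q Q s t, 1))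
  have e5 := (ContinuousLinearMap.le_opNorm
    (fderiv ℝ (fun p : Config N × ℝ => gradV V p.1 p.2) (Q s' t', t'))
        (velOf V q Q s t - velOf V q Q s' t', 0))
  have e6 : ‖((velOf V q Q s t, 1) : Config N × ℝ)‖ ≤ max C 1 := by
    rw [Prod.norm_def, norm_one]
    exact max_le_max (hC s hs t) le_rfl
  have e7 : ‖((velOf V q Q s t - velOf V q Q s' t', 0) : Config N × ℝ)‖ ≤
      ε / (2 * (L + 1)) := by
    rw [Prod.norm_def, norm_zero]
    exact max_le e2.le (by positivity)
  have e8 := hL (Q s' t', t')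
  have e9 : ε / (2 * (max C 1)) * max C 1 = ε / 2 := by field_simp
  have e10 : L * (ε / (2 * (L + 1))) = ε / 2 * (L / (L + 1)) := by field_simp
  have e11 : L / (L + 1) < 1 := by rw [div_lt_one (by positivity)]; linarith
  have e12 : ‖(fderiv ℝ (fun p : Config N × ℝ => gradV V p.1 p.2) (Q s t, t) -
        fderiv ℝ (fun p : Config N × ℝ => gradV V p.1 p.2) (Q s' t', t')) (velOf V q Q s t, 1)‖
      ≤ ε / 2 := by
    rw [← e9]
    exact e4.trans (by gcongr)
  have e13 : ‖fderiv ℝ (fun p : Config N × ℝ => gradV V p.1 p.2) (Q s' t', t')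
        (velOf V q Q s t - velOf V q Q s' t', 0)‖ ≤ ε / 2 * (L / (L + 1)) := by
    rw [← e10]
    exact e5.trans (by gcongr)
  nlinarith

end

end

end GradientShadowing

namespace GradientShadowing

noncomputable section

variable {N : ℕ}

/-! ### Existence of solutions -/

theorem tendsto_l2ulNorm_zero {ι : Type*} {l : Filter ι} {f : ι → ℝ → Config N}
    (h : ∀ ε > 0, ∀ᶠ i in l, ∀ t, ‖f i t‖ ≤ ε) :
    Tendsto (fun i => l2ulNorm (f i)) l (𝓝 0) := by
  rw [ENNReal.tendsto_nhds_zero]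
  intro ε hε
  obtain ⟨δ, hδ0, hδ⟩ := ENNReal.lt_iff_exists_nnreal_btwn.1 hε
  have hδ0' : 0 < (δ : ℝ) := by exact_mod_cast hδ0
  filter_upwards [h (δ / 2) (by positivity)] with i hi
  refine (l2ulNorm_le_of_bound (Eventually.of_forall hi)).trans ?_
  refine le_trans (le_of_eq ?_) hδ.le
  rw [show (2 : ℝ≥0∞) = ENNReal.ofReal 2 by simp, ← ENNReal.ofReal_mul (by norm_num),
    mul_div_cancel₀ _ (by norm_num), ENNReal.ofReal_coe_nnreal]

theorem UCUpTo.tendsto_l2ulNorm {T s : ℝ} {Φ : ℝ → ℝ → Config N} (h : UCUpTo T Φ) (hs : s < T) :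
    Tendsto (fun r => l2ulNorm fun t => Φ r t - Φ s t) (𝓝 s) (𝓝 0) :=
  tendsto_l2ulNorm_zero fun _ hε => h.eventually_norm_sub_le hs hε

theorem tendsto_h2ulNorm_zero {ι : Type*} {l : Filter ι} {f : ι → ℝ → Config N}
    (h0 : Tendsto (fun i => l2ulNorm (f i)) l (𝓝 0))
    (h1 : Tendsto (fun i => l2ulNorm (deriv (f i))) l (𝓝 0))
    (h2 : Tendsto (fun i => l2ulNorm (deriv (deriv (f i)))) l (𝓝 0)) :
    Tendsto (fun i => h2ulNorm (f i)) l (𝓝 0) := by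
  have e := (((ENNReal.Tendsto.pow (n := 2) h0).add (ENNReal.Tendsto.pow (n := 2) h1)).add
    (ENNReal.Tendsto.pow (n := 2) h2))
  have e' := (ENNReal.continuous_rpow_const (y := 1 / 2)).tendsto _ |>.comp e
  simp only [ne_eq, OfNat.ofNat_ne_zero, not_false_eq_true, zero_pow, add_zero] at e'
  rw [ENNReal.zero_rpow_of_pos (by norm_num)] at e'
  exact e'

/-- The mean of `z • φ (t + a z)`. -/
def heatMoment (a : ℝ) (φ : ℝ → Config N) (t : ℝ) : Config N := ∫ z, z • φ (t + a * z) ∂stdGauss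

theorem integrable_heatMoment {φ : ℝ → Config N} (hφ : Continuous φ) {C : ℝ}
    (hC : ∀ t, ‖φ t‖ ≤ C) (a t : ℝ) : Integrable (fun z => z • φ (t + a * z)) stdGauss := by
  refine (integrable_abs_stdGauss.mul_const C).mono' (by fun_prop)
    (Eventually.of_forall fun z => ?_)
  rw [norm_smul, Real.norm_eq_abs]
  gcongr
  exact hC _

theorem norm_heatMoment_le {φ : ℝ → Config N} {C : ℝ}
    (hC : ∀ t, ‖φ t‖ ≤ C) (a t : ℝ) : ‖heatMoment a φ t‖ ≤ C := by
  have hC0 : 0 ≤ C := (norm_nonneg _).trans (hC 0)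
  refine (norm_integral_le_of_norm_le (integrable_abs_stdGauss.mul_const C)
    (Eventually.of_forall fun z => ?_)).trans ?_
  · rw [norm_smul, Real.norm_eq_abs]
    gcongr
    exact hC _
  · rw [integral_mul_const]
    have := integral_abs_stdGauss_le
    nlinarith

theorem norm_heatMoment_sub_le {φ : ℝ → Config N} (hφ : Continuous φ) {C : ℝ}
    (hC : ∀ t, ‖φ t‖ ≤ C) {ε K : ℝ} (hε : 0 ≤ ε) (hK : 0 ≤ K)
    (h : ∀ x y, ‖φ x - φ y‖ ≤ ε + K * |x - y|) (a b t u : ℝ) :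
    ‖heatMoment a φ t - heatMoment b φ u‖ ≤ ε + K * (|t - u| + |a - b|) := by
  have h1 : Integrable (fun z : ℝ => |z| * (ε + K * |t - u|)) stdGauss :=
    integrable_abs_stdGauss.mul_const _
  have h2 : Integrable (fun z : ℝ => z ^ 2 * (K * |a - b|)) stdGauss :=
    integrable_sq_stdGauss.mul_const _
  rw [heatMoment, heatMoment, ← integral_sub (integrable_heatMoment hφ hC a t)
    (integrable_heatMoment hφ hC b u)]
  have h12 : Integrable (fun z : ℝ => |z| * (ε + K * |t - u|) + z ^ 2 * (K * |a - b|))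
    stdGauss := h1.add h2
  refine (norm_integral_le_of_norm_le h12 (Eventually.of_forall fun z => ?_)).trans ?_
  · rw [← smul_sub, norm_smul, Real.norm_eq_abs]
    have e1 := h (t + a * z) (u + b * z)
    have e2 : |t + a * z - (u + b * z)| ≤ |t - u| + |a - b| * |z| := by
      rw [← abs_mul]
      refine le_trans (le_of_eq ?_) (abs_add_le _ _)
      congr 1; ring
    have e3 : ‖φ (t + a * z) - φ (u + b * z)‖ ≤ ε + K * (|t - u| + |a - b| * |z|) :=
      e1.trans (by gcongr)
    refine (mul_le_mul_of_nonneg_left e3 (abs_nonneg z)).trans (le_of_eq ?_)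
    rw [← sq_abs z]; ring
  · rw [integral_add h1 h2, integral_mul_const, integral_mul_const, integral_sq_stdGauss]
    have := integral_abs_stdGauss_le
    have h3 : 0 ≤ ε + K * |t - u| := by positivity
    nlinarith

theorem continuous_heatMoment {φ : ℝ → Config N} (hφ : Continuous φ) {C : ℝ}
    (hC : ∀ t, ‖φ t‖ ≤ C) (h : QuasiLipschitz φ) :
    Continuous fun p : ℝ × ℝ => heatMoment p.1 φ p.2 := by
  rw [Metric.continuous_iff]
  intro p ε hε
  obtain ⟨K, hK, h⟩ := h (ε / 2) (by positivity)
  refine ⟨ε / (4 * (K + 1)), by positivity, fun x hx => ?_⟩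
  rw [dist_eq_norm]
  refine (norm_heatMoment_sub_le hφ hC (by positivity) hK h _ _ _ _).trans_lt ?_
  rw [Prod.dist_eq, max_lt_iff, Real.dist_eq, Real.dist_eq] at hx
  have e1 : (K + 1) * (ε / (4 * (K + 1))) = ε / 4 := by field_simp
  have e2 : 0 < ε / (4 * (K + 1)) := by positivity
  nlinarith [hx.1, hx.2]

theorem hasDerivAt_heat_of_pos {φ : ℝ → Config N} (hφ : Continuous φ) {C : ℝ}
    (hC : ∀ t, ‖φ t‖ ≤ C) (h : QuasiLipschitz φ) {a : ℝ} (ha : 0 < a) (t : ℝ) :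
    HasDerivAt (heat a φ) (a⁻¹ • heatMoment a φ t) t := by
  have hc : Continuous (heatMoment a φ) :=
    (continuous_heatMoment hφ hC h).comp (Continuous.prodMk_right a)
  have hc' : Continuous fun t => a⁻¹ • heatMoment a φ t := by fun_prop
  refine hasDerivAt_of_forall_integral_eq hc' (fun x y => ?_) t
  rw [intervalIntegral.integral_smul]
  simp only [heatMoment, heat]
  rw [intervalIntegral_integral_smul_stdGauss hφ hC x y a, integral_smul, integral_smul,
    ← smul_sub, smul_smul, inv_mul_cancel₀ ha.ne', one_smul]

section

variable {V : Config N → ℝ → ℝ} (hV : IsPotential V) {q : ℝ → Config N} (hq : MemPhase q)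
  {Q : ℝ → ℝ → Config N} (hQ : IsMild V q Q)

include hV hq hQ in
theorem IsMild.ucUpTo_duhamel_forceDeriv (T : ℝ) :
    UCUpTo T (duhamel (fun _ z => z) (forceDerivOf V q Q)) := by
  obtain ⟨B, hB0, hB⟩ := exists_bound_stopAt (exists_bound_forceDeriv hV hq Q T)
  exact ((hQ.ucUpTo_forceDeriv hV hq T).stopAt.duhamel isDuhamelKernel_snd
    (continuous_stopAt (hQ.continuous_forceDeriv hV hq)) hB).congr
    fun s hs t => duhamel_stopAt hs _ _ _

include hV hq in
theorem exists_bound_duhamel_forceDeriv (Q : ℝ → ℝ → Config N) (s : ℝ) :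
    ∃ C : ℝ, ∀ t, ‖duhamel (fun _ z => z) (forceDerivOf V q Q) s t‖ ≤ C := by
  obtain ⟨B, hB0, hB⟩ := exists_bound_forceDeriv hV hq Q s
  exact ⟨_, fun t => norm_duhamel_le isDuhamelKernel_snd t hB⟩

include hV hq hQ in
theorem IsMild.hasDerivAt_duhamel_force (s t : ℝ) :
    HasDerivAt (duhamel (fun _ z => z) (forceOf V Q) s)
      (duhamel (fun _ z => z) (forceDerivOf V q Q) s t) t := by
  obtain ⟨B, hB0, hB⟩ := exists_bound_stopAt (exists_bound_forceDeriv hV hq Q s)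
  have h1 : duhamel (fun _ z => z) (forceOf V Q) s =
      duhamel (fun ρ _ => ρ) (stopAt s (forceDerivOf V q Q)) s := by
    ext1 t
    rw [← duhamel_stopAt le_rfl]
    exact duhamel_snd_eq (continuous_stopAt (hQ.continuous_forceDeriv hV hq)) hB
      (fun r t => hQ.hasDerivAt_force hV hq (min r s) t) s t
  rw [h1, ← duhamel_stopAt le_rfl]
  exact hasDerivAt_duhamel (continuous_stopAt (hQ.continuous_forceDeriv hV hq)) hB s t

include hV hq hQ in
theorem IsMild.isPrim_vel (s : ℝ) : IsPrim (velOf V q Q s) (accOf V q Q s) := by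
  obtain ⟨D, -, -, hD⟩ := hq.exists_bound_deriv
  refine (hq.isPrim_deriv.heat (measurable_deriv_config _) hq.deriv_deriv_mem.norm_lt_top
    le_rfl hD (√(2 * s))).sub ?_
  exact isPrim_of_hasDerivAt (fun t => hQ.hasDerivAt_duhamel_force hV hq s t)
    ((hQ.ucUpTo_duhamel_forceDeriv hV hq s).uniformContinuous le_rfl).continuous

include hV hq hQ in
theorem IsMild.deriv_eq (s : ℝ) : deriv (Q s) = velOf V q Q s :=
  funext fun t => (hQ.hasDerivAt hV hq s t).deriv

include hV hq hQ in
theorem IsMild.memL2ul_acc (s : ℝ) : MemL2ul (accOf V q Q s) := by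
  obtain ⟨C, hC⟩ := exists_bound_duhamel_forceDeriv hV hq Q s
  exact (hq.deriv_deriv_mem.heat (measurable_deriv_config _) _).sub
    (.of_uniformContinuous ((hQ.ucUpTo_duhamel_forceDeriv hV hq s).uniformContinuous le_rfl) hC)

include hV hq hQ in
theorem IsMild.memPhase (s : ℝ) : MemPhase (Q s) where
  contDiff := by
    rw [contDiff_one_iff_deriv, hQ.deriv_eq hV hq]
    exact ⟨fun t => (hQ.hasDerivAt hV hq s t).differentiableAt,
      (hQ.isPrim_vel hV hq s).continuous⟩
  integral_deriv := by
    rw [hQ.deriv_eq hV hq]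
    exact (hQ.isPrim_vel hV hq s).deriv_right.integral_eq
  deriv_mem := by
    obtain ⟨C, -, hC⟩ := exists_bound_vel hV hq Q s
    rw [hQ.deriv_eq hV hq]
    exact .of_uniformContinuous ((hQ.ucUpTo_vel hV hq s).uniformContinuous le_rfl) (hC s le_rfl)
  deriv_deriv_mem := by
    rw [hQ.deriv_eq hV hq]
    exact (hQ.memL2ul_acc hV hq s).congr (hQ.isPrim_vel hV hq s).deriv_ae_eq.symm

include hQ in
theorem IsMild.init : Q 0 = q := by
  ext1 t
  rw [hQ.eq, duhamel_of_nonpos _ le_rfl]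
  simp

include hV hq hQ in
theorem IsMild.exists_bound_sub (s : ℝ) : ∃ C, ∀ t, ‖Q s t - q t‖ ≤ C := by
  obtain ⟨C, hC0, hC, hC'⟩ := hq.exists_lipschitz
  obtain ⟨M, hM0, hM⟩ := hV.exists_bound_gradV
  refine ⟨0 + C * (|0| + |√(2 * s) - 0|) + (√(2 * s) + 1) * M * √(2 * s), fun t => ?_⟩
  have h1 := norm_heat_sub_le hq.contDiff.continuous hC0 hC hC0
    (ε := 0) (K := C) (by simpa using hC') (√(2 * s)) 0 t t
  rw [heat_zero, sub_self] at h1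
  have h2 : ‖duhamel (fun ρ _ => ρ) (forceOf V Q) s t‖ ≤ _ :=
    norm_duhamel_le isDuhamelKernel_fst (C := M) t fun r _ x => hM _ _
  have h3 : Q s t - q t = (heat (√(2 * s)) q t - q t) -
      duhamel (fun ρ _ => ρ) (forceOf V Q) s t := by
    rw [hQ.eq]
    change _ - duhamel (fun ρ _ => ρ) (forceOf V Q) s t - _ = _
    abel
  rw [h3]
  exact (norm_sub_le _ _).trans (add_le_add h1 h2)

include hV hq hQ in
theorem IsMild.deriv_sub (r s : ℝ) :
    deriv (fun t => Q r t - Q s t) = fun t => velOf V q Q r t - velOf V q Q s t :=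
  funext fun t => ((hQ.hasDerivAt hV hq r t).sub (hQ.hasDerivAt hV hq s t)).deriv

include hV hq hQ in
theorem IsMild.deriv_deriv_sub (r s : ℝ) :
    deriv (deriv (fun t => Q r t - Q s t)) =ᵐ[volume]
      fun t => accOf V q Q r t - accOf V q Q s t := by
  rw [hQ.deriv_sub hV hq]
  exact ((hQ.isPrim_vel hV hq r).sub (hQ.isPrim_vel hV hq s)).deriv_ae_eq

include hV hq hQ in
theorem IsMild.memL2ul_sub {s : ℝ} (hs : 0 ≤ s) : MemL2ul (fun t => Q s t - q t) ∧
    MemL2ul (deriv fun t => Q s t - q t) ∧ MemL2ul (deriv (deriv fun t => Q s t - q t)) := by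
  obtain ⟨C, hC⟩ := hQ.exists_bound_sub hV hq s
  have hphase := hQ.memPhase hV hq
  refine ⟨.of_uniformContinuous ?_ hC, ?_, ?_⟩
  · have h := hQ.ucUpTo hV hq s
    have h0 := h.uniformContinuous hs
    rw [hQ.init] at h0
    exact (h.uniformContinuous le_rfl).sub h0
  · have h := hQ.deriv_sub hV hq s 0
    rw [hQ.init] at h
    rw [h]
    refine MemL2ul.sub ?_ ?_
    · rw [← hQ.deriv_eq hV hq]; exact (hphase s).deriv_mem
    · rw [← hQ.deriv_eq hV hq]; exact (hphase 0).deriv_mem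
  · have h := hQ.deriv_deriv_sub hV hq s 0
    rw [hQ.init] at h
    exact ((hQ.memL2ul_acc hV hq s).sub (hQ.memL2ul_acc hV hq 0)).congr h.symm

include hV hq hQ in
theorem IsMild.tendsto_h2ulNorm (s : ℝ) :
    Tendsto (fun r => h2ulNorm fun t => Q r t - Q s t) (𝓝 s) (𝓝 0) := by
  refine tendsto_h2ulNorm_zero ((hQ.ucUpTo hV hq (s + 1)).tendsto_l2ulNorm (lt_add_one s)) ?_ ?_
  · simp only [hQ.deriv_sub hV hq]
    exact (hQ.ucUpTo_vel hV hq (s + 1)).tendsto_l2ulNorm (lt_add_one s)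
  · have h1 : Tendsto (fun r => l2ulNorm fun t =>
        heat (√(2 * r)) (deriv (deriv q)) t - heat (√(2 * s)) (deriv (deriv q)) t)
        (𝓝 s) (𝓝 0) :=
      (hq.deriv_deriv_mem.tendsto_heat (measurable_deriv_config _) (√(2 * s))).comp
        ((by fun_prop : Continuous fun r : ℝ => √(2 * r)).tendsto s)
    have h2 := (hQ.ucUpTo_duhamel_forceDeriv hV hq (s + 1)).tendsto_l2ulNorm (lt_add_one s)
    have h3 := h1.add h2
    rw [add_zero] at h3
    refine tendsto_of_tendsto_of_tendsto_of_le_of_le tendsto_const_nhds h3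
      (fun _ => zero_le) fun r => ?_
    have hm := fun r => (stronglyMeasurable_heat (measurable_deriv_config (deriv q))
      (√(2 * r))).aestronglyMeasurable (μ := volume)
    have hm' := fun r => ((hQ.ucUpTo_duhamel_forceDeriv hV hq r).uniformContinuous
      le_rfl).continuous.aestronglyMeasurable (μ := volume)
    refine le_trans (le_of_eq ?_) (l2ulNorm_sub_le ((hm r).sub (hm s)) ((hm' r).sub (hm' s)))
    rw [l2ulNorm_congr (hQ.deriv_deriv_sub hV hq r s)]
    congr 1
    ext1 t
    simp only [accOf]
    abel

include hV hq hQ in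
theorem IsMild.deriv_deriv_eq {s : ℝ} (hs : 0 < s) (t : ℝ) : deriv (deriv (Q s)) t =
    (√(2 * s))⁻¹ • heatMoment (√(2 * s)) (deriv q) t -
      duhamel (fun _ z => z) (forceDerivOf V q Q) s t := by
  obtain ⟨D, -, hD, -⟩ := hq.exists_bound_deriv
  rw [hQ.deriv_eq hV hq]
  exact ((hasDerivAt_heat_of_pos hq.continuous_deriv hD hq.quasiLipschitz_deriv
    (Real.sqrt_pos.2 (by positivity)) t).sub (hQ.hasDerivAt_duhamel_force hV hq s t)).deriv

include hq in
/-- The time derivative of the heat flow, uniformly in space. -/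
theorem MemPhase.eventually_heat {s : ℝ} (hs : 0 < s) {ε : ℝ} (hε : 0 < ε) :
    ∀ᶠ h in 𝓝[≠] (0 : ℝ), ∀ t, ‖h⁻¹ • (heat (√(2 * (s + h))) q t - heat (√(2 * s)) q t) -
      (√(2 * s))⁻¹ • heatMoment (√(2 * s)) (deriv q) t‖ ≤ ε := by
  obtain ⟨D, hD0, hD, -⟩ := hq.exists_bound_deriv
  set a := √(2 * s) with ha
  have ha0 : 0 < a := Real.sqrt_pos.2 (by positivity)
  have hsl : HasDerivAt (fun h : ℝ => √(2 * (s + h))) a⁻¹ 0 := by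
    have h1 : HasDerivAt (fun h : ℝ => 2 * (s + h)) (2 * 1) 0 :=
      ((hasDerivAt_id (0 : ℝ)).const_add s).const_mul 2
    have := h1.sqrt (by simpa using hs.ne')
    convert this using 1
    rw [add_zero, ← ha]
    field_simp
  have hT := hasDerivAt_iff_tendsto_slope.1 hsl
  set η := ε / (2 * (a⁻¹ + 1)) with hη
  have hη0 : 0 < η := by positivity
  obtain ⟨K, hK0, hK⟩ := hq.quasiLipschitz_deriv (η / 2) (by positivity)
  have e1 : ∀ᶠ h in 𝓝[≠] (0 : ℝ), |slope (fun h : ℝ => √(2 * (s + h))) 0 h - a⁻¹| <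
      min 1 (ε / (2 * (D + 1))) := by
    have := (Metric.tendsto_nhds.1 hT) (min 1 (ε / (2 * (D + 1)))) (by positivity)
    simpa only [Real.dist_eq] using this
  have e2 : ∀ᶠ h in 𝓝[≠] (0 : ℝ), |√(2 * (s + h)) - a| < η / (2 * (K + 1)) := by
    have h1 : Tendsto (fun h : ℝ => √(2 * (s + h))) (𝓝[≠] 0) (𝓝 a) := by
      have := hsl.continuousAt.tendsto
      simp only [add_zero, ← ha] at this
      exact this.mono_left nhdsWithin_le_nhds
    have := (Metric.tendsto_nhds.1 h1) (η / (2 * (K + 1))) (by positivity)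
    simpa only [Real.dist_eq] using this
  filter_upwards [e1, e2, self_mem_nhdsWithin] with h h1 h2 h0 t
  have h0 : h ≠ 0 := h0
  set b := √(2 * (s + h)) with hb
  have hcm : Continuous fun ρ => heatMoment ρ (deriv q) t :=
    (continuous_heatMoment hq.continuous_deriv hD hq.quasiLipschitz_deriv).comp
      (Continuous.prodMk_left t)
  have h3 : heat b q t - heat a q t = ∫ ρ in a..b, heatMoment ρ (deriv q) t :=
    integral_stdGauss_sub (fun t => (hq.differentiable t).hasDerivAt) hq.continuous_deriv hD t a b
  have h4 : heat b q t - heat a q t - (b - a) • heatMoment a (deriv q) t =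
      ∫ ρ in a..b, (heatMoment ρ (deriv q) t - heatMoment a (deriv q) t) := by
    rw [h3, intervalIntegral.integral_sub (hcm.intervalIntegrable a b)
      (continuous_const.intervalIntegrable a b), intervalIntegral.integral_const]
  have h5 : ‖heat b q t - heat a q t - (b - a) • heatMoment a (deriv q) t‖ ≤ η * |b - a| := by
    rw [h4]
    refine intervalIntegral.norm_integral_le_of_norm_le_const fun ρ hρ => ?_
    refine (norm_heatMoment_sub_le hq.continuous_deriv hD (by positivity) hK0 hK _ _ _ _).trans ?_
    have : |ρ - a| ≤ |b - a| := by
      exact abs_sub_left_of_mem_uIcc (uIoc_subset_uIcc hρ)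
    rw [sub_self, abs_zero, zero_add]
    have e3 : (K + 1) * (η / (2 * (K + 1))) = η / 2 := by field_simp
    have e4 : |ρ - a| ≤ η / (2 * (K + 1)) := this.trans h2.le
    have e5 : 0 < η / (2 * (K + 1)) := by positivity
    nlinarith
  have hslope : slope (fun h : ℝ => √(2 * (s + h))) 0 h = h⁻¹ * (b - a) := by
    rw [slope_def_field, sub_zero, add_zero, ← ha, ← hb]
    field_simp
  rw [hslope] at h1
  have h6 : h⁻¹ • (heat b q t - heat a q t) - a⁻¹ • heatMoment a (deriv q) t =
      h⁻¹ • (heat b q t - heat a q t - (b - a) • heatMoment a (deriv q) t) +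
        (h⁻¹ * (b - a) - a⁻¹) • heatMoment a (deriv q) t := by
    module
  rw [h6]
  refine (norm_add_le _ _).trans ?_
  rw [norm_smul, norm_smul, Real.norm_eq_abs, Real.norm_eq_abs]
  have h7 : |h⁻¹| * |b - a| ≤ a⁻¹ + 1 := by
    rw [← abs_mul]
    have h8 := h1.trans_le (min_le_left _ _)
    have h9 : |h⁻¹ * (b - a)| ≤ |h⁻¹ * (b - a) - a⁻¹| + |a⁻¹| := by
      simpa using abs_add_le (h⁻¹ * (b - a) - a⁻¹) a⁻¹
    rw [abs_of_pos (inv_pos.2 ha0)] at h9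
    linarith
  have h8 : |h⁻¹| * ‖heat b q t - heat a q t - (b - a) • heatMoment a (deriv q) t‖ ≤ ε / 2 := by
    calc _ ≤ |h⁻¹| * (η * |b - a|) := by gcongr
      _ = η * (|h⁻¹| * |b - a|) := by ring
      _ ≤ η * (a⁻¹ + 1) := by gcongr
      _ = ε / 2 := by rw [hη]; field_simp
  have h9 : |h⁻¹ * (b - a) - a⁻¹| * ‖heatMoment a (deriv q) t‖ ≤ ε / 2 := by
    calc _ ≤ ε / (2 * (D + 1)) * (D + 1) := by
          gcongr
          · exact h1.le.trans (min_le_right _ _)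
          · exact (norm_heatMoment_le hD _ _).trans (by linarith)
      _ = ε / 2 := by field_simp
  linarith

include hV hq hQ in
theorem IsMild.eventually_duhamel {s : ℝ} (hs : 0 < s) {ε : ℝ} (hε : 0 < ε) :
    ∀ᶠ h in 𝓝[≠] (0 : ℝ), ∀ t, ‖h⁻¹ • (duhamel (fun ρ _ => ρ) (forceOf V Q) (s + h) t -
      duhamel (fun ρ _ => ρ) (forceOf V Q) s t) -
      (forceOf V Q s t + duhamel (fun _ z => z) (forceDerivOf V q Q) s t)‖ ≤ ε := by
  have hu := (hQ.ucUpTo_force hV hq (s + 1)).add (hQ.ucUpTo_duhamel_forceDeriv hV hq (s + 1))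
  obtain ⟨δ, hδ, hu⟩ := hu ε hε
  have e1 : ∀ᶠ h in 𝓝[≠] (0 : ℝ), |h| < min δ (min 1 s) := by
    have := mem_nhdsWithin_of_mem_nhds (t := {0}ᶜ)
      (Metric.ball_mem_nhds (0 : ℝ) (ε := min δ (min 1 s)) (by positivity))
    filter_upwards [this] with h hh
    simpa using hh
  filter_upwards [e1, self_mem_nhdsWithin] with h h1 h0 t
  have h0 : h ≠ 0 := h0
  simp only [lt_min_iff] at h1
  have h2 := abs_lt.1 h1.2.1
  have h3 := abs_lt.1 h1.2.2
  set G : ℝ → Config N := fun x => forceOf V Q x t +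
    duhamel (fun _ z => z) (forceDerivOf V q Q) x t with hG
  have hGc : ContinuousOn G (Iic (s + 1)) :=
    ((hQ.continuous_force hV).comp (Continuous.prodMk_left t)).continuousOn.add
      (hQ.continuous_duhamel_forceDeriv hV hq (s + 1) t)
  have hsub : uIcc s (s + h) ⊆ Iic (s + 1) := by
    intro x hx
    have := hx.2
    refine this.trans (sup_le (by linarith) (by linarith))
  have h4 : duhamel (fun ρ _ => ρ) (forceOf V Q) (s + h) t -
      duhamel (fun ρ _ => ρ) (forceOf V Q) s t - h • G s = ∫ x in s..(s + h), (G x - G s) := by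
    rw [hQ.duhamel_force_sub hV hq hs.le (by linarith), intervalIntegral.integral_sub
      ((hGc.mono hsub).intervalIntegrable) (continuous_const.intervalIntegrable _ _),
      intervalIntegral.integral_const, add_sub_cancel_left]
  have h5 : ‖duhamel (fun ρ _ => ρ) (forceOf V Q) (s + h) t -
      duhamel (fun ρ _ => ρ) (forceOf V Q) s t - h • G s‖ ≤ ε * |s + h - s| := by
    rw [h4]
    refine intervalIntegral.norm_integral_le_of_norm_le_const fun x hx => ?_
    have hx' := uIoc_subset_uIcc hx
    refine (hu x s t t (hsub hx') (by linarith) ?_ (by simpa using hδ)).le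
    have := abs_sub_left_of_mem_uIcc hx'
    refine this.trans_lt ?_
    rw [add_sub_cancel_left]
    exact h1.1
  rw [add_sub_cancel_left] at h5
  have h6 : h⁻¹ • (duhamel (fun ρ _ => ρ) (forceOf V Q) (s + h) t -
      duhamel (fun ρ _ => ρ) (forceOf V Q) s t) - G s =
      h⁻¹ • (duhamel (fun ρ _ => ρ) (forceOf V Q) (s + h) t -
      duhamel (fun ρ _ => ρ) (forceOf V Q) s t - h • G s) := by
    rw [smul_sub _ _ (h • G s), smul_smul, inv_mul_cancel₀ h0, one_smul]
  change ‖_ - G s‖ ≤ ε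
  rw [h6, norm_smul, Real.norm_eq_abs, abs_inv, inv_mul_le_iff₀ (by positivity)]
  linarith

end

theorem exists_isGradientSolution {V : Config N → ℝ → ℝ} (hV : IsPotential V) (q : Phase N) :
    ∃ Q : ℝ → Phase N, IsGradientSolution V q Q := by
  obtain ⟨Q, hQ⟩ := exists_isMild hV q.2
  have hq := q.2
  refine ⟨fun s => ⟨Q s, hQ.memPhase hV hq s⟩, Subtype.ext hQ.init,
    fun s hs => hQ.memL2ul_sub hV hq hs,
    fun s _ => (hQ.tendsto_h2ulNorm hV hq s).mono_left nhdsWithin_le_nhds, fun s hs => ?_⟩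
  refine tendsto_l2ulNorm_zero fun ε hε => ?_
  filter_upwards [hq.eventually_heat hs (half_pos hε),
    hQ.eventually_duhamel hV hq hs (half_pos hε)] with h h1 h2 t
  change ‖h⁻¹ • (Q (s + h) t - Q s t) - (deriv (deriv (Q s)) t - forceOf V Q s t)‖ ≤ ε
  have e1 : ∀ s, Q s t = heat (√(2 * s)) q t - duhamel (fun ρ _ => ρ) (forceOf V Q) s t :=
    fun s => hQ.eq s t
  rw [e1, e1, hQ.deriv_deriv_eq hV hq hs]
  refine le_trans (le_of_eq ?_) ((norm_sub_le _ _).trans (add_le_add (h1 t) (h2 t))) |>.trans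
    (by linarith)
  congr 1
  module

end

end GradientShadowing

namespace GradientShadowing

noncomputable section

open scoped InnerProductSpace BoundedContinuousFunction

variable {N : ℕ}

/-! ### The Hilbert space `L²(dt / cosh t)` -/

/-- The measure with the density `1 / cosh t`. -/
def sechMeasure : Measure ℝ := volume.withDensity fun t => ENNReal.ofReal (Real.cosh t)⁻¹

theorem sechMeasure_ac : sechMeasure ≪ volume := withDensity_absolutelyContinuous _ _

theorem exp_neg_abs_le_inv_cosh (t : ℝ) : Real.exp (-|t|) ≤ (Real.cosh t)⁻¹ := by
  rw [Real.exp_neg]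
  refine inv_anti₀ (Real.cosh_pos t) ?_
  rw [← Real.cosh_abs, Real.cosh_eq]
  have : Real.exp (-|t|) ≤ Real.exp |t| := Real.exp_le_exp.2 (by linarith [abs_nonneg t])
  linarith

theorem inv_cosh_le_two_mul_exp (t : ℝ) : (Real.cosh t)⁻¹ ≤ 2 * Real.exp (-|t|) := by
  rw [Real.exp_neg, ← div_eq_mul_inv, inv_le_comm₀ (Real.cosh_pos t) (by positivity), inv_div,
    ← Real.cosh_abs, Real.cosh_eq]
  have := Real.exp_pos (-|t|)
  linarith

theorem expMeasure_zero : expMeasure 0 = volume.withDensity fun t : ℝ =>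
    ENNReal.ofReal (Real.exp (-|t|)) := by simp [expMeasure]

theorem expMeasure_le_sechMeasure : expMeasure 0 ≤ sechMeasure := by
  rw [expMeasure_zero]
  exact withDensity_mono (Eventually.of_forall fun t =>
    ENNReal.ofReal_le_ofReal (exp_neg_abs_le_inv_cosh t))

theorem sechMeasure_le_expMeasure : sechMeasure ≤ (2 : ℝ≥0∞) • expMeasure 0 := by
  rw [expMeasure_zero, ← withDensity_smul _ (by fun_prop)]
  refine withDensity_mono (Eventually.of_forall fun t => ?_)
  refine (ENNReal.ofReal_le_ofReal (inv_cosh_le_two_mul_exp t)).trans ?_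
  rw [ENNReal.ofReal_mul (by norm_num)]
  simp

theorem eLpNorm_sechMeasure_le {F : Type*} [NormedAddCommGroup F] (f : ℝ → F) :
    eLpNorm f 2 sechMeasure ≤ 2 * eLpNorm f 2 (expMeasure 0) := by
  refine (eLpNorm_mono_measure f sechMeasure_le_expMeasure).trans ?_
  rw [eLpNorm_smul_measure_of_ne_zero (by norm_num)]
  rw [smul_eq_mul]
  gcongr
  have : (2 : ℝ≥0∞) ^ (1 / (2 : ℝ≥0∞).toReal) ≤ 2 ^ (1 : ℝ) :=
    ENNReal.rpow_le_rpow_of_exponent_le (by norm_num) (by norm_num)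
  simpa using this

theorem volume_ac_sechMeasure : volume ≪ sechMeasure :=
  withDensity_absolutelyContinuous' (by fun_prop)
    (Eventually.of_forall fun t => by simpa using Real.cosh_pos t)

theorem integral_sechMeasure (f : ℝ → ℝ) :
    ∫ t, f t ∂sechMeasure = ∫ t, (Real.cosh t)⁻¹ * f t := by
  rw [sechMeasure, integral_withDensity_eq_integral_toReal_smul (by fun_prop) (by simp)]
  congr 1; ext1 t
  rw [ENNReal.toReal_ofReal (inv_nonneg.2 (Real.cosh_pos t).le), smul_eq_mul]

theorem integrable_sechMeasure_iff (f : ℝ → ℝ) :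
    Integrable f sechMeasure ↔ Integrable fun t => (Real.cosh t)⁻¹ * f t := by
  rw [sechMeasure, integrable_withDensity_iff_integrable_smul' (by fun_prop) (by simp)]
  refine integrable_congr (Eventually.of_forall fun t => ?_)
  simp only
  rw [ENNReal.toReal_ofReal (inv_nonneg.2 (Real.cosh_pos t).le), smul_eq_mul]

instance : IsFiniteMeasure sechMeasure := by
  refine ⟨(sechMeasure_le_expMeasure univ).trans_lt ?_⟩
  rw [Measure.smul_apply, expMeasure_univ]
  exact ENNReal.mul_lt_top (by simp) (by simp)

/-- The Hilbert space `L²(dt / cosh t)^N`. -/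
abbrev L2 (N : ℕ) : Type := Lp (Config N) 2 sechMeasure

theorem memLp_sech_of_l2ulNorm {f : ℝ → Config N} (hf : AEStronglyMeasurable f volume)
    (h : l2ulNorm f < ∞) : MemLp f 2 sechMeasure :=
  ⟨hf.mono_ac sechMeasure_ac, (eLpNorm_sechMeasure_le f).trans_lt
    (ENNReal.mul_lt_top (by simp) ((eLpNorm_le_l2ulNorm f 0).trans_lt h))⟩

theorem memLp_abs_sech : MemLp (fun t : ℝ => |t|) 2 sechMeasure := by
  rw [memLp_two_iff_integrable_sq (by fun_prop), integrable_sechMeasure_iff]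
  have h1 : Integrable fun t : ℝ => Real.exp (-|t / 2|) := by
    have h2 : Integrable fun t : ℝ => Real.exp (-|t|) := by
      refine ⟨by fun_prop, ?_⟩
      rw [HasFiniteIntegral]
      simp only [Real.enorm_eq_ofReal (Real.exp_pos _).le]
      rw [lintegral_exp_neg_abs]
      simp
    exact h2.comp_div (by norm_num)
  refine (h1.const_mul 16).mono' (by fun_prop) (Eventually.of_forall fun t => ?_)
  have h3 := inv_cosh_le_two_mul_exp t
  have h4 : t ^ 2 ≤ 8 * Real.exp (|t| / 2) := by
    have := Real.quadratic_le_exp_of_nonneg (x := |t| / 2) (by positivity)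
    have h5 := abs_nonneg t
    have h6 := sq_abs t
    nlinarith
  have h5 : Real.exp (-|t|) * Real.exp (|t| / 2) = Real.exp (-|t / 2|) := by
    rw [← Real.exp_add, abs_div, abs_two]
    congr 1; ring
  rw [Real.norm_of_nonneg (by have := Real.cosh_pos t; positivity), sq_abs]
  calc (Real.cosh t)⁻¹ * t ^ 2 ≤ 2 * Real.exp (-|t|) * (8 * Real.exp (|t| / 2)) := by gcongr
    _ = 16 * Real.exp (-|t / 2|) := by rw [← h5]; ring

theorem MemPhase.memLp {q : ℝ → Config N} (hq : MemPhase q) : MemLp q 2 sechMeasure := by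
  obtain ⟨C, hC0, hC, -⟩ := hq.exists_lipschitz
  have h0 : MemLp (fun _ : ℝ => ‖q 0‖) 2 sechMeasure := memLp_const _
  have h1 : MemLp (fun t : ℝ => C * |t|) 2 sechMeasure := memLp_abs_sech.const_mul C
  have h2 : MemLp (fun t : ℝ => ‖q 0‖ + C * |t|) 2 sechMeasure := h0.add h1
  have hm : AEStronglyMeasurable q sechMeasure := hq.contDiff.continuous.aestronglyMeasurable
  exact MemLp.mono h2 hm (Eventually.of_forall fun t => (hC t).trans (le_abs_self _))

theorem MemPhase.memLp_deriv {q : ℝ → Config N} (hq : MemPhase q) :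
    MemLp (deriv q) 2 sechMeasure :=
  memLp_sech_of_l2ulNorm hq.deriv_mem.aestronglyMeasurable hq.deriv_mem.norm_lt_top

theorem MemPhase.memLp_deriv_deriv {q : ℝ → Config N} (hq : MemPhase q) :
    MemLp (deriv (deriv q)) 2 sechMeasure :=
  memLp_sech_of_l2ulNorm hq.deriv_deriv_mem.aestronglyMeasurable hq.deriv_deriv_mem.norm_lt_top

/-- The position, as an element of the Hilbert space. -/
def posL2 (p : Phase N) : L2 N := p.2.memLp.toLp p

/-- The velocity, as an element of the Hilbert space. -/
def velL2 (p : Phase N) : L2 N := p.2.memLp_deriv.toLp (deriv p)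

/-- The acceleration, as an element of the Hilbert space. -/
def accL2 (p : Phase N) : L2 N := p.2.memLp_deriv_deriv.toLp (deriv (deriv p))

theorem coeFn_posL2 (p : Phase N) : posL2 p =ᵐ[sechMeasure] p := MemLp.coeFn_toLp _
theorem coeFn_velL2 (p : Phase N) : velL2 p =ᵐ[sechMeasure] deriv p := MemLp.coeFn_toLp _
theorem coeFn_accL2 (p : Phase N) : accL2 p =ᵐ[sechMeasure] deriv (deriv p) :=
  MemLp.coeFn_toLp _

theorem tendsto_toLp_of_l2ulNorm {ι : Type*} {l : Filter ι} {f : ι → ℝ → Config N}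
    {g : ℝ → Config N} (hf : ∀ i, MemLp (f i) 2 sechMeasure) (hg : MemLp g 2 sechMeasure)
    (h : Tendsto (fun i => l2ulNorm fun t => f i t - g t) l (𝓝 0)) :
    Tendsto (fun i => (hf i).toLp (f i)) l (𝓝 (hg.toLp g)) := by
  rw [Lp.tendsto_Lp_iff_tendsto_eLpNorm'']
  have h2 := ENNReal.Tendsto.const_mul (a := 2) h (Or.inr (by simp))
  rw [mul_zero] at h2
  refine tendsto_of_tendsto_of_tendsto_of_le_of_le tendsto_const_nhds h2 (fun _ => zero_le)
    fun i => (eLpNorm_sechMeasure_le _).trans ?_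
  exact mul_le_mul_right (eLpNorm_le_l2ulNorm _ 0) _

/-! ### The phase space as a subset of a Hilbert space -/

theorem locNorm_eq_expMeasure (f : ℝ → Config N) :
    locNorm f = eLpNorm (fun t => WithLp.toLp 2 (f t, deriv f t)) 2 (expMeasure 0) := by
  rw [locNorm_eq_eLpNorm, expMeasure_zero]

/-- The pair of the position and the velocity. -/
def phaseL2 (p : Phase N) : L2 N × L2 N := (posL2 p, velL2 p)

theorem edist_posL2 (p q : Phase N) :
    edist (posL2 p) (posL2 q) = eLpNorm (fun t => p t - q t) 2 sechMeasure :=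
  Lp.edist_toLp_toLp _ _ _ _

theorem edist_velL2 (p q : Phase N) :
    edist (velL2 p) (velL2 q) = eLpNorm (fun t => deriv p t - deriv q t) 2 sechMeasure :=
  Lp.edist_toLp_toLp _ _ _ _

theorem edist_phase (p q : Phase N) : edist p q = eLpNorm
    (fun t => WithLp.toLp 2 (p t - q t, deriv p t - deriv q t)) 2 (expMeasure 0) := by
  change locNorm _ = _
  rw [locNorm_eq_expMeasure]
  simp only [Phase.deriv_sub]

theorem lipschitzWith_phaseL2 : LipschitzWith 2 (phaseL2 (N := N)) := by
  intro p q
  rw [phaseL2, phaseL2, Prod.edist_eq, edist_posL2, edist_velL2, edist_phase]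
  refine max_le ?_ ?_
  · refine (eLpNorm_sechMeasure_le _).trans (mul_le_mul_right (eLpNorm_mono fun t => ?_) _)
    exact WithLp.norm_fst_le (x := WithLp.toLp 2 (p t - q t, deriv p t - deriv q t))
  · refine (eLpNorm_sechMeasure_le _).trans (mul_le_mul_right (eLpNorm_mono fun t => ?_) _)
    exact WithLp.norm_snd_le (x := WithLp.toLp 2 (p t - q t, deriv p t - deriv q t))

theorem antilipschitzWith_phaseL2 : AntilipschitzWith 2 (phaseL2 (N := N)) := by
  intro p q
  rw [phaseL2, phaseL2, Prod.edist_eq, edist_posL2, edist_velL2, edist_phase]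
  have hp := p.2.continuous_deriv
  have hq := q.2.continuous_deriv
  have hp' := p.2.contDiff.continuous
  have hq' := q.2.contDiff.continuous
  set u : ℝ → Config N := fun t => p t - q t
  set v : ℝ → Config N := fun t => deriv p t - deriv q t
  have h1 : eLpNorm (fun t => WithLp.toLp 2 (u t, v t)) 2 (expMeasure 0) ≤
      eLpNorm (fun t => ‖u t‖ + ‖v t‖) 2 (expMeasure 0) := by
    refine eLpNorm_mono_real fun t => ?_
    have := WithLp.prod_norm_sq_eq_of_L2 (WithLp.toLp 2 (u t, v t))
    refine abs_le_of_sq_le_sq' ?_ (by positivity) |>.2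
    rw [this]
    change ‖u t‖ ^ 2 + ‖v t‖ ^ 2 ≤ _
    have := mul_nonneg (norm_nonneg (u t)) (norm_nonneg (v t))
    nlinarith
  refine h1.trans ((eLpNorm_add_le (f := fun t => ‖u t‖) (g := fun t => ‖v t‖)
    (by fun_prop) (by fun_prop) (by norm_num)).trans ?_)
  rw [eLpNorm_norm, eLpNorm_norm]
  have h2 : ∀ f : ℝ → Config N, eLpNorm f 2 (expMeasure 0) ≤ eLpNorm f 2 sechMeasure :=
    fun f => eLpNorm_mono_measure f expMeasure_le_sechMeasure
  refine (add_le_add ((h2 u).trans (le_max_left _ (eLpNorm v 2 sechMeasure)))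
    ((h2 v).trans (le_max_right (eLpNorm u 2 sechMeasure) _))).trans (le_of_eq ?_)
  rw [← two_mul]; rfl

theorem isUniformInducing_phaseL2 : IsUniformInducing (phaseL2 (N := N)) :=
  antilipschitzWith_phaseL2.isUniformInducing lipschitzWith_phaseL2.uniformContinuous

theorem continuous_posL2 : Continuous (posL2 (N := N)) :=
  continuous_fst.comp lipschitzWith_phaseL2.continuous

theorem continuous_velL2 : Continuous (velL2 (N := N)) :=
  continuous_snd.comp lipschitzWith_phaseL2.continuous

instance : SecondCountableTopology (L2 N) := by
  have : Fact ((2 : ℝ≥0∞) ≠ ∞) := ⟨by simp⟩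
  infer_instance

instance : SecondCountableTopology (Phase N) :=
  isUniformInducing_phaseL2.isInducing.secondCountableTopology

theorem Phase.eq_of_edist_eq_zero {p q : Phase N} (h : edist p q = 0) : p = q := by
  have h1 : posL2 p = posL2 q := by
    have h2 := (lipschitzWith_phaseL2 p q)
    rw [h, mul_zero, nonpos_iff_eq_zero, edist_eq_zero] at h2
    exact congrArg Prod.fst h2
  have h2 : (p : ℝ → Config N) =ᵐ[volume] q := by
    refine volume_ac_sechMeasure.ae_eq ?_
    exact (coeFn_posL2 p).symm.trans (h1 ▸ coeFn_posL2 q)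
  have h3 := (Continuous.ae_eq_iff_eq volume p.2.contDiff.continuous
    q.2.contDiff.continuous).1 h2
  exact Subtype.ext h3

/-! ### Multipliers and integration by parts -/

/-- The multiplication with a bounded continuous function. -/
def mulL2 (c : ℝ →ᵇ ℝ) : L2 N →L[ℝ] L2 N :=
  (ContinuousLinearMap.lsmul ℝ ℝ).holderL sechMeasure ∞ 2 2
    (memLp_top_of_bound (μ := sechMeasure) (f := c) c.continuous.aestronglyMeasurable ‖c‖
      (Eventually.of_forall c.norm_coe_le_norm)).toLp

theorem coeFn_mulL2 (c : ℝ →ᵇ ℝ) (f : L2 N) :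
    mulL2 c f =ᵐ[sechMeasure] fun t => c t • f t := by
  have hc := memLp_top_of_bound (μ := sechMeasure) (f := c) c.continuous.aestronglyMeasurable
    ‖c‖ (Eventually.of_forall c.norm_coe_le_norm)
  filter_upwards [(ContinuousLinearMap.lsmul ℝ ℝ).coeFn_holder (r := 2) hc.toLp f,
    hc.coeFn_toLp] with t h1 h2
  change ((ContinuousLinearMap.lsmul ℝ ℝ).holder 2 hc.toLp f) t = _
  rw [h1, h2]
  rfl

theorem inner_mulL2_comm (c : ℝ →ᵇ ℝ) (f g : L2 N) :
    ⟪mulL2 c f, g⟫_ℝ = ⟪f, mulL2 c g⟫_ℝ := by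
  rw [L2.inner_def, L2.inner_def]
  refine integral_congr_ae ?_
  filter_upwards [coeFn_mulL2 c f, coeFn_mulL2 c g] with t h1 h2
  rw [h1, h2, inner_smul_left, inner_smul_right]
  rfl

theorem norm_mulL2_le {c : ℝ →ᵇ ℝ} (hc : ∀ t, |c t| ≤ 1) (f : L2 N) : ‖mulL2 c f‖ ≤ ‖f‖ := by
  refine Lp.norm_le_norm_of_ae_le ?_
  filter_upwards [coeFn_mulL2 c f] with t h
  rw [h, norm_smul, Real.norm_eq_abs]
  exact mul_le_of_le_one_left (norm_nonneg _) (hc t)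

theorem mulL2_one (f : L2 N) : mulL2 1 f = f := by
  refine Lp.ext ?_
  filter_upwards [coeFn_mulL2 1 f] with t h
  rw [h]; simp

/-- Integration by parts against the weight `c t / cosh t`. -/
theorem inner_mulL2_velL2 {c c' : ℝ →ᵇ ℝ}
    (hw : ∀ t, HasDerivAt (fun t => c t * (Real.cosh t)⁻¹) (c' t * (Real.cosh t)⁻¹) t)
    (p q : Phase N) : ⟪mulL2 c (velL2 p), velL2 q⟫_ℝ =
      -⟪mulL2 c (accL2 p) + mulL2 c' (velL2 p), posL2 q⟫_ℝ := by
  rw [← add_eq_zero_iff_eq_neg, L2.inner_def, L2.inner_def, ← integral_add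
    (L2.integrable_inner _ _) (L2.integrable_inner _ _)]
  set h : ℝ → ℝ := fun t => ⟪deriv (deriv p) t, (c t * (Real.cosh t)⁻¹) • q t⟫_ℝ +
    ⟪deriv p t, (c' t * (Real.cosh t)⁻¹) • q t + (c t * (Real.cosh t)⁻¹) • deriv q t⟫_ℝ with hh
  have hae : (fun t => ⟪mulL2 c (velL2 p) t, velL2 q t⟫_ℝ +
      ⟪(mulL2 c (accL2 p) + mulL2 c' (velL2 p) : L2 N) t, posL2 q t⟫_ℝ) =ᵐ[sechMeasure]
      fun t => Real.cosh t * h t := by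
    filter_upwards [coeFn_mulL2 c (velL2 p), coeFn_mulL2 c (accL2 p), coeFn_mulL2 c' (velL2 p),
      Lp.coeFn_add (mulL2 c (accL2 p)) (mulL2 c' (velL2 p)), coeFn_posL2 q, coeFn_velL2 p,
      coeFn_velL2 q, coeFn_accL2 p] with t h1 h2 h3 h4 h5 h6 h7 h8
    rw [h4, Pi.add_apply, h1, h2, h3, h5, h6, h7, h8, hh]
    simp only [inner_add_left, inner_add_right, inner_smul_left, inner_smul_right,
      conj_trivial]
    have := (Real.cosh_pos t).ne'
    field_simp
    ring
  have hint : Integrable h := by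
    have h1 := ((L2.integrable_inner (𝕜 := ℝ) (mulL2 c (velL2 p)) (velL2 q)).add
      (L2.integrable_inner (𝕜 := ℝ) (mulL2 c (accL2 p) + mulL2 c' (velL2 p)) (posL2 q))).congr hae
    rw [integrable_sechMeasure_iff] at h1
    refine h1.congr (Eventually.of_forall fun t => ?_)
    simp only
    rw [← mul_assoc, inv_mul_cancel₀ (Real.cosh_pos t).ne', one_mul]
  rw [integral_congr_ae hae, integral_sechMeasure]
  have e1 : ∀ t, (Real.cosh t)⁻¹ * (Real.cosh t * h t) = h t := fun t => by
    rw [← mul_assoc, inv_mul_cancel₀ (Real.cosh_pos t).ne', one_mul]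
  simp only [e1]
  have hg : IsPrim (fun t => (c t * (Real.cosh t)⁻¹) • q t)
      (fun t => (c' t * (Real.cosh t)⁻¹) • q t + (c t * (Real.cosh t)⁻¹) • deriv q t) := by
    refine isPrim_of_hasDerivAt (fun t => ?_) ?_
    · rw [add_comm]
      exact (hw t).smul (q.2.differentiable t).hasDerivAt
    · have h1 := c.continuous
      have h2 := c'.continuous
      have h3 : Continuous fun t : ℝ => (Real.cosh t)⁻¹ :=
        Real.continuous_cosh.inv₀ fun t => (Real.cosh_pos t).ne'
      have h4 := q.2.continuous_deriv
      have h5 := q.2.contDiff.continuous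
      fun_prop
  have hlim := intervalIntegral_tendsto_integral hint tendsto_neg_atTop_atBot tendsto_id
  refine tendsto_nhds_unique hlim ?_
  have hval : ∀ R : ℝ, ∫ t in (-R)..R, h t =
      ⟪deriv p R, (c R * (Real.cosh R)⁻¹) • q R⟫_ℝ -
        ⟪deriv p (-R), (c (-R) * (Real.cosh (-R))⁻¹) • q (-R)⟫_ℝ :=
    fun R => p.2.isPrim_deriv.integral_inner hg (-R) R
  obtain ⟨C, hC0, hC, -⟩ := p.2.exists_bound
  obtain ⟨C', hC0', hC', -⟩ := q.2.exists_lipschitz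
  have hb : ∀ t : ℝ, ‖⟪deriv p t, (c t * (Real.cosh t)⁻¹) • q t⟫_ℝ‖ ≤
      C * (‖c‖ * (2 * Real.exp (-|t|)) * (‖q 0‖ + C' * |t|)) := by
    intro t
    refine (norm_inner_le_norm _ _).trans ?_
    rw [norm_smul, norm_mul, Real.norm_of_nonneg (inv_nonneg.2 (Real.cosh_pos t).le)]
    gcongr
    · exact hC t
    · exact c.norm_coe_le_norm t
    · exact inv_cosh_le_two_mul_exp t
    · exact hC' t
  have hlim0 : Tendsto (fun R : ℝ => C * (‖c‖ * (2 * Real.exp (-|R|)) * (‖q 0‖ + C' * |R|)))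
      atTop (𝓝 0) := by
    have h1 : Tendsto (fun R : ℝ => Real.exp (-R)) atTop (𝓝 0) := Real.tendsto_exp_neg_atTop_nhds_zero
    have h2 : Tendsto (fun R : ℝ => R * Real.exp (-R)) atTop (𝓝 0) := by
      simpa using Real.tendsto_pow_mul_exp_neg_atTop_nhds_zero 1
    have h3 := (h1.const_mul (C * ‖c‖ * 2 * ‖q 0‖)).add (h2.const_mul (C * ‖c‖ * 2 * C'))
    simp only [mul_zero, add_zero] at h3
    refine h3.congr' ?_
    filter_upwards [eventually_ge_atTop 0] with R hR
    rw [abs_of_nonneg hR]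
    ring
  have hR1 : Tendsto (fun R : ℝ => ⟪deriv p R, (c R * (Real.cosh R)⁻¹) • q R⟫_ℝ) atTop (𝓝 0) :=
    squeeze_zero_norm hb hlim0
  have hR2 : Tendsto (fun R : ℝ => ⟪deriv p (-R), (c (-R) * (Real.cosh (-R))⁻¹) • q (-R)⟫_ℝ)
      atTop (𝓝 0) := by
    refine squeeze_zero_norm (fun R => ?_) hlim0
    have := hb (-R)
    rwa [abs_neg] at this
  have := hR1.sub hR2
  rw [sub_zero] at this
  exact this.congr fun R => (hval R).symm

/-- The derivative of a quadratic form of the velocity along a curve. -/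
theorem hasDerivAt_inner_of_parts {H : Type*} [NormedAddCommGroup H] [InnerProductSpace ℝ H]
    {A : H →L[ℝ] H} (hA : ∀ x y, ⟪A x, y⟫_ℝ = ⟪x, A y⟫_ℝ) {x y z : ℝ → H} {y' : H} {s : ℝ}
    (hz : ContinuousAt z s) (hy : HasDerivAt y y' s)
    (h : ∀ r r', ⟪A (x r), x r'⟫_ℝ = ⟪z r, y r'⟫_ℝ) :
    HasDerivAt (fun r => ⟪A (x r), x r⟫_ℝ) (2 * ⟪z s, y'⟫_ℝ) s := by
  rw [hasDerivAt_iff_tendsto_slope]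
  have h1 : Tendsto (fun r => ⟪z r + z s, slope y s r⟫_ℝ) (𝓝[≠] s) (𝓝 ⟪z s + z s, y'⟫_ℝ) :=
    ((hz.tendsto.mono_left nhdsWithin_le_nhds).add tendsto_const_nhds).inner
      (hasDerivAt_iff_tendsto_slope.1 hy)
  rw [← two_smul ℝ, inner_smul_left] at h1
  refine h1.congr fun r => ?_
  rw [slope_def_module, slope_def_module, inner_smul_right, smul_eq_mul, inner_add_left,
    inner_sub_right, inner_sub_right, ← h, ← h, ← h, ← h]
  congr 1
  have : ⟪A (x s), x r⟫_ℝ = ⟪A (x r), x s⟫_ℝ := by rw [hA, real_inner_comm]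
  rw [this]
  ring

end

end GradientShadowing

namespace GradientShadowing

noncomputable section

open scoped InnerProductSpace BoundedContinuousFunction

variable {N : ℕ}

/-! ### Solutions as curves in the Hilbert space -/

theorem IsPotential.continuous_force {V : Config N → ℝ → ℝ} (hV : IsPotential V) (p : Phase N) :
    Continuous fun t => gradV V (p t) t :=
  hV.continuous_gradV.comp (p.2.contDiff.continuous.prodMk continuous_id)

theorem IsPotential.memLp_force {V : Config N → ℝ → ℝ} (hV : IsPotential V) (p : Phase N) :
    MemLp (fun t => gradV V (p t) t) 2 sechMeasure := by
  obtain ⟨M, -, hM⟩ := hV.exists_bound_gradV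
  exact MemLp.of_bound (hV.continuous_force p).aestronglyMeasurable M
    (Eventually.of_forall fun t => hM _ _)

/-- The force along a path, as an element of the Hilbert space. -/
def forceL2 {V : Config N → ℝ → ℝ} (hV : IsPotential V) (p : Phase N) : L2 N :=
  (hV.memLp_force p).toLp fun t => gradV V (p t) t

theorem coeFn_forceL2 {V : Config N → ℝ → ℝ} (hV : IsPotential V) (p : Phase N) :
    forceL2 hV p =ᵐ[sechMeasure] fun t => gradV V (p t) t := MemLp.coeFn_toLp _

theorem norm_forceL2_sub_le {V : Config N → ℝ → ℝ} (hV : IsPotential V) {L : ℝ}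
    (hL : ∀ p p' : Config N × ℝ, ‖gradV V p.1 p.2 - gradV V p'.1 p'.2‖ ≤ L * ‖p - p'‖)
    (p q : Phase N) : ‖forceL2 hV p - forceL2 hV q‖ ≤ L * ‖posL2 p - posL2 q‖ := by
  refine Lp.norm_le_mul_norm_of_ae_le_mul ?_
  filter_upwards [coeFn_forceL2 hV p, coeFn_forceL2 hV q, coeFn_posL2 p, coeFn_posL2 q,
    Lp.coeFn_sub (forceL2 hV p) (forceL2 hV q), Lp.coeFn_sub (posL2 p) (posL2 q)]
    with t h1 h2 h3 h4 h5 h6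
  rw [h5, h6, Pi.sub_apply, Pi.sub_apply, h1, h2, h3, h4]
  exact IsPotential.lipschitz_space hL _ _ _

theorem continuous_forceL2 {V : Config N → ℝ → ℝ} (hV : IsPotential V) :
    Continuous (forceL2 hV) := by
  obtain ⟨L, hL0, -, hL⟩ := hV.exists_lipschitz_gradV
  rw [continuous_iff_continuousAt]
  intro q
  have h1 : Tendsto (fun p => L * ‖posL2 p - posL2 q‖) (𝓝 q) (𝓝 (L * ‖posL2 q - posL2 q‖)) :=
    ((continuous_posL2.sub continuous_const).norm.const_mul L).tendsto q
  rw [sub_self, norm_zero, mul_zero] at h1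
  exact tendsto_iff_norm_sub_tendsto_zero.2 (squeeze_zero (fun _ => norm_nonneg _)
    (fun p => norm_forceL2_sub_le hV hL p q) h1)

theorem Phase.deriv_deriv_sub (p q : Phase N) :
    deriv (deriv fun t => p t - q t) =ᵐ[volume] fun t => deriv (deriv p) t - deriv (deriv q) t := by
  have : (deriv fun t => p t - q t) = fun t => deriv p t - deriv q t :=
    funext fun t => Phase.deriv_sub p q t
  rw [this]
  exact (p.2.isPrim_deriv.sub q.2.isPrim_deriv).deriv_ae_eq

theorem l2ulNorm_le_h2ulNorm (f : ℝ → Config N) :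
    l2ulNorm f ≤ h2ulNorm f ∧ l2ulNorm (deriv f) ≤ h2ulNorm f ∧
      l2ulNorm (deriv (deriv f)) ≤ h2ulNorm f := by
  have h : ∀ a b : ℝ≥0∞, a ^ 2 ≤ b → a ≤ b ^ (1 / 2 : ℝ) := by
    intro a b hab
    calc a = (a ^ 2) ^ (1 / 2 : ℝ) := by
          rw [← ENNReal.rpow_two, ← ENNReal.rpow_mul]; norm_num
      _ ≤ _ := ENNReal.rpow_le_rpow hab (by norm_num)
  refine ⟨h _ _ ?_, h _ _ ?_, h _ _ ?_⟩
  · rw [add_assoc]; exact le_self_add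
  · exact le_add_self.trans le_self_add
  · exact le_add_self

section

variable {V : Config N → ℝ → ℝ} {q : Phase N} {Q : ℝ → Phase N} (hQ : IsGradientSolution V q Q)

include hQ in
theorem IsGradientSolution.continuousOn_posL2 : ContinuousOn (fun s => posL2 (Q s)) (Ici 0) :=
  fun s hs => tendsto_toLp_of_l2ulNorm (fun r => (Q r).2.memLp) (Q s).2.memLp <|
    tendsto_of_tendsto_of_tendsto_of_le_of_le tendsto_const_nhds (hQ.continuous s hs)
      (fun _ => zero_le) fun _ => (l2ulNorm_le_h2ulNorm _).1

include hQ in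
theorem IsGradientSolution.continuousOn_velL2 : ContinuousOn (fun s => velL2 (Q s)) (Ici 0) := by
  refine fun s hs => tendsto_toLp_of_l2ulNorm (fun r => (Q r).2.memLp_deriv)
    (Q s).2.memLp_deriv ?_
  refine tendsto_of_tendsto_of_tendsto_of_le_of_le tendsto_const_nhds (hQ.continuous s hs)
      (fun _ => zero_le) fun r => ?_
  simp only [← Phase.deriv_sub]
  exact (l2ulNorm_le_h2ulNorm _).2.1

include hQ in
theorem IsGradientSolution.continuousOn_accL2 : ContinuousOn (fun s => accL2 (Q s)) (Ici 0) := by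
  refine fun s hs => tendsto_toLp_of_l2ulNorm (fun r => (Q r).2.memLp_deriv_deriv)
    (Q s).2.memLp_deriv_deriv ?_
  refine tendsto_of_tendsto_of_tendsto_of_le_of_le tendsto_const_nhds (hQ.continuous s hs)
      (fun _ => zero_le) fun r => ?_
  rw [l2ulNorm_congr (Phase.deriv_deriv_sub (Q r) (Q s)).symm]
  exact (l2ulNorm_le_h2ulNorm _).2.2

include hQ in
theorem IsGradientSolution.hasDerivAt_posL2 (hV : IsPotential V) {s : ℝ} (hs : 0 < s) :
    HasDerivAt (fun s => posL2 (Q s)) (accL2 (Q s) - forceL2 hV (Q s)) s := by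
  rw [hasDerivAt_iff_tendsto_slope_zero]
  exact tendsto_toLp_of_l2ulNorm (l := 𝓝[≠] 0)
    (f := fun h t => h⁻¹ • (Q (s + h) t - Q s t))
    (g := fun t => deriv (deriv (Q s)) t - gradV V (Q s t) t)
    (fun h => ((Q (s + h)).2.memLp.sub (Q s).2.memLp).const_smul h⁻¹)
    ((Q s).2.memLp_deriv_deriv.sub (hV.memLp_force _)) (hQ.hasDeriv s hs)

end

/-- The logarithmic derivative of `1 / cosh`. -/
def negTanh : ℝ →ᵇ ℝ :=
  BoundedContinuousFunction.ofNormedAddCommGroup (fun t => -(Real.sinh t * (Real.cosh t)⁻¹))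
    ((Real.continuous_sinh.mul
      (Real.continuous_cosh.inv₀ fun t => (Real.cosh_pos t).ne')).neg) 1 (by
    intro t
    rw [norm_neg, norm_mul, norm_inv, Real.norm_eq_abs, Real.norm_of_nonneg (Real.cosh_pos t).le,
      ← div_eq_mul_inv, div_le_one (Real.cosh_pos t), Real.abs_sinh, ← Real.cosh_abs]
    exact (Real.sinh_lt_cosh _).le)

theorem abs_negTanh_le (t : ℝ) : |negTanh t| ≤ 1 :=
  (negTanh.norm_coe_le_norm t).trans
    (BoundedContinuousFunction.norm_ofNormedAddCommGroup_le _ zero_le_one _)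

theorem hasDerivAt_inv_cosh (t : ℝ) :
    HasDerivAt (fun t => (1 : ℝ →ᵇ ℝ) t * (Real.cosh t)⁻¹) (negTanh t * (Real.cosh t)⁻¹) t := by
  have h := (Real.hasDerivAt_cosh t).inv (Real.cosh_pos t).ne'
  simp only [BoundedContinuousFunction.coe_one, Pi.one_apply, one_mul]
  refine h.congr_deriv (Eq.symm ?_)
  change -(Real.sinh t * (Real.cosh t)⁻¹) * (Real.cosh t)⁻¹ = _
  have := (Real.cosh_pos t).ne'
  field_simp

/-- The squared distance of two solutions in the Hilbert space. -/
def gapSq (p q : Phase N) : ℝ :=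
  ⟪posL2 p - posL2 q, posL2 p - posL2 q⟫_ℝ + ⟪velL2 p - velL2 q, velL2 p - velL2 q⟫_ℝ

theorem gapSq_eq (p q : Phase N) :
    gapSq p q = ‖posL2 p - posL2 q‖ ^ 2 + ‖velL2 p - velL2 q‖ ^ 2 := by
  rw [gapSq, real_inner_self_eq_norm_sq, real_inner_self_eq_norm_sq]

theorem energy_young (L a b d g x y : ℝ) (hL : 0 ≤ L)
    (ha : a ≤ d * (x + L * d)) (hg : -(x * x) + x * (L * d) + b * (x + L * d) ≥ g)
    (hy : y = 2 * a + 2 * g) : y ≤ (3 * L ^ 2 + 2 * L + 3) * (d ^ 2 + b ^ 2) := by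
  nlinarith [sq_nonneg (x - 2 * d), sq_nonneg (x - 2 * (L * d)), sq_nonneg (x - 2 * b),
    sq_nonneg (L * d - b), sq_nonneg (L * b), sq_nonneg d, sq_nonneg b, mul_nonneg hL (sq_nonneg b)]

theorem IsGradientSolution.exists_gapSq_le {V : Config N → ℝ → ℝ} (hV : IsPotential V) :
    ∃ K : ℝ, 0 ≤ K ∧ ∀ {p q : Phase N} {P Q : ℝ → Phase N}, IsGradientSolution V p P →
      IsGradientSolution V q Q → ∀ s, 0 ≤ s →
        gapSq (P s) (Q s) ≤ Real.exp (K * s) * gapSq p q := by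
  obtain ⟨L, hL0, -, hL⟩ := hV.exists_lipschitz_gradV
  refine ⟨3 * L ^ 2 + 2 * L + 3, by positivity, fun {p q P Q} hP hQ s hs => ?_⟩
  set K := 3 * L ^ 2 + 2 * L + 3 with hK
  set x0 : ℝ → L2 N := fun s => posL2 (P s) - posL2 (Q s) with hx0
  set x1 : ℝ → L2 N := fun s => velL2 (P s) - velL2 (Q s) with hx1
  set x2 : ℝ → L2 N := fun s => accL2 (P s) - accL2 (Q s) with hx2
  set γ : ℝ → L2 N := fun s => forceL2 hV (P s) - forceL2 hV (Q s) with hγ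
  set z : ℝ → L2 N := fun s => -(x2 s + mulL2 negTanh (x1 s)) with hz
  have c0 : ContinuousOn x0 (Ici 0) := hP.continuousOn_posL2.sub hQ.continuousOn_posL2
  have c1 : ContinuousOn x1 (Ici 0) := hP.continuousOn_velL2.sub hQ.continuousOn_velL2
  have c2 : ContinuousOn x2 (Ici 0) := hP.continuousOn_accL2.sub hQ.continuousOn_accL2
  have cz : ContinuousOn z (Ici 0) :=
    (c2.add ((mulL2 negTanh).continuous.comp_continuousOn c1)).neg
  have hd0 : ∀ s, 0 < s → HasDerivAt x0 (x2 s - γ s) s := by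
    intro s hs
    refine ((hP.hasDerivAt_posL2 hV hs).sub (hQ.hasDerivAt_posL2 hV hs)).congr_deriv ?_
    simp only [hx2, hγ]; abel
  have hparts : ∀ r r', ⟪mulL2 1 (x1 r), x1 r'⟫_ℝ = ⟪z r, x0 r'⟫_ℝ := by
    intro r r'
    have h := fun a b : Phase N => inner_mulL2_velL2 hasDerivAt_inv_cosh a b
    simp only [mulL2_one] at h
    have h1 : z r = (-(accL2 (P r) + mulL2 negTanh (velL2 (P r)))) -
        (-(accL2 (Q r) + mulL2 negTanh (velL2 (Q r)))) := by
      simp only [hz, hx2, hx1, map_sub]; abel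
    simp only [← inner_neg_left] at h
    rw [h1, mulL2_one]
    simp only [hx1, hx0, inner_sub_left, inner_sub_right, h]
  have hd1 : ∀ s, 0 < s → HasDerivAt (fun s => ⟪x1 s, x1 s⟫_ℝ) (2 * ⟪z s, x2 s - γ s⟫_ℝ) s := by
    intro s hs
    have := hasDerivAt_inner_of_parts (inner_mulL2_comm 1)
      (cz.continuousAt (Ici_mem_nhds hs)) (hd0 s hs) hparts
    simpa only [mulL2_one] using this
  set y : ℝ → ℝ := fun s => gapSq (P s) (Q s) with hy
  have hdy : ∀ s, 0 < s → HasDerivAt y (2 * ⟪x0 s, x2 s - γ s⟫_ℝ + 2 * ⟪z s, x2 s - γ s⟫_ℝ) s := by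
    intro s hs
    refine (((hd0 s hs).inner ℝ (hd0 s hs)).add (hd1 s hs)).congr_deriv ?_
    rw [real_inner_comm (x0 s)]; ring
  have hcy : ContinuousOn y (Ici 0) := (c0.inner c0).add (c1.inner c1)
  have hbound : ∀ s, 0 < s → 2 * ⟪x0 s, x2 s - γ s⟫_ℝ + 2 * ⟪z s, x2 s - γ s⟫_ℝ ≤ K * y s := by
    intro s hs
    have hg : ‖γ s‖ ≤ L * ‖x0 s‖ := norm_forceL2_sub_le hV hL _ _
    have ht : ‖mulL2 negTanh (x1 s)‖ ≤ ‖x1 s‖ := norm_mulL2_le abs_negTanh_le _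
    have e0 : ‖x2 s - γ s‖ ≤ ‖x2 s‖ + L * ‖x0 s‖ := (norm_sub_le _ _).trans (by linarith)
    have e1 : ⟪x0 s, x2 s - γ s⟫_ℝ ≤ ‖x0 s‖ * (‖x2 s‖ + L * ‖x0 s‖) :=
      (real_inner_le_norm _ _).trans (by gcongr)
    have e2 : ⟪z s, x2 s - γ s⟫_ℝ ≤ -(‖x2 s‖ * ‖x2 s‖) + ‖x2 s‖ * (L * ‖x0 s‖) +
        ‖x1 s‖ * (‖x2 s‖ + L * ‖x0 s‖) := by
      have h1 : ⟪z s, x2 s - γ s⟫_ℝ = -⟪x2 s, x2 s⟫_ℝ + ⟪x2 s, γ s⟫_ℝ -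
          ⟪mulL2 negTanh (x1 s), x2 s - γ s⟫_ℝ := by
        simp only [hz, inner_neg_left, inner_add_left, inner_sub_right]
        ring
      rw [h1, real_inner_self_eq_norm_mul_norm]
      have h2 : ⟪x2 s, γ s⟫_ℝ ≤ ‖x2 s‖ * (L * ‖x0 s‖) :=
        (real_inner_le_norm _ _).trans (by gcongr)
      have h3 : -⟪mulL2 negTanh (x1 s), x2 s - γ s⟫_ℝ ≤ ‖x1 s‖ * (‖x2 s‖ + L * ‖x0 s‖) :=
        (neg_le_abs _).trans ((abs_real_inner_le_norm _ _).trans (by gcongr))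
      linarith
    have := energy_young L _ ‖x1 s‖ ‖x0 s‖ _ ‖x2 s‖ _ hL0 e1 e2 rfl
    simp only [hy, gapSq_eq]
    exact this
  have hanti : AntitoneOn (fun s => Real.exp (-(K * s)) * y s) (Ici 0) := by
    have hde : ∀ s : ℝ, HasDerivAt (fun s => Real.exp (-(K * s))) (Real.exp (-(K * s)) * (-K)) s := by
      intro s
      exact ((((hasDerivAt_id s).const_mul K).neg).congr_deriv (by rw [mul_one])).exp
    refine antitoneOn_of_hasDerivWithinAt_nonpos (f' := fun s => Real.exp (-(K * s)) * (-K) * y s +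
      Real.exp (-(K * s)) * (2 * ⟪x0 s, x2 s - γ s⟫_ℝ + 2 * ⟪z s, x2 s - γ s⟫_ℝ))
      (convex_Ici 0) (ContinuousOn.mul (by fun_prop) hcy) ?_ ?_
    · intro s hs
      rw [interior_Ici] at hs
      exact ((hde s).mul (hdy s hs)).hasDerivWithinAt
    · intro s hs
      rw [interior_Ici] at hs
      have h1 := hbound s hs
      have h2 := Real.exp_pos (-(K * s))
      nlinarith
  have h1 := hanti (mem_Ici.2 le_rfl) hs hs
  simp only [mul_zero, neg_zero, Real.exp_zero, one_mul] at h1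
  have h2 : y 0 = gapSq p q := by simp only [hy, hP.init, hQ.init]
  rw [h2, Real.exp_neg, inv_mul_le_iff₀ (Real.exp_pos _)] at h1
  exact h1

theorem eq_of_gapSq_nonpos {p q : Phase N} (h : gapSq p q ≤ 0) : p = q := by
  rw [gapSq_eq] at h
  have h1 : ‖posL2 p - posL2 q‖ = 0 := by
    have := sq_nonneg ‖velL2 p - velL2 q‖
    have := sq_nonneg ‖posL2 p - posL2 q‖
    exact pow_eq_zero_iff (n := 2) (by norm_num) |>.1 (by linarith)
  have h2 : ‖velL2 p - velL2 q‖ = 0 := by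
    have := sq_nonneg ‖velL2 p - velL2 q‖
    have := sq_nonneg ‖posL2 p - posL2 q‖
    exact pow_eq_zero_iff (n := 2) (by norm_num) |>.1 (by linarith)
  refine Phase.eq_of_edist_eq_zero ?_
  have h3 := antilipschitzWith_phaseL2 p q
  have h4 : phaseL2 p = phaseL2 q :=
    Prod.ext (sub_eq_zero.1 (norm_eq_zero.1 h1)) (sub_eq_zero.1 (norm_eq_zero.1 h2))
  rw [h4, edist_self, mul_zero] at h3
  exact le_antisymm h3 zero_le

theorem gapSq_self (p : Phase N) : gapSq p p = 0 := by simp [gapSq]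

theorem IsGradientSolution.unique {V : Config N → ℝ → ℝ} (hV : IsPotential V) {q : Phase N}
    {P Q : ℝ → Phase N} (hP : IsGradientSolution V q P) (hQ : IsGradientSolution V q Q) {s : ℝ}
    (hs : 0 ≤ s) : P s = Q s := by
  obtain ⟨K, -, h⟩ := IsGradientSolution.exists_gapSq_le hV
  have := h hP hQ s hs
  rw [gapSq_self, mul_zero] at this
  exact eq_of_gapSq_nonpos this

/-! ### The semiflow -/

section

variable {V : Config N → ℝ → ℝ} (hV : IsPotential V)

include hV in
theorem gradFlow_spec (q : Phase N) : IsGradientSolution V q fun s => gradFlow V s q := by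
  have h := exists_isGradientSolution hV q
  have h1 : (fun s => gradFlow V s q) = h.choose := by
    ext1 s
    rw [gradFlow, dif_pos h]
  rw [h1]
  exact h.choose_spec

include hV in
theorem gradFlow_eq {q : Phase N} {Q : ℝ → Phase N} (hQ : IsGradientSolution V q Q) {s : ℝ}
    (hs : 0 ≤ s) : gradFlow V s q = Q s := (gradFlow_spec hV q).unique hV hQ hs

include hV in
theorem gradFlow_zero (q : Phase N) : gradFlow V 0 q = q := (gradFlow_spec hV q).init

include hV in
theorem continuous_gradFlow {s : ℝ} (hs : 0 ≤ s) : Continuous (gradFlow V s) := by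
  obtain ⟨K, -, h⟩ := IsGradientSolution.exists_gapSq_le hV
  rw [isUniformInducing_phaseL2.isInducing.continuous_iff, continuous_iff_continuousAt]
  intro q
  have h1 : Tendsto (fun p => √(Real.exp (K * s) * gapSq p q)) (𝓝 q) (𝓝 0) := by
    have h2 : Continuous fun p => √(Real.exp (K * s) * gapSq p q) := by
      simp only [gapSq]
      have := continuous_posL2 (N := N)
      have := continuous_velL2 (N := N)
      fun_prop
    have := h2.tendsto q
    simpa [gapSq_self] using this
  have h2 : ∀ p, √(gapSq (gradFlow V s p) (gradFlow V s q)) ≤ √(Real.exp (K * s) * gapSq p q) :=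
    fun p => Real.sqrt_le_sqrt (h (gradFlow_spec hV p) (gradFlow_spec hV q) s hs)
  refine Tendsto.prodMk_nhds ?_ ?_
  · refine tendsto_iff_norm_sub_tendsto_zero.2 (squeeze_zero (fun _ => norm_nonneg _)
      (fun p => (Real.le_sqrt_of_sq_le ?_).trans (h2 p)) h1)
    rw [gapSq_eq]; exact le_add_of_nonneg_right (sq_nonneg _)
  · refine tendsto_iff_norm_sub_tendsto_zero.2 (squeeze_zero (fun _ => norm_nonneg _)
      (fun p => (Real.le_sqrt_of_sq_le ?_).trans (h2 p)) h1)
    rw [gapSq_eq]; exact le_add_of_nonneg_left (sq_nonneg _)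

end

/-- The translate of a path by a lattice vector. -/
def latticeShift (k : Fin N → ℤ) (q : Phase N) : Phase N :=
  ⟨fun t => q t + latticeVec k, by
    have h1 : (deriv fun t => q t + latticeVec k) = deriv q := funext fun _ => deriv_add_const _
    exact ⟨q.2.contDiff.add contDiff_const, by rw [h1]; exact q.2.integral_deriv,
      by rw [h1]; exact q.2.deriv_mem, by rw [h1]; exact q.2.deriv_deriv_mem⟩⟩

theorem latticeShift_apply (k : Fin N → ℤ) (q : Phase N) (t : ℝ) :
    latticeShift k q t = q t + latticeVec k := rfl

theorem deriv_latticeShift (k : Fin N → ℤ) (q : Phase N) :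
    deriv (latticeShift k q) = deriv q := funext fun _ => deriv_add_const _

theorem translate_apply (y : ℝ) (q : Phase N) (t : ℝ) : translate y q t = q (t + y) := rfl

theorem deriv_translate (y : ℝ) (q : Phase N) :
    deriv (translate y q) = fun t => deriv q (t + y) :=
  funext fun _ => deriv_comp_add_const _ _ _

theorem deriv_deriv_translate (y : ℝ) (q : Phase N) :
    deriv (deriv (translate y q)) = fun t => deriv (deriv q) (t + y) := by
  rw [deriv_translate]
  exact funext fun t => deriv_comp_add_const _ _ _

theorem h2ulNorm_translate (f : ℝ → Config N) (y : ℝ) :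
    h2ulNorm (fun t => f (t + y)) = h2ulNorm f := by
  have h1 : (deriv fun t => f (t + y)) = fun t => deriv f (t + y) :=
    funext fun _ => deriv_comp_add_const _ _ _
  have h2 : (deriv fun t => deriv f (t + y)) = fun t => deriv (deriv f) (t + y) :=
    funext fun _ => deriv_comp_add_const _ _ _
  rw [h2ulNorm, h1, h2, l2ulNorm_translate, l2ulNorm_translate, l2ulNorm_translate, h2ulNorm]

section

variable {V : Config N → ℝ → ℝ} (hV : IsPotential V)

include hV in
theorem IsGradientSolution.translate {q : Phase N} {Q : ℝ → Phase N}
    (hQ : IsGradientSolution V q Q) :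
    IsGradientSolution V (GradientShadowing.translate (2 * Real.pi) q)
      fun s => GradientShadowing.translate (2 * Real.pi) (Q s) where
  init := by rw [hQ.init]
  mem s hs := by
    obtain ⟨h1, h2, h3⟩ := hQ.mem s hs
    have e1 : (deriv fun t => Q s (t + 2 * Real.pi) - q (t + 2 * Real.pi)) =
        fun t => (deriv fun t => Q s t - q t) (t + 2 * Real.pi) :=
      funext fun t => deriv_comp_add_const (fun t => Q s t - q t) _ _
    have e2 : (deriv fun t => (deriv fun t => Q s t - q t) (t + 2 * Real.pi)) =
        fun t => (deriv (deriv fun t => Q s t - q t)) (t + 2 * Real.pi) :=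
      funext fun _ => deriv_comp_add_const _ _ _
    refine ⟨h1.translate _, ?_, ?_⟩
    · simp only [translate_apply, e1]
      exact h2.translate _
    · simp only [translate_apply, e1, e2]
      exact h3.translate _
  continuous s hs := by
    refine (hQ.continuous s hs).congr fun r => ?_
    exact (h2ulNorm_translate (fun t => Q r t - Q s t) (2 * Real.pi)).symm
  hasDeriv s hs := by
    refine (hQ.hasDeriv s hs).congr fun h => ?_
    rw [← l2ulNorm_translate _ (2 * Real.pi)]
    simp only [translate_apply, deriv_deriv_translate]
    congr 1; ext1 t
    rw [hV.gradV_add_two_pi]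

include hV in
theorem IsGradientSolution.latticeShift {q : Phase N} {Q : ℝ → Phase N}
    (hQ : IsGradientSolution V q Q) (k : Fin N → ℤ) :
    IsGradientSolution V (GradientShadowing.latticeShift k q)
      fun s => GradientShadowing.latticeShift k (Q s) where
  init := by rw [hQ.init]
  mem s hs := by
    simp only [latticeShift_apply, add_sub_add_right_eq_sub]
    exact hQ.mem s hs
  continuous s hs := by
    simp only [latticeShift_apply, add_sub_add_right_eq_sub]
    exact hQ.continuous s hs
  hasDeriv s hs := by
    simp only [latticeShift_apply, add_sub_add_right_eq_sub, deriv_latticeShift,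
      hV.gradV_add_latticeVec]
    exact hQ.hasDeriv s hs

include hV in
theorem gradFlow_translate {s : ℝ} (hs : 0 ≤ s) (q : Phase N) :
    gradFlow V s (translate (2 * Real.pi) q) = translate (2 * Real.pi) (gradFlow V s q) :=
  gradFlow_eq hV ((gradFlow_spec hV q).translate hV) hs

include hV in
theorem gradFlow_latticeShift {s : ℝ} (hs : 0 ≤ s) (k : Fin N → ℤ) (q : Phase N) :
    gradFlow V s (latticeShift k q) = latticeShift k (gradFlow V s q) :=
  gradFlow_eq hV ((gradFlow_spec hV q).latticeShift hV k) hs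

theorem proj_eq_proj_iff {p q : Phase N} : proj p = proj q ↔ ∃ k, p = latticeShift k q := by
  refine Quotient.eq.trans ⟨?_, ?_⟩
  · rintro ⟨k, hk⟩
    refine ⟨k, Phase.ext fun t => ?_⟩
    ext i
    rw [latticeShift_apply, PiLp.add_apply, latticeVec_apply, ← hk t i]
    ring
  · rintro ⟨k, rfl⟩
    exact ⟨k, fun t i => by rw [latticeShift_apply, PiLp.add_apply, latticeVec_apply]; ring⟩

theorem proj_latticeShift (k : Fin N → ℤ) (q : Phase N) : proj (latticeShift k q) = proj q :=
  proj_eq_proj_iff.2 ⟨k, rfl⟩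

theorem proj_surjective : Function.Surjective (proj (N := N)) := Quotient.mk_surjective

theorem shift_proj (q : Phase N) : shift (proj q) = proj (translate (2 * Real.pi) q) := rfl

theorem isQuotientMap_proj : IsQuotientMap (proj (N := N)) := isQuotientMap_quotient_mk'

theorem continuous_proj : Continuous (proj (N := N)) := isQuotientMap_proj.continuous

theorem continuous_latticeShift (k : Fin N → ℤ) : Continuous (latticeShift k) := by
  refine (LipschitzWith.of_edist_le fun p q => le_of_eq ?_).continuous
  change locNorm _ = locNorm _
  simp only [latticeShift_apply, add_sub_add_right_eq_sub]

theorem isOpenMap_proj : IsOpenMap (proj (N := N)) := by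
  intro U hU
  rw [← isQuotientMap_proj.isOpen_preimage]
  have : proj ⁻¹' (proj '' U) = ⋃ k, latticeShift k ⁻¹' U := by
    ext q
    simp only [mem_preimage, mem_image, mem_iUnion]
    constructor
    · rintro ⟨p, hp, hpq⟩
      obtain ⟨k, rfl⟩ := proj_eq_proj_iff.1 hpq
      exact ⟨k, hp⟩
    · rintro ⟨k, hk⟩
      exact ⟨_, hk, proj_latticeShift k q⟩
  rw [this]
  exact isOpen_iUnion fun k => hU.preimage (continuous_latticeShift k)

instance : SecondCountableTopology (QPhase N) :=
  isQuotientMap_proj.secondCountableTopology isOpenMap_proj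

include hV in
theorem qGradFlow_proj {s : ℝ} (hs : 0 ≤ s) (q : Phase N) :
    qGradFlow V s (proj q) = proj (gradFlow V s q) := by
  obtain ⟨k, hk⟩ := proj_eq_proj_iff.1 (Quotient.out_eq (s := phaseSetoid N) (proj q))
  rw [qGradFlow, hk, gradFlow_latticeShift hV hs, proj_latticeShift]

include hV in
theorem continuous_qGradFlow {s : ℝ} (hs : 0 ≤ s) : Continuous (qGradFlow V s) := by
  rw [isQuotientMap_proj.continuous_iff]
  exact (continuous_proj.comp (continuous_gradFlow hV hs)).congr fun q =>
    (qGradFlow_proj hV hs q).symm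

include hV in
theorem qGradFlow_shift {s : ℝ} (hs : 0 ≤ s) (x : QPhase N) :
    qGradFlow V s (shift x) = shift (qGradFlow V s x) := by
  obtain ⟨q, rfl⟩ := proj_surjective x
  rw [shift_proj, qGradFlow_proj hV hs, qGradFlow_proj hV hs, shift_proj, gradFlow_translate hV hs]

end

end

end GradientShadowing

namespace GradientShadowing

noncomputable section

open scoped InnerProductSpace BoundedContinuousFunction

variable {N : ℕ}

/-! ### A weight whose derivative is a difference of translates -/

theorem cosh_div_cosh_le (t u : ℝ) (h : |t - u| ≤ 2 * Real.pi) :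
    Real.cosh t * (Real.cosh u)⁻¹ ≤ 2 * Real.exp (2 * Real.pi) := by
  have h1 := exp_neg_abs_le_inv_cosh t
  have h2 := inv_cosh_le_two_mul_exp u
  have h3 : Real.cosh t ≤ Real.exp |t| := by
    have := inv_anti₀ (Real.exp_pos _) h1
    rwa [inv_inv, Real.exp_neg, inv_inv] at this
  calc Real.cosh t * (Real.cosh u)⁻¹ ≤ Real.exp |t| * (2 * Real.exp (-|u|)) := by
        gcongr
    _ = 2 * Real.exp (|t| - |u|) := by rw [sub_eq_add_neg, Real.exp_add]; ring
    _ ≤ 2 * Real.exp (2 * Real.pi) := by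
        gcongr
        exact (abs_sub_abs_le_abs_sub t u).trans h

theorem continuous_inv_cosh : Continuous fun t : ℝ => (Real.cosh t)⁻¹ :=
  Real.continuous_cosh.inv₀ fun t => (Real.cosh_pos t).ne'

/-- The quotient of `1 / cosh`, translated by `2π`, and `1 / cosh`. -/
def shiftWeight : ℝ →ᵇ ℝ :=
  BoundedContinuousFunction.ofNormedAddCommGroup
    (fun t => Real.cosh t * (Real.cosh (t - 2 * Real.pi))⁻¹)
    (Real.continuous_cosh.mul (continuous_inv_cosh.comp (by fun_prop)))
    (2 * Real.exp (2 * Real.pi)) (by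
    intro t
    rw [Real.norm_of_nonneg (mul_nonneg (Real.cosh_pos _).le (inv_nonneg.2 (Real.cosh_pos _).le))]
    exact cosh_div_cosh_le _ _ (by rw [sub_sub_cancel, abs_of_pos Real.two_pi_pos]))

theorem shiftWeight_apply (t : ℝ) :
    shiftWeight t = Real.cosh t * (Real.cosh (t - 2 * Real.pi))⁻¹ := rfl

/-- The integral of `1 / cosh` over `[t - 2π, t]`. -/
def cellMass (t : ℝ) : ℝ := ∫ u in (t - 2 * Real.pi)..t, (Real.cosh u)⁻¹

theorem hasDerivAt_cellMass (t : ℝ) :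
    HasDerivAt cellMass ((Real.cosh t)⁻¹ - (Real.cosh (t - 2 * Real.pi))⁻¹) t := by
  have hi : ∀ a b : ℝ, IntervalIntegrable (fun u : ℝ => (Real.cosh u)⁻¹) volume a b :=
    fun a b => continuous_inv_cosh.intervalIntegrable a b
  have hF : ∀ t : ℝ, HasDerivAt (fun x => ∫ u in (0 : ℝ)..x, (Real.cosh u)⁻¹) (Real.cosh t)⁻¹ t :=
    fun t => intervalIntegral.integral_hasDerivAt_right (hi 0 t)
      (continuous_inv_cosh.stronglyMeasurableAtFilter _ _) continuous_inv_cosh.continuousAt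
  have h1 : cellMass = fun t => (∫ u in (0 : ℝ)..t, (Real.cosh u)⁻¹) -
      ∫ u in (0 : ℝ)..(t - 2 * Real.pi), (Real.cosh u)⁻¹ := by
    ext1 t
    exact (intervalIntegral.integral_interval_sub_left (hi _ _) (hi _ _)).symm
  rw [h1]
  exact (hF t).sub ((hF (t - 2 * Real.pi)).comp_sub_const t (2 * Real.pi))

theorem cosh_mul_cellMass (t : ℝ) : Real.cosh t * cellMass t =
    ∫ u in (t - 2 * Real.pi)..t, Real.cosh t * (Real.cosh u)⁻¹ := by
  rw [intervalIntegral.integral_const_mul, cellMass]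

theorem abs_sub_le_of_mem_cell {t u : ℝ} (hu : u ∈ Icc (t - 2 * Real.pi) t) :
    |t - u| ≤ 2 * Real.pi := by
  rw [abs_of_nonneg (by linarith [hu.2])]; linarith [hu.1]

theorem cosh_mul_cellMass_le (t : ℝ) :
    Real.cosh t * cellMass t ≤ 2 * Real.exp (2 * Real.pi) * (2 * Real.pi) := by
  rw [cosh_mul_cellMass]
  have h := intervalIntegral.integral_mono_on (μ := volume) (a := t - 2 * Real.pi) (b := t)
    (g := fun _ => 2 * Real.exp (2 * Real.pi)) (by linarith [Real.two_pi_pos])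
    ((continuous_inv_cosh.const_mul (Real.cosh t)).intervalIntegrable _ _)
    (continuous_const.intervalIntegrable _ _)
    (fun u hu => cosh_div_cosh_le t u (abs_sub_le_of_mem_cell hu))
  refine h.trans (le_of_eq ?_)
  rw [intervalIntegral.integral_const, smul_eq_mul]; ring

/-- A positive lower bound of the weight. -/
def cellBound : ℝ := (2 * Real.exp (2 * Real.pi))⁻¹ * (2 * Real.pi)

theorem cellBound_pos : 0 < cellBound := by
  have := Real.two_pi_pos
  unfold cellBound; positivity

theorem cellBound_le (t : ℝ) : cellBound ≤ Real.cosh t * cellMass t := by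
  rw [cosh_mul_cellMass]
  have h := intervalIntegral.integral_mono_on (μ := volume) (a := t - 2 * Real.pi) (b := t)
    (f := fun _ => (2 * Real.exp (2 * Real.pi))⁻¹) (by linarith [Real.two_pi_pos])
    (continuous_const.intervalIntegrable _ _)
    ((continuous_inv_cosh.const_mul (Real.cosh t)).intervalIntegrable _ _)
    (fun u hu => ?_)
  · refine le_trans (le_of_eq ?_) h
    rw [intervalIntegral.integral_const, smul_eq_mul, cellBound]; ring
  · have h1 := cosh_div_cosh_le u t (by rw [abs_sub_comm]; exact abs_sub_le_of_mem_cell hu)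
    have h2 : 0 < Real.cosh u * (Real.cosh t)⁻¹ :=
      mul_pos (Real.cosh_pos _) (inv_pos.2 (Real.cosh_pos _))
    have h3 := inv_anti₀ h2 h1
    rwa [mul_inv (Real.cosh u), inv_inv, mul_comm (Real.cosh u)⁻¹] at h3

/-- The energy weight, relative to `1 / cosh`. -/
def cellWeight : ℝ →ᵇ ℝ :=
  BoundedContinuousFunction.ofNormedAddCommGroup (fun t => Real.cosh t * cellMass t)
    (Real.continuous_cosh.mul
      (continuous_iff_continuousAt.2 fun t => (hasDerivAt_cellMass t).continuousAt))
    (2 * Real.exp (2 * Real.pi) * (2 * Real.pi)) (by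
    intro t
    rw [Real.norm_of_nonneg (cellBound_pos.le.trans (cellBound_le t))]
    exact cosh_mul_cellMass_le t)

theorem cellWeight_apply (t : ℝ) : cellWeight t = Real.cosh t * cellMass t := rfl

theorem hasDerivAt_cellWeight (t : ℝ) :
    HasDerivAt (fun t => cellWeight t * (Real.cosh t)⁻¹)
      ((1 - shiftWeight) t * (Real.cosh t)⁻¹) t := by
  have h : (fun t => cellWeight t * (Real.cosh t)⁻¹) = cellMass := by
    ext1 t
    have := (Real.cosh_pos t).ne'
    rw [cellWeight_apply]; field_simp
  rw [h]
  refine (hasDerivAt_cellMass t).congr_deriv ?_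
  have := (Real.cosh_pos t).ne'
  have := (Real.cosh_pos (t - 2 * Real.pi)).ne'
  change _ = (1 - Real.cosh t * (Real.cosh (t - 2 * Real.pi))⁻¹) * (Real.cosh t)⁻¹
  field_simp

theorem mulL2_sub (c d : ℝ →ᵇ ℝ) (f : L2 N) : mulL2 (c - d) f = mulL2 c f - mulL2 d f := by
  refine Lp.ext ?_
  filter_upwards [coeFn_mulL2 (c - d) f, coeFn_mulL2 c f, coeFn_mulL2 d f,
    Lp.coeFn_sub (mulL2 c f) (mulL2 d f)] with t h1 h2 h3 h4
  rw [h1, h4, Pi.sub_apply, h2, h3, BoundedContinuousFunction.sub_apply, sub_smul]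

theorem le_inner_mulL2_cellWeight (f : L2 N) :
    cellBound * ‖f‖ ^ 2 ≤ ⟪mulL2 cellWeight f, f⟫_ℝ := by
  rw [← real_inner_self_eq_norm_sq, L2.inner_def, L2.inner_def, ← integral_const_mul]
  refine integral_mono_ae ((L2.integrable_inner (𝕜 := ℝ) f f).const_mul _)
    (L2.integrable_inner (𝕜 := ℝ) _ _) ?_
  filter_upwards [coeFn_mulL2 cellWeight f] with t h
  rw [h, inner_smul_left, conj_trivial]
  exact mul_le_mul_of_nonneg_right (cellBound_le t) real_inner_self_nonneg

/-! ### The energy -/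

theorem IsPrim.smul {f g : ℝ → Config N} (h : IsPrim f g) {w w' : ℝ → ℝ}
    (hw : ∀ t, HasDerivAt w (w' t) t) (hw' : Continuous w') :
    IsPrim (fun t => w t • f t) (fun t => w' t • f t + w t • g t) := by
  have hwc : Continuous w := continuous_iff_continuousAt.2 fun t => (hw t).continuousAt
  have hl1 : LocallyIntegrable (fun t => w' t • f t) volume :=
    (hw'.smul h.continuous).locallyIntegrable
  have hl2 : LocallyIntegrable (fun t => w t • g t) volume := by
    rw [← locallyIntegrableOn_univ]
    exact (locallyIntegrableOn_univ.2 h.locallyIntegrable).continuousOn_smul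
      isOpen_univ.isLocallyClosed hwc.continuousOn
  have hl : LocallyIntegrable (fun t => w' t • f t + w t • g t) volume := hl1.add hl2
  refine ⟨hl, fun a b => ?_⟩
  refine ext_inner_right ℝ fun e => ?_
  have he : IsPrim (fun t => w t • e) (fun t => w' t • e) :=
    isPrim_of_hasDerivAt (fun t => (hw t).smul_const e) (hw'.smul continuous_const)
  have h1 := h.integral_inner he a b
  have h2 : ∀ u : ℝ → Config N, IntervalIntegrable u volume a b →
      ⟪∫ t in a..b, u t, e⟫_ℝ = ∫ t in a..b, ⟪u t, e⟫_ℝ := by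
    intro u hu
    have := ((innerSL ℝ e).intervalIntegral_comp_comm hu).symm
    simp only [innerSL_apply_apply] at this
    rw [real_inner_comm, this]
    simp only [real_inner_comm]
  rw [h2 _ (hl.intervalIntegrable' a b), inner_sub_left]
  simp only [inner_smul_left, inner_smul_right, inner_add_left, conj_trivial] at h1 ⊢
  rw [← h1]
  simp only [add_comm]

theorem inner_velL2_accL2 (p : Phase N) :
    2 * ⟪velL2 p, accL2 p⟫_ℝ = -⟪mulL2 negTanh (velL2 p), velL2 p⟫_ℝ := by
  have hw : ∀ t, HasDerivAt (fun t => (Real.cosh t)⁻¹) (negTanh t * (Real.cosh t)⁻¹) t := by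
    intro t
    have := hasDerivAt_inv_cosh t
    simpa only [BoundedContinuousFunction.coe_one, Pi.one_apply, one_mul] using this
  rw [← add_eq_zero_iff_eq_neg, two_mul, L2.inner_def, L2.inner_def, ← integral_add
    (L2.integrable_inner _ _) (L2.integrable_inner _ _), ← integral_add
    ((L2.integrable_inner _ _).add (L2.integrable_inner _ _)) (L2.integrable_inner _ _)]
  set h : ℝ → ℝ := fun t => ⟪deriv (deriv p) t, (Real.cosh t)⁻¹ • deriv p t⟫_ℝ +
    ⟪deriv p t, (negTanh t * (Real.cosh t)⁻¹) • deriv p t +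
      (Real.cosh t)⁻¹ • deriv (deriv p) t⟫_ℝ with hh
  have hae : (fun t => ⟪velL2 p t, accL2 p t⟫_ℝ + ⟪velL2 p t, accL2 p t⟫_ℝ +
      ⟪mulL2 negTanh (velL2 p) t, velL2 p t⟫_ℝ) =ᵐ[sechMeasure] fun t => Real.cosh t * h t := by
    filter_upwards [coeFn_mulL2 negTanh (velL2 p), coeFn_velL2 p, coeFn_accL2 p]
      with t h1 h2 h3
    rw [h1, h2, h3, hh]
    simp only [inner_add_right, inner_smul_left, inner_smul_right, conj_trivial]
    rw [real_inner_comm (deriv p t) (deriv (deriv p) t)]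
    have := (Real.cosh_pos t).ne'
    field_simp
    ring
  have e1 : ∀ t, (Real.cosh t)⁻¹ * (Real.cosh t * h t) = h t := fun t => by
    rw [← mul_assoc, inv_mul_cancel₀ (Real.cosh_pos t).ne', one_mul]
  have hint : Integrable h := by
    have h1 := (((L2.integrable_inner (𝕜 := ℝ) (velL2 p) (accL2 p)).add
      (L2.integrable_inner (𝕜 := ℝ) (velL2 p) (accL2 p))).add
      (L2.integrable_inner (𝕜 := ℝ) (mulL2 negTanh (velL2 p)) (velL2 p))).congr hae
    rw [integrable_sechMeasure_iff] at h1
    simpa only [e1] using h1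
  rw [integral_congr_ae hae, integral_sechMeasure]
  simp only [e1]
  have hg := p.2.isPrim_deriv.smul hw (negTanh.continuous.mul continuous_inv_cosh)
  have hlim := intervalIntegral_tendsto_integral hint tendsto_neg_atTop_atBot tendsto_id
  refine tendsto_nhds_unique hlim ?_
  have hval : ∀ R : ℝ, ∫ t in (-R)..R, h t = ⟪deriv p R, (Real.cosh R)⁻¹ • deriv p R⟫_ℝ -
      ⟪deriv p (-R), (Real.cosh (-R))⁻¹ • deriv p (-R)⟫_ℝ :=
    fun R => p.2.isPrim_deriv.integral_inner hg (-R) R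
  obtain ⟨C, hC0, hC, -⟩ := p.2.exists_bound
  have hb : ∀ t : ℝ, ‖⟪deriv p t, (Real.cosh t)⁻¹ • deriv p t⟫_ℝ‖ ≤
      C * (2 * Real.exp (-|t|) * C) := by
    intro t
    refine (norm_inner_le_norm _ _).trans ?_
    rw [norm_smul, Real.norm_of_nonneg (inv_nonneg.2 (Real.cosh_pos t).le)]
    gcongr
    · exact hC t
    · exact inv_cosh_le_two_mul_exp t
    · exact hC t
  have hlim0 : Tendsto (fun R : ℝ => C * (2 * Real.exp (-|R|) * C)) atTop (𝓝 0) := by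
    have h3 := Real.tendsto_exp_neg_atTop_nhds_zero.const_mul (C * 2 * C)
    rw [mul_zero] at h3
    refine h3.congr' ?_
    filter_upwards [eventually_ge_atTop 0] with R hR
    rw [abs_of_nonneg hR]
    ring
  have hR1 := squeeze_zero_norm hb hlim0
  have hR2 : Tendsto (fun R : ℝ => ⟪deriv p (-R), (Real.cosh (-R))⁻¹ • deriv p (-R)⟫_ℝ)
      atTop (𝓝 0) := by
    refine squeeze_zero_norm (fun R => ?_) hlim0
    have := hb (-R)
    rwa [abs_neg] at this
  have := hR1.sub hR2
  rw [sub_zero] at this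
  exact this.congr fun R => (hval R).symm

section

variable {V : Config N → ℝ → ℝ} (hV : IsPotential V)

/-- The right-hand side of the gradient equation, as an element of the Hilbert space. -/
def residual (p : Phase N) : L2 N := accL2 p - forceL2 hV p

theorem coeFn_residual (p : Phase N) :
    residual hV p =ᵐ[sechMeasure] fun t => deriv (deriv p) t - gradV V (p t) t := by
  filter_upwards [Lp.coeFn_sub (accL2 p) (forceL2 hV p), coeFn_accL2 p, coeFn_forceL2 hV p]
    with t h1 h2 h3
  rw [residual, h1, Pi.sub_apply, h2, h3]

/-- The flux of energy. -/
def energyFlux (p : Phase N) : ℝ := ⟪velL2 p, residual hV p⟫_ℝ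

theorem energyFlux_eq (p : Phase N) : energyFlux hV p =
    -⟪mulL2 negTanh (velL2 p), velL2 p⟫_ℝ / 2 - ⟪velL2 p, forceL2 hV p⟫_ℝ := by
  rw [← inner_velL2_accL2, energyFlux, residual, inner_sub_right]; ring

theorem continuous_energyFlux : Continuous (energyFlux hV) := by
  have h : energyFlux hV = fun p => -⟪mulL2 negTanh (velL2 p), velL2 p⟫_ℝ / 2 -
    ⟪velL2 p, forceL2 hV p⟫_ℝ := funext (energyFlux_eq hV)
  rw [h]
  have h1 := continuous_velL2 (N := N)
  have h2 := continuous_forceL2 hV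
  have h3 := (mulL2 (N := N) negTanh).continuous
  fun_prop

theorem integral_sech_translate (f : ℝ → ℝ) :
    ∫ t, shiftWeight t * f t ∂sechMeasure = ∫ t, f (t + 2 * Real.pi) ∂sechMeasure := by
  rw [integral_sechMeasure, integral_sechMeasure,
    ← integral_add_right_eq_self (fun t => (Real.cosh t)⁻¹ * (shiftWeight t * f t)) (2 * Real.pi)]
  congr 1; ext1 t
  have := (Real.cosh_pos (t + 2 * Real.pi)).ne'
  rw [shiftWeight_apply, add_sub_cancel_right, ← mul_assoc, ← mul_assoc, inv_mul_cancel₀ this,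
    one_mul]

theorem inner_mulL2_shiftWeight (p : Phase N) :
    ⟪mulL2 shiftWeight (velL2 p), residual hV p⟫_ℝ =
      energyFlux hV (translate (2 * Real.pi) p) := by
  have h1 : ⟪mulL2 shiftWeight (velL2 p), residual hV p⟫_ℝ = ∫ t, shiftWeight t *
      ⟪deriv p t, deriv (deriv p) t - gradV V (p t) t⟫_ℝ ∂sechMeasure := by
    rw [L2.inner_def]
    refine integral_congr_ae ?_
    filter_upwards [coeFn_mulL2 shiftWeight (velL2 p), coeFn_velL2 p, coeFn_residual hV p]
      with t h1 h2 h3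
    rw [h1, h2, h3, inner_smul_left]; rfl
  rw [h1, integral_sech_translate, energyFlux, L2.inner_def]
  refine integral_congr_ae ?_
  filter_upwards [coeFn_velL2 (translate (2 * Real.pi) p),
    coeFn_residual hV (translate (2 * Real.pi) p)] with t h1 h2
  rw [h1, h2, deriv_deriv_translate, deriv_translate, translate_apply,
    ← hV.gradV_add_two_pi (p (t + 2 * Real.pi)) t]

/-- The potential energy with respect to the weight. -/
def potentialEnergy (V : Config N → ℝ → ℝ) (p : Phase N) : ℝ :=
  ∫ t, cellWeight t * V (p t) t ∂sechMeasure

/-- The energy with respect to the weight. -/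
def energy (V : Config N → ℝ → ℝ) (p : Phase N) : ℝ :=
  ⟪mulL2 cellWeight (velL2 p), velL2 p⟫_ℝ / 2 + potentialEnergy V p

include hV in
theorem exists_bound_potential : ∃ M : ℝ, 0 ≤ M ∧ ∀ x t, |V x t| ≤ M := by
  obtain ⟨M, h0, h⟩ := hV.biperiodic.exists_bound hV.contDiff.continuous
  exact ⟨M, h0, fun x t => h (x, t)⟩

theorem norm_potentialEnergy_integrand_le {V : Config N → ℝ → ℝ} {M : ℝ} (hM : ∀ x t, |V x t| ≤ M) (p : Phase N) (t : ℝ) :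
    ‖cellWeight t * V (p t) t‖ ≤ ‖cellWeight‖ * M := by
  rw [norm_mul]
  exact mul_le_mul (cellWeight.norm_coe_le_norm t) (hM _ _) (norm_nonneg _) (norm_nonneg _)

include hV in
theorem integrable_potentialEnergy (p : Phase N) :
    Integrable (fun t => cellWeight t * V (p t) t) sechMeasure := by
  obtain ⟨M, h0, hM⟩ := exists_bound_potential hV
  have hc : Continuous fun t => V (p t) t :=
    hV.contDiff.continuous.comp (f := fun t => (p t, t))
      (p.2.contDiff.continuous.prodMk continuous_id)
  exact Integrable.of_bound (cellWeight.continuous.mul hc).aestronglyMeasurable _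
    (Eventually.of_forall fun t => norm_potentialEnergy_integrand_le hM p t)

theorem potentialEnergy_taylor {L : ℝ}
    (hL : ∀ p p' : Config N × ℝ, ‖gradV V p.1 p.2 - gradV V p'.1 p'.2‖ ≤ L * ‖p - p'‖)
    (p q : Phase N) : |potentialEnergy V p - potentialEnergy V q -
      ⟪mulL2 cellWeight (forceL2 hV q), posL2 p - posL2 q⟫_ℝ| ≤
        ‖cellWeight‖ * L * ‖posL2 p - posL2 q‖ ^ 2 := by
  have h1 : ⟪mulL2 cellWeight (forceL2 hV q), posL2 p - posL2 q⟫_ℝ =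
      ∫ t, cellWeight t * ⟪gradV V (q t) t, p t - q t⟫_ℝ ∂sechMeasure := by
    rw [L2.inner_def]
    refine integral_congr_ae ?_
    filter_upwards [coeFn_mulL2 cellWeight (forceL2 hV q), coeFn_posL2 p, coeFn_posL2 q,
      coeFn_forceL2 hV q, Lp.coeFn_sub (posL2 p) (posL2 q)] with t h1 h2 h3 h4 h5
    rw [h5, Pi.sub_apply, h1, h2, h3, h4, inner_smul_left]; rfl
  have i1 : Integrable (fun t => cellWeight t * ⟪gradV V (q t) t, p t - q t⟫_ℝ) sechMeasure := by
    refine (L2.integrable_inner (𝕜 := ℝ) (mulL2 cellWeight (forceL2 hV q))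
      (posL2 p - posL2 q)).congr ?_
    filter_upwards [coeFn_mulL2 cellWeight (forceL2 hV q), coeFn_posL2 p, coeFn_posL2 q,
      coeFn_forceL2 hV q, Lp.coeFn_sub (posL2 p) (posL2 q)] with t h1 h2 h3 h4 h5
    rw [h5, Pi.sub_apply, h1, h2, h3, h4, inner_smul_left]; rfl
  have h2 : ‖posL2 p - posL2 q‖ ^ 2 = ∫ t, ‖p t - q t‖ ^ 2 ∂sechMeasure := by
    rw [← real_inner_self_eq_norm_sq, L2.inner_def]
    refine integral_congr_ae ?_
    filter_upwards [coeFn_posL2 p, coeFn_posL2 q, Lp.coeFn_sub (posL2 p) (posL2 q)]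
      with t h2 h3 h5
    rw [h5, Pi.sub_apply, h2, h3, real_inner_self_eq_norm_sq]
  have i2 : Integrable (fun t => ‖p t - q t‖ ^ 2) sechMeasure :=
    (memLp_two_iff_integrable_sq_norm (p.2.memLp.sub q.2.memLp).1).1 (p.2.memLp.sub q.2.memLp)
  have hP := integrable_potentialEnergy hV p
  have hQ := integrable_potentialEnergy hV q
  have hPQ : Integrable (fun t => cellWeight t * V (p t) t - cellWeight t * V (q t) t)
    sechMeasure := hP.sub hQ
  rw [h1, h2, potentialEnergy, potentialEnergy, ← integral_sub hP hQ,
    ← integral_sub hPQ i1, ← integral_const_mul]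
  rw [← Real.norm_eq_abs]
  refine norm_integral_le_of_norm_le (i2.const_mul _) (Eventually.of_forall fun t => ?_)
  have h3 := hV.taylor hL (q t) (p t) t
  have h4 : cellWeight t * V (p t) t - cellWeight t * V (q t) t -
      cellWeight t * ⟪gradV V (q t) t, p t - q t⟫_ℝ =
      cellWeight t * (V (p t) t - V (q t) t - ⟪gradV V (q t) t, p t - q t⟫_ℝ) := by ring
  rw [h4, norm_mul, mul_assoc]
  exact mul_le_mul (cellWeight.norm_coe_le_norm t) h3 (norm_nonneg _) (norm_nonneg _)

include hV in
theorem continuous_energy : Continuous (energy V) := by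
  obtain ⟨L, hL0, -, hL⟩ := hV.exists_lipschitz_gradV
  have h1 := continuous_velL2 (N := N)
  have h3 := (mulL2 (N := N) cellWeight).continuous
  have h4 := continuous_posL2 (N := N)
  refine Continuous.add (by fun_prop) (continuous_iff_continuousAt.2 fun q => ?_)
  have h5 : Tendsto (fun p => ‖cellWeight‖ * L * ‖posL2 p - posL2 q‖ ^ 2 +
      |⟪mulL2 cellWeight (forceL2 hV q), posL2 p - posL2 q⟫_ℝ|) (𝓝 q) (𝓝 0) := by
    have h6 : Continuous fun p => ‖cellWeight‖ * L * ‖posL2 p - posL2 q‖ ^ 2 +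
      |⟪mulL2 cellWeight (forceL2 hV q), posL2 p - posL2 q⟫_ℝ| := by fun_prop
    simpa using h6.tendsto q
  refine tendsto_iff_norm_sub_tendsto_zero.2 (squeeze_zero (fun _ => norm_nonneg _)
    (fun p => ?_) h5)
  have h7 := potentialEnergy_taylor hV hL p q
  have h8 := abs_add_le (potentialEnergy V p - potentialEnergy V q -
      ⟪mulL2 cellWeight (forceL2 hV q), posL2 p - posL2 q⟫_ℝ)
      ⟪mulL2 cellWeight (forceL2 hV q), posL2 p - posL2 q⟫_ℝ
  rw [sub_add_cancel] at h8
  rw [Real.norm_eq_abs]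
  linarith

/-- The dissipation. -/
def dissipation (p : Phase N) : ℝ := ⟪mulL2 cellWeight (residual hV p), residual hV p⟫_ℝ

theorem IsGradientSolution.hasDerivAt_energy {q : Phase N} {Q : ℝ → Phase N}
    (hQ : IsGradientSolution V q Q) {s : ℝ} (hs : 0 < s) :
    HasDerivAt (fun s => energy V (Q s)) (-dissipation hV (Q s) -
      (energyFlux hV (Q s) - energyFlux hV (GradientShadowing.translate (2 * Real.pi) (Q s)))) s := by
  obtain ⟨L, hL0, -, hL⟩ := hV.exists_lipschitz_gradV
  have hx := hQ.hasDerivAt_posL2 hV hs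
  set z : ℝ → L2 N := fun s =>
    -(mulL2 cellWeight (accL2 (Q s)) + mulL2 (1 - shiftWeight) (velL2 (Q s))) with hz
  have cz : ContinuousOn z (Ici 0) :=
    (((mulL2 cellWeight).continuous.comp_continuousOn hQ.continuousOn_accL2).add
      ((mulL2 _).continuous.comp_continuousOn hQ.continuousOn_velL2)).neg
  have h1 := hasDerivAt_inner_of_parts (x := fun s => velL2 (Q s)) (z := z)
    (y := fun s => posL2 (Q s)) (inner_mulL2_comm cellWeight)
    (cz.continuousAt (Ici_mem_nhds hs)) hx fun r r' => by
      rw [inner_mulL2_velL2 hasDerivAt_cellWeight, hz, inner_neg_left]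
  have h2 : HasDerivAt (fun s => potentialEnergy V (Q s))
      ⟪mulL2 cellWeight (forceL2 hV (Q s)), accL2 (Q s) - forceL2 hV (Q s)⟫_ℝ s := by
    have e1 : HasDerivAt (fun r => ⟪mulL2 cellWeight (forceL2 hV (Q s)), posL2 (Q r)⟫_ℝ)
        ⟪mulL2 cellWeight (forceL2 hV (Q s)), accL2 (Q s) - forceL2 hV (Q s)⟫_ℝ s :=
      ((hasDerivAt_const s (mulL2 cellWeight (forceL2 hV (Q s)))).inner ℝ hx).congr_deriv
        (by rw [inner_zero_left, add_zero])
    have e2 : HasDerivAt (fun r => potentialEnergy V (Q r) -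
        ⟪mulL2 cellWeight (forceL2 hV (Q s)), posL2 (Q r)⟫_ℝ) 0 s := by
      rw [hasDerivAt_iff_isLittleO]
      have e3 : (fun r => potentialEnergy V (Q r) - ⟪mulL2 cellWeight (forceL2 hV (Q s)),
          posL2 (Q r)⟫_ℝ - (potentialEnergy V (Q s) - ⟪mulL2 cellWeight (forceL2 hV (Q s)),
          posL2 (Q s)⟫_ℝ) - (r - s) • (0 : ℝ)) =O[𝓝 s] fun r => (r - s) ^ 2 := by
        have e4 : (fun r => ‖posL2 (Q r) - posL2 (Q s)‖ ^ 2) =O[𝓝 s] fun r => (r - s) ^ 2 :=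
          hx.isBigO_sub.norm_left.pow 2
        refine (Asymptotics.IsBigO.of_bound (‖cellWeight‖ * L)
          (Eventually.of_forall fun r => ?_)).trans e4
        have e5 := potentialEnergy_taylor hV hL (Q r) (Q s)
        rw [inner_sub_right] at e5
        rw [Real.norm_of_nonneg (sq_nonneg _), Real.norm_eq_abs, smul_zero, sub_zero]
        refine le_trans (le_of_eq ?_) e5
        congr 1; ring
      refine e3.trans_isLittleO ?_
      simpa using Asymptotics.isLittleO_pow_sub_sub s (m := 2) (by norm_num)
    refine ((e2.add e1).congr_deriv (zero_add _)).congr_of_eventuallyEq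
      (Eventually.of_forall fun r => ?_)
    simp
  refine ((h1.div_const 2).add h2).congr_deriv ?_
  rw [← inner_mulL2_shiftWeight, energyFlux, dissipation]
  change 2 * ⟪z s, residual hV (Q s)⟫_ℝ / 2 +
    ⟪mulL2 cellWeight (forceL2 hV (Q s)), residual hV (Q s)⟫_ℝ = _
  simp only [hz, mulL2_sub, mulL2_one]
  have e6 : mulL2 cellWeight (residual hV (Q s)) = mulL2 cellWeight (accL2 (Q s)) -
    mulL2 cellWeight (forceL2 hV (Q s)) := by rw [residual, map_sub]
  rw [e6]
  simp only [inner_neg_left, inner_add_left, inner_sub_left]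
  ring

end

end

end GradientShadowing

namespace GradientShadowing

noncomputable section

open scoped InnerProductSpace BoundedContinuousFunction

variable {N : ℕ}

/-! ### Bounded paths -/

/-- The velocity is bounded by `A` in `H¹_ul`, component by component. -/
def HasBound (A : ℝ≥0) (p : Phase N) : Prop :=
  l2ulNorm (deriv p) ≤ A ∧ l2ulNorm (deriv (deriv p)) ≤ A

theorem hasBound_of_h1ulNorm {A : ℝ≥0} {p : Phase N} (h : h1ulNorm (deriv p) ≤ A) :
    HasBound A p := by
  have h0 : ∀ a b : ℝ≥0∞, a ^ 2 ≤ b → a ≤ b ^ (1 / 2 : ℝ) := by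
    intro a b hab
    calc a = (a ^ 2) ^ (1 / 2 : ℝ) := by
          rw [← ENNReal.rpow_two, ← ENNReal.rpow_mul]; norm_num
      _ ≤ _ := ENNReal.rpow_le_rpow hab (by norm_num)
  exact ⟨(h0 _ _ le_self_add).trans h, (h0 _ _ le_add_self).trans h⟩

theorem l2ulNorm_le_of_tendsto {ι : Type*} {l : Filter ι} [l.NeBot] {f : ι → ℝ → Config N}
    {g : ℝ → Config N} (hf : ∀ i, AEStronglyMeasurable (f i) volume)
    (hg : AEStronglyMeasurable g volume) {A : ℝ≥0∞}
    (h : Tendsto (fun i => l2ulNorm fun t => f i t - g t) l (𝓝 0))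
    (hA : ∃ᶠ i in l, l2ulNorm (f i) ≤ A) : l2ulNorm g ≤ A := by
  refine ENNReal.le_of_forall_pos_le_add fun ε hε _ => ?_
  have h1 := ENNReal.tendsto_nhds_zero.1 h ε (by exact_mod_cast hε)
  obtain ⟨i, hi, hi'⟩ := (hA.and_eventually h1).exists
  have h2 := l2ulNorm_sub_le (hf i) ((hf i).sub hg)
  have h3 : (fun t => f i t - (f i - g) t) = g := by ext1 t; simp
  rw [h3] at h2
  exact h2.trans (add_le_add hi hi')

theorem IsGradientSolution.hasBound_of_rat {V : Config N → ℝ → ℝ} {q : Phase N}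
    {Q : ℝ → Phase N} (hQ : IsGradientSolution V q Q) {A : ℝ≥0}
    (h : ∀ r : ℚ, 0 ≤ (r : ℝ) → HasBound A (Q r)) {s : ℝ} (hs : 0 ≤ s) : HasBound A (Q s) := by
  have hfreq : ∃ᶠ r in 𝓝[Ici 0] s, HasBound A (Q r) := by
    rw [frequently_nhdsWithin_iff, Filter.frequently_iff]
    intro U hU
    obtain ⟨δ, hδ, hU⟩ := Metric.mem_nhds_iff.1 hU
    obtain ⟨r, hr1, hr2⟩ := exists_rat_btwn (show s < s + δ by linarith)
    refine ⟨r, hU ?_, h r (by linarith), mem_Ici.2 (by linarith)⟩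
    rw [Metric.mem_ball, Real.dist_eq, abs_lt]
    constructor <;> linarith
  have : (𝓝[Ici 0] s).NeBot := mem_closure_iff_nhdsWithin_neBot.1 (subset_closure (mem_Ici.2 hs))
  constructor
  · refine l2ulNorm_le_of_tendsto (fun r => (Q r).2.deriv_mem.aestronglyMeasurable)
      (Q s).2.deriv_mem.aestronglyMeasurable ?_ (hfreq.mono fun r hr => hr.1)
    refine tendsto_of_tendsto_of_tendsto_of_le_of_le tendsto_const_nhds (hQ.continuous s hs)
      (fun _ => zero_le) fun r => ?_
    simp only [← Phase.deriv_sub]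
    exact (l2ulNorm_le_h2ulNorm _).2.1
  · refine l2ulNorm_le_of_tendsto (fun r => (Q r).2.deriv_deriv_mem.aestronglyMeasurable)
      (Q s).2.deriv_deriv_mem.aestronglyMeasurable ?_ (hfreq.mono fun r hr => hr.2)
    refine tendsto_of_tendsto_of_tendsto_of_le_of_le tendsto_const_nhds (hQ.continuous s hs)
      (fun _ => zero_le) fun r => ?_
    rw [l2ulNorm_congr (Phase.deriv_deriv_sub (Q r) (Q s)).symm]
    exact (l2ulNorm_le_h2ulNorm _).2.2

theorem eLpNorm_sech_le_of_l2ulNorm {f : ℝ → Config N} {A : ℝ≥0} (h : l2ulNorm f ≤ A) :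
    eLpNorm f 2 sechMeasure ≤ ENNReal.ofReal (2 * A) := by
  refine (eLpNorm_sechMeasure_le f).trans ?_
  rw [ENNReal.ofReal_mul (by norm_num), ENNReal.ofReal_coe_nnreal]
  simp only [ENNReal.ofReal_ofNat]
  gcongr
  exact (eLpNorm_le_l2ulNorm f 0).trans h

theorem HasBound.norm_velL2_le {A : ℝ≥0} {p : Phase N} (h : HasBound A p) :
    ‖velL2 p‖ ≤ 2 * A := by
  rw [velL2, Lp.norm_toLp]
  exact ENNReal.toReal_le_of_le_ofReal (by positivity) (eLpNorm_sech_le_of_l2ulNorm h.1)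

theorem HasBound.norm_accL2_le {A : ℝ≥0} {p : Phase N} (h : HasBound A p) :
    ‖accL2 p‖ ≤ 2 * A := by
  rw [accL2, Lp.norm_toLp]
  exact ENNReal.toReal_le_of_le_ofReal (by positivity) (eLpNorm_sech_le_of_l2ulNorm h.2)

section

variable {V : Config N → ℝ → ℝ} (hV : IsPotential V)

theorem exists_norm_forceL2_le : ∃ M : ℝ, 0 ≤ M ∧ ∀ p : Phase N, ‖forceL2 hV p‖ ≤ M := by
  obtain ⟨M, hM0, hM⟩ := hV.exists_bound_gradV
  refine ⟨_, ?_, fun p => Lp.norm_le_of_ae_bound hM0 ?_⟩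
  · positivity
  · filter_upwards [coeFn_forceL2 hV p] with t h
    rw [h]; exact hM _ _

theorem exists_bound_energy (A : ℝ≥0) : ∃ C : ℝ, ∀ p : Phase N, HasBound A p →
    |energy V p| ≤ C ∧ |energyFlux hV p| ≤ C ∧ |dissipation hV p| ≤ C := by
  obtain ⟨F, hF0, hF⟩ := exists_norm_forceL2_le hV
  obtain ⟨M, hM0, hM⟩ := exists_bound_potential hV
  set c := ‖mulL2 (N := N) cellWeight‖ with hc
  set R := 2 * (A : ℝ) + F with hR
  set C1 := c * (2 * A) * (2 * A) / 2 + ‖cellWeight‖ * M * sechMeasure.real univ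
  refine ⟨max C1 (max (2 * A * R) (c * R * R)), fun p hp => ?_⟩
  have hr : ‖residual hV p‖ ≤ R :=
    (norm_sub_le _ _).trans (add_le_add hp.norm_accL2_le (hF p))
  have hv := hp.norm_velL2_le
  refine ⟨le_max_of_le_left ?_, le_max_of_le_right (le_max_of_le_left ?_),
    le_max_of_le_right (le_max_of_le_right ?_)⟩
  · refine (abs_add_le _ _).trans (add_le_add ?_ ?_)
    · rw [abs_div, abs_two]
      gcongr
      refine (abs_real_inner_le_norm _ _).trans ?_
      exact mul_le_mul (((mulL2 cellWeight).le_opNorm _).trans (by gcongr)) hv (norm_nonneg _)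
        (by positivity)
    · exact norm_integral_le_of_norm_le_const
        (Eventually.of_forall fun t => norm_potentialEnergy_integrand_le hM p t)
  · exact (abs_real_inner_le_norm _ _).trans (by gcongr)
  · refine (abs_real_inner_le_norm _ _).trans ?_
    exact mul_le_mul (((mulL2 cellWeight).le_opNorm _).trans (by gcongr)) hr (norm_nonneg _)
      (by positivity)

theorem velL2_latticeShift (k : Fin N → ℤ) (p : Phase N) :
    velL2 (latticeShift k p) = velL2 p := by
  refine MemLp.toLp_congr _ _ (Eventually.of_forall fun t => ?_)
  rw [deriv_latticeShift]

theorem residual_latticeShift (k : Fin N → ℤ) (p : Phase N) :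
    residual hV (latticeShift k p) = residual hV p := by
  refine congrArg₂ (· - ·) (MemLp.toLp_congr _ _ (Eventually.of_forall fun t => ?_))
    (MemLp.toLp_congr _ _ (Eventually.of_forall fun t => ?_))
  · rw [deriv_latticeShift]
  · change gradV V (p t + latticeVec k) t = gradV V (p t) t
    exact hV.gradV_add_latticeVec _ _ _

include hV in
theorem energy_latticeShift (k : Fin N → ℤ) (p : Phase N) :
    energy V (latticeShift k p) = energy V p := by
  rw [energy, velL2_latticeShift, energy, potentialEnergy, potentialEnergy]
  congr 3; ext1 t
  rw [latticeShift_apply]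
  congr 1
  simpa using hV.biperiodic (p t) t k 0

theorem energyFlux_latticeShift (k : Fin N → ℤ) (p : Phase N) :
    energyFlux hV (latticeShift k p) = energyFlux hV p := by
  rw [energyFlux, velL2_latticeShift, residual_latticeShift, energyFlux]

theorem dissipation_latticeShift (k : Fin N → ℤ) (p : Phase N) :
    dissipation hV (latticeShift k p) = dissipation hV p := by
  rw [dissipation, residual_latticeShift, dissipation]

/-! ### Averages over the quotient -/

/-- The function on the quotient that is induced by a function on the phase space. -/
def descend (f : Phase N → ℝ) (x : QPhase N) : ℝ := f (Quotient.out x)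

theorem descend_proj {f : Phase N → ℝ} (hf : ∀ k p, f (latticeShift k p) = f p) (p : Phase N) :
    descend f (proj p) = f p := by
  obtain ⟨k, hk⟩ := proj_eq_proj_iff.1 (Quotient.out_eq (s := phaseSetoid N) (proj p))
  rw [descend, hk, hf]

theorem continuous_descend {f : Phase N → ℝ} (hf : ∀ k p, f (latticeShift k p) = f p)
    (hc : Continuous f) : Continuous (descend f) := by
  rw [isQuotientMap_proj.continuous_iff]
  exact hc.congr fun p => (descend_proj hf p).symm

theorem locNorm_translate_le (f : ℝ → Config N) (y : ℝ) :
    locNorm (fun t => f (t + y)) ≤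
      ENNReal.ofReal (Real.exp |y|) ^ (1 / 2 : ℝ) * locNorm f := by
  rw [locNorm, locNorm, ← ENNReal.mul_rpow_of_nonneg _ _ (by norm_num : (0 : ℝ) ≤ 1 / 2)]
  refine ENNReal.rpow_le_rpow ?_ (by norm_num)
  rw [← lintegral_const_mul' _ _ ENNReal.ofReal_ne_top,
    ← lintegral_add_right_eq_self (fun t => ENNReal.ofReal (Real.exp |y|) *
      (ENNReal.ofReal (Real.exp (-|t|)) * (‖f t‖ₑ ^ 2 + ‖deriv f t‖ₑ ^ 2))) y]
  refine lintegral_mono fun t => ?_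
  dsimp only
  rw [deriv_comp_add_const, ← mul_assoc, ← ENNReal.ofReal_mul (Real.exp_nonneg _), ← Real.exp_add]
  gcongr
  linarith [abs_add_le t y]

theorem continuous_translate (y : ℝ) : Continuous (translate (N := N) y) := by
  have h : LipschitzWith (Real.toNNReal (Real.exp |y|) ^ (1 / 2 : ℝ)) (translate (N := N) y) := by
    intro p q
    rw [ENNReal.coe_rpow_of_nonneg _ (by norm_num)]
    exact locNorm_translate_le (fun t => p t - q t) y
  exact h.continuous

theorem continuous_shift : Continuous (shift (N := N)) := by
  rw [isQuotientMap_proj.continuous_iff]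
  exact continuous_proj.comp (continuous_translate _)

variable {μ : Measure (QPhase N)} (hμ : IsInvariantProb shift μ) {A : ℝ≥0}
  (hbound : ∀ s : ℝ, 0 ≤ s → ∀ q : Phase N,
      proj q ∈ (μ.map (qGradFlow V s)).support → h1ulNorm (deriv q) ≤ A)

include hV hbound in
theorem ae_hasBound : ∀ᵐ x ∂μ, ∀ p, proj p = x → ∀ s, 0 ≤ s → HasBound A (gradFlow V s p) := by
  have h1 : ∀ r : ℚ, ∀ᵐ x ∂μ, 0 ≤ (r : ℝ) → ∀ p, proj p = x → HasBound A (gradFlow V r p) := by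
    intro r
    rcases lt_or_ge (r : ℝ) 0 with hr | hr
    · exact Eventually.of_forall fun x h => absurd h (not_le.2 hr)
    · have h2 := ae_of_ae_map (continuous_qGradFlow hV hr).measurable.aemeasurable
        (Measure.support_mem_ae (μ := μ.map (qGradFlow V r)))
      filter_upwards [h2] with x hx _ p hp
      refine hasBound_of_h1ulNorm (hbound r hr _ ?_)
      rw [← qGradFlow_proj hV hr, hp]
      exact hx
  filter_upwards [ae_all_iff.2 h1] with x hx p hp s hs
  exact (gradFlow_spec hV p).hasBound_of_rat (fun r hr => hx r hr p hp) hs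

/-- The mean energy at time `s`. -/
def meanEnergy (V : Config N → ℝ → ℝ) (μ : Measure (QPhase N)) (s : ℝ) : ℝ :=
  ∫ x, descend (energy V) (qGradFlow V s x) ∂μ

/-- The mean dissipation at time `s`. -/
def meanDissipation (μ : Measure (QPhase N)) (s : ℝ) : ℝ :=
  ∫ x, descend (dissipation hV) (qGradFlow V s x) ∂μ

include hμ hbound in
theorem hasDerivAt_meanEnergy {s : ℝ} (hs : 0 < s) :
    Integrable (fun x => descend (dissipation hV) (qGradFlow V s x)) μ ∧
      HasDerivAt (meanEnergy V μ) (-meanDissipation hV μ s) s := by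
  have := hμ.isProbabilityMeasure
  obtain ⟨C, hC⟩ := exists_bound_energy hV A
  have hb := ae_hasBound hV hbound
  have hmeas : ∀ s, 0 ≤ s → Measurable fun x => descend (energy V) (qGradFlow V s x) :=
    fun s hs => ((continuous_descend (energy_latticeShift hV) (continuous_energy hV)).comp
      (continuous_qGradFlow hV hs)).measurable
  have hE : ∀ p s, 0 ≤ s → descend (energy V) (qGradFlow V s (proj p)) =
      energy V (gradFlow V s p) := fun p s hs => by
    rw [qGradFlow_proj hV hs, descend_proj (energy_latticeShift hV)]
  have hD : ∀ p s, 0 ≤ s → descend (dissipation hV) (qGradFlow V s (proj p)) =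
      dissipation hV (gradFlow V s p) := fun p s hs => by
    rw [qGradFlow_proj hV hs, descend_proj (dissipation_latticeShift hV)]
  have hF : ∀ p s, 0 ≤ s → descend (energyFlux hV) (qGradFlow V s (proj p)) =
      energyFlux hV (gradFlow V s p) := fun p s hs => by
    rw [qGradFlow_proj hV hs, descend_proj (energyFlux_latticeShift hV)]
  have hF' : ∀ p s, 0 ≤ s → descend (energyFlux hV) (qGradFlow V s (shift (proj p))) =
      energyFlux hV (translate (2 * Real.pi) (gradFlow V s p)) := fun p s hs => by
    rw [shift_proj, hF _ _ hs, gradFlow_translate hV hs]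
  set F' : ℝ → QPhase N → ℝ := fun s x => -descend (dissipation hV) (qGradFlow V s x) -
    (descend (energyFlux hV) (qGradFlow V s x) -
      descend (energyFlux hV) (qGradFlow V s (shift x))) with hF'_def
  have hmF : Measurable fun x => descend (energyFlux hV) (qGradFlow V s x) :=
    ((continuous_descend (energyFlux_latticeShift hV) (continuous_energyFlux hV)).comp
      (continuous_qGradFlow hV hs.le)).measurable
  have hiF : Integrable (fun x => descend (energyFlux hV) (qGradFlow V s x)) μ := by
    refine Integrable.of_bound hmF.aestronglyMeasurable C ?_
    filter_upwards [hb] with x hx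
    obtain ⟨p, rfl⟩ := proj_surjective x
    rw [hF _ _ hs.le]
    exact (hC _ (hx p rfl s hs.le)).2.1
  have hiF' : Integrable (fun x => descend (energyFlux hV) (qGradFlow V s (shift x))) μ :=
    hμ.measurePreserving.integrable_comp_of_integrable hiF
  have hzero : ∫ x, (descend (energyFlux hV) (qGradFlow V s x) -
      descend (energyFlux hV) (qGradFlow V s (shift x))) ∂μ = 0 := by
    rw [integral_sub hiF hiF', sub_eq_zero]
    have h1 := integral_map (μ := μ) hμ.measurePreserving.measurable.aemeasurable
      (f := fun x => descend (energyFlux hV) (qGradFlow V s x))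
      hmF.aestronglyMeasurable
    rw [hμ.measurePreserving.map_eq] at h1
    exact h1
  have hder : ∀ p r, 0 < r → HasDerivAt
      (fun r => descend (energy V) (qGradFlow V r (proj p))) (F' r (proj p)) r := by
    intro p r hr
    have h1 := (gradFlow_spec hV p).hasDerivAt_energy hV hr
    simp only [hF'_def]
    rw [hD p r hr.le, hF p r hr.le, hF' p r hr.le]
    refine h1.congr_of_eventuallyEq ?_
    filter_upwards [Ici_mem_nhds hr] with u hu
    exact hE p u hu
  have hF'b : ∀ᵐ x ∂μ, ∀ r ∈ Metric.ball s s, ‖F' r x‖ ≤ 3 * C := by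
    filter_upwards [hb, hμ.measurePreserving.quasiMeasurePreserving.ae hb] with x hx hx' r hr
    have hr0 : 0 < r := by
      rw [Metric.mem_ball, Real.dist_eq, abs_lt] at hr; linarith
    obtain ⟨p, rfl⟩ := proj_surjective x
    simp only [hF'_def]
    rw [hD p r hr0.le, hF p r hr0.le, hF' p r hr0.le]
    have h1 := (hC _ (hx p rfl r hr0.le))
    have h2 := (hC _ (hx' _ (shift_proj p).symm r hr0.le)).2.1
    rw [gradFlow_translate hV hr0.le] at h2
    have h3 := abs_le.1 h1.2.1
    have h4 := abs_le.1 h1.2.2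
    have h5 := abs_le.1 h2
    rw [Real.norm_eq_abs, abs_le]
    constructor <;> linarith
  have hF'm : AEStronglyMeasurable (F' s) μ := by
    refine aestronglyMeasurable_of_tendsto_ae atTop (f := fun (n : ℕ) x =>
      ((1 / ((n : ℝ) + 1)))⁻¹ • (descend (energy V) (qGradFlow V (s + 1 / ((n : ℝ) + 1)) x) -
        descend (energy V) (qGradFlow V s x))) (fun n => ?_) (Eventually.of_forall fun x => ?_)
    · have h1 := hmeas (s + 1 / ((n : ℝ) + 1)) (by positivity)
      have h2 := hmeas s hs.le
      exact ((h1.sub h2).const_smul (1 / ((n : ℝ) + 1))⁻¹).aestronglyMeasurable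
    · obtain ⟨p, rfl⟩ := proj_surjective x
      have h1 := hasDerivAt_iff_tendsto_slope_zero.1 (hder p s hs)
      refine h1.comp (tendsto_nhdsWithin_iff.2 ⟨tendsto_one_div_add_atTop_nhds_zero_nat, ?_⟩)
      exact Eventually.of_forall fun n => by
        have : (0 : ℝ) < 1 / ((n : ℝ) + 1) := by positivity
        exact this.ne'
  have key := hasDerivAt_integral_of_dominated_loc_of_deriv_le (μ := μ)
    (F := fun s x => descend (energy V) (qGradFlow V s x)) (F' := F') (x₀ := s)
    (bound := fun _ => 3 * C) (s := Metric.ball s s) (Metric.ball_mem_nhds s hs)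
    (by
      filter_upwards [Ici_mem_nhds hs] with u hu
      exact (hmeas u hu).aestronglyMeasurable)
    (by
      refine Integrable.of_bound (hmeas s hs.le).aestronglyMeasurable C ?_
      filter_upwards [hb] with x hx
      obtain ⟨p, rfl⟩ := proj_surjective x
      rw [hE _ _ hs.le]
      exact (hC _ (hx p rfl s hs.le)).1) hF'm hF'b (integrable_const _)
    (Eventually.of_forall fun x r hr => by
      have hr0 : 0 < r := by
        rw [Metric.mem_ball, Real.dist_eq, abs_lt] at hr; linarith
      obtain ⟨p, rfl⟩ := proj_surjective x
      exact hder p r hr0)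
  have hiD : Integrable (fun x => descend (dissipation hV) (qGradFlow V s x)) μ := by
    refine ((key.1.add (hiF.sub hiF')).neg).congr (Eventually.of_forall fun x => ?_)
    simp only [hF'_def, Pi.neg_apply, Pi.add_apply, Pi.sub_apply]
    ring
  refine ⟨hiD, key.2.congr_deriv ?_⟩
  simp only [hF'_def]
  have hneg : Integrable (fun x => -descend (dissipation hV) (qGradFlow V s x)) μ := hiD.neg
  have hdiff : Integrable (fun x => descend (energyFlux hV) (qGradFlow V s x) -
      descend (energyFlux hV) (qGradFlow V s (shift x))) μ := hiF.sub hiF'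
  rw [integral_sub hneg hdiff, hzero, sub_zero]
  simp only [integral_neg, meanDissipation]

include hμ hbound in
theorem exists_tendsto_meanDissipation : ∃ s : ℕ → ℝ, (∀ n, 0 < s n) ∧
    Tendsto (fun n => meanDissipation hV μ (s n)) atTop (𝓝 0) := by
  have := hμ.isProbabilityMeasure
  have hder := fun s hs => (hasDerivAt_meanEnergy hV hμ hbound (s := s) hs).2
  obtain ⟨C, hC⟩ := exists_bound_energy hV A
  have hlow : ∀ s, 0 ≤ s → -C ≤ meanEnergy V μ s := by
    intro s hs
    have h1 : |meanEnergy V μ s| ≤ C := by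
      rw [← mul_one C, ← probReal_univ (μ := μ)]
      refine norm_integral_le_of_norm_le_const (μ := μ)
        (f := fun x => descend (energy V) (qGradFlow V s x)) ?_
      filter_upwards [ae_hasBound hV hbound] with x hx
      obtain ⟨p, rfl⟩ := proj_surjective x
      rw [qGradFlow_proj hV hs, descend_proj (energy_latticeShift hV)]
      exact (hC _ (hx p rfl s hs)).1
    exact (abs_le.1 h1).1
  have hD0 : ∀ s, 0 ≤ meanDissipation hV μ s := fun s =>
    integral_nonneg fun x => (mul_nonneg cellBound_pos.le (sq_nonneg _)).trans
      (le_inner_mulL2_cellWeight _)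
  have hmvt : ∀ n : ℕ, ∃ s : ℝ, 0 < s ∧ meanDissipation hV μ s =
      meanEnergy V μ (n + 1) - meanEnergy V μ (n + 2) := by
    intro n
    have hn : (0 : ℝ) ≤ n := Nat.cast_nonneg n
    obtain ⟨s, hs, h⟩ := exists_hasDerivAt_eq_slope (meanEnergy V μ)
      (fun s => -meanDissipation hV μ s) (show (n + 1 : ℝ) < n + 2 by linarith)
      (fun s hs => (hder s (by linarith [hs.1])).continuousAt.continuousWithinAt)
      (fun s hs => hder s (by linarith [hs.1]))
    refine ⟨s, by linarith [hs.1], ?_⟩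
    have : (n + 2 - (n + 1) : ℝ) = 1 := by ring
    rw [this, div_one] at h
    linarith
  choose s hs hs' using hmvt
  refine ⟨s, hs, ?_⟩
  simp only [hs']
  have hanti : Antitone fun n : ℕ => meanEnergy V μ (n + 1) := by
    refine antitone_nat_of_succ_le fun n => ?_
    have := hD0 (s n)
    rw [hs'] at this
    push_cast
    have e : (n + 1 + 1 : ℝ) = n + 2 := by ring
    rw [e]; linarith
  have hlim := tendsto_atTop_ciInf hanti ⟨-C, by
    rintro _ ⟨n, rfl⟩
    exact hlow _ (by positivity)⟩
  have h2 := hlim.sub (hlim.comp (tendsto_add_atTop_nat 1))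
  rw [sub_self] at h2
  refine h2.congr fun n => ?_
  simp only [Function.comp_apply]
  push_cast
  congr 2; ring

end

end

end GradientShadowing

namespace GradientShadowing

noncomputable section

variable {N : ℕ}

/-! ### Difference quotients -/

/-- The difference quotient of step `1 / (n + 1)`. -/
def diffQuot (v : ℝ → Config N) (n : ℕ) (t : ℝ) : Config N :=
  (n + 1 : ℝ) • (v (t + 1 / (n + 1 : ℝ)) - v t)

theorem continuous_diffQuot {v : ℝ → Config N} (hv : Continuous v) (n : ℕ) :
    Continuous (diffQuot v n) := by
  unfold diffQuot; fun_prop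

theorem lintegral_Icc_enorm_le {f : ℝ → Config N} (hf : AEStronglyMeasurable f volume) (R : ℝ) :
    ∫⁻ t in Icc (-R) R, ‖f t‖ₑ ≤
      ENNReal.ofReal (Real.exp R) * (2 * eLpNorm f 2 (expMeasure 0)) := by
  have h1 := lintegral_mono' (volume_restrict_le_expMeasure 0 R) (le_refl fun t => ‖f t‖ₑ)
  rw [lintegral_smul_measure, abs_zero, add_zero, smul_eq_mul] at h1
  refine h1.trans (mul_le_mul_right ?_ _)
  rw [← eLpNorm_one_eq_lintegral_enorm, mul_comm]
  refine (eLpNorm_le_eLpNorm_mul_rpow_measure_univ (q := 2) (by norm_num)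
    (hf.mono_ac (expMeasure_ac 0))).trans (mul_le_mul_right ?_ _)
  rw [expMeasure_univ]
  calc (2 : ℝ≥0∞) ^ (1 / (1 : ℝ≥0∞).toReal - 1 / (2 : ℝ≥0∞).toReal) ≤ 2 ^ (1 : ℝ) :=
        ENNReal.rpow_le_rpow_of_exponent_le (by norm_num) (by norm_num)
    _ = 2 := by simp

theorem tendsto_intervalIntegral_of_l2ulNorm {ι : Type*} {l : Filter ι} {f : ι → ℝ → Config N}
    {g : ℝ → Config N} (hf : ∀ i, LocallyIntegrable (f i) volume)
    (hg : LocallyIntegrable g volume)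
    (h : Tendsto (fun i => l2ulNorm fun t => f i t - g t) l (𝓝 0)) (a b : ℝ) :
    Tendsto (fun i => ∫ t in a..b, f i t) l (𝓝 (∫ t in a..b, g t)) := by
  obtain ⟨R, hR⟩ := exists_subset_Icc_neg (isCompact_uIcc (a := a) (b := b))
  rw [tendsto_iff_edist_tendsto_0]
  have h1 : Tendsto (fun i => ENNReal.ofReal (Real.exp R) *
      (2 * l2ulNorm fun t => f i t - g t)) l (𝓝 0) := by
    have := ENNReal.Tendsto.const_mul (a := ENNReal.ofReal (Real.exp R))
      (ENNReal.Tendsto.const_mul (a := 2) h (Or.inr (by simp))) (Or.inr (by simp))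
    simpa using this
  refine tendsto_of_tendsto_of_tendsto_of_le_of_le tendsto_const_nhds h1 (fun _ => zero_le)
    fun i => ?_
  rw [edist_eq_enorm_sub, ← intervalIntegral.integral_sub ((hf i).intervalIntegrable' a b)
    (hg.intervalIntegrable' a b)]
  calc ‖∫ t in a..b, f i t - g t‖ₑ ≤ ∫⁻ t in Icc (-R) R, ‖f i t - g t‖ₑ := by
        rw [← ofReal_norm, intervalIntegral.norm_intervalIntegral_eq, ofReal_norm]
        exact (enorm_integral_le_lintegral_enorm _).trans
          (lintegral_mono_set (uIoc_subset_uIcc.trans hR))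
    _ ≤ _ := by
        refine (lintegral_Icc_enorm_le ((hf i).sub hg).aestronglyMeasurable R).trans ?_
        gcongr
        exact eLpNorm_le_l2ulNorm _ 0

theorem tendsto_integral_diffQuot {v : ℝ → Config N} (hv : Continuous v) (a b : ℝ) :
    Tendsto (fun n => ∫ t in a..b, diffQuot v n t) atTop (𝓝 (v b - v a)) := by
  set W : ℝ → Config N := fun x => ∫ t in (0 : ℝ)..x, v t with hW
  have hW' : ∀ x, HasDerivAt W (v x) x := fun x =>
    intervalIntegral.integral_hasDerivAt_right (hv.intervalIntegrable _ _)
      hv.aestronglyMeasurable.stronglyMeasurableAtFilter hv.continuousAt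
  have hn : Tendsto (fun n : ℕ => 1 / (n + 1 : ℝ)) atTop (𝓝[≠] 0) :=
    tendsto_nhdsWithin_iff.2 ⟨tendsto_one_div_add_atTop_nhds_zero_nat,
      Eventually.of_forall fun n => by
        have : (0 : ℝ) < 1 / ((n : ℝ) + 1) := by positivity
        exact this.ne'⟩
  have h1 := fun x => (hasDerivAt_iff_tendsto_slope_zero.1 (hW' x)).comp hn
  refine ((h1 b).sub (h1 a)).congr fun n => ?_
  have hi : ∀ c d, IntervalIntegrable v volume c d := fun c d => hv.intervalIntegrable _ _
  have hi' : IntervalIntegrable (fun t => v (t + 1 / (n + 1 : ℝ))) volume a b :=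
    (hv.comp (by fun_prop)).intervalIntegrable _ _
  simp only [Function.comp_apply, diffQuot]
  rw [intervalIntegral.integral_smul, intervalIntegral.integral_sub hi' (hi _ _),
    intervalIntegral.integral_comp_add_right, ← smul_sub, one_div, inv_inv]
  congr 1
  have h2 : ∀ c d, ∫ t in c..d, v t = W d - W c := fun c d =>
    (intervalIntegral.integral_interval_sub_left (hi 0 d) (hi 0 c)).symm
  rw [h2, h2]
  abel

theorem isPrim_of_tendsto_diffQuot {v k : ℝ → Config N} (hv : Continuous v)
    (hk : LocallyIntegrable k volume)
    (h : Tendsto (fun n => l2ulNorm fun t => diffQuot v n t - k t) atTop (𝓝 0)) : IsPrim v k where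
  locallyIntegrable := hk
  integral_eq a b := tendsto_nhds_unique (tendsto_intervalIntegral_of_l2ulNorm
    (fun n => (continuous_diffQuot hv n).locallyIntegrable) hk h a b)
    (tendsto_integral_diffQuot hv a b)

theorem IsPrim.tendsto_diffQuot {v k : ℝ → Config N} (h : IsPrim v k) (hk : MemL2ul k)
    (hm : Measurable k) :
    Tendsto (fun n => l2ulNorm fun t => diffQuot v n t - k t) atTop (𝓝 0) := by
  set P : Measure ℝ := volume.restrict (Ioc 0 1) with hP
  have : IsProbabilityMeasure P := ⟨by simp [hP]⟩
  have h1 : ∀ n t, diffQuot v n t - k t = ∫ z, (k (t + 1 / (n + 1 : ℝ) * z) - k t) ∂P := by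
    intro n t
    have hn : (1 / (n + 1 : ℝ)) ≠ 0 := by positivity
    have hi : IntervalIntegrable (fun z => k (t + 1 / (n + 1 : ℝ) * z)) volume 0 1 := by
      have h3 := (h.intervalIntegrable t (t + 1 / (n + 1 : ℝ))).comp_add_left t
      have h4 := h3.comp_mul_left (c := 1 / (n + 1 : ℝ))
      simp only [sub_self, zero_div, add_sub_cancel_left, div_self hn] at h4
      exact h4
    rw [hP, ← intervalIntegral.integral_of_le zero_le_one,
      intervalIntegral.integral_sub hi intervalIntegrable_const, diffQuot,
      ← h.integral_eq, intervalIntegral.integral_comp_add_mul _ hn]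
    simp
  have h2 : ∀ n : ℕ, l2ulNorm (fun t => diffQuot v n t - k t) ^ 2 ≤
      ∫⁻ z, l2ulNorm (fun t => k (t + 1 / (n + 1 : ℝ) * z) - k t) ^ 2 ∂P := by
    intro n
    simp only [h1 n]
    refine l2ulNorm_average_le P (G := fun z t => k (t + 1 / (n + 1 : ℝ) * z) - k t) ?_
      (fun _ => le_rfl)
    exact (hm.comp (by fun_prop)).sub (hm.comp measurable_fst)
  rw [ENNReal.tendsto_nhds_zero]
  intro ε hε
  obtain ⟨δ, hδ, hd⟩ := Metric.eventually_nhds_iff.1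
    (ENNReal.tendsto_nhds_zero.1 hk.tendsto_translate ε hε)
  filter_upwards [tendsto_one_div_add_atTop_nhds_zero_nat.eventually_lt_const hδ] with n hn
  have hn0 : (0 : ℝ) < 1 / ((n : ℝ) + 1) := by positivity
  rw [← ENNReal.pow_le_pow_left_iff (n := 2) (by norm_num)]
  refine (h2 n).trans ?_
  calc ∫⁻ z, l2ulNorm (fun t => k (t + 1 / (n + 1 : ℝ) * z) - k t) ^ 2 ∂P
      ≤ ∫⁻ _, ε ^ 2 ∂P := by
        refine setLIntegral_mono' measurableSet_Ioc fun z hz => ?_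
        gcongr
        refine hd ?_
        rw [Real.dist_eq, sub_zero, abs_of_pos (mul_pos hn0 hz.1)]
        exact (mul_le_of_le_one_right hn0.le hz.2).trans_lt hn
    _ = ε ^ 2 := by simp

/-- Completeness of `L²_ul`. -/
theorem exists_memL2ul_of_cauchy {f : ℕ → ℝ → Config N} (hf : ∀ n, MemL2ul (f n))
    (hc : ∀ ε : ℝ≥0∞, 0 < ε → ∃ n₀, ∀ n ≥ n₀, ∀ m ≥ n₀,
      l2ulNorm (fun t => f n t - f m t) ≤ ε) :
    ∃ k, MemL2ul k ∧ Tendsto (fun n => l2ulNorm fun t => f n t - k t) atTop (𝓝 0) := by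
  have hLp := fun n => memLp_sech_of_l2ulNorm (hf n).aestronglyMeasurable (hf n).norm_lt_top
  have hcauchy : CauchySeq fun n => (hLp n).toLp (f n) := by
    rw [EMetric.cauchySeq_iff]
    intro ε hε
    obtain ⟨n₀, h⟩ := hc (min (ε / 4) 1) (by
      rw [lt_min_iff]; exact ⟨ENNReal.div_pos hε.ne' (by norm_num), one_pos⟩)
    refine ⟨n₀, fun m hm n hn => ?_⟩
    rw [Lp.edist_toLp_toLp]
    have h1 := (eLpNorm_sechMeasure_le (fun t => f m t - f n t)).trans
      (mul_le_mul_right ((eLpNorm_le_l2ulNorm _ 0).trans (h m hm n hn)) _)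
    refine lt_of_le_of_lt h1 ?_
    rcases eq_or_ne ε ∞ with rfl | hε'
    · exact ENNReal.mul_lt_top (by simp) ((min_le_right _ _).trans_lt (by simp))
    · calc 2 * min (ε / 4) 1 ≤ 2 * (ε / 4) := by gcongr; exact min_le_left _ _
        _ = ε / 2 := by
          rw [show (4 : ℝ≥0∞) = 2 * 2 by norm_num, ENNReal.div_eq_inv_mul, ENNReal.mul_inv
            (by simp) (by simp), ← mul_assoc, ← mul_assoc,
            ENNReal.mul_inv_cancel (by simp) (by simp), one_mul, ENNReal.div_eq_inv_mul]
        _ < ε := ENNReal.half_lt_self hε.ne' hε'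
  obtain ⟨F, hF⟩ := cauchySeq_tendsto_of_complete hcauchy
  set k : ℝ → Config N := fun t => (F : ℝ →ₘ[sechMeasure] Config N) t with hk
  have hkm : StronglyMeasurable k := Lp.stronglyMeasurable F
  have hmeas : TendstoInMeasure sechMeasure f atTop k := by
    refine (tendstoInMeasure_of_tendsto_Lp hF).congr (fun n => (hLp n).coeFn_toLp)
      (EventuallyEq.refl _ _)
  obtain ⟨φ, hφ, hae⟩ := hmeas.exists_seq_tendsto_ae
  have hae' : ∀ᵐ t, Tendsto (fun i => f (φ i) t) atTop (𝓝 (k t)) := volume_ac_sechMeasure.ae_le hae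
  have hconv : Tendsto (fun n => l2ulNorm fun t => f n t - k t) atTop (𝓝 0) := by
    rw [ENNReal.tendsto_atTop_zero]
    intro ε hε
    obtain ⟨n₀, h⟩ := hc ε hε
    refine ⟨n₀, fun n hn => ?_⟩
    rw [l2ulNorm_eq_iSup]
    refine iSup_le fun y => ?_
    refine (Lp.eLpNorm_lim_le_liminf_eLpNorm (f := fun i t => f n t - f (φ i) t) (fun i =>
      ((hf n).aestronglyMeasurable.sub (hf _).aestronglyMeasurable).mono_ac (expMeasure_ac y)) _
      ?_).trans ?_
    · filter_upwards [(expMeasure_ac y).ae_le hae'] with t ht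
      exact tendsto_const_nhds.sub ht
    · refine liminf_le_of_frequently_le' (Eventually.frequently ?_)
      filter_upwards [hφ.tendsto_atTop.eventually_ge_atTop n₀] with i hi
      exact (eLpNorm_le_l2ulNorm _ y).trans (h n hn _ hi)
  have hkm' : AEStronglyMeasurable k volume := hkm.aestronglyMeasurable
  have hd := fun n => (hf n).aestronglyMeasurable.sub hkm'
  refine ⟨k, ⟨hkm', ?_, ?_⟩, hconv⟩
  · obtain ⟨n, hn⟩ := (hconv.eventually_lt_const one_pos).exists
    have h1 := l2ulNorm_sub_le (hf n).aestronglyMeasurable (hd n)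
    simp only [Pi.sub_apply, sub_sub_cancel] at h1
    exact h1.trans_lt (ENNReal.add_lt_top.2 ⟨(hf n).norm_lt_top, hn.trans (by simp)⟩)
  · rw [ENNReal.tendsto_nhds_zero]
    intro ε hε
    have hε3 : 0 < ε / 3 := ENNReal.div_pos hε.ne' (by norm_num)
    obtain ⟨n, hn⟩ := (hconv.eventually_lt_const hε3).exists
    filter_upwards [ENNReal.tendsto_nhds_zero.1 (hf n).tendsto_translate _ hε3] with y hy
    have h1 : (fun t => k (t + y) - k t) = fun t => (f n (t + y) - f n t) -
        ((f n (t + y) - k (t + y)) - (f n t - k t)) := by ext1 t; abel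
    rw [h1]
    have hdy := aestronglyMeasurable_translate (hd n) y
    calc _ ≤ l2ulNorm (fun t => f n (t + y) - f n t) +
          l2ulNorm (fun t => (f n (t + y) - k (t + y)) - (f n t - k t)) :=
          l2ulNorm_sub_le ((aestronglyMeasurable_translate (hf n).aestronglyMeasurable y).sub
            (hf n).aestronglyMeasurable) (hdy.sub (hd n))
      _ ≤ ε / 3 + (ε / 3 + ε / 3) := by
          refine add_le_add hy ((l2ulNorm_sub_le hdy (hd n)).trans (add_le_add ?_ hn.le))
          exact (l2ulNorm_translate (fun t => f n t - k t) y).trans_le hn.le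
      _ = ε := by rw [← add_assoc, ENNReal.add_thirds]

/-- A bounded, uniformly continuous function has a derivative in `L²_ul` if and only if its
difference quotients are a Cauchy sequence. -/
theorem exists_isPrim_iff_cauchy {v : ℝ → Config N} (hv : UniformContinuous v) {C : ℝ}
    (hC : ∀ t, ‖v t‖ ≤ C) :
    (∃ k, MemL2ul k ∧ IsPrim v k) ↔ ∀ j : ℕ, ∃ n₀, ∀ n ≥ n₀, ∀ m ≥ n₀,
      l2ulNorm (fun t => diffQuot v n t - diffQuot v m t) ≤ ((j : ℝ≥0∞) + 1)⁻¹ := by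
  constructor
  · rintro ⟨k, hk, hp⟩ j
    have hk' : MemL2ul (deriv v) := hk.congr hp.deriv_ae_eq.symm
    have h := hp.deriv_right.tendsto_diffQuot hk' (measurable_deriv v)
    have hj : (0 : ℝ≥0∞) < ((j : ℝ≥0∞) + 1)⁻¹ / 2 :=
      ENNReal.div_pos (ENNReal.inv_ne_zero.2 (by finiteness)) (by norm_num)
    obtain ⟨n₀, hn₀⟩ := ENNReal.tendsto_atTop_zero.1 h _ hj
    refine ⟨n₀, fun n hn m hm => ?_⟩
    have h1 : (fun t => diffQuot v n t - diffQuot v m t) = fun t =>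
        (diffQuot v n t - deriv v t) - (diffQuot v m t - deriv v t) := by ext1 t; abel
    rw [h1]
    have hd := fun n => (continuous_diffQuot hp.continuous n).aestronglyMeasurable.sub
      hk'.aestronglyMeasurable
    refine (l2ulNorm_sub_le (hd n) (hd m)).trans ?_
    rw [← ENNReal.add_halves ((j : ℝ≥0∞) + 1)⁻¹]
    exact add_le_add (hn₀ n hn) (hn₀ m hm)
  · intro h
    have hmem : ∀ n, MemL2ul (diffQuot v n) := by
      intro n
      have hv' : UniformContinuous fun t => v (t + 1 / (n + 1 : ℝ)) :=
        hv.comp (uniformContinuous_id.add uniformContinuous_const)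
      have hd : UniformContinuous (diffQuot v n) := (hv'.sub hv).const_smul (n + 1 : ℝ)
      refine MemL2ul.of_uniformContinuous hd (C := ‖(n + 1 : ℝ)‖ * (C + C)) fun t => ?_
      rw [diffQuot, norm_smul]
      exact mul_le_mul_of_nonneg_left ((norm_sub_le _ _).trans (add_le_add (hC _) (hC _)))
        (norm_nonneg _)
    obtain ⟨k, hk, hlim⟩ := exists_memL2ul_of_cauchy hmem fun ε hε => by
      obtain ⟨j, hj⟩ := ENNReal.exists_inv_nat_lt hε.ne'
      obtain ⟨n₀, hn₀⟩ := h j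
      refine ⟨n₀, fun n hn m hm => (hn₀ n hn m hm).trans (le_trans ?_ hj.le)⟩
      exact ENNReal.inv_le_inv.2 le_self_add
    exact ⟨k, hk, isPrim_of_tendsto_diffQuot hv.continuous
      (locallyIntegrable_of_l2ulNorm hk.aestronglyMeasurable hk.norm_lt_top) hlim⟩

/-! ### Evaluation at a point -/

theorem norm_sq_le_integral {f : ℝ → Config N} (hf : ContDiff ℝ 1 f) (t : ℝ) :
    ‖f t‖ ^ 2 ≤ 2 * ∫ u in (t - 1)..t, (‖f u‖ ^ 2 + ‖deriv f u‖ ^ 2) := by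
  have hc := hf.continuous
  have hc' := hf.continuous_deriv le_rfl
  have hcs : Continuous fun u => ‖f u‖ ^ 2 + ‖deriv f u‖ ^ 2 := by fun_prop
  obtain ⟨u, hu, hmin⟩ := isCompact_Icc.exists_isMinOn
    (nonempty_Icc.2 (by linarith : t - 1 ≤ t)) (hc.norm.pow 2).continuousOn
  have h1 : ‖f u‖ ^ 2 ≤ ∫ u in (t - 1)..t, (‖f u‖ ^ 2 + ‖deriv f u‖ ^ 2) := by
    have h2 := intervalIntegral.integral_mono_on (μ := volume) (f := fun _ => ‖f u‖ ^ 2)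
      (by linarith : t - 1 ≤ t) (by simp) (hcs.intervalIntegrable _ _) fun x hx =>
        (hmin hx).trans (le_add_of_nonneg_right (sq_nonneg ‖deriv f x‖))
    simpa using h2
  have h2 : ∀ x, HasDerivAt (fun x => ‖f x‖ ^ 2) (2 * inner ℝ (f x) (deriv f x)) x :=
    fun x => ((hf.differentiable (by norm_num)) x).hasDerivAt.norm_sq
  have hc2 : Continuous fun x => 2 * inner ℝ (f x) (deriv f x) := by fun_prop
  have h3 := intervalIntegral.integral_eq_sub_of_hasDerivAt (fun x _ => h2 x)
    (hc2.intervalIntegrable u t)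
  have h4 : ∫ x in u..t, 2 * inner ℝ (f x) (deriv f x) ≤
      ∫ x in u..t, (‖f x‖ ^ 2 + ‖deriv f x‖ ^ 2) := by
    refine intervalIntegral.integral_mono_on (μ := volume) hu.2 (hc2.intervalIntegrable _ _)
      (hcs.intervalIntegrable _ _) fun x _ => ?_
    have := real_inner_le_norm (f x) (deriv f x)
    nlinarith [sq_nonneg (‖f x‖ - ‖deriv f x‖)]
  have h5 : ∫ x in u..t, (‖f x‖ ^ 2 + ‖deriv f x‖ ^ 2) ≤
      ∫ x in (t - 1)..t, (‖f x‖ ^ 2 + ‖deriv f x‖ ^ 2) :=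
    intervalIntegral.integral_mono_interval hu.1 hu.2 le_rfl
      (Eventually.of_forall fun x => by positivity) (hcs.intervalIntegrable _ _)
  linarith

theorem enorm_apply_le {f : ℝ → Config N} (hf : ContDiff ℝ 1 f) (t : ℝ) :
    ‖f t‖ₑ ≤ ENNReal.ofReal (2 * Real.exp (|t| + 1)) ^ (1 / 2 : ℝ) * locNorm f := by
  have hc := hf.continuous
  have hc' := hf.continuous_deriv le_rfl
  have h0 : ‖f t‖ₑ = (‖f t‖ₑ ^ 2) ^ (1 / 2 : ℝ) := by
    rw [← ENNReal.rpow_two, ← ENNReal.rpow_mul]; norm_num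
  rw [h0, locNorm, ← ENNReal.mul_rpow_of_nonneg _ _ (by norm_num : (0 : ℝ) ≤ 1 / 2)]
  refine ENNReal.rpow_le_rpow ?_ (by norm_num)
  have hcs : Continuous fun u => ‖f u‖ ^ 2 + ‖deriv f u‖ ^ 2 := by fun_prop
  calc ‖f t‖ₑ ^ 2 = ENNReal.ofReal (‖f t‖ ^ 2) := by
        rw [ENNReal.ofReal_pow (norm_nonneg _), ofReal_norm]
    _ ≤ ENNReal.ofReal (2 * ∫ u in (t - 1)..t, (‖f u‖ ^ 2 + ‖deriv f u‖ ^ 2)) :=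
        ENNReal.ofReal_le_ofReal (norm_sq_le_integral hf t)
    _ = ENNReal.ofReal 2 * ∫⁻ u in Ioc (t - 1) t, (‖f u‖ₑ ^ 2 + ‖deriv f u‖ₑ ^ 2) := by
        rw [ENNReal.ofReal_mul (by norm_num),
          intervalIntegral.integral_of_le (by linarith : t - 1 ≤ t),
          ofReal_integral_eq_lintegral_ofReal (hcs.integrableOn_Ioc)
            (Eventually.of_forall fun x => by positivity)]
        congr 2; ext1 u
        rw [ENNReal.ofReal_add (by positivity) (by positivity), ENNReal.ofReal_pow (norm_nonneg _),
          ENNReal.ofReal_pow (norm_nonneg _), ofReal_norm, ofReal_norm]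
    _ ≤ ENNReal.ofReal 2 * ∫⁻ u in Ioc (t - 1) t, ENNReal.ofReal (Real.exp (|t| + 1)) *
          (ENNReal.ofReal (Real.exp (-|u|)) * (‖f u‖ₑ ^ 2 + ‖deriv f u‖ₑ ^ 2)) := by
        refine mul_le_mul_right ?_ _
        refine setLIntegral_mono' measurableSet_Ioc fun u hu => ?_
        rw [← mul_assoc, ← ENNReal.ofReal_mul (Real.exp_pos _).le, ← Real.exp_add]
        refine le_mul_of_one_le_left zero_le ?_
        refine ENNReal.one_le_ofReal.2 (Real.one_le_exp ?_)
        have h1 : |t - u| ≤ 1 := abs_le.2 ⟨by linarith [hu.2], by linarith [hu.1]⟩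
        have h2 := abs_sub_abs_le_abs_sub u t
        rw [abs_sub_comm] at h2
        linarith
    _ ≤ _ := by
        rw [lintegral_const_mul' _ _ ENNReal.ofReal_ne_top, ← mul_assoc,
          ← ENNReal.ofReal_mul (by norm_num)]
        exact mul_le_mul_right (setLIntegral_le_lintegral _ _) _

theorem Phase.continuous_apply (t : ℝ) : Continuous fun p : Phase N => p t := by
  have h : LipschitzWith (Real.toNNReal (2 * Real.exp (|t| + 1)) ^ (1 / 2 : ℝ))
      (fun p : Phase N => p t) := by
    intro p q
    rw [ENNReal.coe_rpow_of_nonneg _ (by norm_num), edist_eq_enorm_sub]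
    exact enorm_apply_le (p.2.contDiff.sub q.2.contDiff) t
  exact h.continuous

end

end GradientShadowing

namespace GradientShadowing

noncomputable section

variable {N : ℕ} {C : ℝ≥0}

/-! ### A compact space of paths -/

/-- The admissible velocities: bounded by `C` and `1/2`-Hölder with constant `C`. -/
def IsVelocity (C : ℝ≥0) (v : ℝ → Config N) : Prop :=
  (∀ t, ‖v t‖ ≤ C) ∧ ∀ t u, ‖v t - v u‖ ≤ C * √|t - u|

theorem IsVelocity.uniformContinuous {v : ℝ → Config N} (hv : IsVelocity C v) :
    UniformContinuous v := by
  have h : Tendsto (fun p : ℝ × ℝ => C * √|p.1 - p.2|) (uniformity ℝ) (𝓝 0) := by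
    have h1 : Continuous fun x : ℝ => C * √|x| := by fun_prop
    have h2 := (h1.tendsto 0).comp
      (tendsto_iff_comap.2 (uniformity_eq_comap_nhds_zero_swapped ℝ).le)
    rw [abs_zero, Real.sqrt_zero, mul_zero] at h2
    exact h2
  rw [UniformContinuous, uniformity_eq_comap_nhds_zero_swapped (Config N), tendsto_comap_iff]
  exact squeeze_zero_norm (fun p => hv.2 _ _) h

theorem IsVelocity.continuous {v : ℝ → Config N} (hv : IsVelocity C v) : Continuous v :=
  hv.uniformContinuous.continuous

theorem IsVelocity.translate {v : ℝ → Config N} (hv : IsVelocity C v) (y : ℝ) :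
    IsVelocity C fun t => v (t + y) :=
  ⟨fun t => hv.1 _, fun t u => by simpa using hv.2 (t + y) (u + y)⟩

theorem isVelocity_zero : IsVelocity C (0 : ℝ → Config N) :=
  ⟨fun t => by simp, fun t u => by simp; positivity⟩

instance : Fact (0 < 2 * Real.pi) := ⟨Real.two_pi_pos⟩

/-- The space of pairs of an initial position modulo `2π` and an admissible velocity, with the
topology of pointwise convergence. -/
def PathSpace (N : ℕ) (C : ℝ≥0) : Type :=
  {y : (Fin N → AddCircle (2 * Real.pi)) × (ℝ → Config N) // IsVelocity C y.2}

instance : TopologicalSpace (PathSpace N C) :=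
  inferInstanceAs (TopologicalSpace {y : (Fin N → AddCircle (2 * Real.pi)) × (ℝ → Config N) //
    IsVelocity C y.2})

instance : T2Space (PathSpace N C) :=
  inferInstanceAs (T2Space {y : (Fin N → AddCircle (2 * Real.pi)) × (ℝ → Config N) //
    IsVelocity C y.2})

instance : MeasurableSpace (PathSpace N C) := borel _

instance : BorelSpace (PathSpace N C) := ⟨rfl⟩

/-- The velocity. -/
def PathSpace.vel (y : PathSpace N C) : ℝ → Config N := y.1.2

theorem PathSpace.isVelocity (y : PathSpace N C) : IsVelocity C y.vel := y.2

theorem PathSpace.continuous_vel (t : ℝ) : Continuous fun y : PathSpace N C => y.vel t :=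
  (_root_.continuous_apply t).comp (continuous_snd.comp continuous_subtype_val)

instance : CompactSpace (PathSpace N C) := by
  suffices h : IsCompact {y : (Fin N → AddCircle (2 * Real.pi)) × (ℝ → Config N) |
      IsVelocity C y.2} from isCompact_iff_compactSpace.1 h
  refine IsCompact.of_isClosed_subset (s := univ ×ˢ Set.pi univ fun _ =>
    Metric.closedBall (0 : Config N) C)
    (isCompact_univ.prod (isCompact_univ_pi fun _ => isCompact_closedBall _ _)) ?_ ?_
  · simp only [IsVelocity, ofPred_and, ofPred_forall]
    exact (isClosed_iInter fun t => isClosed_le (by fun_prop) continuous_const).inter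
      (isClosed_iInter fun t => isClosed_iInter fun u =>
        isClosed_le (by fun_prop) continuous_const)
  · intro y hy
    exact ⟨mem_univ _, fun t _ => by simpa using hy.1 t⟩

theorem PathSpace.ext_rat {y z : PathSpace N C} (h : y.1.1 = z.1.1)
    (h' : ∀ r : ℚ, y.vel r = z.vel r) : y = z := by
  refine Subtype.ext (Prod.ext h ?_)
  exact Rat.denseRange_cast.equalizer y.isVelocity.continuous z.isVelocity.continuous
    (funext h')

/-- The coordinates at the rational times determine a path. -/
def PathSpace.ratCoord (y : PathSpace N C) :
    (Fin N → AddCircle (2 * Real.pi)) × (ℚ → Config N) := (y.1.1, fun r => y.vel r)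

theorem PathSpace.isClosedEmbedding_ratCoord :
    IsClosedEmbedding (PathSpace.ratCoord (N := N) (C := C)) := by
  refine Continuous.isClosedEmbedding ?_ ?_
  · exact (continuous_fst.comp continuous_subtype_val).prodMk
      (continuous_pi fun r => PathSpace.continuous_vel _)
  · intro y z h
    exact PathSpace.ext_rat (congrArg (fun z => z.1) h :) fun r => congrFun (congrArg (fun z => z.2) h :) r

instance : TopologicalSpace.MetrizableSpace (PathSpace N C) :=
  PathSpace.isClosedEmbedding_ratCoord.isEmbedding.metrizableSpace

instance : SecondCountableTopology (PathSpace N C) :=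
  PathSpace.isClosedEmbedding_ratCoord.isEmbedding.secondCountableTopology

instance : PolishSpace (PathSpace N C) := by
  let := TopologicalSpace.metrizableSpaceMetric (PathSpace N C)
  infer_instance

/-- The representative of the initial position. -/
def PathSpace.base (y : PathSpace N C) : Config N :=
  WithLp.toLp 2 fun i => (AddCircle.equivIco (2 * Real.pi) 0 (y.1.1 i) : ℝ)

theorem PathSpace.coe_base (y : PathSpace N C) (i : Fin N) :
    ((y.base i : ℝ) : AddCircle (2 * Real.pi)) = y.1.1 i :=
  (AddCircle.equivIco (2 * Real.pi) 0).symm_apply_apply (y.1.1 i)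

/-- The path with the given initial position and velocity. -/
def PathSpace.path (y : PathSpace N C) (t : ℝ) : Config N := y.base + ∫ u in (0 : ℝ)..t, y.vel u

theorem PathSpace.hasDerivAt_path (y : PathSpace N C) (t : ℝ) :
    HasDerivAt y.path (y.vel t) t := by
  have hc := y.isVelocity.continuous
  exact (intervalIntegral.integral_hasDerivAt_right (hc.intervalIntegrable _ _)
      hc.aestronglyMeasurable.stronglyMeasurableAtFilter hc.continuousAt).const_add _

theorem PathSpace.deriv_path (y : PathSpace N C) : deriv y.path = y.vel :=
  funext fun t => (y.hasDerivAt_path t).deriv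

theorem PathSpace.continuous_path (y : PathSpace N C) : Continuous y.path :=
  continuous_iff_continuousAt.2 fun t => (y.hasDerivAt_path t).continuousAt

theorem exists_eq_add_latticeVec {x x' : Config N}
    (h : ∀ i, ((x i : ℝ) : AddCircle (2 * Real.pi)) = x' i) :
    ∃ k : Fin N → ℤ, x = x' + latticeVec k := by
  have h1 : ∀ i, ∃ n : ℤ, n • (2 * Real.pi) = x i - x' i := by
    intro i
    have h2 := (sub_eq_zero.2 (h i))
    rw [← AddCircle.coe_sub, AddCircle.coe_eq_zero_iff] at h2
    exact h2
  choose k hk using h1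
  refine ⟨k, ?_⟩
  ext i
  have := hk i
  rw [zsmul_eq_mul] at this
  rw [PiLp.add_apply, latticeVec_apply]
  linarith

/-- A curve with the data of a point of the path space is a lattice translate of its path. -/
theorem PathSpace.exists_path_eq (y : PathSpace N C) {f : ℝ → Config N}
    (hf : ∀ t, HasDerivAt f (y.vel t) t)
    (h0 : ∀ i, ((f 0 i : ℝ) : AddCircle (2 * Real.pi)) = y.1.1 i) :
    ∃ k : Fin N → ℤ, ∀ t, y.path t = f t + latticeVec k := by
  obtain ⟨k, hk⟩ := exists_eq_add_latticeVec (x := y.base) (x' := f 0)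
    fun i => (y.coe_base i).trans (h0 i).symm
  refine ⟨k, fun t => ?_⟩
  have hc := y.isVelocity.continuous
  have h1 := intervalIntegral.integral_eq_sub_of_hasDerivAt (fun x _ => hf x)
    (hc.intervalIntegrable 0 t)
  rw [path, hk, h1]; abel

theorem PathSpace.continuous_integral_vel (a b : ℝ) :
    Continuous fun y : PathSpace N C => ∫ u in a..b, y.vel u :=
  intervalIntegral.continuous_of_dominated_interval (bound := fun _ => C)
    (fun y => y.isVelocity.continuous.aestronglyMeasurable)
    (fun y => Eventually.of_forall fun t _ => y.isVelocity.1 t)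
    intervalIntegrable_const (Eventually.of_forall fun t _ => PathSpace.continuous_vel t)

/-- Up to lattice translates, the paths depend continuously on the point of the path space. -/
theorem PathSpace.exists_tendsto_path (y : PathSpace N C) :
    ∃ k : PathSpace N C → Fin N → ℤ, ∀ t,
      Tendsto (fun z => z.path t + latticeVec (k z)) (𝓝 y) (𝓝 (y.path t)) := by
  set k : PathSpace N C → Fin N → ℤ := fun z i =>
    -round ((2 * Real.pi)⁻¹ * (z.base i - y.base i)) with hk
  have hb : Tendsto (fun z => z.base + latticeVec (k z)) (𝓝 y) (𝓝 y.base) := by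
    rw [tendsto_iff_norm_sub_tendsto_zero]
    have h1 : ∀ i, Tendsto (fun z : PathSpace N C => ‖z.1.1 i - y.1.1 i‖) (𝓝 y) (𝓝 0) := by
      intro i
      have : Continuous fun z : PathSpace N C => ‖z.1.1 i - y.1.1 i‖ :=
        (((_root_.continuous_apply i).comp
          (continuous_fst.comp continuous_subtype_val)).sub continuous_const).norm
      simpa using this.tendsto y
    have h2 : ∀ (z : PathSpace N C) i,
        ‖z.1.1 i - y.1.1 i‖ = |(z.base + latticeVec (k z) - y.base) i| := by
      intro z i
      rw [← z.coe_base, ← y.coe_base, ← AddCircle.coe_sub, AddCircle.norm_eq]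
      congr 1
      simp only [PiLp.sub_apply, PiLp.add_apply, latticeVec_apply, hk]
      push_cast; ring
    simp only [h2] at h1
    have h3 := (tendsto_finsetSum Finset.univ fun i _ => (h1 i).pow 2).sqrt
    simp only [EuclideanSpace.norm_eq, Real.norm_eq_abs]
    simpa using h3
  refine ⟨k, fun t => ?_⟩
  refine (hb.add ((PathSpace.continuous_integral_vel 0 t).tendsto y)).congr fun z => ?_
  rw [path]; abel

end

end GradientShadowing

namespace GradientShadowing

noncomputable section

variable {N : ℕ} {C : ℝ≥0}

/-! ### Regular paths and the phase space -/

theorem PathSpace.memPhase_path_iff (y : PathSpace N C) :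
    MemPhase y.path ↔ ∃ k, MemL2ul k ∧ IsPrim y.vel k := by
  have hc := y.isVelocity.continuous
  constructor
  · intro h
    refine ⟨_, h.deriv_deriv_mem, ?_⟩
    have := h.isPrim_deriv
    rwa [y.deriv_path] at this ⊢
  · rintro ⟨k, hk, hp⟩
    refine ⟨?_, ?_, ?_, ?_⟩
    · rw [contDiff_one_iff_deriv, y.deriv_path]
      exact ⟨fun t => (y.hasDerivAt_path t).differentiableAt, hc⟩
    · rw [y.deriv_path]
      exact hp.deriv_right.integral_eq
    · rw [y.deriv_path]
      exact MemL2ul.of_uniformContinuous y.isVelocity.uniformContinuous y.isVelocity.1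
    · rw [y.deriv_path]
      exact hk.congr hp.deriv_ae_eq.symm

/-- The points of the path space whose paths are in the phase space. -/
def regularPaths (N : ℕ) (C : ℝ≥0) : Set (PathSpace N C) := {y | MemPhase y.path}

theorem measurable_l2ulNorm_diffQuot (n m : ℕ) : Measurable fun y : PathSpace N C =>
    l2ulNorm fun t => diffQuot y.vel n t - diffQuot y.vel m t := by
  have hc1 : ∀ n t, Continuous fun y : PathSpace N C => diffQuot y.vel n t := fun n t => by
    have h1 := PathSpace.continuous_vel (N := N) (C := C) (t + 1 / (n + 1 : ℝ))
    have h2 := PathSpace.continuous_vel (N := N) (C := C) t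
    exact (h1.sub h2).const_smul (n + 1 : ℝ)
  have hc : ∀ t, Continuous fun y : PathSpace N C => diffQuot y.vel n t - diffQuot y.vel m t :=
    fun t => (hc1 n t).sub (hc1 m t)
  have hct : ∀ y : PathSpace N C, Continuous fun t => diffQuot y.vel n t - diffQuot y.vel m t :=
    fun y => (continuous_diffQuot y.isVelocity.continuous n).sub
      (continuous_diffQuot y.isVelocity.continuous m)
  set B : ℝ := ‖(n + 1 : ℝ)‖ * (C + C) + ‖(m + 1 : ℝ)‖ * (C + C) with hB
  have hbd : ∀ (y : PathSpace N C) t, ‖diffQuot y.vel n t - diffQuot y.vel m t‖ ≤ B := by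
    intro y t
    refine (norm_sub_le _ _).trans (add_le_add ?_ ?_) <;>
    · rw [diffQuot, norm_smul]
      exact mul_le_mul_of_nonneg_left ((norm_sub_le _ _).trans
        (add_le_add (y.isVelocity.1 _) (y.isVelocity.1 _))) (norm_nonneg _)
  have h1 : ∀ z, Continuous fun y : PathSpace N C => ∫⁻ t : ℝ,
      ENNReal.ofReal (Real.exp (-|t + z|)) * ‖diffQuot y.vel n t - diffQuot y.vel m t‖ₑ ^ 2 := by
    intro z
    refine continuous_iff_continuousAt.2 fun y => ?_
    refine tendsto_lintegral_filter_of_dominated_convergence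
      (fun t => ENNReal.ofReal (Real.exp (-|t + z|)) * ENNReal.ofReal B ^ 2)
      (Eventually.of_forall fun y => ?_) (Eventually.of_forall fun y =>
        Eventually.of_forall fun t => ?_) ?_ (Eventually.of_forall fun t => ?_)
    · exact (measurable_expWeight z).mul ((hct y).measurable.enorm.pow_const 2)
    · gcongr
      rw [← ofReal_norm]
      exact ENNReal.ofReal_le_ofReal (hbd y t)
    · rw [lintegral_mul_const _ (measurable_expWeight z),
        lintegral_add_right_eq_self (fun t => ENNReal.ofReal (Real.exp (-|t|))) z,
        lintegral_exp_neg_abs]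
      finiteness
    · refine ENNReal.Tendsto.const_mul ?_ (Or.inr ENNReal.ofReal_ne_top)
      exact ((ENNReal.continuous_pow 2).comp (hc t).enorm).tendsto y
  have h2 : LowerSemicontinuous fun y : PathSpace N C =>
      l2ulNorm (fun t => diffQuot y.vel n t - diffQuot y.vel m t) := by
    unfold l2ulNorm
    exact lowerSemicontinuous_iSup fun z =>
      ((ENNReal.continuous_rpow_const (y := 1 / 2)).comp (h1 z)).lowerSemicontinuous
  exact h2.measurable

theorem measurableSet_regularPaths : MeasurableSet (regularPaths N C) := by
  have h : regularPaths N C = ⋂ j : ℕ, ⋃ n₀ : ℕ, ⋂ n : ℕ, ⋂ _ : n ≥ n₀, ⋂ m : ℕ, ⋂ _ : m ≥ n₀,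
      {y | l2ulNorm (fun t => diffQuot y.vel n t - diffQuot y.vel m t) ≤ ((j : ℝ≥0∞) + 1)⁻¹} := by
    ext y
    simp only [mem_iInter, mem_iUnion, mem_ofPred_eq]
    exact y.memPhase_path_iff.trans
      (exists_isPrim_iff_cauchy y.isVelocity.uniformContinuous y.isVelocity.1)
  rw [h]
  refine MeasurableSet.iInter fun j => MeasurableSet.iUnion fun n₀ => MeasurableSet.iInter fun n =>
    MeasurableSet.iInter fun _ => MeasurableSet.iInter fun m => MeasurableSet.iInter fun _ => ?_
  exact measurableSet_le (measurable_l2ulNorm_diffQuot n m) measurable_const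

theorem memPhase_zero : MemPhase (0 : ℝ → Config N) := by
  have h : deriv (0 : ℝ → Config N) = 0 := funext fun t => deriv_const t 0
  have h0 : MemL2ul (0 : ℝ → Config N) :=
    MemL2ul.of_uniformContinuous (C := 0) uniformContinuous_const fun t => by simp
  exact ⟨contDiff_const, fun a b => by simp [h], by rwa [h], by rwa [h, h]⟩

open Classical in
/-- The path as a point of the phase space, if it is regular. -/
def PathSpace.toPhase (y : PathSpace N C) : Phase N :=
  if h : MemPhase y.path then ⟨y.path, h⟩ else ⟨0, memPhase_zero⟩

theorem PathSpace.toPhase_apply {y : PathSpace N C} (h : y ∈ regularPaths N C) (t : ℝ) :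
    y.toPhase t = y.path t := by
  have h' : MemPhase y.path := h
  exact congrArg (fun p : Phase N => p t) (dif_pos h')

theorem PathSpace.deriv_toPhase {y : PathSpace N C} (h : y ∈ regularPaths N C) :
    deriv y.toPhase = y.vel := by
  rw [← y.deriv_path]
  exact congrArg deriv (funext fun t => PathSpace.toPhase_apply h t)

/-- The point of the quotient phase space that is given by a regular path. -/
def PathSpace.toQPhase (y : PathSpace N C) : QPhase N := proj y.toPhase

theorem lintegral_exp_neg_abs_mul_ne_top (c : ℝ) :
    ∫⁻ t : ℝ, ENNReal.ofReal (Real.exp (-|t|) * ((1 + c * |t|) ^ 2 + c ^ 2)) ≠ ∞ := by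
  have h3 : MemLp (fun t : ℝ => 1 + c * |t|) 2 sechMeasure :=
    MemLp.add (f := fun _ : ℝ => (1 : ℝ)) (g := fun t : ℝ => c * |t|) (memLp_const 1)
      (memLp_abs_sech.const_mul c)
  have h4 : Integrable (fun t : ℝ => (1 + c * |t|) ^ 2 + c ^ 2) sechMeasure :=
    h3.integrable_sq.add (integrable_const (c ^ 2))
  refine (lt_of_le_of_lt ?_ h4.lintegral_lt_top).ne
  refine le_trans (le_of_eq ?_) (lintegral_mono' expMeasure_le_sechMeasure le_rfl)
  rw [lintegral_expMeasure]
  congr 1; ext1 t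
  rw [add_zero, ENNReal.ofReal_mul (Real.exp_pos _).le]

theorem PathSpace.continuousOn_toQPhase :
    ContinuousOn (PathSpace.toQPhase (N := N) (C := C)) (regularPaths N C) := by
  intro y hy
  obtain ⟨k, hk⟩ := y.exists_tendsto_path
  have h1 : Tendsto (fun z => latticeShift (k z) (PathSpace.toPhase z)) (𝓝[regularPaths N C] y)
      (𝓝 y.toPhase) := by
    rw [tendsto_iff_edist_tendsto_0]
    have hR : ∀ᶠ z in 𝓝[regularPaths N C] y, z ∈ regularPaths N C := self_mem_nhdsWithin
    have hev : ∀ᶠ z in 𝓝[regularPaths N C] y, ‖z.path 0 + latticeVec (k z) - y.path 0‖ ≤ 1 := by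
      have h2 := (hk 0).eventually (Metric.closedBall_mem_nhds _ one_pos)
      refine (h2.filter_mono nhdsWithin_le_nhds).mono fun z hz => ?_
      rw [← dist_eq_norm]; exact hz
    have hdiff : ∀ z ∈ regularPaths N C, ∀ t, latticeShift (k z) (PathSpace.toPhase z) t -
        y.toPhase t = z.path t + latticeVec (k z) - y.path t := by
      intro z hz t
      rw [latticeShift_apply, PathSpace.toPhase_apply hz, PathSpace.toPhase_apply hy]
    have hbound : ∀ z, ‖z.path 0 + latticeVec (k z) - y.path 0‖ ≤ 1 → ∀ t,
        ‖z.path t + latticeVec (k z) - y.path t‖ ≤ 1 + (C + C) * |t| := by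
      intro z hz t
      have h2 : ∀ u, HasDerivAt (fun t => z.path t + latticeVec (k z) - y.path t)
          (z.vel u - y.vel u) u := fun u =>
        ((z.hasDerivAt_path u).add_const _).sub (y.hasDerivAt_path u)
      refine (norm_le_add_mul_abs (C := C + C) (fun u => (h2 u).differentiableAt)
        (fun u => ?_) t).trans (add_le_add_left hz _)
      rw [(h2 u).deriv]
      exact (norm_sub_le _ _).trans (add_le_add (z.isVelocity.1 u) (y.isVelocity.1 u))
    have key : Tendsto (fun z : PathSpace N C => ∫⁻ t : ℝ, ENNReal.ofReal (Real.exp (-|t|)) *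
        (‖z.path t + latticeVec (k z) - y.path t‖ₑ ^ 2 + ‖z.vel t - y.vel t‖ₑ ^ 2))
        (𝓝[regularPaths N C] y) (𝓝 (∫⁻ _ : ℝ, 0)) := by
      refine tendsto_lintegral_filter_of_dominated_convergence
        (fun t => ENNReal.ofReal (Real.exp (-|t|) * ((1 + (C + C) * |t|) ^ 2 + (C + C) ^ 2)))
        (Eventually.of_forall fun z => ?_) (hev.mono fun z hz => Eventually.of_forall fun t => ?_)
        ?_ (Eventually.of_forall fun t => ?_)
      · have h3 := z.continuous_path
        have h4 := y.continuous_path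
        have h5 := z.isVelocity.continuous
        have h6 := y.isVelocity.continuous
        have h7 : Measurable fun t => ‖z.path t + latticeVec (k z) - y.path t‖ₑ :=
          ((h3.add continuous_const).sub h4).measurable.enorm
        have h8 : Measurable fun t => ‖z.vel t - y.vel t‖ₑ := (h5.sub h6).measurable.enorm
        have h9 : Measurable fun t : ℝ => ENNReal.ofReal (Real.exp (-|t|)) := by fun_prop
        exact h9.mul ((h7.pow_const 2).add (h8.pow_const 2))
      · rw [ENNReal.ofReal_mul (Real.exp_pos _).le, ENNReal.ofReal_add (by positivity)
          (by positivity), ENNReal.ofReal_pow (by positivity), ENNReal.ofReal_pow (by positivity)]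
        gcongr
        · rw [← ofReal_norm]
          exact ENNReal.ofReal_le_ofReal (hbound z hz t)
        · rw [← ofReal_norm]
          exact ENNReal.ofReal_le_ofReal ((norm_sub_le _ _).trans
            (add_le_add (z.isVelocity.1 t) (y.isVelocity.1 t)))
      · exact lintegral_exp_neg_abs_mul_ne_top _
      · rw [← mul_zero (ENNReal.ofReal (Real.exp (-|t|)))]
        refine ENNReal.Tendsto.const_mul ?_ (Or.inr ENNReal.ofReal_ne_top)
        have h3 : Tendsto (fun z => ‖z.path t + latticeVec (k z) - y.path t‖ₑ)
            (𝓝[regularPaths N C] y) (𝓝 0) := by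
          have := (((hk t).sub_const (y.path t)).mono_left
            (nhdsWithin_le_nhds (s := regularPaths N C))).enorm
          simpa using this
        have h4 : Tendsto (fun z => ‖z.vel t - y.vel t‖ₑ) (𝓝[regularPaths N C] y) (𝓝 0) := by
          have := ((((PathSpace.continuous_vel t).tendsto y).sub_const (y.vel t)).mono_left
            (nhdsWithin_le_nhds (s := regularPaths N C))).enorm
          simpa using this
        simpa using (ENNReal.Tendsto.pow (n := 2) h3).add (ENNReal.Tendsto.pow (n := 2) h4)
    rw [lintegral_zero] at key
    have key2 := (ENNReal.continuous_rpow_const (y := 1 / 2)).continuousAt.tendsto.comp key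
    rw [ENNReal.zero_rpow_of_pos (by norm_num)] at key2
    refine key2.congr' (hR.mono fun z hz => ?_)
    change _ = locNorm fun t => latticeShift (k z) (PathSpace.toPhase z) t - y.toPhase t
    have h3 : ∀ t, deriv (fun t => latticeShift (k z) (PathSpace.toPhase z) t - y.toPhase t) t =
        z.vel t - y.vel t := fun t => by
      rw [Phase.deriv_sub, deriv_latticeShift, PathSpace.deriv_toPhase hz,
        PathSpace.deriv_toPhase hy]
    simp only [Function.comp_apply, locNorm, h3]
    simp only [hdiff z hz]
  have h2 := (continuous_proj.tendsto _).comp h1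
  refine h2.congr fun z => ?_
  exact proj_latticeShift _ _

theorem PathSpace.measurable_toQPhase : Measurable (PathSpace.toQPhase (N := N) (C := C)) := by
  refine measurable_of_restrict_of_restrict_compl measurableSet_regularPaths ?_ ?_
  · exact (continuousOn_iff_continuous_domRestrict.1 PathSpace.continuousOn_toQPhase).measurable
  · have : (regularPaths N C)ᶜ.domRestrict (PathSpace.toQPhase (N := N) (C := C)) =
        fun _ => proj ⟨0, memPhase_zero⟩ :=
      funext fun y => congrArg proj (dif_neg (show ¬ MemPhase y.1.path from y.2))
    rw [this]
    exact measurable_const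

/-! ### The inverse map -/

/-- A representative of a point of the quotient phase space. -/
def rep (x : QPhase N) : Phase N := Quotient.out x

theorem exists_rep_proj (p : Phase N) : ∃ k, rep (proj p) = latticeShift k p :=
  proj_eq_proj_iff.1 (Quotient.out_eq (s := phaseSetoid N) (proj p))

/-- The velocity of a point of the quotient phase space. -/
def qVel (x : QPhase N) : ℝ → Config N := deriv (rep x)

theorem qVel_proj (p : Phase N) : qVel (proj p) = deriv p := by
  obtain ⟨k, hk⟩ := exists_rep_proj p
  rw [qVel, hk, deriv_latticeShift]

/-- The initial position modulo `2π` of a point of the quotient phase space. -/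
def qPos (x : QPhase N) (i : Fin N) : AddCircle (2 * Real.pi) := (rep x 0 i : ℝ)

theorem qPos_proj (p : Phase N) (i : Fin N) : qPos (proj p) i = (p 0 i : ℝ) := by
  obtain ⟨k, hk⟩ := exists_rep_proj p
  rw [qPos, hk, latticeShift_apply, PiLp.add_apply, latticeVec_apply, AddCircle.coe_add,
    add_eq_left, AddCircle.coe_eq_zero_iff]
  exact ⟨k i, by rw [zsmul_eq_mul, mul_comm]⟩

theorem continuous_qPos (i : Fin N) : Continuous fun x : QPhase N => qPos x i := by
  rw [isQuotientMap_proj.continuous_iff]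
  have : Continuous fun p : Phase N => ((p 0 i : ℝ) : AddCircle (2 * Real.pi)) :=
    (AddCircle.continuous_mk' _).comp
      ((EuclideanSpace.proj (𝕜 := ℝ) i).continuous.comp (Phase.continuous_apply 0))
  exact this.congr fun p => (qPos_proj p i).symm

theorem measurable_qVel (t : ℝ) : Measurable fun x : QPhase N => qVel x t := by
  set F : ℕ → QPhase N → Config N := fun n x =>
    (1 / (n + 1 : ℝ))⁻¹ • (rep x (t + 1 / (n + 1 : ℝ)) - rep x t) with hF
  have h1 : ∀ n, Measurable (F n) := by
    intro n
    refine Continuous.measurable ?_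
    rw [isQuotientMap_proj.continuous_iff]
    have : Continuous fun p : Phase N => (1 / (n + 1 : ℝ))⁻¹ • (p (t + 1 / (n + 1 : ℝ)) - p t) :=
      ((Phase.continuous_apply (t + 1 / (n + 1 : ℝ))).sub (Phase.continuous_apply t)).const_smul
        (1 / (n + 1 : ℝ))⁻¹
    refine this.congr fun p => ?_
    obtain ⟨k, hk⟩ := exists_rep_proj p
    simp only [hF, Function.comp_apply]
    rw [hk, latticeShift_apply, latticeShift_apply, add_sub_add_right_eq_sub]
  refine measurable_of_tendsto_metrizable h1 (tendsto_pi_nhds.2 fun x => ?_)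
  have h2 := hasDerivAt_iff_tendsto_slope_zero.1
    ((rep x).2.differentiable t).hasDerivAt
  refine h2.comp (tendsto_nhdsWithin_iff.2 ⟨tendsto_one_div_add_atTop_nhds_zero_nat, ?_⟩)
  exact Eventually.of_forall fun n => by
    have : (0 : ℝ) < 1 / ((n : ℝ) + 1) := by positivity
    exact this.ne'

/-- The points of the quotient phase space with admissible velocities. -/
def boundedPhase (N : ℕ) (C : ℝ≥0) : Set (QPhase N) := {x | IsVelocity C (qVel x)}

theorem measurableSet_boundedPhase : MeasurableSet (boundedPhase N C) := by
  have h : boundedPhase N C = (⋂ r : ℚ, {x | ‖qVel x r‖ ≤ C}) ∩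
      ⋂ r : ℚ, ⋂ r' : ℚ, {x | ‖qVel x r - qVel x r'‖ ≤ C * √|(r : ℝ) - r'|} := by
    ext x
    have hc : Continuous (qVel x) := (rep x).2.continuous_deriv
    constructor
    · intro hx
      exact ⟨mem_iInter.2 fun r => hx.1 r,
        mem_iInter.2 fun r => mem_iInter.2 fun r' => hx.2 r r'⟩
    · rintro ⟨h1, h2⟩
      rw [mem_iInter] at h1 h2
      simp only [mem_iInter] at h2
      constructor
      · intro t
        exact Rat.denseRange_cast.induction_on (p := fun t => ‖qVel x t‖ ≤ C) t
          (isClosed_le (by fun_prop) (by fun_prop)) h1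
      · intro t u
        exact Rat.denseRange_cast.induction_on₂ (p := fun t u =>
          ‖qVel x t - qVel x u‖ ≤ C * √|t - u|)
          (isClosed_le (by fun_prop) (by fun_prop)) h2 t u
  rw [h]
  refine (MeasurableSet.iInter fun r => ?_).inter
    (MeasurableSet.iInter fun r => MeasurableSet.iInter fun r' => ?_)
  · exact measurableSet_le (measurable_qVel _).norm measurable_const
  · exact measurableSet_le ((measurable_qVel _).sub (measurable_qVel _)).norm measurable_const

open Classical in
/-- The point of the path space that is given by a point of the quotient phase space. -/
def ofQPhase (C : ℝ≥0) (x : QPhase N) : PathSpace N C :=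
  if h : IsVelocity C (qVel x) then ⟨(qPos x, qVel x), h⟩ else ⟨(0, 0), isVelocity_zero⟩

theorem ofQPhase_eq {x : QPhase N} (h : x ∈ boundedPhase N C) :
    ofQPhase C x = ⟨(qPos x, qVel x), h⟩ := dif_pos h

theorem exists_path_ofQPhase {p : Phase N} (h : proj p ∈ boundedPhase N C) :
    ∃ k : Fin N → ℤ, ∀ t, (ofQPhase C (proj p)).path t = p t + latticeVec k := by
  rw [ofQPhase_eq h]
  refine PathSpace.exists_path_eq _ (fun t => ?_) fun i => (qPos_proj p i).symm
  change HasDerivAt p (qVel (proj p) t) t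
  rw [qVel_proj]
  exact (p.2.differentiable t).hasDerivAt

theorem ofQPhase_mem_regularPaths {x : QPhase N} (h : x ∈ boundedPhase N C) :
    ofQPhase C x ∈ regularPaths N C := by
  obtain ⟨p, rfl⟩ := proj_surjective x
  obtain ⟨k, hk⟩ := exists_path_ofQPhase h
  have : (ofQPhase C (proj p)).path = latticeShift k p := funext hk
  change MemPhase _
  rw [this]
  exact (latticeShift k p).2

theorem toQPhase_ofQPhase {x : QPhase N} (h : x ∈ boundedPhase N C) :
    (ofQPhase C x).toQPhase = x := by
  have hr := ofQPhase_mem_regularPaths h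
  obtain ⟨p, rfl⟩ := proj_surjective x
  obtain ⟨k, hk⟩ := exists_path_ofQPhase h
  exact (congrArg proj (Phase.ext fun t => (PathSpace.toPhase_apply hr t).trans (hk t))).trans
    (proj_latticeShift k p)

theorem measurable_ofQPhase : Measurable (ofQPhase (N := N) C) := by
  refine measurable_of_restrict_of_restrict_compl (measurableSet_boundedPhase (C := C)) ?_ ?_
  · have he := (PathSpace.isClosedEmbedding_ratCoord (N := N) (C := C)).measurableEmbedding
    have hm : Measurable fun x : boundedPhase N C => (qPos x.1, fun r : ℚ => qVel x.1 r) :=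
      (measurable_pi_lambda _ fun i => ((continuous_qPos i).measurable.comp
        measurable_subtype_coe)).prodMk (measurable_pi_lambda _ fun r =>
          (measurable_qVel _).comp measurable_subtype_coe)
    have h3 : (PathSpace.ratCoord (N := N) (C := C)) ∘
        (boundedPhase N C).domRestrict (ofQPhase C) =
        fun x => (qPos x.1, fun r : ℚ => qVel x.1 r) :=
      funext fun x => congrArg PathSpace.ratCoord (ofQPhase_eq x.2)
    rw [← he.measurable_comp_iff, h3]
    exact hm
  · have : (boundedPhase N C)ᶜ.domRestrict (ofQPhase (N := N) C) =
        fun _ => ⟨(0, 0), isVelocity_zero⟩ :=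
      funext fun x => dif_neg (show ¬ IsVelocity C (qVel x.1) from x.2)
    rw [this]
    exact measurable_const

/-! ### The translation -/

/-- The translation by `2π` on the path space. -/
def PathSpace.shift (y : PathSpace N C) : PathSpace N C :=
  ⟨(fun i => y.1.1 i + (((∫ u in (0 : ℝ)..2 * Real.pi, y.vel u) i : ℝ) : AddCircle (2 * Real.pi)),
    fun t => y.vel (t + 2 * Real.pi)), y.isVelocity.translate _⟩

theorem PathSpace.continuous_shift : Continuous (PathSpace.shift (N := N) (C := C)) := by
  refine Continuous.subtype_mk (Continuous.prodMk (continuous_pi fun i => ?_)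
    (continuous_pi fun t => PathSpace.continuous_vel _)) _
  refine ((_root_.continuous_apply i).comp
    (continuous_fst.comp continuous_subtype_val)).add ((AddCircle.continuous_mk' _).comp
      ((EuclideanSpace.proj (𝕜 := ℝ) i).continuous.comp (PathSpace.continuous_integral_vel _ _)))

theorem PathSpace.exists_path_shift (y : PathSpace N C) :
    ∃ k : Fin N → ℤ, ∀ t, y.shift.path t = y.path (t + 2 * Real.pi) + latticeVec k := by
  refine PathSpace.exists_path_eq _ (fun t => ?_) fun i => ?_
  · exact (y.hasDerivAt_path (t + 2 * Real.pi)).comp_add_const t (2 * Real.pi)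
  · change _ = y.1.1 i + _
    rw [path, zero_add, PiLp.add_apply, AddCircle.coe_add, y.coe_base]

theorem PathSpace.shift_mem_regularPaths {y : PathSpace N C} (h : y ∈ regularPaths N C) :
    y.shift ∈ regularPaths N C := by
  obtain ⟨k, hk⟩ := y.exists_path_shift
  have h' : y.shift.path = latticeShift k (translate (2 * Real.pi) ⟨y.path, h⟩) := funext hk
  change MemPhase _
  rw [h']
  exact (latticeShift k (translate (2 * Real.pi) ⟨y.path, h⟩)).2

theorem PathSpace.toQPhase_shift {y : PathSpace N C} (h : y ∈ regularPaths N C) :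
    y.shift.toQPhase = GradientShadowing.shift y.toQPhase := by
  obtain ⟨k, hk⟩ := y.exists_path_shift
  refine (congrArg proj (Phase.ext fun t => ?_)).trans
    (proj_latticeShift k (GradientShadowing.translate (2 * Real.pi) y.toPhase))
  refine (PathSpace.toPhase_apply (PathSpace.shift_mem_regularPaths h) t).trans ((hk t).trans ?_)
  rw [latticeShift_apply, translate_apply, PathSpace.toPhase_apply h]

theorem shift_mem_boundedPhase {x : QPhase N} (h : x ∈ boundedPhase N C) :
    GradientShadowing.shift x ∈ boundedPhase N C := by
  obtain ⟨p, rfl⟩ := proj_surjective x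
  change IsVelocity C _
  rw [shift_proj, qVel_proj, deriv_translate, ← qVel_proj]
  exact IsVelocity.translate h _

theorem ofQPhase_shift {x : QPhase N} (h : x ∈ boundedPhase N C) :
    ofQPhase C (GradientShadowing.shift x) = (ofQPhase C x).shift := by
  rw [ofQPhase_eq h, ofQPhase_eq (shift_mem_boundedPhase h)]
  obtain ⟨p, rfl⟩ := proj_surjective x
  refine Subtype.ext (Prod.ext (funext fun i => ?_) ?_)
  · change qPos (GradientShadowing.shift (proj p)) i = qPos (proj p) i +
      (((∫ u in (0 : ℝ)..2 * Real.pi, qVel (proj p) u) i : ℝ) : AddCircle (2 * Real.pi))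
    rw [shift_proj, qPos_proj, qPos_proj, qVel_proj, p.2.isPrim.integral_eq, ← AddCircle.coe_add,
      translate_apply, zero_add, PiLp.sub_apply, add_sub_cancel]
  · change qVel (GradientShadowing.shift (proj p)) = fun t => qVel (proj p) (t + 2 * Real.pi)
    rw [shift_proj, qVel_proj, qVel_proj, deriv_translate]

end

end GradientShadowing

namespace GradientShadowing

noncomputable section

variable {N : ℕ} {C : ℝ≥0} {V : Config N → ℝ → ℝ}

/-! ### Equilibria in the path space -/

/-- The defect in the integrated Euler--Lagrange equation. -/
def defect (V : Config N → ℝ → ℝ) (a b : ℝ) (y : PathSpace N C) : Config N :=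
  y.vel b - y.vel a - ∫ t in a..b, gradV V (y.path t) t

theorem IsPotential.continuous_gradV_path (hV : IsPotential V) (y : PathSpace N C) :
    Continuous fun t => gradV V (y.path t) t :=
  hV.continuous_gradV.comp (y.continuous_path.prodMk continuous_id)

theorem continuous_defect (hV : IsPotential V) (a b : ℝ) :
    Continuous (defect (N := N) (C := C) V a b) := by
  obtain ⟨M, hM0, hM⟩ := hV.exists_bound_gradV
  have h1 : ∀ t, Continuous fun y : PathSpace N C => gradV V (y.path t) t := by
    intro t
    refine continuous_iff_continuousAt.2 fun y => ?_
    obtain ⟨k, hk⟩ := y.exists_tendsto_path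
    have h2 := (hV.continuous_gradV.tendsto (y.path t, t)).comp
      ((hk t).prodMk_nhds tendsto_const_nhds)
    refine h2.congr fun z => ?_
    exact hV.gradV_add_latticeVec _ _ _
  refine ((PathSpace.continuous_vel b).sub (PathSpace.continuous_vel a)).sub ?_
  exact intervalIntegral.continuous_of_dominated_interval (bound := fun _ => M)
    (fun y => (hV.continuous_gradV_path y).aestronglyMeasurable)
    (fun y => Eventually.of_forall fun t _ => hM _ _)
    intervalIntegrable_const (Eventually.of_forall fun t _ => h1 t)

/-- The points of the path space whose paths solve the Euler--Lagrange equation. -/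
def equilibriumPaths (V : Config N → ℝ → ℝ) (C : ℝ≥0) : Set (PathSpace N C) :=
  {y | ∀ a b : ℚ, defect V a b y = 0}

theorem isClosed_equilibriumPaths (hV : IsPotential V) : IsClosed (equilibriumPaths V C) := by
  simp only [equilibriumPaths, ofPred_forall]
  exact isClosed_iInter fun a => isClosed_iInter fun b =>
    isClosed_eq (continuous_defect hV _ _) continuous_const

theorem hasDerivAt_vel_of_mem_equilibriumPaths (hV : IsPotential V) {y : PathSpace N C}
    (hy : y ∈ equilibriumPaths V C) (t : ℝ) : HasDerivAt y.vel (gradV V (y.path t) t) t := by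
  have hg := hV.continuous_gradV_path y
  have h1 : ∀ b : ℝ, y.vel b = y.vel 0 + ∫ t in (0 : ℝ)..b, gradV V (y.path t) t := by
    refine congrFun (Rat.denseRange_cast.equalizer y.isVelocity.continuous
      (continuous_const.add (intervalIntegral.continuous_primitive
        (fun a b => hg.intervalIntegrable a b) 0)) (funext fun b => ?_))
    have h2 := hy 0 b
    rw [defect, sub_eq_zero, sub_eq_iff_eq_add, Rat.cast_zero] at h2
    simp only [Function.comp_apply]
    rw [h2, add_comm]
  rw [funext h1]
  exact (intervalIntegral.integral_hasDerivAt_right (hg.intervalIntegrable _ _)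
    hg.aestronglyMeasurable.stronglyMeasurableAtFilter hg.continuousAt).const_add _

theorem equilibriumPaths_subset_regularPaths (hV : IsPotential V) :
    equilibriumPaths V C ⊆ regularPaths N C := by
  intro y hy
  obtain ⟨M, hM0, hM⟩ := hV.exists_bound_gradV
  refine y.memPhase_path_iff.2 ⟨fun t => gradV V (y.path t) t, ?_,
    isPrim_of_hasDerivAt (hasDerivAt_vel_of_mem_equilibriumPaths hV hy)
      (hV.continuous_gradV_path y)⟩
  refine MemL2ul.of_uniformContinuous (C := M) ?_ fun t => hM _ _
  have h1 : LipschitzWith C y.path := by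
    refine lipschitzWith_of_nnnorm_deriv_le (fun t => (y.hasDerivAt_path t).differentiableAt)
      fun t => ?_
    rw [y.deriv_path]
    exact y.isVelocity.1 t
  exact (hV.gradV_biperiodic.uniformContinuous hV.continuous_gradV).comp
    (h1.uniformContinuous.prodMk uniformContinuous_id)

theorem toQPhase_mem_qEquilibria (hV : IsPotential V) {y : PathSpace N C}
    (hy : y ∈ equilibriumPaths V C) : y.toQPhase ∈ qEquilibria V := by
  refine ⟨y.toPhase, fun t => ?_, rfl⟩
  have hr := equilibriumPaths_subset_regularPaths hV hy
  rw [PathSpace.deriv_toPhase hr, PathSpace.toPhase_apply hr]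
  exact hasDerivAt_vel_of_mem_equilibriumPaths hV hy t

theorem isClosed_equilibriumPaths_inter (hV : IsPotential V) {B : Set (QPhase N)}
    (hB : IsClosed B) : IsClosed (equilibriumPaths V C ∩ PathSpace.toQPhase ⁻¹' B) :=
  (PathSpace.continuousOn_toQPhase.mono
    (equilibriumPaths_subset_regularPaths hV)).preimage_isClosed_of_isClosed
    (isClosed_equilibriumPaths hV) hB

theorem exists_norm_defect_sq_le (hV : IsPotential V) (C : ℝ≥0) (a b : ℝ) :
    ∃ c : ℝ, 0 ≤ c ∧ ∀ p : Phase N, proj p ∈ boundedPhase N C →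
      ‖defect V a b (ofQPhase C (proj p))‖ ^ 2 ≤ c * dissipation hV p := by
  obtain ⟨R, hR⟩ := exists_subset_Icc_neg (isCompact_uIcc (a := a) (b := b))
  have hc := cellBound_pos
  refine ⟨(Real.exp R * 2) ^ 2 / cellBound, by positivity, fun p hp => ?_⟩
  have h1 : ‖defect V a b (ofQPhase C (proj p))‖ ≤ Real.exp R * 2 * ‖residual hV p‖ := by
    obtain ⟨k, hk⟩ := exists_path_ofQPhase hp
    have hv : (ofQPhase C (proj p)).vel = deriv p := by
      rw [ofQPhase_eq hp]; exact qVel_proj p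
    have hf : LocallyIntegrable (fun t => gradV V (p t) t) volume :=
      (hV.continuous_gradV.comp
        (p.2.contDiff.continuous.prodMk continuous_id)).locallyIntegrable
    have hd := p.2.isPrim_deriv
    have h2 : defect V a b (ofQPhase C (proj p)) =
        ∫ t in a..b, (deriv (deriv p) t - gradV V (p t) t) := by
      rw [intervalIntegral.integral_sub (hd.intervalIntegrable a b) (hf.intervalIntegrable' a b),
        hd.integral_eq, defect, hv]
      simp only [hk, hV.gradV_add_latticeVec]
    have h3 := (hd.locallyIntegrable.sub hf).aestronglyMeasurable
    have h4 : ‖defect V a b (ofQPhase C (proj p))‖ₑ ≤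
        ENNReal.ofReal (Real.exp R) * (2 * ‖residual hV p‖ₑ) := by
      rw [h2, ← ofReal_norm, intervalIntegral.norm_intervalIntegral_eq, ofReal_norm]
      refine (enorm_integral_le_lintegral_enorm _).trans
        ((lintegral_mono_set (uIoc_subset_uIcc.trans hR)).trans
          ((lintegral_Icc_enorm_le h3 R).trans ?_))
      gcongr
      rw [Lp.enorm_def]
      exact (eLpNorm_mono_measure _ expMeasure_le_sechMeasure).trans
        (eLpNorm_congr_ae (coeFn_residual hV p)).ge
    have h5 : ENNReal.ofReal (Real.exp R) * (2 * ‖residual hV p‖ₑ) =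
        ENNReal.ofReal (Real.exp R * 2 * ‖residual hV p‖) := by
      rw [mul_assoc, ENNReal.ofReal_mul (Real.exp_pos _).le, ENNReal.ofReal_mul (by norm_num),
        ofReal_norm, ENNReal.ofReal_ofNat]
    rw [h5, ← ofReal_norm, ENNReal.ofReal_le_ofReal_iff (by positivity)] at h4
    exact h4
  have h2 := le_inner_mulL2_cellWeight (residual hV p)
  calc ‖defect V a b (ofQPhase C (proj p))‖ ^ 2 ≤ (Real.exp R * 2 * ‖residual hV p‖) ^ 2 := by
        gcongr
    _ = (Real.exp R * 2) ^ 2 / cellBound * (cellBound * ‖residual hV p‖ ^ 2) := by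
        field_simp
    _ ≤ _ := by
        gcongr
        exact h2

/-! ### The limit measure -/

theorem HasBound.isVelocity {A : ℝ≥0} {p : Phase N} (h : HasBound A p) :
    IsVelocity (8 * A) (deriv p) := by
  have hm := p.2.deriv_deriv_mem.aestronglyMeasurable
  have h1 : l2ulNorm (deriv p) ≤ ENNReal.ofReal A := by
    rw [ENNReal.ofReal_coe_nnreal]; exact h.1
  have h2 : l2ulNorm (deriv (deriv p)) ≤ ENNReal.ofReal A := by
    rw [ENNReal.ofReal_coe_nnreal]; exact h.2
  constructor
  · intro t
    have := norm_le_of_isPrim p.2.isPrim_deriv hm h1 h2 A.2 t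
    have hA : (0 : ℝ) ≤ A := A.2
    push_cast
    linarith
  · intro t u
    have := norm_sub_le_of_isPrim p.2.isPrim_deriv hm h1 h2 A.2 t u
    push_cast
    exact this

theorem exists_limit_measure (hV : IsPotential V) {μ : Measure (QPhase N)}
    (hμ : IsInvariantProb shift μ) {A : ℝ≥0}
    (hbound : ∀ s : ℝ, 0 ≤ s → ∀ q : Phase N,
      proj q ∈ (μ.map (qGradFlow V s)).support → h1ulNorm (deriv q) ≤ A) :
    ∃ ν : ProbabilityMeasure (PathSpace N (8 * A)),
      ν.map PathSpace.continuous_shift.measurable.aemeasurable = ν ∧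
      (ν : Measure (PathSpace N (8 * A))) (equilibriumPaths V (8 * A)) = 1 ∧
      ∀ B : Set (QPhase N), IsClosed B →
        (∀ᵐ x ∂μ, x ∈ B → ∀ s : ℝ, 0 ≤ s → qGradFlow V s x ∈ B) →
        μ B ≤ (ν : Measure (PathSpace N (8 * A)))
          (equilibriumPaths V (8 * A) ∩ PathSpace.toQPhase ⁻¹' B) := by
  have := hμ.isProbabilityMeasure
  obtain ⟨s, hs, hlim⟩ := exists_tendsto_meanDissipation hV hμ hbound
  have hbd : ∀ᵐ x ∂μ, ∀ r, 0 ≤ r → qGradFlow V r x ∈ boundedPhase N (8 * A) := by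
    filter_upwards [ae_hasBound hV hbound] with x hx r hr
    obtain ⟨p, rfl⟩ := proj_surjective x
    rw [qGradFlow_proj hV hr]
    change IsVelocity _ _
    rw [qVel_proj]
    exact (hx p rfl r hr).isVelocity
  set F : ℕ → QPhase N → PathSpace N (8 * A) := fun n x =>
    ofQPhase (8 * A) (qGradFlow V (s n) x) with hF
  have hFm : ∀ n, Measurable (F n) := fun n =>
    measurable_ofQPhase.comp (continuous_qGradFlow hV (hs n).le).measurable
  set μP : ProbabilityMeasure (QPhase N) := ⟨μ, this⟩ with hμP
  set ρ : ℕ → ProbabilityMeasure (PathSpace N (8 * A)) := fun n =>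
    μP.map (hFm n).aemeasurable with hρ
  set 𝔲 : Ultrafilter ℕ := Ultrafilter.of atTop with h𝔲
  have hle : (𝔲 : Filter ℕ) ≤ atTop := Ultrafilter.of_le _
  obtain ⟨ν, -, hν⟩ := isCompact_univ.ultrafilter_le_nhds (𝔲.map ρ) (by simp)
  have hν' : Tendsto ρ 𝔲 (𝓝 ν) := hν
  have hρm : ∀ n, (ρ n : Measure (PathSpace N (8 * A))) = μ.map (F n) := fun n => rfl
  have hE : (ν : Measure (PathSpace N (8 * A))) (equilibriumPaths V (8 * A)) = 1 := by
    have h0 : ∀ a b : ℝ, ∀ᵐ y ∂(ν : Measure (PathSpace N (8 * A))), defect V a b y = 0 := by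
      intro a b
      obtain ⟨c, hc0, hc⟩ := exists_norm_defect_sq_le hV (8 * A) a b
      set f : C(PathSpace N (8 * A), ℝ) :=
        ⟨fun y => ‖defect V a b y‖ ^ 2, (continuous_defect hV a b).norm.pow 2⟩ with hf
      have hf0 : ∀ y, 0 ≤ f y := fun y => sq_nonneg _
      have hint : ∀ n, ∫ y, f y ∂(ρ n : Measure (PathSpace N (8 * A))) ≤
          c * meanDissipation hV μ (s n) := by
        intro n
        rw [hρm, integral_map (hFm n).aemeasurable f.continuous.aestronglyMeasurable,
          meanDissipation, ← integral_const_mul]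
        refine integral_mono_of_nonneg (Eventually.of_forall fun x => hf0 _)
          ((hasDerivAt_meanEnergy hV hμ hbound (hs n)).1.const_mul c) ?_
        filter_upwards [hbd] with x hx
        have hx' := hx _ (hs n).le
        obtain ⟨p, hp⟩ := proj_surjective (qGradFlow V (s n) x)
        simp only [hF]
        rw [← hp] at hx' ⊢
        rw [descend_proj (dissipation_latticeShift hV)]
        exact hc p hx'
      have h1 := ((ProbabilityMeasure.continuous_integral_continuousMap f).tendsto ν).comp hν'
      have h2 : Tendsto (fun n => c * meanDissipation hV μ (s n)) 𝔲 (𝓝 0) := by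
        simpa using (hlim.mono_left hle).const_mul c
      have h3 := tendsto_nhds_unique h1
        (squeeze_zero (fun n => integral_nonneg hf0) hint h2)
      have hi : Integrable (fun y => f y) (ν : Measure (PathSpace N (8 * A))) :=
        (BoundedContinuousFunction.mkOfCompact f).integrable _
      filter_upwards [(integral_eq_zero_iff_of_nonneg hf0 hi).1 h3] with y hy
      exact norm_eq_zero.1 (pow_eq_zero_iff (two_ne_zero)|>.1 hy)
    have h1 := ae_all_iff.2 fun a : ℚ => ae_all_iff.2 fun b : ℚ => h0 a b
    have h2 := (isClosed_equilibriumPaths (C := 8 * A) hV).measurableSet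
    exact (prob_compl_eq_zero_iff h2).1 h1
  refine ⟨ν, ?_, hE, fun B hB hinv => ?_⟩
  · refine tendsto_nhds_unique
      (ProbabilityMeasure.tendsto_map_of_tendsto_of_continuous _ _ hν'
        PathSpace.continuous_shift) (hν'.congr fun n => ?_)
    refine Subtype.ext ?_
    change μ.map (F n) = (μ.map (F n)).map PathSpace.shift
    rw [Measure.map_map PathSpace.continuous_shift.measurable (hFm n)]
    have h1 : PathSpace.shift ∘ F n =ᵐ[μ] F n ∘ shift := by
      filter_upwards [hbd] with x hx
      simp only [Function.comp_apply, hF]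
      rw [qGradFlow_shift hV (hs n).le, ofQPhase_shift (hx _ (hs n).le)]
    rw [Measure.map_congr h1, ← Measure.map_map (hFm n) hμ.measurePreserving.measurable,
      hμ.measurePreserving.map_eq]
  · set K := closure (ofQPhase (8 * A) '' (B ∩ boundedPhase N (8 * A))) with hK
    have h1 : ∀ n, μ B ≤ (ρ n : Measure (PathSpace N (8 * A))) K := by
      intro n
      rw [hρm, Measure.map_apply (hFm n) isClosed_closure.measurableSet]
      refine measure_mono_ae ?_
      filter_upwards [hinv, hbd] with x hx hx' hxB
      exact subset_closure ⟨_, ⟨hx hxB _ (hs n).le, hx' _ (hs n).le⟩, rfl⟩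
    have h2 : μ B ≤ (ν : Measure (PathSpace N (8 * A))) K :=
      (le_limsup_of_frequently_le (Frequently.of_forall h1)).trans
        (ProbabilityMeasure.limsup_measure_closed_le_of_tendsto hν' isClosed_closure)
    have h3 : equilibriumPaths V (8 * A) ∩ K ⊆
        equilibriumPaths V (8 * A) ∩ PathSpace.toQPhase ⁻¹' B := by
      rintro y ⟨hy, hyK⟩
      refine ⟨hy, ?_⟩
      have hyr := equilibriumPaths_subset_regularPaths hV hy
      have hsub : ofQPhase (8 * A) '' (B ∩ boundedPhase N (8 * A)) ⊆ regularPaths N (8 * A) := by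
        rintro _ ⟨x, hx, rfl⟩
        exact ofQPhase_mem_regularPaths hx.2
      have h4 := ((PathSpace.continuousOn_toQPhase y hyr).mono hsub).mem_closure_image hyK
      refine hB.closure_subset_iff.2 ?_ h4
      rintro _ ⟨_, ⟨x, hx, rfl⟩, rfl⟩
      rw [toQPhase_ofQPhase hx.2]
      exact hx.1
    refine h2.trans (le_trans (measure_mono_ae ?_) (measure_mono h3))
    have h5 := (prob_compl_eq_zero_iff (isClosed_equilibriumPaths hV).measurableSet).2 hE
    filter_upwards [compl_mem_ae_iff.2 h5] with y hy hyK
    exact ⟨not_not.1 hy, hyK⟩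

end

end GradientShadowing

namespace GradientShadowing

noncomputable section

/-! ### Members of stable partitions -/

section Partition

variable {X : Type*} [TopologicalSpace X]

/-- The closed sets that are invariant for the semiflow, as far as the points of `M₁` are
concerned. -/
structure IsStable (ξ : ℝ → X → X) (M₁ B : Set X) : Prop where
  isClosed : IsClosed B
  mem : ∀ q ∈ M₁, q ∈ B → ∀ s : ℝ, 0 ≤ s → ξ s q ∈ B

theorem IsStable.inter {ξ : ℝ → X → X} {M₁ B B' : Set X} (h : IsStable ξ M₁ B)
    (h' : IsStable ξ M₁ B') : IsStable ξ M₁ (B ∩ B') where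
  isClosed := h.isClosed.inter h'.isClosed
  mem q hq hB s hs := ⟨h.mem q hq hB.1 s hs, h'.mem q hq hB.2 s hs⟩

theorem IsStable.preimage {ξ : ℝ → X → X} {M₁ B : Set X} (h : IsStable ξ M₁ B) {S : X → X}
    (hS : Continuous S) (hM : MapsTo S M₁ M₁) (hξ : ∀ s x, 0 ≤ s → ξ s (S x) = S (ξ s x)) :
    IsStable ξ M₁ (S ⁻¹' B) where
  isClosed := h.isClosed.preimage hS
  mem q hq hB s hs := by
    have := h.mem _ (hM hq) hB s hs
    rwa [hξ s q hs] at this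

variable [MeasurableSpace X]

/-- The members of the countable partitions (up to null sets) by stable sets. -/
def stableParts (ξ : ℝ → X → X) (M₁ : Set X) (μ : Measure X) : Set (Set X) :=
  {B | ∃ J : Set (Set X), B ∈ J ∧ J.Countable ∧ J.PairwiseDisjoint id ∧
    (∀ C ∈ J, IsStable ξ M₁ C) ∧ μ (⋃₀ J) = 1}

variable {ξ : ℝ → X → X} {M₁ : Set X} {μ : Measure X} {B B' : Set X}

theorem isStable_of_mem_stableParts (h : B ∈ stableParts ξ M₁ μ) : IsStable ξ M₁ B := by
  obtain ⟨J, hB, -, -, hJ, -⟩ := h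
  exact hJ B hB

variable [BorelSpace X]

theorem stableParts_inter [IsProbabilityMeasure μ] (h : B ∈ stableParts ξ M₁ μ)
    (h' : B' ∈ stableParts ξ M₁ μ) : B ∩ B' ∈ stableParts ξ M₁ μ := by
  obtain ⟨J, hB, hJc, hJd, hJ, hJ1⟩ := h
  obtain ⟨J', hB', hJc', hJd', hJ', hJ1'⟩ := h'
  refine ⟨image2 (· ∩ ·) J J', mem_image2_of_mem hB hB', hJc.image2 hJc' _, ?_, ?_, ?_⟩
  · rintro _ ⟨C₁, hC₁, C₁', hC₁', rfl⟩ _ ⟨C₂, hC₂, C₂', hC₂', rfl⟩ hne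
    by_cases h1 : C₁ = C₂
    · subst h1
      have h2 : C₁' ≠ C₂' := fun h => hne (by rw [h])
      exact (hJd' hC₁' hC₂' h2).mono inter_subset_right inter_subset_right
    · exact (hJd hC₁ hC₂ h1).mono inter_subset_left inter_subset_left
  · rintro _ ⟨C₁, hC₁, C₁', hC₁', rfl⟩
    exact (hJ _ hC₁).inter (hJ' _ hC₁')
  · have h1 : ⋃₀ image2 (· ∩ ·) J J' = ⋃₀ J ∩ ⋃₀ J' := by
      ext x
      simp only [mem_sUnion, mem_inter_iff, mem_image2]
      constructor
      · rintro ⟨_, ⟨C, hC, C', hC', rfl⟩, hx⟩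
        exact ⟨⟨C, hC, hx.1⟩, ⟨C', hC', hx.2⟩⟩
      · rintro ⟨⟨C, hC, hx⟩, ⟨C', hC', hx'⟩⟩
        exact ⟨_, ⟨C, hC, C', hC', rfl⟩, hx, hx'⟩
    have hm : MeasurableSet (⋃₀ J) :=
      MeasurableSet.sUnion hJc fun C hC => (hJ C hC).isClosed.measurableSet
    have hm' : MeasurableSet (⋃₀ J') :=
      MeasurableSet.sUnion hJc' fun C hC => (hJ' C hC).isClosed.measurableSet
    rw [h1]
    have h2 : ∀ᵐ x ∂μ, x ∈ ⋃₀ J := (prob_compl_eq_zero_iff hm).2 hJ1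
    have h3 : ∀ᵐ x ∂μ, x ∈ ⋃₀ J' := (prob_compl_eq_zero_iff hm').2 hJ1'
    exact (prob_compl_eq_zero_iff (hm.inter hm')).1 (h2.and h3)

theorem stableParts_preimage {S : X → X} (hS : Continuous S) (hμ : MeasurePreserving S μ μ)
    (hM : MapsTo S M₁ M₁) (hξ : ∀ s x, 0 ≤ s → ξ s (S x) = S (ξ s x))
    (h : B ∈ stableParts ξ M₁ μ) : S ⁻¹' B ∈ stableParts ξ M₁ μ := by
  obtain ⟨J, hB, hJc, hJd, hJ, hJ1⟩ := h
  refine ⟨preimage S '' J, mem_image_of_mem _ hB, hJc.image _, ?_, ?_, ?_⟩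
  · rintro _ ⟨C₁, hC₁, rfl⟩ _ ⟨C₂, hC₂, rfl⟩ hne
    exact (hJd hC₁ hC₂ fun h => hne (by rw [h])).preimage S
  · rintro _ ⟨C, hC, rfl⟩
    exact (hJ C hC).preimage hS hM hξ
  · have h1 : ⋃₀ (preimage S '' J) = S ⁻¹' ⋃₀ J := by
      rw [sUnion_image, preimage_sUnion]
    rw [h1, hμ.measure_preimage, hJ1]
    exact (MeasurableSet.sUnion hJc fun C hC =>
      (hJ C hC).isClosed.measurableSet).nullMeasurableSet

theorem isPiSystem_stableParts [IsProbabilityMeasure μ] : IsPiSystem (stableParts ξ M₁ μ) :=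
  fun _ h _ h' _ => stableParts_inter h h'

/-- An upper bound for the measures of the members of stable partitions is sharp. -/
theorem measure_eq_of_le_of_mem_stableParts {ν : Measure X} [IsProbabilityMeasure μ]
    [IsProbabilityMeasure ν] (hle : ∀ B ∈ stableParts ξ M₁ μ, μ B ≤ ν B)
    (hB : B ∈ stableParts ξ M₁ μ) : μ B = ν B := by
  refine le_antisymm (hle B hB) ?_
  obtain ⟨J, hBJ, hJc, hJd, hJ, hJ1⟩ := hB
  have hm : ∀ C ∈ J, MeasurableSet C := fun C hC => (hJ C hC).isClosed.measurableSet
  have hparts : ∀ C ∈ J, C ∈ stableParts ξ M₁ μ := fun C hC => ⟨J, hC, hJc, hJd, hJ, hJ1⟩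
  set J' := J \ {B} with hJ'
  have hsub : J' ⊆ J := sdiff_subset
  have hdisj : Disjoint B (⋃₀ J') := disjoint_sUnion_right.2 fun C hC =>
    hJd hBJ hC.1 fun h => hC.2 h.symm
  have hunion : B ∪ ⋃₀ J' = ⋃₀ J := by
    rw [← sUnion_insert, hJ', insert_sdiff_singleton, insert_eq_of_mem hBJ]
  have hm' : MeasurableSet (⋃₀ J') :=
    MeasurableSet.sUnion (hJc.mono hsub) fun C hC => hm C (hsub hC)
  have h1 : μ (⋃₀ J') ≤ ν (⋃₀ J') := by
    rw [measure_sUnion (hJc.mono hsub) (hJd.subset hsub) fun C hC => hm C (hsub hC),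
      measure_sUnion (hJc.mono hsub) (hJd.subset hsub) fun C hC => hm C (hsub hC)]
    exact ENNReal.tsum_le_tsum fun C => hle C (hparts C (hsub C.2))
  have h2 : μ B + μ (⋃₀ J') = 1 := by rw [← measure_union hdisj hm', hunion, hJ1]
  have h3 : ν B + ν (⋃₀ J') ≤ 1 := by
    rw [← measure_union hdisj hm']; exact prob_le_one
  refine (ENNReal.add_le_add_iff_right (measure_ne_top μ (⋃₀ J'))).1 ?_
  rw [h2]
  exact (add_le_add_right h1 _).trans h3

/-- The `σ`-algebra generated by the members of stable partitions. -/
abbrev stableAlgebra (ξ : ℝ → X → X) (M₁ : Set X) (μ : Measure X) : MeasurableSpace X :=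
  MeasurableSpace.generateFrom (stableParts ξ M₁ μ)

theorem stableAlgebra_le : stableAlgebra ξ M₁ μ ≤ ‹MeasurableSpace X› :=
  MeasurableSpace.generateFrom_le fun _ hB => (isStable_of_mem_stableParts hB).isClosed.measurableSet

theorem measure_eq_of_stableAlgebra {ν : Measure X} [IsProbabilityMeasure μ]
    [IsProbabilityMeasure ν] (hle : ∀ B ∈ stableParts ξ M₁ μ, μ B ≤ ν B)
    {C : Set X} (hC : MeasurableSet[stableAlgebra ξ M₁ μ] C) : μ C = ν C := by
  have h : μ.trim (stableAlgebra_le (ξ := ξ) (M₁ := M₁) (μ := μ)) =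
      ν.trim (stableAlgebra_le (ξ := ξ) (M₁ := M₁) (μ := μ)) := by
    refine @ext_of_generate_finite X (stableAlgebra ξ M₁ μ) _ _ (stableParts ξ M₁ μ) rfl
      isPiSystem_stableParts _ (fun B hB => ?_) ?_
    · have hB' : MeasurableSet[stableAlgebra ξ M₁ μ] B :=
        MeasurableSpace.measurableSet_generateFrom hB
      rw [trim_measurableSet_eq _ hB', trim_measurableSet_eq _ hB']
      exact measure_eq_of_le_of_mem_stableParts hle hB
    · rw [trim_measurableSet_eq _ (@MeasurableSet.univ _ (stableAlgebra ξ M₁ μ)),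
        trim_measurableSet_eq _ (@MeasurableSet.univ _ (stableAlgebra ξ M₁ μ)), measure_univ,
        measure_univ]
  rw [← trim_measurableSet_eq stableAlgebra_le hC, h, trim_measurableSet_eq stableAlgebra_le hC]

omit [BorelSpace X] in
theorem le_stableAlgebra {G : SubAlg X} (hM2 : FlowInvariance ξ G M₁) (hM4 : ClosedSets μ G) :
    G.1 ≤ stableAlgebra ξ M₁ μ := by
  obtain ⟨F, hF, hG, hJ⟩ := hM4
  rw [hG]
  refine MeasurableSpace.generateFrom_mono fun C hC => ?_
  obtain ⟨J, hJF, hCJ, hJc, hJd, hJ1⟩ := hJ C hC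
  refine ⟨J, hCJ, hJc, hJd, fun C' hC' => ⟨hF C' (hJF hC'), fun q hq hqC s hs => ?_⟩, hJ1⟩
  refine hM2 q hq C' ?_ hqC s hs
  rw [hG]
  exact MeasurableSpace.measurableSet_generateFrom (hJF hC')

theorem measurable_stableAlgebra {S : X → X} (hS : Continuous S) (hμ : MeasurePreserving S μ μ)
    (hM : MapsTo S M₁ M₁) (hξ : ∀ s x, 0 ≤ s → ξ s (S x) = S (ξ s x)) :
    Measurable[stableAlgebra ξ M₁ μ, stableAlgebra ξ M₁ μ] S :=
  @measurable_generateFrom _ _ (stableAlgebra ξ M₁ μ) _ _ fun _ hB =>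
    MeasurableSpace.measurableSet_generateFrom (stableParts_preimage hS hμ hM hξ hB)

end Partition

end

end GradientShadowing

namespace GradientShadowing

noncomputable section

/-! ### Factors and ergodic components -/

section Factor

variable {X K : Type*} [MeasurableSpace X]

/-- A map into a standard Borel space that is Borel on a set extends from this set to a
`G`-measurable map, if `G` induces the Borel `σ`-algebra on the set. -/
theorem exists_measurable_extension [MeasurableSpace K] [StandardBorelSpace K] [Nonempty K]
    {G : SubAlg X} {M₁ : Set X} (hM₁ : MeasurableSet M₁)
    (htrace : ∀ B : Set X, MeasurableSet B → B ⊆ M₁ →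
      ∃ C : Set X, MeasurableSet[G.1] C ∧ C ∩ M₁ = B)
    {j : X → K} (hj : Measurable j) :
    ∃ h : X → K, Measurable[G.1] h ∧ ∀ x ∈ M₁, h x = j x := by
  have hg : Measurable[G.1.comap (Subtype.val : M₁ → X)] fun x : M₁ => j x := by
    intro B hB
    obtain ⟨C, hC, hCM⟩ := htrace (j ⁻¹' B ∩ M₁) ((hj hB).inter hM₁) inter_subset_right
    refine ⟨C, hC, ?_⟩
    ext x
    have h1 : (x : X) ∈ C ∩ M₁ ↔ (x : X) ∈ j ⁻¹' B ∩ M₁ := by rw [hCM]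
    simpa using h1
  obtain ⟨h, hh, heq⟩ := @Measurable.exists_eq_measurable_comp _ _ _ G.1 _ _ _ _ _ hg
  exact ⟨h, hh, fun x hx => (congrFun heq ⟨x, hx⟩).symm⟩

variable {S : X → X} {μ ν : Measure X}

theorem measure_eq_one_of_ae [IsProbabilityMeasure μ] {A : Set X} (h : ∀ᵐ x ∂μ, x ∈ A) :
    μ A = 1 := by
  have : A =ᵐ[μ] univ := by
    filter_upwards [h] with x hx
    exact propext ⟨fun _ => trivial, fun _ => hx⟩
  rw [measure_congr this, measure_univ]

theorem isFactorOf_of_ae [IsProbabilityMeasure μ] [IsProbabilityMeasure ν]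
    (hν : MeasurePreserving S ν ν) {θ : X → X} (hθ : MeasurePreserving θ ν μ) {W : Set X}
    (hW : MeasurableSet W) (hWν : ∀ᵐ x ∂ν, x ∈ W) (hWS : ∀ x ∈ W, θ (S x) = S (θ x)) :
    IsFactorOf S μ ν := by
  refine ⟨univ, ⋂ n : ℕ, S^[n] ⁻¹' W, θ, MeasurableSet.univ,
    MeasurableSet.iInter fun n => hν.measurable.iterate n hW, measure_univ,
    measure_eq_one_of_ae ?_, mapsTo_univ _ _, ?_, mapsTo_univ _ _, fun x hx => ?_, hθ⟩
  · have h := ae_all_iff.2 fun n : ℕ => (hν.iterate n).quasiMeasurePreserving.ae hWν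
    filter_upwards [h] with x hx
    exact mem_iInter.2 hx
  · intro x hx
    rw [mem_iInter] at hx ⊢
    intro n
    have := hx (n + 1)
    rwa [mem_preimage, Function.iterate_succ_apply] at this
  · exact hWS x (mem_iInter.1 hx 0)

/-- An invariant measure that is absolutely continuous with respect to an extension of an ergodic
measure is an extension of the same ergodic measure. -/
theorem measurePreserving_of_absolutelyContinuous [IsProbabilityMeasure μ] {ν' : Measure X}
    [IsProbabilityMeasure ν'] (hμ : Ergodic S μ) {θ : X → X} (hθ : MeasurePreserving θ ν μ)
    (hW : ∀ᵐ x ∂ν, θ (S x) = S (θ x)) (hν' : MeasurePreserving S ν' ν') (hac : ν' ≪ ν) :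
    MeasurePreserving θ ν' μ := by
  refine ⟨hθ.measurable, ?_⟩
  have hprob : IsProbabilityMeasure (ν'.map θ) :=
    Measure.isProbabilityMeasure_map hθ.measurable.aemeasurable
  refine hμ.eq_of_absolutelyContinuous ⟨hμ.measurable, ?_⟩ ?_
  · rw [Measure.map_map hμ.measurable hθ.measurable]
    have h1 : S ∘ θ =ᵐ[ν'] θ ∘ S := by
      filter_upwards [hac.ae_le hW] with x hx using hx.symm
    rw [Measure.map_congr h1, ← Measure.map_map hθ.measurable hν'.measurable, hν'.map_eq]
  · have := hac.map hθ.measurable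
    rwa [hθ.map_eq] at this

/-- Ergodicity passes to factors, if the factor map is equivariant almost everywhere. -/
theorem ergodic_map_of_ae [MeasurableSpace K] {T : K → K} {ρ : Measure K} (hρ : Ergodic T ρ)
    {r : K → X} (hr : Measurable r) (hS : Measurable S)
    (h : ∀ᵐ y ∂ρ, r (T y) = S (r y)) : Ergodic S (ρ.map r) where
  measurable := hS
  map_eq := by
    have h1 : S ∘ r =ᵐ[ρ] r ∘ T := by filter_upwards [h] with y hy using hy.symm
    rw [Measure.map_map hS hr, Measure.map_congr h1, ← Measure.map_map hr hρ.measurable,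
      hρ.toMeasurePreserving.map_eq]
  aeconst_set s hs hSs := by
    have h1 : T ⁻¹' (r ⁻¹' s) =ᵐ[ρ] r ⁻¹' s := by
      filter_upwards [h] with y hy
      refine propext ?_
      change r (T y) ∈ s ↔ r y ∈ s
      rw [hy]
      exact Set.ext_iff.1 hSs (r y)
    have h2 := hρ.quasiErgodic.aeconst_set₀ (hr hs).nullMeasurableSet h1
    rw [eventuallyConst_set] at h2 ⊢
    exact h2.imp (ae_map_iff hr.aemeasurable hs).2 (ae_map_iff hr.aemeasurable hs.compl).2

end Factor

/-! ### Extreme points -/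

section Extreme

variable {K : Type*} [TopologicalSpace K] [CompactSpace K] [TopologicalSpace.MetrizableSpace K]
  [MeasurableSpace K] [BorelSpace K]

/-- The functional on continuous functions that is given by a measure. -/
def integralMap (ν : ProbabilityMeasure K) (f : C(K, ℝ)) : ℝ := ∫ y, f y ∂(ν : Measure K)

omit [TopologicalSpace.MetrizableSpace K] in
theorem continuous_integralMap : Continuous (integralMap (K := K)) :=
  continuous_pi fun f => ProbabilityMeasure.continuous_integral_continuousMap f

omit [CompactSpace K] in
theorem injective_integralMap : Function.Injective (integralMap (K := K)) := by
  intro ν ν' h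
  have h1 : (ν : Measure K) = ν' :=
    ext_of_forall_integral_eq_of_IsFiniteMeasure fun f => congrFun h f.toContinuousMap
  exact Subtype.ext h1

/-- A nonempty compact set of invariant measures contains an ergodic measure, if it contains the
invariant measures that are absolutely continuous with respect to one of its elements. -/
theorem exists_ergodic_of_isCompact {T : K → K} {s : Set (ProbabilityMeasure K)}
    (hs : IsCompact s) (hne : s.Nonempty) (hT : ∀ ν ∈ s, MeasurePreserving T (ν : Measure K) ν)
    (hface : ∀ ν ∈ s, ∀ ν' : ProbabilityMeasure K,
      MeasurePreserving T (ν' : Measure K) ν' → (ν' : Measure K) ≪ ν → ν' ∈ s) :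
    ∃ ν ∈ s, Ergodic T (ν : Measure K) := by
  obtain ⟨_, ⟨ν, hν, rfl⟩, hext⟩ :=
    (hs.image continuous_integralMap).extremePoints_nonempty (hne.image _)
  refine ⟨ν, hν, Ergodic.of_mem_extremePoints ?_⟩
  rw [mem_extremePoints_iff_left]
  refine ⟨⟨hT ν hν, inferInstance⟩, ?_⟩
  rintro ν₁ ⟨hν₁, hp₁⟩ ν₂ ⟨hν₂, hp₂⟩ ⟨a, b, ha, hb, hab, heq⟩
  have hac₁ : ν₁ ≪ (ν : Measure K) := by
    rw [← heq]
    exact (Measure.absolutelyContinuous_smul ha.ne').add_right _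
  have hac₂ : ν₂ ≪ (ν : Measure K) := by
    rw [← heq, add_comm]
    exact (Measure.absolutelyContinuous_smul hb.ne').add_right _
  have ha' : a ≠ ∞ := fun h => by simp [h] at hab
  have hb' : b ≠ ∞ := fun h => by simp [h] at hab
  have h1 := hext (x₁ := integralMap ⟨ν₁, hp₁⟩)
    (mem_image_of_mem _ (hface ν hν ⟨ν₁, hp₁⟩ hν₁ hac₁)) (x₂ := integralMap ⟨ν₂, hp₂⟩)
    (mem_image_of_mem _ (hface ν hν ⟨ν₂, hp₂⟩ hν₂ hac₂)) ⟨a.toReal, b.toReal,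
      ENNReal.toReal_pos ha.ne' ha', ENNReal.toReal_pos hb.ne' hb', ?_, ?_⟩
  · exact congrArg Subtype.val (injective_integralMap h1)
  · rw [← ENNReal.toReal_add ha' hb', hab, ENNReal.toReal_one]
  · ext f
    have hi : ∀ (ν : Measure K) [IsProbabilityMeasure ν], Integrable (fun y => f y) ν :=
      fun ν _ => (BoundedContinuousFunction.mkOfCompact f).integrable ν
    change a.toReal • ∫ y, f y ∂ν₁ + b.toReal • ∫ y, f y ∂ν₂ = ∫ y, f y ∂(ν : Measure K)
    rw [← heq, integral_add_measure ((hi ν₁).smul_measure ha') ((hi ν₂).smul_measure hb'),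
      integral_smul_measure, integral_smul_measure]

end Extreme

end

end GradientShadowing

namespace GradientShadowing

noncomputable section

variable {N : ℕ} {V : Config N → ℝ → ℝ} {μ : Measure (QPhase N)} {G : SubAlg (QPhase N)}
  {M₁ : Set (QPhase N)} {C : ℝ≥0}

/-! ### The set of shadowing measures -/

theorem isClosed_setOf_le_measure {K : Type*} [TopologicalSpace K] [MeasurableSpace K]
    [OpensMeasurableSpace K] [HasOuterApproxClosed K] {F : Set K} (hF : IsClosed F) (c : ℝ≥0∞) :
    IsClosed {ν : ProbabilityMeasure K | c ≤ (ν : Measure K) F} := by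
  rw [isClosed_iff_ultrafilter]
  intro ν u hu hmem
  have hu' : Tendsto id (u : Filter (ProbabilityMeasure K)) (𝓝 ν) := hu
  refine le_trans ?_ (ProbabilityMeasure.limsup_measure_closed_le_of_tendsto hu' hF)
  have hev : ∀ᶠ ν' in (u : Filter (ProbabilityMeasure K)), c ≤ ((id ν' : ProbabilityMeasure K) :
      Measure K) F := hmem
  exact le_limsup_of_frequently_le hev.frequently

/-- The invariant measures on the equilibria of the path space that give at least the right
measure to the members of stable partitions. -/
def shadowMeasures (V : Config N → ℝ → ℝ) (μ : Measure (QPhase N)) (M₁ : Set (QPhase N))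
    (C : ℝ≥0) : Set (ProbabilityMeasure (PathSpace N C)) :=
  {ν | ν.map PathSpace.continuous_shift.measurable.aemeasurable = ν ∧
    1 ≤ (ν : Measure (PathSpace N C)) (equilibriumPaths V C) ∧
    ∀ B ∈ stableParts (qGradFlow V) M₁ μ, μ B ≤
      (ν : Measure (PathSpace N C)) (equilibriumPaths V C ∩ PathSpace.toQPhase ⁻¹' B)}

theorem isCompact_shadowMeasures (hV : IsPotential V) : IsCompact (shadowMeasures V μ M₁ C) := by
  have h : IsClosed {ν : ProbabilityMeasure (PathSpace N C) |
      ∀ B ∈ stableParts (qGradFlow V) M₁ μ, μ B ≤ (ν : Measure (PathSpace N C))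
        (equilibriumPaths V C ∩ PathSpace.toQPhase ⁻¹' B)} := by
    simp only [ofPred_forall]
    exact isClosed_iInter fun B => isClosed_iInter fun hB => isClosed_setOf_le_measure
      (isClosed_equilibriumPaths_inter hV (isStable_of_mem_stableParts hB).isClosed) _
  exact (IsClosed.inter (isClosed_eq (ProbabilityMeasure.continuous_map
    PathSpace.continuous_shift) continuous_id) (IsClosed.inter
    (isClosed_setOf_le_measure (isClosed_equilibriumPaths hV) 1) h)).isCompact

theorem measurePreserving_shift_of_map_eq {ν : ProbabilityMeasure (PathSpace N C)}
    (h : ν.map PathSpace.continuous_shift.measurable.aemeasurable = ν) :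
    MeasurePreserving PathSpace.shift (ν : Measure (PathSpace N C)) ν :=
  ⟨PathSpace.continuous_shift.measurable, congrArg Subtype.val h⟩

theorem ae_mem_equilibriumPaths (hV : IsPotential V) {ν : ProbabilityMeasure (PathSpace N C)}
    (h : 1 ≤ (ν : Measure (PathSpace N C)) (equilibriumPaths V C)) :
    ∀ᵐ y ∂(ν : Measure (PathSpace N C)), y ∈ equilibriumPaths V C :=
  (prob_compl_eq_zero_iff (isClosed_equilibriumPaths hV).measurableSet).2 (le_antisymm prob_le_one h)

theorem ae_toQPhase_shift (hV : IsPotential V) {ν : ProbabilityMeasure (PathSpace N C)}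
    (h : 1 ≤ (ν : Measure (PathSpace N C)) (equilibriumPaths V C)) :
    ∀ᵐ y ∂(ν : Measure (PathSpace N C)),
      PathSpace.toQPhase (PathSpace.shift y) = shift (PathSpace.toQPhase y) := by
  filter_upwards [ae_mem_equilibriumPaths hV h] with y hy
  exact PathSpace.toQPhase_shift (equilibriumPaths_subset_regularPaths hV hy)

theorem isProbabilityMeasure_map_toQPhase (ν : ProbabilityMeasure (PathSpace N C)) :
    IsProbabilityMeasure ((ν : Measure (PathSpace N C)).map PathSpace.toQPhase) :=
  Measure.isProbabilityMeasure_map PathSpace.measurable_toQPhase.aemeasurable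

theorem measurePreserving_shift_map (hV : IsPotential V) {ν : ProbabilityMeasure (PathSpace N C)}
    (h : 1 ≤ (ν : Measure (PathSpace N C)) (equilibriumPaths V C))
    (hν : MeasurePreserving PathSpace.shift (ν : Measure (PathSpace N C)) ν) :
    MeasurePreserving shift ((ν : Measure (PathSpace N C)).map PathSpace.toQPhase)
      ((ν : Measure (PathSpace N C)).map PathSpace.toQPhase) := by
  refine ⟨continuous_shift.measurable, ?_⟩
  have h1 : shift ∘ PathSpace.toQPhase =ᵐ[(ν : Measure (PathSpace N C))]
      PathSpace.toQPhase ∘ PathSpace.shift := by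
    filter_upwards [ae_toQPhase_shift hV h] with y hy using hy.symm
  rw [Measure.map_map continuous_shift.measurable PathSpace.measurable_toQPhase,
    Measure.map_congr h1, ← Measure.map_map PathSpace.measurable_toQPhase hν.measurable, hν.map_eq]

theorem map_qEquilibria (hV : IsPotential V) {ν : ProbabilityMeasure (PathSpace N C)}
    (h : 1 ≤ (ν : Measure (PathSpace N C)) (equilibriumPaths V C)) :
    (ν : Measure (PathSpace N C)).map PathSpace.toQPhase (qEquilibria V) = 1 := by
  have := isProbabilityMeasure_map_toQPhase ν
  refine le_antisymm prob_le_one (h.trans ?_)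
  exact (measure_mono fun y hy => toQPhase_mem_qEquilibria hV hy).trans
    (Measure.le_map_apply PathSpace.measurable_toQPhase.aemeasurable _)

theorem measure_le_map_toQPhase {B : Set (QPhase N)} (hB : IsClosed B)
    {ν : ProbabilityMeasure (PathSpace N C)}
    (h : μ B ≤ (ν : Measure (PathSpace N C)) (equilibriumPaths V C ∩ PathSpace.toQPhase ⁻¹' B)) :
    μ B ≤ (ν : Measure (PathSpace N C)).map PathSpace.toQPhase B := by
  rw [Measure.map_apply PathSpace.measurable_toQPhase hB.measurableSet]
  exact h.trans (measure_mono inter_subset_right)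

/-! ### The factor map -/

/-- A `G`-measurable factor map that is the identity almost everywhere for `μ`. -/
structure IsFactorMap (V : Config N → ℝ → ℝ) (μ : Measure (QPhase N)) (G : SubAlg (QPhase N))
    (M₁ : Set (QPhase N)) (θ : QPhase N → QPhase N) (W : Set (QPhase N)) : Prop where
  measurable : Measurable[G.1] θ
  ae_eq : ∀ᵐ x ∂μ, θ x = x
  measurableSet : MeasurableSet[stableAlgebra (qGradFlow V) M₁ μ] W
  ae_mem : ∀ᵐ x ∂μ, x ∈ W
  equivariant : ∀ x ∈ W, θ (shift x) = shift (θ x)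

theorem exists_isFactorMap (hV : IsPotential V) (hμ : IsInvariantProb shift μ)
    (hbd : ∀ᵐ x ∂μ, x ∈ boundedPhase N C) {D : QPhase N → Set (QPhase N)}
    (hM1 : Separation shift μ G M₁ D) (hM2 : FlowInvariance (qGradFlow V) G M₁)
    (hM4 : ClosedSets μ G) : ∃ θ W, IsFactorMap V μ G M₁ θ W := by
  have := hμ.isProbabilityMeasure
  have : Nonempty (PathSpace N C) := ⟨⟨(0, 0), isVelocity_zero⟩⟩
  have hM : ∀ᵐ x ∂μ, x ∈ M₁ := (prob_compl_eq_zero_iff hM1.measurableSet).2 hM1.full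
  obtain ⟨h, hh, hhj⟩ := exists_measurable_extension hM1.measurableSet hM1.trace
    (measurable_ofQPhase (N := N) (C := C))
  have hG := le_stableAlgebra hM2 hM4
  have hS := measurable_stableAlgebra (ξ := qGradFlow V) (M₁ := M₁) continuous_shift
    hμ.measurePreserving (fun q hq => (hM1.equivariant q hq).1)
    fun s x hs => qGradFlow_shift hV hs x
  have hh' : Measurable[stableAlgebra (qGradFlow V) M₁ μ] h := hh.mono hG le_rfl
  refine ⟨fun x => (h x).toQPhase, {x | h (shift x) = (h x).shift} ∩ h ⁻¹' regularPaths N C,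
    PathSpace.measurable_toQPhase.comp hh, ?_, ?_, ?_, ?_⟩
  · filter_upwards [hM, hbd] with x hx hx'
    rw [hhj x hx, toQPhase_ofQPhase hx']
  · refine MeasurableSet.inter ?_ (hh' measurableSet_regularPaths)
    exact measurableSet_eq_fun (hh'.comp hS)
      (PathSpace.continuous_shift.measurable.comp hh')
  · filter_upwards [hM, hbd] with x hx hx'
    have hSx := (hM1.equivariant x hx).1
    refine ⟨?_, ?_⟩
    · change h (shift x) = (h x).shift
      rw [hhj _ hSx, hhj x hx, ofQPhase_shift hx']
    · rw [mem_preimage, hhj x hx]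
      exact ofQPhase_mem_regularPaths hx'
  · rintro x ⟨hx, hx'⟩
    rw [hx, PathSpace.toQPhase_shift hx']

section

variable {θ : QPhase N → QPhase N} {W : Set (QPhase N)} (hθ : IsFactorMap V μ G M₁ θ W)
  [IsProbabilityMeasure μ] (hG : G.1 ≤ stableAlgebra (qGradFlow V) M₁ μ)
  {ν : Measure (QPhase N)} [IsProbabilityMeasure ν]
  (hle : ∀ B ∈ stableParts (qGradFlow V) M₁ μ, μ B ≤ ν B)

include hθ hle in
theorem IsFactorMap.ae_mem_of_le : ∀ᵐ x ∂ν, x ∈ W := by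
  have h1 := measure_eq_of_stableAlgebra hle hθ.measurableSet.compl
  rw [show μ Wᶜ = 0 from hθ.ae_mem] at h1
  exact h1.symm

include hθ hG hle in
theorem IsFactorMap.measurePreserving_of_le : MeasurePreserving θ ν μ := by
  have hm : Measurable θ := hθ.measurable.mono G.2 le_rfl
  refine ⟨hm, Measure.ext fun B hB => ?_⟩
  rw [Measure.map_apply hm hB, ← measure_eq_of_stableAlgebra hle (hG _ (hθ.measurable hB))]
  refine measure_congr ?_
  filter_upwards [hθ.ae_eq] with x hx
  refine propext ?_
  change θ x ∈ B ↔ x ∈ B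
  rw [hx]

include hθ hG hle in
theorem IsFactorMap.shadows (hν : MeasurePreserving shift ν ν) : Shadows shift G ν μ :=
  ⟨isFactorOf_of_ae hν (hθ.measurePreserving_of_le hG hle)
    (stableAlgebra_le _ hθ.measurableSet) (hθ.ae_mem_of_le hle) hθ.equivariant,
    fun _ hC => measure_eq_of_stableAlgebra hle (hG _ hC)⟩

include hθ hG hle in
theorem IsFactorMap.measure_eq_of_absolutelyContinuous (hμ : Ergodic shift μ) {ν' : Measure (QPhase N)}
    [IsProbabilityMeasure ν'] (hν' : MeasurePreserving shift ν' ν') (hac : ν' ≪ ν)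
    {B : Set (QPhase N)} (hB : B ∈ stableParts (qGradFlow V) M₁ μ) : ν' B = μ B := by
  have h1 : ∀ᵐ x ∂ν, θ (shift x) = shift (θ x) :=
    (hθ.ae_mem_of_le hle).mono hθ.equivariant
  have h2 := measurePreserving_of_absolutelyContinuous hμ
    (hθ.measurePreserving_of_le hG hle) h1 hν' hac
  have hBm := (isStable_of_mem_stableParts hB).isClosed.measurableSet
  have hBs : MeasurableSet[stableAlgebra (qGradFlow V) M₁ μ] B :=
    MeasurableSpace.measurableSet_generateFrom hB
  have hBθ : MeasurableSet[stableAlgebra (qGradFlow V) M₁ μ] (θ ⁻¹' B) :=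
    hG _ (hθ.measurable hBm)
  have h3 : μ (symmDiff B (θ ⁻¹' B)) = 0 := by
    rw [measure_symmDiff_eq_zero_iff]
    filter_upwards [hθ.ae_eq] with x hx
    refine propext ?_
    change x ∈ B ↔ θ x ∈ B
    rw [hx]
  rw [measure_eq_of_stableAlgebra hle (@MeasurableSet.symmDiff _ (stableAlgebra _ _ _) _ _ hBs hBθ)]
    at h3
  rw [measure_congr (measure_symmDiff_eq_zero_iff.1 (hac h3)), ← h2.measure_preimage
    hBm.nullMeasurableSet]

end

end

end GradientShadowing

theorem theorem4p4 {N : ℕ} (V : Config N → ℝ → ℝ) (hV : IsPotential V)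
    (μ : Measure (QPhase N)) (hμ : IsInvariantProb shift μ)
    (hbound : ∃ A : ℝ≥0, ∀ s : ℝ, 0 ≤ s → ∀ q : Phase N,
      proj q ∈ (μ.map (qGradFlow V s)).support → h1ulNorm (deriv q) ≤ A)
    (G : SubAlg (QPhase N)) (M₁ : Set (QPhase N)) (D : QPhase N → Set (QPhase N))
    (hM1 : Separation shift μ G M₁ D)
    (hM2 : FlowInvariance (qGradFlow V) G M₁)
    (hM3 : ProjectionMeasurable M₁ D)
    (hM4 : ClosedSets μ G) :
    (∃ ν : Measure (QPhase N),
      IsInvariantProb shift ν ∧ ν (qEquilibria V) = 1 ∧ Shadows shift G ν μ) ∧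
    (Ergodic shift μ → ∃ ν : Measure (QPhase N),
      IsInvariantProb shift ν ∧ ν (qEquilibria V) = 1 ∧ Shadows shift G ν μ ∧
        Ergodic shift ν) := by
  have hprob := hμ.isProbabilityMeasure
  obtain ⟨A, hbound⟩ := hbound
  have hbd : ∀ᵐ x ∂μ, x ∈ boundedPhase N (8 * A) := by
    filter_upwards [ae_hasBound hV hbound] with x hx
    obtain ⟨p, rfl⟩ := proj_surjective x
    have h := hx p rfl 0 le_rfl
    rw [gradFlow_zero hV] at h
    change IsVelocity _ _
    rw [qVel_proj]
    exact h.isVelocity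
  obtain ⟨θ, W, hθ⟩ := exists_isFactorMap hV hμ hbd hM1 hM2 hM4
  have hG := le_stableAlgebra hM2 hM4
  have hM : ∀ᵐ x ∂μ, x ∈ M₁ := (prob_compl_eq_zero_iff hM1.measurableSet).2 hM1.full
  have hne : (shadowMeasures V μ M₁ (8 * A)).Nonempty := by
    obtain ⟨ν, h1, h2, h3⟩ := exists_limit_measure hV hμ hbound
    refine ⟨ν, h1, h2.ge, fun B hB => h3 B (isStable_of_mem_stableParts hB).isClosed ?_⟩
    filter_upwards [hM] with x hx hxB
    exact (isStable_of_mem_stableParts hB).mem x hx hxB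
  have hle : ∀ ν ∈ shadowMeasures V μ M₁ (8 * A), ∀ B ∈ stableParts (qGradFlow V) M₁ μ,
      μ B ≤ (ν : Measure (PathSpace N (8 * A))).map PathSpace.toQPhase B := fun ν hν B hB =>
    measure_le_map_toQPhase (isStable_of_mem_stableParts hB).isClosed (hν.2.2 B hB)
  have key : ∀ ν ∈ shadowMeasures V μ M₁ (8 * A),
      IsInvariantProb shift ((ν : Measure (PathSpace N (8 * A))).map PathSpace.toQPhase) ∧
        (ν : Measure (PathSpace N (8 * A))).map PathSpace.toQPhase (qEquilibria V) = 1 ∧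
        Shadows shift G ((ν : Measure (PathSpace N (8 * A))).map PathSpace.toQPhase) μ := by
    intro ν hν
    have h1 := isProbabilityMeasure_map_toQPhase ν
    have h2 := measurePreserving_shift_map hV hν.2.1 (measurePreserving_shift_of_map_eq hν.1)
    exact ⟨⟨h1, h2⟩, map_qEquilibria hV hν.2.1, hθ.shadows hG (hle ν hν) h2⟩
  refine ⟨?_, fun herg => ?_⟩
  · obtain ⟨ν, hν⟩ := hne
    exact ⟨_, key ν hν⟩
  · obtain ⟨ν, hν, hνe⟩ := exists_ergodic_of_isCompact (isCompact_shadowMeasures hV) hne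
      (fun ν hν => measurePreserving_shift_of_map_eq hν.1) fun ν hν ν' hν' hac => by
        have h1 := isProbabilityMeasure_map_toQPhase ν
        have h1' := isProbabilityMeasure_map_toQPhase ν'
        have hE := hac.ae_le (ae_mem_equilibriumPaths hV hν.2.1)
        have hE1 : 1 ≤ (ν' : Measure (PathSpace N (8 * A))) (equilibriumPaths V (8 * A)) :=
          (measure_eq_one_of_ae hE).ge
        refine ⟨Subtype.ext hν'.map_eq, hE1, fun B hB => ?_⟩
        have h2 := hθ.measure_eq_of_absolutelyContinuous hG (hle ν hν) herg
          (measurePreserving_shift_map hV hE1 hν') (hac.map PathSpace.measurable_toQPhase) hB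
        rw [Measure.map_apply PathSpace.measurable_toQPhase
          (isStable_of_mem_stableParts hB).isClosed.measurableSet] at h2
        rw [← h2]
        refine measure_mono_ae ?_
        filter_upwards [hE] with y hy hyB using ⟨hy, hyB⟩
    obtain ⟨h1, h2, h3⟩ := key ν hν
    exact ⟨_, h1, h2, h3, ergodic_map_of_ae hνe PathSpace.measurable_toQPhase
      continuous_shift.measurable (ae_toQPhase_shift hV hν.2.1)⟩
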